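/- **Theorem.** Let $m\ge 2$, let $M^m$ be a smooth manifold and let $x:M^m\to\mathbb S^{m+2}\subset\mathbb R^{m+3}$ be a smooth immersion with oriented normal bundle which is umbilic-free (the trace-free second fundamental form $II-\frac1m\mathrm{tr}(II)\,I$ vanishes nowhere) and Wintgen ideal, i.e. at every point equality holds in the DDVV inequality $s+s^\perp\le |H|^2+1$, where $s=\frac{2}{m(m-1)}\sum_{i<j}\langle R(e_i,e_j)e_j,e_i\rangle$ and $s^\perp=\frac{2}{m(m-1)}\big(\sum_{i<j}\langle R^\perp(e_i,e_j)n_1,n_2\rangle^2\big)^{1/2}$ for orthonormal tangent and normal bases $(e_i)$, $(n_1,n_2)$. Notation. Put $\rho^2=\frac{m}{m-1}|II-\frac1m \mathrm{tr}(II) I|^2$, $\mu=\sqrt{\frac{m-1}{4m}}$; the Möbius metric is $\mathrm g=\rho^2dx\cdot dx$. A $\mathrm g$-orthonormal tangent frame $E_1,\dots,E_m$ and an orthonormal normal frame $n_1,n_2$ at a point are *adapted* if the matrices $B^r_{ij}=\rho\,\langle (II-\frac1m\mathrm{tr}(II) I)(E_i,E_j),n_r\rangle$ satisfy $B^1_{12}=B^1_{21}=\mu$,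 $B^2_{11}=-B^2_{22}=\mu$, all other entries being $0$. Let $\langle\cdot,\cdot\rangle$ be the Lorentz product $-Y_0Z_0+Y_1Z_1+\dots+Y_{m+3}Z_{m+3}$ on $\mathbb R^{m+4}_1$, extended bilinearly to $\mathbb C^{m+4}$, and let $$Q^{m+2}_+=\{[Z]\in\mathbb CP^{m+3}:\langle Z,Z\rangle=0,\ \langle Z,\bar Z\rangle>0\},$$ with the (indefinite) Hermitian metric $h_\xi=\langle\xi,\bar\xi\rangle^{-1}\langle (d\xi)^{h},\overline{(d\xi)^{h}}\rangle$, $(d\xi)^{h}=d\xi-\frac{\langle d\xi,\bar\xi\rangle}{\langle\xi,\bar\xi\rangle}\xi$. The mean curvature sphere of $x$ at a point is given by $\xi_r=(H^r,n_r+H^rx)\in\mathbb R^{m+4}_1$, $H^r=\langle H,n_r\rangle$, for an oriented orthonormal normal basis $(n_1,n_2)$; it is the $m$-sphere $\{y\in\mathbb S^{m+2}:\langle(1,y),\xi_1-i\xi_2\rangle=0\}$, and the line $[\xi_1-i\xi_2]$ does not depend on the basis. "Riemann surface" means a second countable complex one-dimensional manifold; it is locally, but not necessarily globally, Hausdorff.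 At every point there is an adapted frame whose normal frame is positively oriented, and $\mathbb D^\perp=\mathrm{Span}\{E_3,\dots,E_m\}$ is the same for all adapted frames. Moreover: 1. The map $[\xi_1-i\xi_2]$ descends to the space of leaves $\overline M^2=M/\mathscr D$ of part 2, as a map $[\xi]:\overline M^2\to Q^{m+2}_+$ that is a 1-isotropic complex curve: it is a holomorphic immersion ($\partial\xi/\partial\bar z\parallel\xi$ for every local lift $\xi$), $\langle d\xi,d\xi\rangle=0$ and $\langle d\xi,d\bar\xi\rangle>0$, and the metric induced from $Q^{m+2}_+$ is positive definite. 2. The distribution $\mathbb D^\perp$ is integrable; its leaves form a foliation $\mathscr D$ of $M$, and the space of leaves $\overline M^2=M/\mathscr D$, with the quotient topology, has the structure of a Riemann surface for which the projection $\pi:M\to\overline M^2$ is a smooth submersion with $\ker d\pi=\mathbb D^\perp$. 3. $\pi$ is a Riemannian submersion up to the factor $\mu$: if $v\in T_pM$ is $\mathrm g$-orthogonal to $\mathbb D^\perp$, then $d\pi(v)$ has length $\mu|v|_{\mathrm g}$ in the metric induced on $\overline M^2$ from $Q^{m+2}_+$. 4. Thus the mean curvature spheres form a 2-parameter family, parametrized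 by $\overline M^2$. Their envelope $$\widehat M=\{(q,y)\in\overline M^2\times\mathbb S^{m+2}:\ \langle(1,y),\xi(q)\rangle=0,\ \langle(1,y),d\xi_q\rangle=0\}$$ is a smooth $m$-dimensional manifold; the map $\hat y:\widehat M\to\mathbb S^{m+2}$, $(q,y)\mapsto y$, is smooth (it need not be immersive everywhere), and at each $(q,y)$ the image of $d\hat y$ is tangent to the sphere with parameter $q$. The envelope contains $M$: the map $p\mapsto(\pi(p),x(p))$ is a local diffeomorphism $M\to\widehat M$. 5. $\widehat M\to\overline M^2$ is a smooth bundle of round $(m-2)$-spheres of $\mathbb S^{m+2}$ (pairs of points if $m=2$), and the foliation of $\widehat M$ by these spheres extends $\mathscr D$. -/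

import Mathlib

open scoped Manifold ContDiff Topology InnerProductSpace LinearAlgebra.Projectivization

noncomputable section

namespace Wintgen

/-- Euclidean space `ℝⁿ`. -/
abbrev Euc (n : ℕ) : Type := EuclideanSpace ℝ (Fin n)

/-- The Euclidean space `ℝ^{m+3}` that contains the unit sphere `S^{m+2}`. -/
abbrev Amb (m : ℕ) : Type := Euc (m + 3)

/-! ### Immersions into the unit sphere of `ℝ^{m+3}`, in a coordinate domain

Here `f` is the expression of the immersion in a chart and `u` is a point of the chart. -/

section Coordinates

variable {m : ℕ} (f : Euc m → Amb m) (u : Euc m)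

/-- The `i`-th coordinate vector. -/
def coordVec (m : ℕ) (i : Fin m) : Euc m := EuclideanSpace.single i (1 : ℝ)

/-- The first fundamental form `I = df · df`. -/
def firstFF (v w : Euc m) : ℝ := ⟪fderiv ℝ f u v, fderiv ℝ f u w⟫_ℝ

/-- The inverse `(g^{ij})` of the matrix of the first fundamental form. -/
def gramInv : Matrix (Fin m) (Fin m) ℝ :=
  (Matrix.of fun i j => firstFF f u (coordVec m i) (coordVec m j))⁻¹

/-- The tangent plane `df(T)`. -/
def tangentPlane : Submodule ℝ (Amb m) := LinearMap.range (fderiv ℝ f u).toLinearMap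

/-- The normal plane of the submanifold inside the sphere: the vectors orthogonal both to the
position vector and to the tangent plane. -/
def normalPlane : Submodule ℝ (Amb m) := (Submodule.span ℝ {f u} ⊔ tangentPlane f u)ᗮ

/-- The second fundamental form: the normal part of the second derivative. -/
def secondFF (v w : Euc m) : Amb m :=
  (normalPlane f u).starProjection (fderiv ℝ (fderiv ℝ f) u v w)

/-- The mean curvature vector `H = (1/m) tr II`. -/
def meanCurv : Amb m :=
  (1 / (m : ℝ)) •
    ∑ i, ∑ j, gramInv f u i j • secondFF f u (coordVec m i) (coordVec m j)

/-- The trace-free second fundamental form `II - (1/m) tr(II) I`. -/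
def tracelessFF (v w : Euc m) : Amb m := secondFF f u v w - firstFF f u v w • meanCurv f u

/-- `|II - (1/m) tr(II) I|²`, the norm being that of the first fundamental form. -/
def tracelessNormSq : ℝ :=
  ∑ i, ∑ j, ∑ k, ∑ l, gramInv f u i k * gramInv f u j l *
    ⟪tracelessFF f u (coordVec m i) (coordVec m j),
      tracelessFF f u (coordVec m k) (coordVec m l)⟫_ℝ

/-- The conformal factor `ρ`, `ρ² = m/(m-1) |II - (1/m) tr(II) I|²`. -/
def rho : ℝ := Real.sqrt ((m : ℝ) / ((m : ℝ) - 1) * tracelessNormSq f u)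

/-- A field `P` of orthogonal projections defines the vector bundle with fibre `range (P u)` over
the coordinate domain, with the induced connection `∇_w s = P (D_w s)`. This is `∇_w (P s)` at the
point `u`, where `s` is a fixed vector, extended to the section `P s`. -/
def projCov (P : Euc m → Amb m →L[ℝ] Amb m) (s : Amb m) (w : Euc m) (u : Euc m) : Amb m :=
  P u (fderiv ℝ (fun u' => P u' s) u w)

/-- The curvature `R(v,w)s = ∇_v ∇_w s - ∇_w ∇_v s` of the connection `∇ = P D`, for constant
(hence commuting) coordinate fields `v`, `w`. -/
def projCurvature (P : Euc m → Amb m →L[ℝ] Amb m) (u : Euc m) (v w : Euc m) (s : Amb m) :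
    Amb m :=
  P u (fderiv ℝ (projCov P s w) u v) - P u (fderiv ℝ (projCov P s v) u w)

/-- The Riemann curvature of the induced metric, as an operator on the tangent plane: the curvature
of the Levi-Civita connection, which is the tangential part of the derivative. -/
def tangentCurvature (v w : Euc m) (s : Amb m) : Amb m :=
  projCurvature (fun u' => (tangentPlane f u').starProjection) u v w s

/-- The curvature `R^⊥` of the normal connection of the submanifold in the sphere. -/
def normalCurvature (v w : Euc m) (s : Amb m) : Amb m :=
  projCurvature (fun u' => (normalPlane f u').starProjection) u v w s

/-- `e` is an orthonormal basis of the tangent space for the first fundamental form. -/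
def IsTangentFrame (e : Fin m → Euc m) : Prop :=
  ∀ i j, firstFF f u (e i) (e j) = if i = j then 1 else 0

/-- `(n₁, n₂)` is an orthonormal basis of the (two-dimensional) normal plane. -/
def IsNormalFrame (n₁ n₂ : Amb m) : Prop :=
  n₁ ∈ normalPlane f u ∧ n₂ ∈ normalPlane f u ∧ ‖n₁‖ = 1 ∧ ‖n₂‖ = 1 ∧ ⟪n₁, n₂⟫_ℝ = 0

/-- The normalized scalar curvature `2/(m(m-1)) ∑_{i<j} ⟨R(e_i,e_j)e_j, e_i⟩`. -/
def scalarCurv (e : Fin m → Euc m) : ℝ :=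
  2 / ((m : ℝ) * ((m : ℝ) - 1)) *
    ∑ i, ∑ j, if i < j then
      ⟪tangentCurvature f u (e i) (e j) (fderiv ℝ f u (e j)), fderiv ℝ f u (e i)⟫_ℝ else 0

/-- The normalized normal scalar curvature
`2/(m(m-1)) (∑_{i<j} ∑_{r<s} ⟨R^⊥(e_i,e_j)n_r, n_s⟩²)^{1/2}`, in codimension two. -/
def normalScalarCurv (e : Fin m → Euc m) (n₁ n₂ : Amb m) : ℝ :=
  2 / ((m : ℝ) * ((m : ℝ) - 1)) *
    Real.sqrt (∑ i, ∑ j, if i < j then ⟪normalCurvature f u (e i) (e j) n₁, n₂⟫_ℝ ^ 2 else 0)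

/-- Equality in the DDVV inequality `s + s^⊥ ≤ |H|² + c`, at one point of a submanifold of the unit
sphere (`c = 1`). -/
def DDVVEquality : Prop :=
  ∃ (e : Fin m → Euc m) (n₁ n₂ : Amb m), IsTangentFrame f u e ∧ IsNormalFrame f u n₁ n₂ ∧
    scalarCurv f u e + normalScalarCurv f u e n₁ n₂ = ‖meanCurv f u‖ ^ 2 + 1

end Coordinates

/-! ### The Lorentz space and the quadric -/

/-- The complexified Lorentz space `ℂ^{m+4}`. -/
abbrev CLor (m : ℕ) : Type := Fin (m + 4) → ℂ

/-- The complex bilinear extension of the Lorentz inner product. -/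
def lor {m : ℕ} (Z W : CLor m) : ℂ := -(Z 0 * W 0) + ∑ i : Fin (m + 3), Z i.succ * W i.succ

/-- Complex conjugation on `ℂ^{m+4}`. -/
def conjL {m : ℕ} (Z : CLor m) : CLor m := fun i => (starRingEnd ℂ) (Z i)

/-- The real vector `(t, y)` of the Lorentz space, regarded in the complexification. -/
def realVec {m : ℕ} (t : ℝ) (y : Amb m) : CLor m :=
  Fin.cons (t : ℂ) fun i : Fin (m + 3) => (y i : ℂ)

/-- The open quadric `Q^{m+2}_+ = {[Z] : ⟨Z,Z⟩ = 0, ⟨Z,Z̄⟩ > 0}` in `ℂP^{m+3}`. -/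
def quadric (m : ℕ) : Set (ℙ ℂ (CLor m)) :=
  {P | lor P.rep P.rep = 0 ∧ 0 < (lor P.rep (conjL P.rep)).re}

/-- The horizontal part `ζ - (⟨ζ,Z̄⟩/⟨Z,Z̄⟩) Z`. -/
def horPart {m : ℕ} (Z ζ : CLor m) : CLor m := ζ - (lor ζ (conjL Z) / lor Z (conjL Z)) • Z

/-- The Hermitian metric of the quadric: the value of `h_ξ` for the lift value `ξ = Z` and the
lift derivative `dξ = ζ`. -/
def quadricMetric {m : ℕ} (Z ζ : CLor m) : ℝ :=
  (lor (horPart Z ζ) (conjL (horPart Z ζ)) / lor Z (conjL Z)).re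

/-! ### Submanifolds of the sphere -/

section Submanifold

variable {m : ℕ} {M : Type*} [TopologicalSpace M] [ChartedSpace (Euc m) M]

/-- The map `x` in the preferred chart at `p`. The tangent space at `p` is the model space `ℝ^m`
through this chart. -/
def localRep (x : M → Amb m) (p : M) : Euc m → Amb m := x ∘ (extChartAt (𝓡 m) p).symm

/-- The coordinates of `p` in the preferred chart at `p`. -/
def basePt (p : M) : Euc m := extChartAt (𝓡 m) p p

/-- `x` is a smooth immersion into the unit sphere `S^{m+2} ⊂ ℝ^{m+3}`. -/
structure IsSphereImmersion (x : M → Amb m) : Prop where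
  norm_eq_one : ∀ p, ‖x p‖ = 1
  smooth : ContMDiff (𝓡 m) 𝓘(ℝ, Amb m) ∞ x
  immersion : ∀ p, Function.Injective (mfderiv (𝓡 m) 𝓘(ℝ, Amb m) x p)

/-- `x` is umbilic-free: the trace-free second fundamental form vanishes nowhere. -/
def IsUmbilicFree (x : M → Amb m) : Prop :=
  ∀ p, ∃ v w : Euc m, tracelessFF (localRep x p) (basePt p) v w ≠ 0

/-- `x` is Wintgen ideal: equality holds in the DDVV inequality at every point. -/
def IsWintgenIdeal (x : M → Amb m) : Prop := ∀ p : M, DDVVEquality (localRep x p) (basePt p)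

/-- The normal plane of `x` at `p`, inside the tangent space of the sphere. -/
def normalAt (x : M → Amb m) (p : M) : Submodule ℝ (Amb m) :=
  normalPlane (localRep x p) (basePt p)

/-- The mean curvature vector of `x` at `p`. -/
def meanCurvAt (x : M → Amb m) (p : M) : Amb m := meanCurv (localRep x p) (basePt p)

/-- An orientation of the normal bundle, given by a continuous field `J` that restricts on every
normal plane to the quarter turn in the positive direction: `(n, J n)` is the oriented orthonormal
basis that begins with the unit normal vector `n`. -/
structure IsNormalOrientation (x : M → Amb m) (J : M → Amb m →L[ℝ] Amb m) : Prop where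
  continuous : Continuous J
  mapsTo : ∀ p, ∀ n ∈ normalAt x p, J p n ∈ normalAt x p
  norm_eq : ∀ p, ∀ n ∈ normalAt x p, ‖J p n‖ = ‖n‖
  inner_eq_zero : ∀ p, ∀ n ∈ normalAt x p, ⟪J p n, n⟫_ℝ = 0

/-- The vector `(H·n, n + (H·n) x)` of the Lorentz space: the hypersphere tangent to the
submanifold at `p` with normal vector `n` and with the same mean curvature `H·n`. -/
def sphereVec (x : M → Amb m) (p : M) (n : Amb m) : CLor m :=
  realVec ⟪meanCurvAt x p, n⟫_ℝ (n + ⟪meanCurvAt x p, n⟫_ℝ • x p)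

/-- The vector `ξ₁ - i ξ₂` of the mean curvature sphere at `p`, for the oriented orthonormal normal
basis `(n, J n)`. -/
def gaussVec (x : M → Amb m) (J : M → Amb m →L[ℝ] Amb m) (p : M) (n : Amb m) : CLor m :=
  sphereVec x p n - Complex.I • sphereVec x p (J p n)

/-- The Möbius metric `g = ρ² dx·dx`. -/
def mobiusMetric (x : M → Amb m) (p : M) (v w : TangentSpace (𝓡 m) p) : ℝ :=
  rho (localRep x p) (basePt p) ^ 2 * firstFF (localRep x p) (basePt p) v w

/-- The Möbius second fundamental form in the direction of the normal vector `n`. Its components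
in a `g`-orthonormal frame `E_i = ρ⁻¹ e_i` are `ρ⁻¹ (h_{ij} - H δ_{ij})`. -/
def mobiusFF (x : M → Amb m) (p : M) (n : Amb m) (v w : TangentSpace (𝓡 m) p) : ℝ :=
  rho (localRep x p) (basePt p) * ⟪tracelessFF (localRep x p) (basePt p) v w, n⟫_ℝ

/-- The constant `μ = √((m-1)/(4m))`. -/
def mu (m : ℕ) : ℝ := Real.sqrt (((m : ℝ) - 1) / (4 * (m : ℝ)))

/-- The matrix with entries `(1,2)` and `(2,1)` equal to `μ`, the others zero. -/
def normalForm₁ (m : ℕ) (i j : Fin m) : ℝ :=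
  if (i.val = 0 ∧ j.val = 1) ∨ (i.val = 1 ∧ j.val = 0) then mu m else 0

/-- The matrix `diag(μ, -μ, 0, …, 0)`. -/
def normalForm₂ (m : ℕ) (i j : Fin m) : ℝ :=
  if i.val = 0 ∧ j.val = 0 then mu m else if i.val = 1 ∧ j.val = 1 then -mu m else 0

/-- A frame `E₁, …, E_m` of the tangent space, orthonormal for the Möbius metric, and an orthonormal
normal frame `n₁, n₂` in which the Möbius second fundamental form has the normal form of Wintgen
ideal submanifolds. -/
structure IsAdaptedFrame (x : M → Amb m) (p : M) (E : Fin m → TangentSpace (𝓡 m) p)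
    (n₁ n₂ : Amb m) : Prop where
  orthonormal : ∀ i j, mobiusMetric x p (E i) (E j) = if i = j then 1 else 0
  normal : IsNormalFrame (localRep x p) (basePt p) n₁ n₂
  form₁ : ∀ i j, mobiusFF x p n₁ (E i) (E j) = normalForm₁ m i j
  form₂ : ∀ i j, mobiusFF x p n₂ (E i) (E j) = normalForm₂ m i j

/-- The distribution `𝔻^⊥ = Span{E₃, …, E_m}`, where `E` is an adapted frame (the span of all
`E₃, …, E_m` for all adapted frames at `p`; it does not depend on the frame). -/
def Dperp (x : M → Amb m) (p : M) : Submodule ℝ (TangentSpace (𝓡 m) p) :=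
  Submodule.span ℝ {v | ∃ (E : Fin m → TangentSpace (𝓡 m) p) (n₁ n₂ : Amb m),
    IsAdaptedFrame x p E n₁ n₂ ∧ ∃ a : Fin m, 2 ≤ a.val ∧ v = E a}

/-! ### Foliations of codimension two -/

/-- A distribution of codimension two is (completely) integrable: around every point there is a
chart of the smooth structure in which the distribution is tangent to the slices on which the first
two coordinates are constant. -/
def IsIntegrable (D : ∀ p : M, Submodule ℝ (TangentSpace (𝓡 m) p)) : Prop :=
  ∀ p : M, ∃ φ ∈ IsManifold.maximalAtlas (𝓡 m) ∞ M, p ∈ φ.source ∧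
    ∀ q ∈ φ.source, ∀ v : TangentSpace (𝓡 m) q,
      v ∈ D q ↔ ∀ i : Fin m, i.val < 2 → (show Euc m from mfderiv (𝓡 m) (𝓡 m) φ q v) i = 0

/-- Two points lie on the same leaf: they are the ends of a smooth curve tangent to the
distribution. -/
def LeafRel (D : ∀ p : M, Submodule ℝ (TangentSpace (𝓡 m) p)) (p q : M) : Prop :=
  ∃ γ : ℝ → M, ContMDiff 𝓘(ℝ, ℝ) (𝓡 m) ∞ γ ∧ γ 0 = p ∧ γ 1 = q ∧
    ∀ t : ℝ, mfderiv 𝓘(ℝ, ℝ) (𝓡 m) γ t (1 : ℝ) ∈ D (γ t)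

/-- The partition of the manifold into leaves. -/
def leafSetoid (D : ∀ p : M, Submodule ℝ (TangentSpace (𝓡 m) p)) : Setoid M :=
  Relation.EqvGen.setoid (LeafRel D)

/-- The space of leaves, with the quotient topology. -/
abbrev LeafSpace (D : ∀ p : M, Submodule ℝ (TangentSpace (𝓡 m) p)) : Type _ :=
  Quotient (leafSetoid D)

/-- The projection onto the space of leaves. -/
def leafProj (D : ∀ p : M, Submodule ℝ (TangentSpace (𝓡 m) p)) : M → LeafSpace D :=
  Quotient.mk (leafSetoid D)

end Submanifold

/-! ### Complex curves in the quadric and the envelope of a sphere congruence -/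

section Curves

variable {m : ℕ} {X : Type*} [TopologicalSpace X] [ChartedSpace ℂ X]

/-- `ξ` is a smooth lift to `ℂ^{m+4}` of the map `G` into `ℂP^{m+3}`, on the open set `U`. -/
structure IsLift (G : X → ℙ ℂ (CLor m)) (U : Set X) (ξ : X → CLor m) : Prop where
  isOpen : IsOpen U
  smooth : ContMDiffOn 𝓘(ℝ, ℂ) 𝓘(ℝ, CLor m) ∞ ξ U
  lifts : ∀ q ∈ U, ∃ h : ξ q ≠ 0, Projectivization.mk ℂ (ξ q) h = G q

/-- The differential of a lift at `q`. The tangent space of the surface at `q` is `ℂ`, through the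
complex coordinate `z = u + i v` that is preferred at `q`; thus `dLift ξ q 1 = ∂ξ/∂u` and
`dLift ξ q I = ∂ξ/∂v`. -/
def dLift (ξ : X → CLor m) (q : X) (v : TangentSpace 𝓘(ℝ, ℂ) q) : CLor m :=
  mfderiv 𝓘(ℝ, ℂ) 𝓘(ℝ, CLor m) ξ q v

/-- A 1-isotropic complex curve in the quadric `Q^{m+2}_+`: a holomorphic immersion `[ξ]` of a
Riemann surface (`∂ξ/∂z̄ = λ ξ` for local lifts `ξ`) with `⟨dξ,dξ⟩ = 0` and `⟨dξ,dξ̄⟩ > 0`, on which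
the metric of the quadric is positive definite. -/
structure IsIsotropicCurve (G : X → ℙ ℂ (CLor m)) : Prop where
  mem_quadric : ∀ q, G q ∈ quadric m
  exists_lift : ∀ q, ∃ U ξ, q ∈ U ∧ IsLift G U ξ
  holomorphic : ∀ U ξ, IsLift G U ξ → ∀ q ∈ U,
    ∃ c : ℂ, (1 / 2 : ℂ) • (dLift ξ q (1 : ℂ) + Complex.I • dLift ξ q Complex.I) = c • ξ q
  isotropic : ∀ U ξ, IsLift G U ξ → ∀ q ∈ U, ∀ v w : TangentSpace 𝓘(ℝ, ℂ) q,
    lor (dLift ξ q v) (dLift ξ q w) = 0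
  positive : ∀ U ξ, IsLift G U ξ → ∀ q ∈ U, ∀ v : TangentSpace 𝓘(ℝ, ℂ) q, v ≠ 0 →
    0 < (lor (dLift ξ q v) (conjL (dLift ξ q v))).re
  immersion : ∀ U ξ, IsLift G U ξ → ∀ q ∈ U, ∀ v : TangentSpace 𝓘(ℝ, ℂ) q, v ≠ 0 →
    0 < quadricMetric (ξ q) (dLift ξ q v)

/-- The envelope of the family of `m`-spheres `{y ∈ S^{m+2} : ⟨(1,y), ξ(q)⟩ = 0}`, `q ∈ X`, with
`G = [ξ]`: the pairs `(q, y)` such that the equation of the sphere with parameter `q` and its first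
derivatives with respect to the parameter hold at `y`. -/
def envelope (G : X → ℙ ℂ (CLor m)) : Set (X × Amb m) :=
  {z | ‖z.2‖ = 1 ∧ ∃ U ξ, IsLift G U ξ ∧ z.1 ∈ U ∧ lor (realVec 1 z.2) (ξ z.1) = 0 ∧
    ∀ v, lor (realVec 1 z.2) (dLift ξ z.1 v) = 0}

/-- The projection of the envelope to the parameter surface. -/
def envProj (G : X → ℙ ℂ (CLor m)) (z : envelope G) : X := z.1.1

/-- The map of the envelope to the sphere `S^{m+2} ⊂ ℝ^{m+3}`. -/
def envMap (G : X → ℙ ℂ (CLor m)) (z : envelope G) : Amb m := z.1.2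

/-- A smooth trivialization over `U` of the envelope as a bundle of round `(m-2)`-spheres: a
diffeomorphism of `U × S^{m-2}` with the part of the envelope over `U`, compatible with the
projections, that maps the fibre over `q` to a round sphere of `ℝ^{m+3}` with centre `c q`, radius
`r q` and an orthonormal basis `w 0 q, …, w (m-2) q` of its linear span. -/
structure IsSphereTrivialization (G : X → ℙ ℂ (CLor m)) [ChartedSpace (Euc m) (envelope G)]
    (U : Set X)
    (Ψ : PartialDiffeomorph (𝓘(ℝ, ℂ).prod (𝓡 (m - 2))) (𝓡 m)
      (X × Metric.sphere (0 : Euc (m - 2 + 1)) 1) (envelope G) ∞)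
    (c : X → Amb m) (r : X → ℝ) (w : Fin (m - 2 + 1) → X → Amb m) : Prop where
  isOpen : IsOpen U
  source_eq : Ψ.source = U ×ˢ Set.univ
  target_eq : Ψ.target = envProj G ⁻¹' U
  smooth_centre : ContMDiffOn 𝓘(ℝ, ℂ) 𝓘(ℝ, Amb m) ∞ c U
  smooth_radius : ContMDiffOn 𝓘(ℝ, ℂ) 𝓘(ℝ, ℝ) ∞ r U
  smooth_frame : ∀ j, ContMDiffOn 𝓘(ℝ, ℂ) 𝓘(ℝ, Amb m) ∞ (w j) U
  radius_pos : ∀ q ∈ U, 0 < r q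
  orthonormal : ∀ q ∈ U, Orthonormal ℝ fun j => w j q
  proj_eq : ∀ q ∈ U, ∀ Θ, envProj G (Ψ (q, Θ)) = q
  map_eq : ∀ q ∈ U, ∀ Θ, envMap G (Ψ (q, Θ)) = c q + r q • ∑ j, Θ.1 j • w j q

end Curves

end Wintgen

end

set_option linter.unusedSectionVars false

noncomputable section

namespace Wintgen

/-! ### Smooth families of projections and orthonormal frames -/

section SmoothFrames

variable {V : Type*} [NormedAddCommGroup V] [NormedSpace ℝ V]
variable {E : Type*} [NormedAddCommGroup E] [InnerProductSpace ℝ E] [FiniteDimensional ℝ E]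
variable {F : Type*} [NormedAddCommGroup F] [InnerProductSpace ℝ F] [FiniteDimensional ℝ F]

/-! Everything rests on a formula for the differential of the map `[ξ₁ - i ξ₂]` from `M` to the
complex projective space.

Pointwise algebra. The Gauss and Ricci equations turn equality in the DDVV inequality into `(|A|² +
|B|²)² = 2 |[A,B]|²` for the two trace-free shape operators (`DDVVEquality.exists_matrixEq`). This
identity survives orthogonal conjugation and orthogonal changes of the pair `(A, B)`. For diagonal
`B = diag(l)` one has `|[A,B]|² = ∑ aᵢⱼ² (lⱼ - lᵢ)² ≤ 2 |A|² |B|²`, and equality leaves one pair of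
opposite eigenvalues and one symmetric pair of entries of `A`. Hence the normal form exists for
every prescribed orthonormal normal frame (`DDVVEquality.exists_isNormalForm`): the normal frame may
be taken smooth, while the tangent frame and the number `t = μρ` are needed only at one point at a
time.

The differential. Put `Y = (1, x)` and `η(v) = ⟨v,e₂⟩ - i⟨v,e₁⟩`. The Weingarten equations give `dξ
= a ξ + b Y - t η (0, e₁ + i e₂)`. That `b` is also a multiple of `η` would classically come from
the Codazzi equations. Here it comes from isotropy: the values of `dξ` are mutually orthogonal for
the bilinear product, so `⟨D²ξ(a,v), dξ(w)⟩` is symmetric in `a, v` and skew in `v, w`, and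
therefore zero. For `a = v = e₂` this is a linear equation for `b` with leading coefficient
`⟨D²ξ(e₂,e₂), Y⟩ = i t`. So `dξ = a ξ + η τ` with a single vector `τ`
(`IsWintgenFrameOn.exists_isGaussPair`); the complex plane of `ξ, τ` is totally isotropic,
orthogonal to `Y`, and the Hermitian product on it is `diag(2, 2t²)`.

The leaf space. The kernel of `η` is the nullity of the trace-free second fundamental form, that is
`𝔻^⊥`. A suitable affine coordinate of `[ξ]` is therefore a local submersion to `ℂ` with kernel
`𝔻^⊥` (`IsSubmersiveCurve.exists_isFlowBox`), which proves integrability and supplies coordinates on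
the space of leaves. Since `d[ξ]` is a complex-valued form times one vector, the coordinate changes
are holomorphic. The projection to the leaf space is open because saturations of open sets are open
(`IsSubmersiveCurve.isOpenMap_leafProj`). Isotropy and positivity of the curve are read off from the
products of `ξ` and `τ`, and its metric is `t² |η|² = μ² g` on the complement of `𝔻^⊥`.

The envelope. Its fibre over a point consists of the unit vectors `y` with `(1, y)` orthogonal to
`ξ` and `τ`. These are four real affine equations, and since real parts of vectors of an isotropic
positive plane are spacelike, the affine subspace they cut out meets the open unit ball
(`IsGaussPair.abs_timeRe_lt`, `norm_footPoint_lt_one`). The fibre is a round `(m-2)`-sphere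
depending smoothly on the parameter (`exists_smooth_round_spheres`), and the local products with a
sphere are glued to a manifold. Differentiating `⟨(1, y), ξ⟩ = 0` gives tangency to the spheres. The
map `(π, x)` is a local diffeomorphism because `x` is an immersion and the dimensions agree. -/

theorem contDiff_adjoint {n : WithTop ℕ∞} [CompleteSpace E] [CompleteSpace F] :
    ContDiff ℝ n (fun L : F →L[ℝ] E => ContinuousLinearMap.adjoint L) := by
  have : IsBoundedLinearMap ℝ (fun L : F →L[ℝ] E => ContinuousLinearMap.adjoint L) :=
    { map_add := fun a b => map_add _ a b
      map_smul := fun c a => by simp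
      bound := ⟨1, one_pos, fun L => by simp⟩ }
  exact this.contDiff

/-- `⟪L*L a, a⟫ = ‖L a‖²`, so `L*L` is injective, hence bijective in finite dimension. -/
theorem isInvertible_adjoint_comp_self [CompleteSpace E] [CompleteSpace F] {L : F →L[ℝ] E}
    (hL : Function.Injective L) :
    (ContinuousLinearMap.adjoint L ∘L L).IsInvertible := by
  have hinj : Function.Injective (ContinuousLinearMap.adjoint L ∘L L : F →L[ℝ] F) := by
    rw [injective_iff_map_eq_zero]
    intro a ha
    apply hL
    have : ⟪(ContinuousLinearMap.adjoint L ∘L L) a, a⟫_ℝ = ⟪L a, L a⟫_ℝ := by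
      simp [ContinuousLinearMap.adjoint_inner_left]
    rw [ha, inner_zero_left] at this
    rw [map_zero]
    exact inner_self_eq_zero.1 this.symm
  exact ⟨(LinearEquiv.ofInjectiveEndo
    (ContinuousLinearMap.adjoint L ∘L L : F →L[ℝ] F).toLinearMap hinj).toContinuousLinearEquiv,
    by ext a; rfl⟩

/-- The least-squares formula `L (L*L)⁻¹ L*`: it presents the projection as a composite of
operations that are smooth in `L`. -/
theorem starProjection_range_eq [CompleteSpace E] [CompleteSpace F] {L : F →L[ℝ] E}
    (hL : Function.Injective L) :
    (LinearMap.range L.toLinearMap).starProjection =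
      L ∘L (ContinuousLinearMap.adjoint L ∘L L).inverse ∘L ContinuousLinearMap.adjoint L := by
  ext y
  apply Submodule.eq_starProjection_of_mem_of_inner_eq_zero
  · exact ⟨_, rfl⟩
  · rintro _ ⟨w, rfl⟩
    have key : (ContinuousLinearMap.adjoint L ∘L L)
        ((ContinuousLinearMap.adjoint L ∘L L).inverse (ContinuousLinearMap.adjoint L y)) =
          ContinuousLinearMap.adjoint L y := by
      obtain ⟨e, he⟩ := isInvertible_adjoint_comp_self hL
      rw [← he]; simp
    have : ContinuousLinearMap.adjoint L (y - L ((ContinuousLinearMap.adjoint L ∘L L).inverse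
        (ContinuousLinearMap.adjoint L y))) = 0 := by
      rw [map_sub, sub_eq_zero]; exact key.symm
    change ⟪y - L ((ContinuousLinearMap.adjoint L ∘L L).inverse
        (ContinuousLinearMap.adjoint L y)), L w⟫_ℝ = 0
    rw [← ContinuousLinearMap.adjoint_inner_left, this, inner_zero_left]

/-- The orthogonal projection onto the range of a smooth family of injective maps is smooth. -/
theorem contDiffOn_starProjection_range [CompleteSpace E] [CompleteSpace F]
    {L : V → F →L[ℝ] E} {Ω : Set V}
    {n : WithTop ℕ∞} (hL : ContDiffOn ℝ n L Ω) (hinj : ∀ u ∈ Ω, Function.Injective (L u)) :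
    ContDiffOn ℝ n (fun u => (LinearMap.range (L u).toLinearMap).starProjection) Ω := by
  have h1 : ContDiffOn ℝ n (fun u => ContinuousLinearMap.adjoint (L u)) Ω :=
    contDiff_adjoint.comp_contDiffOn hL
  have h2 : ContDiffOn ℝ n (fun u => ContinuousLinearMap.adjoint (L u) ∘L L u) Ω :=
    h1.clm_comp hL
  have h3 : ContDiffOn ℝ n
      (fun u => (ContinuousLinearMap.adjoint (L u) ∘L L u).inverse) Ω := by
    intro u hu
    exact ((isInvertible_adjoint_comp_self (hinj u hu)).contDiffAt_map_inverse
      (n := n)).comp_contDiffWithinAt u (h2 u hu)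
  exact (hL.clm_comp (h3.clm_comp h1)).congr fun u hu => starProjection_range_eq (hinj u hu)

/-- Induction along the recursion; linear independence keeps the denominators away from zero. -/
theorem contDiffOn_gramSchmidt {k : ℕ} {v : Fin k → V → E} {Ω : Set V} {n : WithTop ℕ∞}
    (hv : ∀ j, ContDiffOn ℝ n (v j) Ω) (hli : ∀ u ∈ Ω, LinearIndependent ℝ fun j => v j u)
    (j : Fin k) :
    ContDiffOn ℝ n (fun u => InnerProductSpace.gramSchmidt ℝ (fun i => v i u) j) Ω := by
  induction j using WellFoundedLT.induction with
  | ind j ih =>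
    have : (fun u => InnerProductSpace.gramSchmidt ℝ (fun i => v i u) j) = fun u => v j u -
        ∑ i ∈ Finset.Iio j, (⟪InnerProductSpace.gramSchmidt ℝ (fun i => v i u) i, v j u⟫_ℝ /
          ‖InnerProductSpace.gramSchmidt ℝ (fun i => v i u) i‖ ^ 2) •
            InnerProductSpace.gramSchmidt ℝ (fun i => v i u) i := by
      ext1 u
      rw [InnerProductSpace.gramSchmidt_def]
      simp only [Submodule.starProjection_singleton, RCLike.ofReal_real_eq_id, id]
    rw [this]
    refine (hv j).sub (ContDiffOn.sum fun i hi => ?_)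
    have hi' := ih i (Finset.mem_Iio.1 hi)
    refine ContDiffOn.smul (ContDiffOn.div (hi'.inner ℝ (hv j)) (hi'.norm_sq ℝ) ?_) hi'
    intro u hu
    have := InnerProductSpace.gramSchmidt_ne_zero i (hli u hu)
    positivity

/-- A smooth family of orthogonal projections of constant rank has local smooth orthonormal
frames. -/
theorem exists_smooth_orthonormal_frame {k : ℕ} {K : V → Submodule ℝ E} {Ω : Set V}
    (hΩ : IsOpen Ω) (hK : ContDiffOn ℝ ∞ (fun u => (K u).starProjection) Ω) {u₀ : V}
    (hu₀ : u₀ ∈ Ω) (hk : Module.finrank ℝ (K u₀) = k) :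
    ∃ (Ω' : Set V) (w : Fin k → V → E), IsOpen Ω' ∧ u₀ ∈ Ω' ∧ Ω' ⊆ Ω ∧
      (∀ j, ContDiffOn ℝ ∞ (w j) Ω') ∧
      ∀ u ∈ Ω', (Orthonormal ℝ fun j => w j u) ∧ ∀ j, w j u ∈ K u := by
  subst hk
  let b := stdOrthonormalBasis ℝ (K u₀)
  -- A basis of the fibre at `u₀` is projected to the nearby fibres. Linear independence is an open
  -- condition, and Gram–Schmidt stays inside the fibre.
  let v : Fin (Module.finrank ℝ (K u₀)) → V → E := fun j u => (K u).starProjection (b j)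
  have hv : ∀ j, ContDiffOn ℝ ∞ (v j) Ω := fun j => hK.clm_apply contDiffOn_const
  have hcont : ContinuousOn (fun u j => v j u) Ω :=
    continuousOn_pi.2 fun j => (hv j).continuousOn
  have hopen : IsOpen (Ω ∩ (fun u j => v j u) ⁻¹' {f | LinearIndependent ℝ f}) :=
    hcont.isOpen_inter_preimage hΩ isOpen_setOfPred_linearIndependent
  have hb0 : (fun j => v j u₀) = fun j => (b j : E) := by
    funext j
    exact Submodule.starProjection_eq_self_iff.2 (b j).2
  have hmem : u₀ ∈ Ω ∩ (fun u j => v j u) ⁻¹' {f | LinearIndependent ℝ f} := by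
    refine ⟨hu₀, ?_⟩
    change LinearIndependent ℝ fun j => v j u₀
    rw [hb0]
    exact (b.orthonormal.linearIndependent.map' (K u₀).subtype (Submodule.ker_subtype _))
  refine ⟨_, fun j u => InnerProductSpace.gramSchmidtNormed ℝ (fun i => v i u) j, hopen, hmem,
    Set.inter_subset_left, fun j => ?_, fun u hu => ⟨?_, fun j => ?_⟩⟩
  · have h := contDiffOn_gramSchmidt (n := ∞)
      (fun j => (hv j).mono (Set.inter_subset_left
        (t := (fun u j => v j u) ⁻¹' {f | LinearIndependent ℝ f}))) (fun u hu => hu.2) j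
    have hne : ∀ u ∈ Ω ∩ (fun u j => v j u) ⁻¹' {f | LinearIndependent ℝ f},
        InnerProductSpace.gramSchmidt ℝ (fun i => v i u) j ≠ 0 := fun u hu =>
      InnerProductSpace.gramSchmidt_ne_zero j hu.2
    exact ((h.norm ℝ hne).inv fun u hu => by simpa using hne u hu).smul h
  · exact InnerProductSpace.gramSchmidtNormed_orthonormal hu.2
  · have : InnerProductSpace.gramSchmidt ℝ (fun i => v i u) j ∈ K u := by
      have h1 := InnerProductSpace.gramSchmidt_mem_span ℝ (fun i => v i u) (le_refl j)
      refine (Submodule.span_le.2 ?_) h1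
      rintro _ ⟨i, -, rfl⟩
      exact Submodule.starProjection_apply_mem _ _
    exact (K u).smul_mem _ this

end SmoothFrames

/-! ### The equality case of the DDVV inequality for two symmetric matrices -/

/-- The matrix with entries `(1,2)` and `(2,1)` equal to `t`, the others zero. -/
def offDiagForm (t : ℝ) {m : ℕ} (i j : Fin m) : ℝ :=
  if (i.val = 0 ∧ j.val = 1) ∨ (i.val = 1 ∧ j.val = 0) then t else 0

/-- The matrix `diag(t, -t, 0, …, 0)`. -/
def diagForm (t : ℝ) {m : ℕ} (i j : Fin m) : ℝ :=
  if i.val = 0 ∧ j.val = 0 then t else if i.val = 1 ∧ j.val = 1 then -t else 0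

/-- Equality in the DDVV inequality for two matrices. -/
def DDVVMatrixEq {m : ℕ} (a b : Matrix (Fin m) (Fin m) ℝ) : Prop :=
  ((a * a.transpose).trace + (b * b.transpose).trace) ^ 2 =
    2 * ((a * b - b * a) * (a * b - b * a).transpose).trace

theorem trace_mul_transpose_self {m : ℕ} (a : Matrix (Fin m) (Fin m) ℝ) :
    (a * a.transpose).trace = ∑ i, ∑ j, a i j ^ 2 := by
  simp [Matrix.trace, Matrix.mul_apply, pow_two]

/-- Orthogonal conjugation commutes with products and preserves the Frobenius norm. -/
theorem DDVVMatrixEq.conj {m : ℕ} {a b U : Matrix (Fin m) (Fin m) ℝ} (h : DDVVMatrixEq a b)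
    (hU : U.transpose * U = 1) :
    DDVVMatrixEq (U * a * U.transpose) (U * b * U.transpose) := by
  have key : ∀ x : Matrix (Fin m) (Fin m) ℝ,
      ((U * x * U.transpose) * (U * x * U.transpose).transpose).trace =
        (x * x.transpose).trace := by
    intro x
    have : (U * x * U.transpose) * (U * x * U.transpose).transpose =
        U * (x * (U.transpose * U) * x.transpose * U.transpose) := by
      simp only [Matrix.transpose_mul, Matrix.transpose_transpose, Matrix.mul_assoc]
    rw [this, Matrix.trace_mul_comm, hU]
    simp [Matrix.mul_assoc, hU]
  have hmul : ∀ x y : Matrix (Fin m) (Fin m) ℝ,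
      (U * x * U.transpose) * (U * y * U.transpose) = U * (x * y) * U.transpose := by
    intro x y
    calc (U * x * U.transpose) * (U * y * U.transpose)
        = U * x * (U.transpose * U) * y * U.transpose := by simp only [Matrix.mul_assoc]
      _ = _ := by rw [hU]; simp [Matrix.mul_assoc]
  unfold DDVVMatrixEq at *
  rw [key, key, hmul, hmul, ← Matrix.sub_mul, ← Matrix.mul_sub, key, h]

/-- The commutator is bilinear and alternating, so an orthogonal change of the pair multiplies it by
a determinant `±1`, while the sum of the squared norms is preserved. -/
theorem DDVVMatrixEq.rotate {m : ℕ} {a b : Matrix (Fin m) (Fin m) ℝ} (h : DDVVMatrixEq a b)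
    {p q r t : ℝ} (h1 : p ^ 2 + q ^ 2 = 1) (h2 : r ^ 2 + t ^ 2 = 1) (h3 : p * r + q * t = 0) :
    DDVVMatrixEq (p • a + q • b) (r • a + t • b) := by
  have hd : (p * t - q * r) ^ 2 = 1 := by nlinarith
  -- Orthonormal rows give orthonormal columns: with `δ = p t - q r = ±1` one has `p = t δ` and `r =
  -- -q δ`.
  have e1 : p ^ 2 + r ^ 2 = 1 := by
    have : p = t * (p * t - q * r) := by linear_combination (-p) * h2 + r * h3
    have h4 : p ^ 2 = t ^ 2 := by
      calc p ^ 2 = (t * (p * t - q * r)) ^ 2 := by rw [← this]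
        _ = t ^ 2 := by rw [mul_pow, hd, mul_one]
    linarith
  have e2 : q ^ 2 + t ^ 2 = 1 := by linarith
  have e3 : p * q + r * t = 0 := by
    have h4 : p = t * (p * t - q * r) := by linear_combination (-p) * h2 + r * h3
    have h5 : r = - q * (p * t - q * r) := by linear_combination (-r) * h1 + p * h3
    have : p * q + r * t = (t * (p * t - q * r)) * q + (- q * (p * t - q * r)) * t := by
      rw [← h4, ← h5]
    rw [this]; ring
  have hc : (p • a + q • b) * (r • a + t • b) - (r • a + t • b) * (p • a + q • b) =
      (p * t - q * r) • (a * b - b * a) := by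
    simp only [Matrix.add_mul, Matrix.mul_add, Matrix.smul_mul, Matrix.mul_smul,
      smul_sub, sub_smul]
    module
  unfold DDVVMatrixEq at *
  rw [hc, Matrix.transpose_smul, Matrix.smul_mul, Matrix.mul_smul, smul_smul, ← pow_two, hd,
    one_smul, ← h]
  congr 1
  simp only [trace_mul_transpose_self, Matrix.add_apply, Matrix.smul_apply, smul_eq_mul,
    ← Finset.sum_add_distrib]
  refine Finset.sum_congr rfl fun i _ => Finset.sum_congr rfl fun j _ => ?_
  linear_combination (a i j) ^ 2 * e1 + (b i j) ^ 2 * e2 + 2 * (a i j) * (b i j) * e3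

theorem exists_perm_zero_one {m : ℕ} (hm : 2 ≤ m) {i j : Fin m} (hij : i ≠ j) :
    ∃ σ : Equiv.Perm (Fin m), σ ⟨0, by omega⟩ = i ∧ σ ⟨1, by omega⟩ = j := by
  let z : Fin m := ⟨0, by omega⟩
  let o : Fin m := ⟨1, by omega⟩
  have hzo : z ≠ o := by simp [z, o, Fin.ext_iff]
  -- The outer swap sends `z` to `i`; the inner one fixes `z` and first moves `o` to the preimage of
  -- `j` under the outer swap.
  refine ⟨Equiv.swap z i * Equiv.swap o (Equiv.swap z i j), ?_, ?_⟩
  · change (Equiv.swap z i) (Equiv.swap o (Equiv.swap z i j) z) = i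
    rw [Equiv.swap_apply_of_ne_of_ne hzo, Equiv.swap_apply_left]
    intro h
    have : j = i := by
      have := congrArg (Equiv.swap z i) h
      rw [Equiv.swap_apply_left, Equiv.swap_apply_self] at this
      exact this.symm
    exact hij this.symm
  · change (Equiv.swap z i) (Equiv.swap o (Equiv.swap z i j) o) = j
    rw [Equiv.swap_apply_left, Equiv.swap_apply_self]

/-- The equality case when the second matrix is diagonal. -/
theorem DDVVMatrixEq.of_diagonal {m : ℕ} {a b : Matrix (Fin m) (Fin m) ℝ}
    {l : Fin m → ℝ} (hb : b = Matrix.diagonal l) (ha : a.transpose = a)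
    (h : DDVVMatrixEq a b) (hne : a ≠ 0 ∨ b ≠ 0) :
    ∃ i j : Fin m, i ≠ j ∧ 0 < l i ∧ l j = - l i ∧ (∀ k, k ≠ i → k ≠ j → l k = 0) ∧
      a i j ^ 2 = l i ^ 2 ∧
      ∀ k n, ¬ (k = i ∧ n = j) → ¬ (k = j ∧ n = i) → a k n = 0 := by
  have hC : ∀ i j, (a * b - b * a) i j = a i j * (l j - l i) := by
    intro i j
    rw [hb, Matrix.sub_apply, Matrix.mul_diagonal, Matrix.diagonal_mul]; ring
  unfold DDVVMatrixEq at h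
  simp only [trace_mul_transpose_self, hC] at h
  have hbb : ∑ i, ∑ j, b i j ^ 2 = ∑ i, l i ^ 2 := by
    refine Finset.sum_congr rfl fun i _ => ?_
    rw [hb, Finset.sum_eq_single i]
    · simp
    · intro j _ hj; simp [Matrix.diagonal_apply_ne' _ hj]
    · simp
  rw [hbb] at h
  set S := ∑ i, l i ^ 2 with hS
  set A := ∑ i, ∑ j, a i j ^ 2 with hA
  have hS0 : 0 ≤ S := hS ▸ Finset.sum_nonneg fun i _ => sq_nonneg _
  clear_value S A
  have hA0 : 0 ≤ A := hA ▸ Finset.sum_nonneg fun i _ => Finset.sum_nonneg fun j _ => sq_nonneg _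
  have hpair : ∀ i j, i ≠ j → l i ^ 2 + l j ^ 2 ≤ S := by
    intro i j hij
    rw [hS, ← Finset.sum_pair hij (f := fun i => l i ^ 2)]
    exact Finset.sum_le_sum_of_subset_of_nonneg (Finset.subset_univ _) fun _ _ _ => sq_nonneg _
  -- `(l j - l i)² ≤ 2 (l i² + l j²)`; this is the only inequality behind the bound for the
  -- commutator.
  have hdiff : ∀ i j, (l j - l i) ^ 2 ≤ 2 * S := by
    intro i j
    by_cases hij : i = j
    · subst hij; simp; exact hS0
    · have := hpair i j hij
      nlinarith [sq_nonneg (l i + l j)]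
  have hterm : ∀ i j, 0 ≤ a i j ^ 2 * (2 * S - (l j - l i) ^ 2) := fun i j =>
    mul_nonneg (sq_nonneg _) (by linarith [hdiff i j])
  have hsum : ∑ i, ∑ j, a i j ^ 2 * (2 * S - (l j - l i) ^ 2) =
      2 * S * A - ∑ i, ∑ j, (a i j * (l j - l i)) ^ 2 := by
    rw [hA, Finset.mul_sum, ← Finset.sum_sub_distrib]
    refine Finset.sum_congr rfl fun i _ => ?_
    rw [Finset.mul_sum, ← Finset.sum_sub_distrib]
    refine Finset.sum_congr rfl fun j _ => ?_
    ring
  have hsum0 : 0 ≤ ∑ i, ∑ j, a i j ^ 2 * (2 * S - (l j - l i) ^ 2) :=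
    Finset.sum_nonneg fun i _ => Finset.sum_nonneg fun j _ => hterm i j
  -- The hypothesis `h` and `hsum` combine to `(A - S)² + 2 · (sum of the slacks) = 0`, so both
  -- terms vanish.
  have hAS : A = S := by nlinarith [sq_nonneg (A - S)]
  have hzero : ∑ i, ∑ j, a i j ^ 2 * (2 * S - (l j - l i) ^ 2) = 0 := by
    nlinarith [sq_nonneg (A - S)]
  have hz : ∀ i j, a i j ^ 2 * (2 * S - (l j - l i) ^ 2) = 0 := by
    intro i j
    have h1 := (Finset.sum_eq_zero_iff_of_nonneg
      (fun i _ => Finset.sum_nonneg fun j _ => hterm i j)).1 hzero i (Finset.mem_univ _)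
    exact (Finset.sum_eq_zero_iff_of_nonneg (fun j _ => hterm i j)).1 h1 j (Finset.mem_univ _)
  have hSpos : 0 < S := by
    rcases hS0.lt_or_eq with h0 | h0
    · exact h0
    · exfalso
      have hA' : ∑ i, ∑ j, a i j ^ 2 = 0 := by rw [← hA, hAS, ← h0]
      have hl : ∀ i, l i = 0 := fun i => by
        have := (Finset.sum_eq_zero_iff_of_nonneg (fun i _ => sq_nonneg (l i))).1 (hS ▸ h0.symm) i
          (Finset.mem_univ _)
        exact pow_eq_zero_iff two_ne_zero |>.1 this
      rcases hne with h1 | h1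
      · apply h1
        ext i j
        have h2 := (Finset.sum_eq_zero_iff_of_nonneg
          (fun i _ => Finset.sum_nonneg fun j _ => sq_nonneg (a i j))).1 hA' i (Finset.mem_univ _)
        have h3 := (Finset.sum_eq_zero_iff_of_nonneg (fun j _ => sq_nonneg (a i j))).1 h2 j
          (Finset.mem_univ _)
        exact pow_eq_zero_iff two_ne_zero |>.1 h3
      · apply h1
        rw [hb]; ext i j; simp [Matrix.diagonal_apply, hl]
  have hval : ∀ i j, a i j ≠ 0 → (l j - l i) ^ 2 = 2 * S := fun i j hij => by
    have := (mul_eq_zero.1 (hz i j)).resolve_left (pow_ne_zero 2 hij)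
    linarith
  obtain ⟨i, j, hij0⟩ : ∃ i j, a i j ≠ 0 := by
    by_contra hcon
    push Not at hcon
    have : A = 0 := by rw [hA]; simp [hcon]
    linarith
  have hsymm : ∀ i j, a i j = a j i := fun i j => by
    conv_lhs => rw [← ha]
    rfl
  -- The two eigenvalues of a nonzero entry are opposite and nonzero; the indices are exchanged if
  -- the first eigenvalue is negative.
  wlog hpos : 0 < l i generalizing i j
  · have hv := hval i j hij0
    have hij : i ≠ j := by rintro rfl; simp at hv; linarith
    have h2 := hpair i j hij
    refine this j i (by rwa [hsymm]) ?_
    have h3 : l i + l j = 0 := by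
      have : (l i + l j) ^ 2 = 0 := le_antisymm (by nlinarith) (sq_nonneg _)
      exact pow_eq_zero_iff two_ne_zero |>.1 this
    have h4 : l i ≠ 0 := by
      intro h0
      rw [h0] at h3 hv
      simp at h3
      rw [h3] at hv; simp at hv; linarith
    rcases lt_or_gt_of_ne h4 with h5 | h5
    · linarith
    · exact absurd h5 hpos
  · have hv := hval i j hij0
    have hij : i ≠ j := by rintro rfl; simp at hv; linarith
    have h2 := hpair i j hij
    -- `(l i + l j)² = 2 (l i² + l j²) - (l j - l i)² ≤ 2S - 2S`.
    have h3 : l i + l j = 0 := by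
      have : (l i + l j) ^ 2 = 0 := le_antisymm (by nlinarith) (sq_nonneg _)
      exact pow_eq_zero_iff two_ne_zero |>.1 this
    have hj : l j = - l i := by linarith
    have hS2 : S = 2 * l i ^ 2 := by rw [hj] at hv; nlinarith
    have hrest : ∀ k, k ≠ i → k ≠ j → l k = 0 := by
      intro k hki hkj
      -- The indices `i` and `j` already exhaust the sum `S = 2 (l i)²`, so nothing is left for a
      -- third eigenvalue.
      have h6 : l i ^ 2 + (l j ^ 2 + l k ^ 2) ≤ S := by
        have h7 : ∑ n ∈ ({i, j, k} : Finset (Fin m)), l n ^ 2 = l i ^ 2 + (l j ^ 2 + l k ^ 2) := by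
          rw [Finset.sum_insert (by simp [hij, hki.symm]), Finset.sum_pair hkj.symm]
        rw [← h7, hS]
        exact Finset.sum_le_sum_of_subset_of_nonneg (Finset.subset_univ _)
          fun _ _ _ => sq_nonneg _
      have h8 : l k ^ 2 ≤ 0 := by rw [hj] at h6; nlinarith
      exact pow_eq_zero_iff two_ne_zero |>.1 (le_antisymm h8 (sq_nonneg _))
    have hoff : ∀ k n, ¬ (k = i ∧ n = j) → ¬ (k = j ∧ n = i) → a k n = 0 := by
      intro k n h1 h2
      by_contra hkn
      have h4 := hval k n hkn
      have hlk : ∀ k, l k = if k = i then l i else if k = j then - l i else 0 := by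
        intro k
        by_cases hk : k = i
        · simp [hk]
        · by_cases hk' : k = j
          · subst hk'; simp [hk, hj]
          · simp [hk, hk', hrest k hk hk']
      rw [hlk k, hlk n] at h4
      have hp : 0 < l i ^ 2 := by positivity
      split_ifs at h4 with c1 c2 c3 c4 c5 c6 c7 c8 <;> first | (exact h1 ⟨by assumption, by assumption⟩) | (exact h2 ⟨by assumption, by assumption⟩) | nlinarith
    refine ⟨i, j, hij, hpos, hj, hrest, ?_, hoff⟩
    -- Only two entries of `a` survive, so `A = 2 (a i j)²`; comparison with `S = 2 (l i)²` gives
    -- the required square.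
    have hA2 : A = a i j ^ 2 + a j i ^ 2 := by
      rw [hA, ← Fintype.sum_prod_type' (f := fun i j => a i j ^ 2)]
      rw [← Finset.sum_subset (Finset.subset_univ {(i, j), (j, i)})]
      · rw [Finset.sum_pair (by simp [hij])]
      · rintro ⟨k, n⟩ - hk
        simp only [Finset.mem_insert, Finset.mem_singleton, Prod.mk.injEq, not_or] at hk
        simp [hoff k n hk.1 hk.2]
    rw [hsymm j i] at hA2
    linarith

/-- The second matrix is diagonalized and the diagonal equality case applied; then the two
distinguished eigenvectors are moved to the first two places and the sign of the second is adjusted.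
-/
theorem DDVVMatrixEq.exists_normalForm {m : ℕ} (hm : 2 ≤ m) {a b : Matrix (Fin m) (Fin m) ℝ}
    (ha : a.transpose = a) (hb : b.transpose = b)
    (h : DDVVMatrixEq a b) (hne : a ≠ 0 ∨ b ≠ 0) :
    ∃ (U : Matrix (Fin m) (Fin m) ℝ) (t : ℝ), U * U.transpose = 1 ∧ 0 < t ∧
      (∀ i j, (U * a * U.transpose) i j = offDiagForm t i j) ∧
      ∀ i j, (U * b * U.transpose) i j = diagForm t i j := by
  have hbH : b.IsHermitian := by
    rw [Matrix.IsHermitian, Matrix.conjTranspose_eq_transpose_of_trivial, hb]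
  let B := hbH.eigenvectorBasis
  let W : Matrix (Fin m) (Fin m) ℝ := Matrix.of fun i k => B i k
  have hW : W * W.transpose = 1 := by
    ext i j
    have := orthonormal_iff_ite.1 B.orthonormal i j
    simp only [PiLp.inner_apply, RCLike.inner_apply, conj_trivial] at this
    simp only [Matrix.mul_apply, Matrix.transpose_apply, W, Matrix.of_apply, Matrix.one_apply]
    rw [← this]
    exact Finset.sum_congr rfl fun _ _ => mul_comm _ _
  have hW' : W.transpose * W = 1 := mul_eq_one_comm.1 hW
  have hWb : W * b * W.transpose = Matrix.diagonal hbH.eigenvalues := by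
    have h1 : b * W.transpose = W.transpose * Matrix.diagonal hbH.eigenvalues := by
      ext i j
      have := congrFun (hbH.mulVec_eigenvectorBasis j) i
      rw [Matrix.mul_diagonal]
      simp only [Matrix.mulVec, dotProduct, Pi.smul_apply, smul_eq_mul] at this
      simp only [Matrix.mul_apply, Matrix.transpose_apply, W, Matrix.of_apply]
      rw [mul_comm, ← this]
    rw [Matrix.mul_assoc, h1, ← Matrix.mul_assoc, hW, Matrix.one_mul]
  have h' := h.conj hW'
  have ha' : (W * a * W.transpose).transpose = W * a * W.transpose := by
    simp [Matrix.transpose_mul, ha, Matrix.mul_assoc]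
  have hconj0 : ∀ x : Matrix (Fin m) (Fin m) ℝ, W * x * W.transpose = 0 → x = 0 := by
    intro x hx
    calc x = (W.transpose * W) * x * (W.transpose * W) := by rw [hW']; simp
      _ = W.transpose * (W * x * W.transpose) * W := by simp only [Matrix.mul_assoc]
      _ = 0 := by rw [hx]; simp
  obtain ⟨i, j, hij, hpos, hj, hrest, hsq, hoff⟩ := h'.of_diagonal hWb ha'
    (hne.imp (fun h h0 => h (hconj0 _ h0)) (fun h h0 => h (hconj0 _ h0)))
  set l := hbH.eigenvalues with hl
  set a' := W * a * W.transpose with ha'def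
  obtain ⟨σ, hσ0, hσ1⟩ := exists_perm_zero_one hm hij
  -- the sign that makes the off-diagonal entry positive
  obtain ⟨s, hs, hsa⟩ : ∃ s : ℝ, s * s = 1 ∧ s * a' i j = l i := by
    rcases sq_eq_sq_iff_eq_or_eq_neg.1 hsq with h1 | h1
    · exact ⟨1, by norm_num, by rw [h1]; ring⟩
    · exact ⟨-1, by norm_num, by rw [h1]; ring⟩
  -- Changing the sign of the second basis vector multiplies the off-diagonal entry by `s` and
  -- leaves the diagonal matrix alone.
  let d : Fin m → ℝ := fun k => if k.val = 1 then s else 1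
  have hd : ∀ k, d k * d k = 1 := by intro k; by_cases hk : k.val = 1 <;> simp [d, hk, hs]
  let Q : Matrix (Fin m) (Fin m) ℝ := Matrix.of fun k n => d k * W (σ k) n
  have hQ : ∀ x : Matrix (Fin m) (Fin m) ℝ, ∀ k n, (Q * x * Q.transpose) k n =
      d k * d n * (W * x * W.transpose) (σ k) (σ n) := by
    intro x k n
    simp only [Matrix.mul_apply, Q, Matrix.of_apply, Matrix.transpose_apply, Finset.sum_mul,
      Finset.mul_sum]
    exact Finset.sum_congr rfl fun _ _ => Finset.sum_congr rfl fun _ _ => by ring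
  have hsymm : a' j i = a' i j := by
    conv_lhs => rw [← ha']
    rfl
  have hz : ∀ k : Fin m, σ k = i ↔ k.val = 0 := by
    intro k; rw [← hσ0, σ.injective.eq_iff, Fin.ext_iff]
  have ho : ∀ k : Fin m, σ k = j ↔ k.val = 1 := by
    intro k; rw [← hσ1, σ.injective.eq_iff, Fin.ext_iff]
  refine ⟨Q, l i, ?_, hpos, ?_, ?_⟩
  · ext k n
    have := hQ 1 k n
    rw [Matrix.mul_one, Matrix.mul_one, hW] at this
    rw [this, Matrix.one_apply, Matrix.one_apply]
    by_cases hkn : k = n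
    · subst hkn; simp [hd]
    · simp [hkn]
  · intro k n
    rw [hQ, ← ha'def, offDiagForm]
    split_ifs with hc
    · rcases hc with ⟨h0, h1⟩ | ⟨h1, h0⟩
      · rw [(hz k).2 h0, (ho n).2 h1]; simp [d, h0, h1, hsa]
      · rw [(hz n).2 h0, (ho k).2 h1, hsymm]; simp [d, h0, h1, hsa]
    · rw [hoff, mul_zero]
      · rw [hz, ho]; tauto
      · rw [hz, ho]; tauto
  · intro k n
    rw [hQ, hWb, diagForm, Matrix.diagonal_apply]
    simp only [σ.injective.eq_iff]
    by_cases hkn : k = n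
    · subst hkn
      simp only [if_true, hd, one_mul, and_self]
      split_ifs with h0 h1
      · rw [(hz k).2 h0]
      · rw [(ho k).2 h1, hj]
      · exact hrest _ (fun h => h0 ((hz k).1 h)) (fun h => h1 ((ho k).1 h))
    · have : k.val ≠ n.val := fun h => hkn (Fin.ext h)
      rw [if_neg hkn, if_neg (by omega), if_neg (by omega), mul_zero]

/-! ### Immersions into the unit sphere on an open set of `ℝᵐ` -/

/-- `f` is a smooth immersion of the open set `Ω` into the unit sphere. -/
structure IsImmersionOn {m : ℕ} (f : Euc m → Amb m) (Ω : Set (Euc m)) : Prop where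
  isOpen : IsOpen Ω
  smooth : ContDiffOn ℝ ∞ f Ω
  norm_eq_one : ∀ u ∈ Ω, ‖f u‖ = 1
  injective : ∀ u ∈ Ω, Function.Injective (fderiv ℝ f u)

section Immersion

variable {m : ℕ} {f : Euc m → Amb m} {Ω : Set (Euc m)} {u : Euc m}

theorem IsImmersionOn.contDiffAt (hf : IsImmersionOn f Ω) (hu : u ∈ Ω) : ContDiffAt ℝ ∞ f u :=
  hf.smooth.contDiffAt (hf.isOpen.mem_nhds hu)

theorem IsImmersionOn.differentiableAt (hf : IsImmersionOn f Ω) (hu : u ∈ Ω) :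
    DifferentiableAt ℝ f u := (hf.contDiffAt hu).differentiableAt (by simp)

theorem IsImmersionOn.contDiffOn_fderiv (hf : IsImmersionOn f Ω) :
    ContDiffOn ℝ ∞ (fderiv ℝ f) Ω :=
  hf.smooth.fderiv_of_isOpen hf.isOpen (by simp)

theorem IsImmersionOn.differentiableAt_fderiv (hf : IsImmersionOn f Ω) (hu : u ∈ Ω) :
    DifferentiableAt ℝ (fderiv ℝ f) u :=
  (hf.contDiffOn_fderiv.contDiffAt (hf.isOpen.mem_nhds hu)).differentiableAt (by simp)

theorem IsImmersionOn.contDiffOn_fderiv_fderiv (hf : IsImmersionOn f Ω) :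
    ContDiffOn ℝ ∞ (fderiv ℝ (fderiv ℝ f)) Ω :=
  hf.contDiffOn_fderiv.fderiv_of_isOpen hf.isOpen (by simp)

theorem IsImmersionOn.fderiv_fderiv_comm (hf : IsImmersionOn f Ω) (hu : u ∈ Ω) (v w : Euc m) :
    fderiv ℝ (fderiv ℝ f) u v w = fderiv ℝ (fderiv ℝ f) u w v :=
  ((hf.contDiffAt hu).isSymmSndFDerivAt (by
    simp only [minSmoothness_of_isRCLikeNormedField]
    exact WithTop.coe_le_coe.2 (le_top : (2 : ℕ∞) ≤ ⊤))) v w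

theorem IsImmersionOn.hasFDerivAt_apply (hf : IsImmersionOn f Ω) (hu : u ∈ Ω) (w : Euc m) :
    HasFDerivAt (fun u' => fderiv ℝ f u' w)
      ((ContinuousLinearMap.apply ℝ (Amb m) w) ∘L fderiv ℝ (fderiv ℝ f) u) u :=
  (ContinuousLinearMap.apply ℝ (Amb m) w).hasFDerivAt.comp u
    (hf.differentiableAt_fderiv hu).hasFDerivAt

theorem IsImmersionOn.inner_self (hf : IsImmersionOn f Ω) (hu : u ∈ Ω) :
    ⟪f u, f u⟫_ℝ = 1 := by
  rw [real_inner_self_eq_norm_sq, hf.norm_eq_one u hu, one_pow]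

theorem IsImmersionOn.inner_fderiv (hf : IsImmersionOn f Ω) (hu : u ∈ Ω) (v : Euc m) :
    ⟪f u, fderiv ℝ f u v⟫_ℝ = 0 := by
  have h1 : HasFDerivAt (fun u' => ⟪f u', f u'⟫_ℝ)
      ((fderivInnerCLM ℝ (f u, f u)).comp ((fderiv ℝ f u).prod (fderiv ℝ f u))) u :=
    (hf.differentiableAt hu).hasFDerivAt.inner ℝ (hf.differentiableAt hu).hasFDerivAt
  have h2 : HasFDerivAt (fun u' => ⟪f u', f u'⟫_ℝ) (0 : Euc m →L[ℝ] ℝ) u := by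
    refine (hasFDerivAt_const (1 : ℝ) u).congr_of_eventuallyEq ?_
    filter_upwards [hf.isOpen.mem_nhds hu] with u' hu'
    exact hf.inner_self hu'
  have := congrArg (fun L => L v) (h1.unique h2)
  simp only [ContinuousLinearMap.comp_apply, ContinuousLinearMap.prod_apply,
    fderivInnerCLM_apply, zero_apply] at this
  rw [real_inner_comm (f u)] at this
  linarith

/-- Derivative of `⟪f, df(w)⟫ = 0`: in the direction of the position vector, the second fundamental
form in Euclidean space is `-I`. -/
theorem IsImmersionOn.inner_fderiv_fderiv (hf : IsImmersionOn f Ω) (hu : u ∈ Ω) (v w : Euc m) :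
    ⟪f u, fderiv ℝ (fderiv ℝ f) u v w⟫_ℝ = - firstFF f u v w := by
  have h1 := (hf.differentiableAt hu).hasFDerivAt.inner ℝ (hf.hasFDerivAt_apply hu w)
  have h2 : HasFDerivAt (fun u' => ⟪f u', fderiv ℝ f u' w⟫_ℝ) (0 : Euc m →L[ℝ] ℝ) u := by
    refine (hasFDerivAt_const (0 : ℝ) u).congr_of_eventuallyEq ?_
    filter_upwards [hf.isOpen.mem_nhds hu] with u' hu'
    exact hf.inner_fderiv hu' w
  have := congrArg (fun L => L v) (h1.unique h2)
  simp only [ContinuousLinearMap.comp_apply, ContinuousLinearMap.prod_apply,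
    fderivInnerCLM_apply, zero_apply, ContinuousLinearMap.apply_apply] at this
  rw [firstFF]
  linarith

theorem mem_normalPlane_iff {n : Amb m} :
    n ∈ normalPlane f u ↔ ⟪f u, n⟫_ℝ = 0 ∧ ∀ v, ⟪fderiv ℝ f u v, n⟫_ℝ = 0 := by
  rw [normalPlane, ← Submodule.inf_orthogonal, Submodule.mem_inf,
    Submodule.mem_orthogonal_singleton_iff_inner_right]
  refine and_congr_right fun _ => ?_
  rw [Submodule.mem_orthogonal]
  exact ⟨fun h v => h _ ⟨v, rfl⟩, by rintro h _ ⟨v, rfl⟩; exact h v⟩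

/-- The ambient space is the orthogonal sum of the position line, the tangent plane and the normal
plane; smoothness of the normal projection is thereby reduced to that of the tangential one. -/
theorem IsImmersionOn.starProjection_normalPlane (hf : IsImmersionOn f Ω) (hu : u ∈ Ω)
    (y : Amb m) :
    (normalPlane f u).starProjection y =
      y - (tangentPlane f u).starProjection y - ⟪f u, y⟫_ℝ • f u := by
  have hT : ∀ z ∈ tangentPlane f u, ⟪f u, z⟫_ℝ = 0 := by
    rintro _ ⟨v, rfl⟩; exact hf.inner_fderiv hu v
  apply Submodule.eq_starProjection_of_mem_of_inner_eq_zero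
  · rw [mem_normalPlane_iff]
    constructor
    · rw [inner_sub_right, inner_sub_right, inner_smul_right, hf.inner_self hu,
        hT _ (Submodule.starProjection_apply_mem _ _)]
      ring
    · intro v
      rw [inner_sub_right, inner_smul_right, real_inner_comm (f u), hf.inner_fderiv hu, mul_zero,
        sub_zero, real_inner_comm]
      exact Submodule.starProjection_inner_eq_zero _ _ ⟨v, rfl⟩
  · intro w hw
    rw [mem_normalPlane_iff] at hw
    have : y - (y - (tangentPlane f u).starProjection y - ⟪f u, y⟫_ℝ • f u) =
        (tangentPlane f u).starProjection y + ⟪f u, y⟫_ℝ • f u := by abel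
    rw [this, inner_add_left, inner_smul_left, hw.1, mul_zero, add_zero]
    obtain ⟨v, hv⟩ := Submodule.starProjection_apply_mem (tangentPlane f u) y
    rw [← hv]
    exact hw.2 v

theorem IsImmersionOn.contDiffOn_tangentProj (hf : IsImmersionOn f Ω) :
    ContDiffOn ℝ ∞ (fun u' => (tangentPlane f u').starProjection) Ω :=
  contDiffOn_starProjection_range hf.contDiffOn_fderiv hf.injective

theorem IsImmersionOn.contDiffOn_normalProj (hf : IsImmersionOn f Ω) :
    ContDiffOn ℝ ∞ (fun u' => (normalPlane f u').starProjection) Ω := by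
  have h1 : ContDiffOn ℝ ∞ (fun u' => (innerSL ℝ (f u')).smulRight (f u')) Ω :=
    ((innerSL ℝ).contDiff.comp_contDiffOn hf.smooth).smulRight hf.smooth
  refine ((contDiffOn_const (c := ContinuousLinearMap.id ℝ (Amb m))).sub
    hf.contDiffOn_tangentProj |>.sub h1).congr fun u' hu' => ?_
  ext1 y
  rw [hf.starProjection_normalPlane hu']
  simp

theorem IsImmersionOn.finrank_tangentPlane (hf : IsImmersionOn f Ω) (hu : u ∈ Ω) :
    Module.finrank ℝ (tangentPlane f u) = m := by
  have := LinearMap.finrank_range_of_inj (f := (fderiv ℝ f u).toLinearMap) (hf.injective u hu)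
  rw [tangentPlane, this]; simp

theorem IsImmersionOn.finrank_normalPlane (hf : IsImmersionOn f Ω) (hu : u ∈ Ω) :
    Module.finrank ℝ (normalPlane f u) = 2 := by
  have h0 : f u ≠ 0 := by
    intro h; have := hf.norm_eq_one u hu; rw [h] at this; simp at this
  have hdisj : Disjoint (Submodule.span ℝ {f u}) (tangentPlane f u) := by
    rw [Submodule.disjoint_def]
    intro z hz hz'
    obtain ⟨c, rfl⟩ := Submodule.mem_span_singleton.1 hz
    obtain ⟨v, hv⟩ := hz'
    have := hf.inner_fderiv hu v
    change fderiv ℝ f u v = _ at hv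
    rw [hv, inner_smul_right, hf.inner_self hu, mul_one] at this
    rw [this, zero_smul]
  have h1 := Submodule.finrank_sup_add_finrank_inf_eq (Submodule.span ℝ {f u}) (tangentPlane f u)
  rw [hdisj.eq_bot, finrank_bot, add_zero] at h1
  have h2 := Submodule.finrank_add_finrank_orthogonal (Submodule.span ℝ {f u} ⊔ tangentPlane f u)
  rw [h1, finrank_span_singleton h0, hf.finrank_tangentPlane hu, finrank_euclideanSpace_fin] at h2
  change Module.finrank ℝ (Submodule.span ℝ {f u} ⊔ tangentPlane f u)ᗮ = 2
  omega

theorem inner_secondFF {n : Amb m} (hn : n ∈ normalPlane f u) (v w : Euc m) :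
    ⟪secondFF f u v w, n⟫_ℝ = ⟪fderiv ℝ (fderiv ℝ f) u v w, n⟫_ℝ := by
  rw [secondFF, Submodule.inner_starProjection_left_eq_right,
    Submodule.starProjection_eq_self_iff.2 hn]

theorem secondFF_mem (v w : Euc m) : secondFF f u v w ∈ normalPlane f u :=
  Submodule.starProjection_apply_mem _ _

theorem meanCurv_mem : meanCurv f u ∈ normalPlane f u :=
  Submodule.smul_mem _ _ (Submodule.sum_mem _ fun _ _ => Submodule.sum_mem _ fun _ _ =>
    Submodule.smul_mem _ _ (secondFF_mem _ _))

theorem tracelessFF_mem (v w : Euc m) : tracelessFF f u v w ∈ normalPlane f u :=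
  Submodule.sub_mem _ (secondFF_mem _ _) (Submodule.smul_mem _ _ meanCurv_mem)

theorem IsImmersionOn.secondFF_comm (hf : IsImmersionOn f Ω) (hu : u ∈ Ω) (v w : Euc m) :
    secondFF f u v w = secondFF f u w v := by
  rw [secondFF, hf.fderiv_fderiv_comm hu, secondFF]

theorem firstFF_comm (v w : Euc m) : firstFF f u v w = firstFF f u w v := real_inner_comm _ _

theorem IsImmersionOn.tracelessFF_comm (hf : IsImmersionOn f Ω) (hu : u ∈ Ω) (v w : Euc m) :
    tracelessFF f u v w = tracelessFF f u w v := by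
  rw [tracelessFF, hf.secondFF_comm hu, firstFF_comm, tracelessFF]

/-- The first fundamental form as a bilinear map. -/
def firstFFBilin (f : Euc m → Amb m) (u : Euc m) : Euc m →ₗ[ℝ] Euc m →ₗ[ℝ] ℝ :=
  LinearMap.mk₂ ℝ (firstFF f u) (by intros; simp [firstFF, inner_add_left])
    (by intros; simp [firstFF, inner_smul_left]) (by intros; simp [firstFF, inner_add_right])
    (by intros; simp [firstFF, inner_smul_right])

/-- The trace-free second fundamental form as a bilinear map. -/
def tracelessBilin (f : Euc m → Amb m) (u : Euc m) : Euc m →ₗ[ℝ] Euc m →ₗ[ℝ] Amb m :=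
  LinearMap.mk₂ ℝ (tracelessFF f u)
    (by intros; simp [tracelessFF, secondFF, firstFF, inner_add_left, add_smul]; abel)
    (by intros; simp [tracelessFF, secondFF, firstFF, inner_smul_left, smul_sub, smul_smul])
    (by intros; simp [tracelessFF, secondFF, firstFF, inner_add_right, add_smul]; abel)
    (by intros; simp [tracelessFF, secondFF, firstFF, inner_smul_right, smul_sub, smul_smul])

/-- The second fundamental form as a bilinear map. -/
def secondBilin (f : Euc m → Amb m) (u : Euc m) : Euc m →ₗ[ℝ] Euc m →ₗ[ℝ] Amb m :=
  LinearMap.mk₂ ℝ (secondFF f u)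
    (by intros; simp [secondFF]) (by intros; simp [secondFF])
    (by intros; simp [secondFF]) (by intros; simp [secondFF])

theorem firstFFBilin_apply (v w : Euc m) : firstFFBilin f u v w = firstFF f u v w := rfl
theorem tracelessBilin_apply (v w : Euc m) : tracelessBilin f u v w = tracelessFF f u v w := rfl
theorem secondBilin_apply (v w : Euc m) : secondBilin f u v w = secondFF f u v w := rfl

/-! ### Tangent frames -/

theorem IsTangentFrame.linearIndependent {e : Fin m → Euc m} (he : IsTangentFrame f u e) :
    LinearIndependent ℝ e := by
  rw [Fintype.linearIndependent_iff]
  intro g hg i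
  have h := congrArg (fun x => firstFFBilin f u x (e i)) hg
  simp only [map_sum, map_smul, LinearMap.sum_apply, LinearMap.smul_apply, firstFFBilin_apply,
    map_zero, LinearMap.zero_apply, smul_eq_mul] at h
  simpa [he _ i] using h

theorem IsTangentFrame.expand {e : Fin m → Euc m} (he : IsTangentFrame f u e) (v : Euc m) :
    ∑ k, firstFF f u v (e k) • e k = v := by
  have hspan : v ∈ Submodule.span ℝ (Set.range e) := by
    rw [he.linearIndependent.span_eq_top_of_card_eq_finrank' (by simp)]; trivial
  obtain ⟨c, rfl⟩ := (Submodule.mem_span_range_iff_exists_fun ℝ).1 hspan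
  refine Finset.sum_congr rfl fun k _ => ?_
  congr 1
  have : firstFF f u (∑ i, c i • e i) (e k) = firstFFBilin f u (∑ i, c i • e i) (e k) := rfl
  rw [this]
  simp only [map_sum, map_smul, LinearMap.sum_apply, LinearMap.smul_apply, firstFFBilin_apply,
    smul_eq_mul]
  simp [he _ k]

theorem exists_isTangentFrame (hinj : Function.Injective (fderiv ℝ f u)) :
    ∃ e, IsTangentFrame f u e := by
  have hfin : Module.finrank ℝ (tangentPlane f u) = m := by
    have := LinearMap.finrank_range_of_inj (f := (fderiv ℝ f u).toLinearMap) hinj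
    rw [tangentPlane, this]; simp
  let b := (stdOrthonormalBasis ℝ (tangentPlane f u)).reindex (finCongr hfin)
  have hb : ∀ i, ∃ v, fderiv ℝ f u v = b i := fun i => (b i).2
  choose e he using hb
  refine ⟨e, fun i j => ?_⟩
  rw [firstFF, he, he]
  have := orthonormal_iff_ite.1 b.orthonormal i j
  rwa [Submodule.coe_inner] at this

theorem euc_expand (v : Euc m) : v = ∑ i, v i • coordVec m i := by
  ext k
  simp [coordVec, Finset.sum_apply, Pi.single_apply]

/-- The inverse Gram matrix in terms of an orthonormal frame. -/
theorem IsTangentFrame.gramInv_eq {e : Fin m → Euc m} (he : IsTangentFrame f u e) (i j : Fin m) :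
    gramInv f u i j = ∑ k, e k i * e k j := by
  let X : Matrix (Fin m) (Fin m) ℝ := Matrix.of fun i k => e k i
  let Gm : Matrix (Fin m) (Fin m) ℝ :=
    Matrix.of fun i j => firstFF f u (coordVec m i) (coordVec m j)
  have hfe : ∀ v w : Euc m, firstFF f u v w = ∑ i, ∑ j, v i * w j * Gm i j := by
    intro v w
    rw [← firstFFBilin_apply]
    conv_lhs => rw [euc_expand v, euc_expand w]
    simp only [map_sum, map_smul, LinearMap.sum_apply, LinearMap.smul_apply, smul_eq_mul,
      firstFFBilin_apply, Gm, Matrix.of_apply, Finset.mul_sum]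
    rw [Finset.sum_comm]
    exact Finset.sum_congr rfl fun _ _ => Finset.sum_congr rfl fun _ _ => by ring
  -- Orthonormality of the frame whose vectors are the columns of `X`. A one-sided inverse of a
  -- square matrix is two-sided, hence `Gm⁻¹ = X Xᵀ`.
  have h1 : X.transpose * (Gm * X) = 1 := by
    ext k l
    have := he k l
    rw [hfe] at this
    rw [Matrix.one_apply, ← this]
    simp only [Matrix.mul_apply, Matrix.transpose_apply, X, Matrix.of_apply, Finset.mul_sum]
    exact Finset.sum_congr rfl fun _ _ => Finset.sum_congr rfl fun _ _ => by ring
  have h2 : Gm * (X * X.transpose) = 1 := by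
    have : Gm * X * X.transpose = 1 := mul_eq_one_comm.1 h1
    rwa [Matrix.mul_assoc] at this
  have h3 : gramInv f u = X * X.transpose := Matrix.inv_eq_right_inv h2
  rw [h3, Matrix.mul_apply]
  rfl

/-- Contraction with `g^{ij}` is the trace over an orthonormal frame. This removes coordinates from
all traces below, so that they can be computed in a frame adapted to the second fundamental form. -/
theorem IsTangentFrame.sum_gramInv {W : Type*} [AddCommGroup W] [Module ℝ W]
    {e : Fin m → Euc m} (he : IsTangentFrame f u e)
    (S : Euc m →ₗ[ℝ] Euc m →ₗ[ℝ] W) :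
    ∑ i, ∑ j, gramInv f u i j • S (coordVec m i) (coordVec m j) = ∑ k, S (e k) (e k) := by
  have h1 : ∀ k, S (e k) (e k) = ∑ i, ∑ j, (e k i * e k j) • S (coordVec m i) (coordVec m j) := by
    intro k
    conv_lhs => rw [euc_expand (e k)]
    simp only [map_sum, map_smul, LinearMap.sum_apply, LinearMap.smul_apply, Finset.smul_sum,
      smul_smul]
    rw [Finset.sum_comm]
    exact Finset.sum_congr rfl fun _ _ => Finset.sum_congr rfl fun _ _ => by rw [mul_comm]
  simp only [h1, he.gramInv_eq, Finset.sum_smul]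
  rw [Finset.sum_comm_cycle]

theorem IsTangentFrame.meanCurv_eq {e : Fin m → Euc m} (he : IsTangentFrame f u e) :
    meanCurv f u = (1 / (m : ℝ)) • ∑ k, secondFF f u (e k) (e k) := by
  rw [meanCurv]
  congr 1
  exact he.sum_gramInv (secondBilin f u)

theorem IsTangentFrame.tracelessNormSq_eq {e : Fin m → Euc m} (he : IsTangentFrame f u e) :
    tracelessNormSq f u = ∑ k, ∑ l, ‖tracelessFF f u (e k) (e l)‖ ^ 2 := by
  have hS : ∀ v w : Euc m, ∑ j, ∑ l, gramInv f u j l *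
      ⟪tracelessFF f u v (coordVec m j), tracelessFF f u w (coordVec m l)⟫_ℝ =
      ∑ l, ⟪tracelessFF f u v (e l), tracelessFF f u w (e l)⟫_ℝ := fun v w =>
    he.sum_gramInv ((innerₗ (Amb m)).compl₁₂ (tracelessBilin f u v) (tracelessBilin f u w))
  have h2 : ∀ l, ∑ i, ∑ k, gramInv f u i k *
      ⟪tracelessFF f u (coordVec m i) (e l), tracelessFF f u (coordVec m k) (e l)⟫_ℝ =
      ∑ k, ⟪tracelessFF f u (e k) (e l), tracelessFF f u (e k) (e l)⟫_ℝ := fun l =>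
    he.sum_gramInv ((innerₗ (Amb m)).compl₁₂ ((tracelessBilin f u).flip (e l))
      ((tracelessBilin f u).flip (e l)))
  rw [tracelessNormSq]
  have h3 : ∀ i, ∑ j, ∑ k, ∑ l, gramInv f u i k * gramInv f u j l *
      ⟪tracelessFF f u (coordVec m i) (coordVec m j),
        tracelessFF f u (coordVec m k) (coordVec m l)⟫_ℝ =
      ∑ k, gramInv f u i k * ∑ l, ⟪tracelessFF f u (coordVec m i) (e l),
        tracelessFF f u (coordVec m k) (e l)⟫_ℝ := by
    intro i
    rw [Finset.sum_comm]
    refine Finset.sum_congr rfl fun k _ => ?_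
    rw [← hS, Finset.mul_sum]
    refine Finset.sum_congr rfl fun j _ => ?_
    rw [Finset.mul_sum]
    exact Finset.sum_congr rfl fun l _ => by ring
  simp only [h3, Finset.mul_sum]
  rw [Finset.sum_comm_cycle]
  simp only [← real_inner_self_eq_norm_sq]
  rw [Finset.sum_comm (f := fun k l => ⟪tracelessFF f u (e k) (e l), tracelessFF f u (e k) (e l)⟫_ℝ)]
  refine Finset.sum_congr rfl fun l _ => ?_
  rw [← h2]

end Immersion

/-! ### The Gauss and Ricci equations -/

section Curvature

variable {m : ℕ} {f : Euc m → Amb m} {Ω : Set (Euc m)} {u : Euc m}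

theorem hasFDerivAt_clm_apply_const {A B C : Type*} [NormedAddCommGroup A] [NormedSpace ℝ A]
    [NormedAddCommGroup B] [NormedSpace ℝ B] [NormedAddCommGroup C] [NormedSpace ℝ C]
    {P : A → B →L[ℝ] C} {u : A} (hP : DifferentiableAt ℝ P u) (s : B) :
    HasFDerivAt (fun u' => P u' s) ((ContinuousLinearMap.apply ℝ C s) ∘L fderiv ℝ P u) u :=
  (ContinuousLinearMap.apply ℝ C s).hasFDerivAt.comp u hP.hasFDerivAt

/-- Self-adjointness is a linear condition, so it passes to the derivative of the family. -/
theorem inner_fderiv_selfAdjoint {P : Euc m → Amb m →L[ℝ] Amb m} (hΩ : IsOpen Ω) (hu : u ∈ Ω)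
    (hP : ContDiffOn ℝ ∞ P Ω) (hsa : ∀ u' ∈ Ω, ∀ x y, ⟪P u' x, y⟫_ℝ = ⟪x, P u' y⟫_ℝ)
    (v : Euc m) (x y : Amb m) :
    ⟪fderiv ℝ P u v x, y⟫_ℝ = ⟪x, fderiv ℝ P u v y⟫_ℝ := by
  have hd : DifferentiableAt ℝ P u :=
    (hP.contDiffAt (hΩ.mem_nhds hu)).differentiableAt (by simp)
  have h1 := (hasFDerivAt_clm_apply_const hd x).inner ℝ (hasFDerivAt_const y u)
  have h2 := (hasFDerivAt_const x u).inner ℝ (hasFDerivAt_clm_apply_const hd y)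
  have h3 := h2.congr_of_eventuallyEq (f₁ := fun u' => ⟪P u' x, y⟫_ℝ) (by
    filter_upwards [hΩ.mem_nhds hu] with u' hu'
    exact hsa u' hu' x y)
  have := congrArg (fun L => L v) (h1.unique h3)
  simpa [fderivInnerCLM_apply] using this

/-- In `∇_v ∇_w - ∇_w ∇_v` the second derivatives of `P` cancel by symmetry, and self-adjointness
moves one first derivative to the other side. The Gauss and Ricci equations then only need the
derivative of `P` on tangent or normal vectors. -/
theorem inner_projCurvature {P : Euc m → Amb m →L[ℝ] Amb m} (hΩ : IsOpen Ω) (hu : u ∈ Ω)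
    (hP : ContDiffOn ℝ ∞ P Ω) (hsa : ∀ u' ∈ Ω, ∀ x y, ⟪P u' x, y⟫_ℝ = ⟪x, P u' y⟫_ℝ)
    (v w : Euc m) (s : Amb m) {t : Amb m} (ht : P u t = t) :
    ⟪projCurvature P u v w s, t⟫_ℝ =
      ⟪fderiv ℝ P u w s, fderiv ℝ P u v t⟫_ℝ - ⟪fderiv ℝ P u v s, fderiv ℝ P u w t⟫_ℝ := by
  have hd : ∀ u' ∈ Ω, DifferentiableAt ℝ P u' := fun u' hu' =>
    (hP.contDiffAt (hΩ.mem_nhds hu')).differentiableAt (by simp)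
  have hd2 : DifferentiableAt ℝ (fderiv ℝ P) u :=
    ((hP.fderiv_of_isOpen (m := ∞) hΩ (by simp)).contDiffAt (hΩ.mem_nhds hu)).differentiableAt
      (by simp)
  have hcov : ∀ a, HasFDerivAt (projCov P s a)
      ((P u) ∘L (ContinuousLinearMap.apply ℝ (Amb m) s ∘L
        (ContinuousLinearMap.apply ℝ (Amb m →L[ℝ] Amb m) a ∘L fderiv ℝ (fderiv ℝ P) u)) +
        (fderiv ℝ P u).flip (fderiv ℝ P u a s)) u := by
    intro a
    have h0 : HasFDerivAt (fun u' => fderiv ℝ P u' a)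
        (ContinuousLinearMap.apply ℝ (Amb m →L[ℝ] Amb m) a ∘L fderiv ℝ (fderiv ℝ P) u) u :=
      hasFDerivAt_clm_apply_const hd2 a
    have h1 : HasFDerivAt (fun u' => fderiv ℝ P u' a s)
        (ContinuousLinearMap.apply ℝ (Amb m) s ∘L
        (ContinuousLinearMap.apply ℝ (Amb m →L[ℝ] Amb m) a ∘L fderiv ℝ (fderiv ℝ P) u)) u :=
      (ContinuousLinearMap.apply ℝ (Amb m) s).hasFDerivAt.comp u h0
    refine ((hd u hu).hasFDerivAt.clm_apply h1).congr_of_eventuallyEq ?_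
    filter_upwards [hΩ.mem_nhds hu] with u' hu'
    rw [projCov, (hasFDerivAt_clm_apply_const (hd u' hu') s).fderiv]
    rfl
  have hsym : fderiv ℝ (fderiv ℝ P) u v w = fderiv ℝ (fderiv ℝ P) u w v :=
    ((hP.contDiffAt (hΩ.mem_nhds hu)).isSymmSndFDerivAt (by
      simp only [minSmoothness_of_isRCLikeNormedField]
      exact WithTop.coe_le_coe.2 (le_top : (2 : ℕ∞) ≤ ⊤))) v w
  have hself := inner_fderiv_selfAdjoint hΩ hu hP hsa
  rw [projCurvature, (hcov w).fderiv, (hcov v).fderiv]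
  simp only [add_apply, ContinuousLinearMap.comp_apply,
    ContinuousLinearMap.apply_apply, ContinuousLinearMap.flip_apply, hsym]
  rw [inner_sub_left, hsa u hu, hsa u hu, ht, inner_add_left, inner_add_left,
    hself v (fderiv ℝ P u w s) t, hself w (fderiv ℝ P u v s) t]
  ring

/-- Differentiating `P (df a) = df a` shows that `(D_w P)(df a)` is the part of `D²f(w,a)` outside
the tangent plane. -/
theorem IsImmersionOn.fderiv_tangentProj (hf : IsImmersionOn f Ω) (hu : u ∈ Ω) (w a : Euc m) :
    fderiv ℝ (fun u' => (tangentPlane f u').starProjection) u w (fderiv ℝ f u a) =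
      secondFF f u w a - firstFF f u w a • f u := by
  have hd : DifferentiableAt ℝ (fun u' => (tangentPlane f u').starProjection) u :=
    (hf.contDiffOn_tangentProj.contDiffAt (hf.isOpen.mem_nhds hu)).differentiableAt (by simp)
  have h1 := hd.hasFDerivAt.clm_apply (hf.hasFDerivAt_apply hu a)
  have h2 := (hf.hasFDerivAt_apply hu a).congr_of_eventuallyEq
    (f₁ := fun u' => (tangentPlane f u').starProjection (fderiv ℝ f u' a)) (by
      filter_upwards with u'
      exact Submodule.starProjection_eq_self_iff.2 ⟨a, rfl⟩)
  have := congrArg (fun L => L w) (h1.unique h2)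
  simp only [add_apply, ContinuousLinearMap.comp_apply,
    ContinuousLinearMap.apply_apply, ContinuousLinearMap.flip_apply] at this
  rw [secondFF, hf.starProjection_normalPlane hu, hf.inner_fderiv_fderiv hu, ← sub_eq_iff_eq_add'.2
    this.symm]
  module

/-- The Gauss equation. -/
theorem IsImmersionOn.inner_tangentCurvature (hf : IsImmersionOn f Ω) (hu : u ∈ Ω)
    (v w a b : Euc m) :
    ⟪tangentCurvature f u v w (fderiv ℝ f u a), fderiv ℝ f u b⟫_ℝ =
      ⟪secondFF f u w a, secondFF f u v b⟫_ℝ + firstFF f u w a * firstFF f u v b -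
      (⟪secondFF f u v a, secondFF f u w b⟫_ℝ + firstFF f u v a * firstFF f u w b) := by
  have hn : ∀ v w, ⟪f u, secondFF f u v w⟫_ℝ = 0 := fun v w =>
    (mem_normalPlane_iff.1 (secondFF_mem v w)).1
  have hn' : ∀ v w, ⟪secondFF f u v w, f u⟫_ℝ = 0 := fun v w => by
    rw [real_inner_comm]; exact hn v w
  have hb : (tangentPlane f u).starProjection (fderiv ℝ f u b) = fderiv ℝ f u b :=
    Submodule.starProjection_eq_self_iff.2 ⟨b, rfl⟩
  rw [tangentCurvature, inner_projCurvature hf.isOpen hu hf.contDiffOn_tangentProj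
    (fun u' _ x y => Submodule.inner_starProjection_left_eq_right _ x y) v w _ hb]
  simp only [hf.fderiv_tangentProj hu]
  simp only [inner_sub_left, inner_sub_right, real_inner_smul_left, real_inner_smul_right, hn, hn',
    hf.inner_self hu]
  ring

theorem ext_inner_immersion {X Y : Amb m}
    (h1 : ⟪f u, X⟫_ℝ = ⟪f u, Y⟫_ℝ)
    (h2 : ∀ a, ⟪fderiv ℝ f u a, X⟫_ℝ = ⟪fderiv ℝ f u a, Y⟫_ℝ)
    (h3 : ∀ n ∈ normalPlane f u, ⟪n, X⟫_ℝ = ⟪n, Y⟫_ℝ) : X = Y := by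
  have hmem : X - Y ∈ normalPlane f u := by
    rw [mem_normalPlane_iff]
    exact ⟨by rw [inner_sub_right, h1, sub_self], fun v => by rw [inner_sub_right, h2, sub_self]⟩
  have := h3 _ hmem
  rw [← sub_eq_zero, ← inner_sub_right, inner_self_eq_zero, sub_eq_zero] at this
  exact this

/-- The Weingarten formula. The components of `(D_w N) n` along the position vector, the tangent
plane and the normal plane come from differentiating `N f = 0`, `N df(a) = 0` and `N N = N`;
self-adjointness of `D_w N` transfers the first two to `n`. -/
theorem IsImmersionOn.fderiv_normalProj (hf : IsImmersionOn f Ω) (hu : u ∈ Ω)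
    {e : Fin m → Euc m} (he : IsTangentFrame f u e) (w : Euc m) {n : Amb m}
    (hn : n ∈ normalPlane f u) :
    fderiv ℝ (fun u' => (normalPlane f u').starProjection) u w n =
      - ∑ k, ⟪secondFF f u w (e k), n⟫_ℝ • fderiv ℝ f u (e k) := by
  set N := fun u' => (normalPlane f u').starProjection with hN
  have hd : DifferentiableAt ℝ N u :=
    (hf.contDiffOn_normalProj.contDiffAt (hf.isOpen.mem_nhds hu)).differentiableAt (by simp)
  have hle : ∀ u', Submodule.span ℝ {f u'} ⊔ tangentPlane f u' ≤ (normalPlane f u')ᗮ :=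
    fun u' => Submodule.le_orthogonal_orthogonal _
  have hNf : ∀ u' ∈ Ω, N u' (f u') = 0 := fun u' hu' => by
    rw [hN, Submodule.starProjection_apply_eq_zero_iff]
    have ha : f u' ∈ Submodule.span ℝ {f u'} := Submodule.mem_span_singleton_self _
    exact hle u' (Submodule.mem_sup_left ha)
  have hNd : ∀ u' ∈ Ω, ∀ a, N u' (fderiv ℝ f u' a) = 0 := fun u' hu' a => by
    rw [hN, Submodule.starProjection_apply_eq_zero_iff]
    have ha : fderiv ℝ f u' a ∈ tangentPlane f u' := ⟨a, rfl⟩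
    exact hle u' (Submodule.mem_sup_right ha)
  have hsa := inner_fderiv_selfAdjoint hf.isOpen hu hf.contDiffOn_normalProj
    (fun u' _ x y => Submodule.inner_starProjection_left_eq_right _ x y) w
  have h1 : fderiv ℝ N u w (f u) = 0 := by
    have h1 := hd.hasFDerivAt.clm_apply (hf.differentiableAt hu).hasFDerivAt
    have h2 := (hasFDerivAt_const (𝕜 := ℝ) (0 : Amb m) u).congr_of_eventuallyEq
      (f₁ := fun u' => N u' (f u')) (by
        filter_upwards [hf.isOpen.mem_nhds hu] with u' hu' using hNf u' hu')
    have := congrArg (fun L => L w) (h1.unique h2)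
    simpa [hNd u hu] using this
  have h2 : ∀ a, fderiv ℝ N u w (fderiv ℝ f u a) = - secondFF f u w a := by
    intro a
    have h1 := hd.hasFDerivAt.clm_apply (hf.hasFDerivAt_apply hu a)
    have h2 := (hasFDerivAt_const (𝕜 := ℝ) (0 : Amb m) u).congr_of_eventuallyEq
      (f₁ := fun u' => N u' (fderiv ℝ f u' a)) (by
        filter_upwards [hf.isOpen.mem_nhds hu] with u' hu' using hNd u' hu' a)
    have := congrArg (fun L => L w) (h1.unique h2)
    simp only [add_apply, ContinuousLinearMap.comp_apply,
      ContinuousLinearMap.apply_apply, ContinuousLinearMap.flip_apply, zero_apply] at this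
    rw [secondFF]
    exact eq_neg_of_add_eq_zero_right this
  -- `N' N + N N' = N'`, paired with two normal vectors, says that a number equals twice itself.
  have h3 : ∀ n' ∈ normalPlane f u, ⟪fderiv ℝ N u w n, n'⟫_ℝ = 0 := by
    intro n' hn'
    have hs : ∀ x ∈ normalPlane f u, N u x = x := fun x hx =>
      Submodule.starProjection_eq_self_iff.2 hx
    have hx := hasFDerivAt_clm_apply_const hd n
    have h1 := hd.hasFDerivAt.clm_apply hx
    have h2 := hx.congr_of_eventuallyEq (f₁ := fun u' => N u' (N u' n)) (by
        filter_upwards with u'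
        exact Submodule.starProjection_eq_self_iff.2 (Submodule.starProjection_apply_mem _ _))
    have := congrArg (fun L => ⟪L w, n'⟫_ℝ) (h1.unique h2)
    simp only [add_apply, ContinuousLinearMap.comp_apply,
      ContinuousLinearMap.apply_apply, ContinuousLinearMap.flip_apply, inner_add_left, hs n hn]
      at this
    have h4 : ⟪N u (fderiv ℝ N u w n), n'⟫_ℝ = ⟪fderiv ℝ N u w n, n'⟫_ℝ := by
      rw [hN, Submodule.inner_starProjection_left_eq_right]
      exact congrArg _ (hs n' hn')
    rw [h4] at this
    linarith
  have hnm := mem_normalPlane_iff.1 hn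
  apply ext_inner_immersion (f := f) (u := u)
  · rw [real_inner_comm, hsa, h1, inner_zero_right, inner_neg_right, inner_sum]
    simp [inner_smul_right, hf.inner_fderiv hu]
  · intro a
    rw [real_inner_comm, hsa, h2, inner_neg_right, inner_neg_right, inner_sum]
    congr 1
    have : secondFF f u w a = ∑ k, firstFF f u a (e k) • secondFF f u w (e k) := by
      conv_lhs => rw [← he.expand a]
      rw [← secondBilin_apply]
      simp [secondBilin_apply]
    rw [this, inner_sum]
    refine Finset.sum_congr rfl fun k _ => ?_
    rw [inner_smul_right, inner_smul_right, firstFF, mul_comm, real_inner_comm n]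
  · intro n' hn'
    rw [real_inner_comm, h3 n' hn', inner_neg_right, inner_sum,
      Finset.sum_eq_zero, neg_zero]
    intro k _
    rw [inner_smul_right, real_inner_comm _ n', (mem_normalPlane_iff.1 hn').2, mul_zero]

/-- The Ricci equation. -/
theorem IsImmersionOn.inner_normalCurvature (hf : IsImmersionOn f Ω) (hu : u ∈ Ω)
    {e : Fin m → Euc m} (he : IsTangentFrame f u e) (v w : Euc m) {n₁ n₂ : Amb m}
    (hn₁ : n₁ ∈ normalPlane f u) (hn₂ : n₂ ∈ normalPlane f u) :
    ⟪normalCurvature f u v w n₁, n₂⟫_ℝ =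
      ∑ k, (⟪secondFF f u w (e k), n₁⟫_ℝ * ⟪secondFF f u v (e k), n₂⟫_ℝ -
        ⟪secondFF f u v (e k), n₁⟫_ℝ * ⟪secondFF f u w (e k), n₂⟫_ℝ) := by
  have key : ∀ c d : Fin m → ℝ, ⟪- ∑ k, c k • fderiv ℝ f u (e k),
      - ∑ k, d k • fderiv ℝ f u (e k)⟫_ℝ = ∑ k, c k * d k := by
    intro c d
    rw [inner_neg_neg, sum_inner]
    refine Finset.sum_congr rfl fun k _ => ?_
    rw [inner_smul_left, inner_sum]
    congr 1
    rw [Finset.sum_eq_single k]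
    · rw [inner_smul_right]
      have := he k k
      rw [firstFF, if_pos rfl] at this
      rw [this, mul_one]
    · intro j _ hj
      rw [inner_smul_right]
      have := he k j
      rw [firstFF, if_neg hj.symm] at this
      rw [this, mul_zero]
    · simp
  rw [normalCurvature, inner_projCurvature hf.isOpen hu hf.contDiffOn_normalProj
    (fun u' _ x y => Submodule.inner_starProjection_left_eq_right _ x y) v w _
    (Submodule.starProjection_eq_self_iff.2 hn₂), hf.fderiv_normalProj hu he w hn₁,
    hf.fderiv_normalProj hu he w hn₂, hf.fderiv_normalProj hu he v hn₁,
    hf.fderiv_normalProj hu he v hn₂, key, key, Finset.sum_sub_distrib]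

end Curvature

/-! ### The normal form of the second fundamental form at a point with DDVV equality -/

section NormalForm

variable {m : ℕ} {f : Euc m → Amb m} {Ω : Set (Euc m)} {u : Euc m}

theorem IsNormalFrame.expand {n₁ n₂ : Amb m} (hn : IsNormalFrame f u n₁ n₂)
    (hr : Module.finrank ℝ (normalPlane f u) = 2) {X : Amb m} (hX : X ∈ normalPlane f u) :
    X = ⟪X, n₁⟫_ℝ • n₁ + ⟪X, n₂⟫_ℝ • n₂ := by
  obtain ⟨h1, h2, h3, h4, h5⟩ := hn
  have ho : Orthonormal ℝ ![n₁, n₂] := by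
    constructor
    · intro i; fin_cases i <;> simpa
    · intro i j hij
      fin_cases i <;> fin_cases j <;> simp_all [real_inner_comm]
  have hspan : Submodule.span ℝ (Set.range ![n₁, n₂]) = normalPlane f u := by
    apply Submodule.eq_of_le_of_finrank_eq
    · rw [Submodule.span_le]
      rintro _ ⟨i, rfl⟩
      fin_cases i <;> assumption
    · rw [finrank_span_eq_card ho.linearIndependent, hr]; simp
  rw [← hspan] at hX
  obtain ⟨c, rfl⟩ := (Submodule.mem_span_range_iff_exists_fun ℝ).1 hX
  have h6 : ⟪n₂, n₁⟫_ℝ = 0 := by rw [real_inner_comm]; exact h5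
  simp [Fin.sum_univ_two, inner_add_left, inner_smul_left, h3, h4, h5, h6]

theorem IsNormalFrame.inner_eq {n₁ n₂ : Amb m} (hn : IsNormalFrame f u n₁ n₂)
    (hr : Module.finrank ℝ (normalPlane f u) = 2) {X : Amb m} (hX : X ∈ normalPlane f u)
    (Y : Amb m) :
    ⟪X, Y⟫_ℝ = ⟪X, n₁⟫_ℝ * ⟪Y, n₁⟫_ℝ + ⟪X, n₂⟫_ℝ * ⟪Y, n₂⟫_ℝ := by
  conv_lhs => rw [hn.expand hr hX]
  rw [inner_add_left, real_inner_smul_left, real_inner_smul_left, real_inner_comm Y,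
    real_inner_comm Y n₂]

theorem sum_lt_eq_half {m : ℕ} (g : Fin m → Fin m → ℝ) (hs : ∀ i j, g i j = g j i)
    (h0 : ∀ i, g i i = 0) :
    ∑ i, ∑ j, (if i < j then g i j else 0) = (1 / 2) * ∑ i, ∑ j, g i j := by
  have h1 : ∑ i, ∑ j, g i j = ∑ i, ∑ j, (if i < j then g i j else 0) +
      ∑ i, ∑ j, (if j < i then g i j else 0) := by
    rw [← Finset.sum_add_distrib]
    refine Finset.sum_congr rfl fun i _ => ?_
    rw [← Finset.sum_add_distrib]
    refine Finset.sum_congr rfl fun j _ => ?_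
    rcases lt_trichotomy i j with h | h | h
    · simp [h, h.le.not_gt]
    · subst h; simp [h0]
    · simp [h, h.le.not_gt]
  have h2 : ∑ i, ∑ j, (if j < i then g i j else 0) = ∑ i, ∑ j, (if i < j then g i j else 0) := by
    rw [Finset.sum_comm]
    exact Finset.sum_congr rfl fun i _ => Finset.sum_congr rfl fun j _ => by rw [hs]
  rw [h1, h2]; ring

/-- The matrix of the trace-free second fundamental form in the direction `n`. -/
def tracelessMatrix (f : Euc m → Amb m) (u : Euc m) (e : Fin m → Euc m) (n : Amb m) :
    Matrix (Fin m) (Fin m) ℝ := Matrix.of fun i j => ⟪tracelessFF f u (e i) (e j), n⟫_ℝ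

theorem IsTangentFrame.secondFF_eq {e : Fin m → Euc m} (he : IsTangentFrame f u e) (i j : Fin m) :
    secondFF f u (e i) (e j) =
      tracelessFF f u (e i) (e j) + (if i = j then (1 : ℝ) else 0) • meanCurv f u := by
  rw [tracelessFF, he i j]; abel

theorem IsTangentFrame.sum_tracelessFF {e : Fin m → Euc m} (he : IsTangentFrame f u e)
    (hm : m ≠ 0) : ∑ i, tracelessFF f u (e i) (e i) = 0 := by
  have h1 : ∑ i, secondFF f u (e i) (e i) = (m : ℝ) • meanCurv f u := by
    rw [he.meanCurv_eq, smul_smul, mul_one_div_cancel (by exact_mod_cast hm), one_smul]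
  have h2 : ∀ i, tracelessFF f u (e i) (e i) = secondFF f u (e i) (e i) - meanCurv f u := by
    intro i; rw [he.secondFF_eq i i]; simp
  simp only [h2, Finset.sum_sub_distrib, h1]
  simp [← Nat.cast_smul_eq_nsmul ℝ]

/-- The trace of the Gauss equation. The mean curvature contributes `(m² - m)|H|²`, the ambient
sphere `m² - m`, and the mixed terms vanish since the trace-free part has trace zero. -/
theorem IsImmersionOn.sum_sectional (hf : IsImmersionOn f Ω) (hu : u ∈ Ω) (hm : m ≠ 0)
    {e : Fin m → Euc m} (he : IsTangentFrame f u e) :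
    ∑ i, ∑ j, (if i < j then
      ⟪tangentCurvature f u (e i) (e j) (fderiv ℝ f u (e j)), fderiv ℝ f u (e i)⟫_ℝ else 0) =
      (1 / 2) * ((m : ℝ) * (m - 1) * (‖meanCurv f u‖ ^ 2 + 1) -
        ∑ i, ∑ j, ‖tracelessFF f u (e i) (e j)‖ ^ 2) := by
  simp only [hf.inner_tangentCurvature hu]
  rw [sum_lt_eq_half (g := fun i j => ⟪secondFF f u (e j) (e j), secondFF f u (e i) (e i)⟫_ℝ +
    firstFF f u (e j) (e j) * firstFF f u (e i) (e i) -
    (⟪secondFF f u (e i) (e j), secondFF f u (e j) (e i)⟫_ℝ +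
      firstFF f u (e i) (e j) * firstFF f u (e j) (e i)))]
  · congr 1
    simp only [Finset.sum_sub_distrib, Finset.sum_add_distrib]
    have h1 : ∑ i, ∑ j, ⟪secondFF f u (e j) (e j), secondFF f u (e i) (e i)⟫_ℝ =
        (m : ℝ) ^ 2 * ‖meanCurv f u‖ ^ 2 := by
      have hS : ∑ i, secondFF f u (e i) (e i) = (m : ℝ) • meanCurv f u := by
        rw [he.meanCurv_eq, smul_smul, mul_one_div_cancel (by exact_mod_cast hm), one_smul]
      simp_rw [← sum_inner, hS, ← inner_sum, hS, inner_smul_left, inner_smul_right,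
        real_inner_self_eq_norm_sq]
      simp; ring
    have h2 : ∑ i, ∑ j, firstFF f u (e j) (e j) * firstFF f u (e i) (e i) = (m : ℝ) ^ 2 := by
      have : ∀ i, firstFF f u (e i) (e i) = 1 := fun i => by rw [he i i, if_pos rfl]
      simp [this, pow_two]
    have h3 : ∑ i, ∑ j, firstFF f u (e i) (e j) * firstFF f u (e j) (e i) = (m : ℝ) := by
      have : ∀ i j, firstFF f u (e i) (e j) * firstFF f u (e j) (e i) =
          if i = j then 1 else 0 := fun i j => by
        rw [he i j, he j i]; by_cases h : i = j <;> simp [h]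
      simp [this]
    have h4 : ∑ i, ∑ j, ⟪secondFF f u (e i) (e j), secondFF f u (e j) (e i)⟫_ℝ =
        ∑ i, ∑ j, ‖tracelessFF f u (e i) (e j)‖ ^ 2 + m * ‖meanCurv f u‖ ^ 2 := by
      have : ∀ i j, ⟪secondFF f u (e i) (e j), secondFF f u (e j) (e i)⟫_ℝ =
          ‖tracelessFF f u (e i) (e j)‖ ^ 2 + (if i = j then ‖meanCurv f u‖ ^ 2 else 0) +
          (if i = j then 2 * ⟪tracelessFF f u (e i) (e i), meanCurv f u⟫_ℝ else 0) := by
        intro i j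
        rw [hf.secondFF_comm hu (e j), he.secondFF_eq, real_inner_self_eq_norm_sq,
          norm_add_sq_real]
        by_cases h : i = j
        · subst h; simp; ring
        · simp [h]
      simp only [this, Finset.sum_add_distrib, Finset.sum_ite_eq, Finset.mem_univ, if_true]
      rw [← Finset.mul_sum, ← sum_inner, he.sum_tracelessFF hm]
      simp
    rw [h1, h2, h3, h4]; ring
  · intro i j
    rw [real_inner_comm, real_inner_comm (secondFF f u (e j) (e i))]; ring
  · intro i; ring

/-- Multiples of the identity commute with everything, so only the trace-free parts of the shape
operators enter the Ricci equation. -/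
theorem IsImmersionOn.inner_normalCurvature_frame (hf : IsImmersionOn f Ω) (hu : u ∈ Ω)
    {e : Fin m → Euc m} (he : IsTangentFrame f u e) {n₁ n₂ : Amb m}
    (hn₁ : n₁ ∈ normalPlane f u) (hn₂ : n₂ ∈ normalPlane f u) (i j : Fin m) :
    ⟪normalCurvature f u (e i) (e j) n₁, n₂⟫_ℝ =
      - (tracelessMatrix f u e n₁ * tracelessMatrix f u e n₂ -
        tracelessMatrix f u e n₂ * tracelessMatrix f u e n₁) i j := by
  have hs : ∀ n : Amb m, ∀ i j, ⟪secondFF f u (e i) (e j), n⟫_ℝ =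
      tracelessMatrix f u e n i j + (if i = j then ⟪meanCurv f u, n⟫_ℝ else 0) := by
    intro n i j
    rw [he.secondFF_eq, inner_add_left, real_inner_smul_left]
    by_cases h : i = j <;> simp [h, tracelessMatrix]
  have hc : ∀ n : Amb m, ∀ i j, tracelessMatrix f u e n i j = tracelessMatrix f u e n j i := by
    intro n i j; simp only [tracelessMatrix, Matrix.of_apply]; rw [hf.tracelessFF_comm hu]
  rw [hf.inner_normalCurvature hu he _ _ hn₁ hn₂]
  simp only [hs, Matrix.sub_apply, Matrix.mul_apply, add_mul, mul_add, Finset.sum_sub_distrib,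
    Finset.sum_add_distrib, ite_mul, mul_ite, zero_mul, mul_zero, Finset.sum_ite_eq,
    Finset.mem_univ, if_true]
  have e1 : ∑ x, tracelessMatrix f u e n₁ j x * tracelessMatrix f u e n₂ i x =
      ∑ x, tracelessMatrix f u e n₂ i x * tracelessMatrix f u e n₁ x j :=
    Finset.sum_congr rfl fun x _ => by rw [hc n₁ j x]; ring
  have e2 : ∑ x, tracelessMatrix f u e n₁ i x * tracelessMatrix f u e n₂ j x =
      ∑ x, tracelessMatrix f u e n₁ i x * tracelessMatrix f u e n₂ x j :=
    Finset.sum_congr rfl fun x _ => by rw [hc n₂ j x]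
  rw [e1, e2, hc n₁ j i, hc n₂ j i]
  by_cases h : i = j
  · subst h; simp
  · simp [h, Ne.symm h]

/-- With `τ = |A|² + |B|²` and `K = |[A,B]|²`, the traced equations reduce the equality to `τ = 2
√(K/2)`, which is then squared. -/
theorem DDVVEquality.exists_matrixEq (hm : 2 ≤ m) (hf : IsImmersionOn f Ω) (hu : u ∈ Ω)
    (h : DDVVEquality f u) :
    ∃ (e : Fin m → Euc m) (n₁ n₂ : Amb m), IsTangentFrame f u e ∧ IsNormalFrame f u n₁ n₂ ∧
      DDVVMatrixEq (tracelessMatrix f u e n₁) (tracelessMatrix f u e n₂) := by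
  obtain ⟨e, n₁, n₂, he, hn, heq⟩ := h
  refine ⟨e, n₁, n₂, he, hn, ?_⟩
  have hr := hf.finrank_normalPlane hu
  have hm1 : (0 : ℝ) < m * (m - 1) := by
    have : (2 : ℝ) ≤ m := by exact_mod_cast hm
    nlinarith
  have htr : (tracelessMatrix f u e n₁ * (tracelessMatrix f u e n₁).transpose).trace +
      (tracelessMatrix f u e n₂ * (tracelessMatrix f u e n₂).transpose).trace =
      ∑ i, ∑ j, ‖tracelessFF f u (e i) (e j)‖ ^ 2 := by
    simp only [trace_mul_transpose_self, ← Finset.sum_add_distrib]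
    refine Finset.sum_congr rfl fun i _ => Finset.sum_congr rfl fun j _ => ?_
    rw [← real_inner_self_eq_norm_sq, hn.inner_eq hr (tracelessFF_mem _ _)]
    simp [tracelessMatrix]; ring
  unfold DDVVMatrixEq
  rw [htr, trace_mul_transpose_self]
  rw [scalarCurv, normalScalarCurv, hf.sum_sectional hu (by omega) he] at heq
  simp only [hf.inner_normalCurvature_frame hu he hn.1 hn.2.1, neg_sq] at heq
  set C := tracelessMatrix f u e n₁ * tracelessMatrix f u e n₂ -
        tracelessMatrix f u e n₂ * tracelessMatrix f u e n₁ with hC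
  have hanti : ∀ i j, C i j = - C j i := by
    intro i j
    have hc : ∀ n : Amb m, (tracelessMatrix f u e n).transpose = tracelessMatrix f u e n := by
      intro n; ext i j
      simp only [tracelessMatrix, Matrix.of_apply, Matrix.transpose_apply]
      rw [hf.tracelessFF_comm hu]
    have : C.transpose = - C := by
      rw [hC, Matrix.transpose_sub, Matrix.transpose_mul, Matrix.transpose_mul, hc, hc, neg_sub]
    have := congrFun (congrFun this j) i
    simpa using this
  rw [sum_lt_eq_half (g := fun i j => C i j ^ 2) (fun i j => by rw [hanti]; ring)
    (fun i => by have := hanti i i; have : C i i = 0 := by linarith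
                 simp [this])] at heq
  set τ := ∑ i, ∑ j, ‖tracelessFF f u (e i) (e j)‖ ^ 2
  set K := ∑ i, ∑ j, C i j ^ 2
  have hK : 0 ≤ K := Finset.sum_nonneg fun i _ => Finset.sum_nonneg fun j _ => sq_nonneg _
  have hτ : τ = 2 * Real.sqrt (1 / 2 * K) := by
    field_simp at heq
    have h2 : (m : ℝ) - 1 ≠ 0 := by
      have : (2 : ℝ) ≤ m := by exact_mod_cast hm
      linarith
    field_simp at heq
    rw [show (1 / 2 * K) = K / 2 by ring]
    linarith
  rw [hτ, mul_pow, Real.sq_sqrt (by positivity)]; ring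

/-- The trace-free second fundamental form has the normal form of Wintgen ideal submanifolds in
the tangent frame `e` and the normal frame `n₁, n₂`. -/
structure IsNormalForm (f : Euc m → Amb m) (u : Euc m) (e : Fin m → Euc m) (n₁ n₂ : Amb m)
    (t : ℝ) : Prop where
  pos : 0 < t
  frame : IsTangentFrame f u e
  form₁ : ∀ i j, ⟪tracelessFF f u (e i) (e j), n₁⟫_ℝ = offDiagForm t i j
  form₂ : ∀ i j, ⟪tracelessFF f u (e i) (e j), n₂⟫_ℝ = diagForm t i j

/-- Two orthonormal normal frames differ by an orthogonal `2 × 2` matrix, so the matrix identity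
holds for the prescribed frame too, not only for the one in the hypothesis. For this reason a smooth
normal frame can be fixed in advance, and no smooth choice of the tangent frame is ever needed. -/
theorem DDVVEquality.exists_isNormalForm (hm : 2 ≤ m) (hf : IsImmersionOn f Ω) (hu : u ∈ Ω)
    (h : DDVVEquality f u) (hne : ∃ v w, tracelessFF f u v w ≠ 0) {n₁ n₂ : Amb m}
    (hn : IsNormalFrame f u n₁ n₂) : ∃ e t, IsNormalForm f u e n₁ n₂ t := by
  obtain ⟨e, k₁, k₂, he, hk, heq⟩ := h.exists_matrixEq hm hf hu
  have hr := hf.finrank_normalPlane hu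
  have hexp : ∀ n ∈ normalPlane f u, tracelessMatrix f u e n =
      ⟪n, k₁⟫_ℝ • tracelessMatrix f u e k₁ + ⟪n, k₂⟫_ℝ • tracelessMatrix f u e k₂ := by
    intro n hn
    ext i j
    simp only [tracelessMatrix, Matrix.of_apply, Matrix.add_apply, Matrix.smul_apply, smul_eq_mul]
    rw [real_inner_comm, hk.inner_eq hr hn]
  have hsq : ∀ n ∈ normalPlane f u, ‖n‖ = 1 → ⟪n, k₁⟫_ℝ ^ 2 + ⟪n, k₂⟫_ℝ ^ 2 = 1 := by
    intro n hn hn1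
    have := hk.inner_eq hr hn n
    rw [real_inner_self_eq_norm_sq, hn1] at this
    linarith
  have heq' := heq.rotate (hsq n₁ hn.1 hn.2.2.1) (hsq n₂ hn.2.1 hn.2.2.2.1) (by
    rw [← hk.inner_eq hr hn.1, hn.2.2.2.2])
  rw [← hexp n₁ hn.1, ← hexp n₂ hn.2.1] at heq'
  have hc : ∀ n : Amb m, (tracelessMatrix f u e n).transpose = tracelessMatrix f u e n := by
    intro n; ext i j
    simp only [tracelessMatrix, Matrix.of_apply, Matrix.transpose_apply]
    rw [hf.tracelessFF_comm hu]
  have hne' : tracelessMatrix f u e n₁ ≠ 0 ∨ tracelessMatrix f u e n₂ ≠ 0 := by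
    by_contra hcon
    push Not at hcon
    obtain ⟨v, w, hvw⟩ := hne
    have h0 : ∀ i j, tracelessFF f u (e i) (e j) = 0 := by
      intro i j
      have h1 : ⟪tracelessFF f u (e i) (e j), n₁⟫_ℝ = 0 := congrFun (congrFun hcon.1 i) j
      have h2 : ⟪tracelessFF f u (e i) (e j), n₂⟫_ℝ = 0 := congrFun (congrFun hcon.2 i) j
      rw [hn.expand hr (tracelessFF_mem (f := f) (u := u) (e i) (e j)), h1, h2]; simp
    apply hvw
    rw [← he.expand v, ← he.expand w, ← tracelessBilin_apply]
    simp [tracelessBilin_apply, h0]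
  obtain ⟨U, t, hU, ht, h1, h2⟩ := heq'.exists_normalForm hm (hc _) (hc _) hne'
  let e' : Fin m → Euc m := fun k => ∑ i, U k i • e i
  have hconj : ∀ n, ∀ k l, ⟪tracelessFF f u (e' k) (e' l), n⟫_ℝ =
      (U * tracelessMatrix f u e n * U.transpose) k l := by
    intro n k l
    rw [← tracelessBilin_apply]
    simp only [e', map_sum, map_smul, LinearMap.sum_apply, LinearMap.smul_apply, sum_inner,
      real_inner_smul_left, Matrix.mul_apply, Matrix.transpose_apply, tracelessMatrix,
      Matrix.of_apply, tracelessBilin_apply, Finset.sum_mul, Finset.mul_sum]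
    exact Finset.sum_congr rfl fun _ _ => Finset.sum_congr rfl fun _ _ => by ring
  refine ⟨e', t, ht, ?_, fun i j => by rw [hconj, h1], fun i j => by rw [hconj, h2]⟩
  intro k l
  have := congrFun (congrFun hU k) l
  rw [Matrix.one_apply] at this
  rw [← this, ← firstFFBilin_apply]
  simp only [e', map_sum, map_smul, LinearMap.sum_apply, LinearMap.smul_apply, smul_eq_mul,
    firstFFBilin_apply, Matrix.mul_apply, Matrix.transpose_apply]
  simp only [he _ _, mul_ite, mul_one, mul_zero, Finset.sum_ite_eq',
    Finset.mem_univ, if_true]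
  exact Finset.sum_congr rfl fun _ _ => mul_comm _ _

end NormalForm

/-! ### Invariance under changes of coordinates -/

section CoordChange

variable {m : ℕ} {f g : Euc m → Amb m} {Ω : Set (Euc m)} {u : Euc m} {τ : Euc m → Euc m}

/-- `g` is obtained from the immersion `f` by the change of coordinates `τ` near `u`, with
derivative `T` at `u`. -/
structure IsCoordChange (f g : Euc m → Amb m) (Ω : Set (Euc m)) (τ : Euc m → Euc m) (u : Euc m)
    (T : Euc m ≃L[ℝ] Euc m) : Prop where
  immersion : IsImmersionOn f Ω
  mem : τ u ∈ Ω
  smooth : ContDiffAt ℝ ∞ τ u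
  hasFDerivAt : HasFDerivAt τ (T : Euc m →L[ℝ] Euc m) u
  eventuallyEq : g =ᶠ[𝓝 u] f ∘ τ

variable {T : Euc m ≃L[ℝ] Euc m}

theorem IsCoordChange.apply_eq (h : IsCoordChange f g Ω τ u T) : g u = f (τ u) :=
  h.eventuallyEq.eq_of_nhds

theorem IsCoordChange.fderiv_eq (h : IsCoordChange f g Ω τ u T) (v : Euc m) :
    fderiv ℝ g u v = fderiv ℝ f (τ u) (T v) := by
  rw [h.eventuallyEq.fderiv_eq,
    ((h.immersion.differentiableAt h.mem).hasFDerivAt.comp u h.hasFDerivAt).fderiv]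
  rfl

theorem IsCoordChange.firstFF_eq (h : IsCoordChange f g Ω τ u T) (v w : Euc m) :
    firstFF g u v w = firstFF f (τ u) (T v) (T w) := by
  rw [firstFF, h.fderiv_eq, h.fderiv_eq, firstFF]

theorem IsCoordChange.normalPlane_eq (h : IsCoordChange f g Ω τ u T) :
    normalPlane g u = normalPlane f (τ u) := by
  ext n
  rw [mem_normalPlane_iff, mem_normalPlane_iff, h.apply_eq]
  refine and_congr_right fun _ => ⟨fun hn v => ?_, fun hn v => ?_⟩
  · have := hn (T.symm v)
    rwa [h.fderiv_eq, T.apply_symm_apply] at this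
  · rw [h.fderiv_eq]; exact hn _

theorem IsCoordChange.injective (h : IsCoordChange f g Ω τ u T) :
    Function.Injective (fderiv ℝ g u) := by
  intro v w hvw
  rw [h.fderiv_eq, h.fderiv_eq] at hvw
  exact T.injective (h.immersion.injective _ h.mem hvw)

/-- The extra term of the second-order chain rule is `df(D²τ)`, which is tangential and is killed by
the normal projection. -/
theorem IsCoordChange.secondFF_eq (h : IsCoordChange f g Ω τ u T) (v w : Euc m) :
    secondFF g u v w = secondFF f (τ u) (T v) (T w) := by
  have hev : fderiv ℝ g =ᶠ[𝓝 u] fun y => (fderiv ℝ f (τ y)).comp (fderiv ℝ τ y) := by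
    have h1 : ∀ᶠ y in 𝓝 u, τ y ∈ Ω :=
      h.smooth.continuousAt (h.immersion.isOpen.mem_nhds h.mem)
    have h2 : ∀ᶠ y in 𝓝 u, ContDiffAt ℝ 1 τ y :=
      (h.smooth.of_le (by exact_mod_cast le_top)).eventually (by simp)
    filter_upwards [h1, h2, h.eventuallyEq.eventuallyEq_nhds] with y hy1 hy2 hy3
    rw [hy3.fderiv_eq, ((h.immersion.differentiableAt hy1).hasFDerivAt.comp y
      (hy2.differentiableAt one_ne_zero).hasFDerivAt).fderiv]
  have hτ2 : DifferentiableAt ℝ (fderiv ℝ τ) u :=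
    (h.smooth.fderiv_right (m := 1) (by
      exact WithTop.coe_le_coe.2 (le_top : (2 : ℕ∞) ≤ ⊤))).differentiableAt one_ne_zero
  have h1 : HasFDerivAt (fun y => fderiv ℝ f (τ y)) _ u :=
    (h.immersion.differentiableAt_fderiv h.mem).hasFDerivAt.comp u h.hasFDerivAt
  have h2 := h1.clm_comp hτ2.hasFDerivAt
  have h3 : fderiv ℝ (fderiv ℝ g) u v w =
      fderiv ℝ (fderiv ℝ f) (τ u) (T v) (T w) + fderiv ℝ f (τ u) (fderiv ℝ (fderiv ℝ τ) u v w) := by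
    rw [hev.fderiv_eq, h2.fderiv]
    simp only [add_apply, ContinuousLinearMap.comp_apply, ContinuousLinearMap.compL_apply,
      ContinuousLinearMap.flip_apply, h.hasFDerivAt.fderiv]
    rw [add_comm]
    rfl
  have h4 : (normalPlane f (τ u)).starProjection
      (fderiv ℝ f (τ u) (fderiv ℝ (fderiv ℝ τ) u v w)) = 0 := by
    rw [Submodule.starProjection_apply_eq_zero_iff]
    rw [Submodule.mem_orthogonal]
    intro n hn
    rw [real_inner_comm]
    exact (mem_normalPlane_iff.1 hn).2 _
  have h5 : (normalPlane g u).starProjection = (normalPlane f (τ u)).starProjection := by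
    simp only [h.normalPlane_eq]
  rw [secondFF, h5, h3, map_add, h4, add_zero, secondFF]

theorem IsCoordChange.isTangentFrame (h : IsCoordChange f g Ω τ u T) {e : Fin m → Euc m}
    (he : IsTangentFrame g u e) : IsTangentFrame f (τ u) fun i => T (e i) := fun i j => by
  rw [← h.firstFF_eq, he]

/-- Orthonormal frames correspond to orthonormal frames, so the inverse Gram matrix need not be
transformed. -/
theorem IsCoordChange.meanCurv_eq (h : IsCoordChange f g Ω τ u T) :
    meanCurv g u = meanCurv f (τ u) := by
  obtain ⟨e, he⟩ := exists_isTangentFrame h.injective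
  rw [he.meanCurv_eq, (h.isTangentFrame he).meanCurv_eq]
  simp only [h.secondFF_eq]

theorem IsCoordChange.tracelessFF_eq (h : IsCoordChange f g Ω τ u T) (v w : Euc m) :
    tracelessFF g u v w = tracelessFF f (τ u) (T v) (T w) := by
  rw [tracelessFF, h.secondFF_eq, h.firstFF_eq, h.meanCurv_eq, tracelessFF]

theorem IsCoordChange.isNormalForm (h : IsCoordChange f g Ω τ u T) {e : Fin m → Euc m}
    {n₁ n₂ : Amb m} {t : ℝ} (he : IsNormalForm g u e n₁ n₂ t) :
    IsNormalForm f (τ u) (fun i => T (e i)) n₁ n₂ t where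
  pos := he.pos
  frame := h.isTangentFrame he.frame
  form₁ i j := by rw [← h.tracelessFF_eq, he.form₁]
  form₂ i j := by rw [← h.tracelessFF_eq, he.form₂]

end CoordChange

/-! ### The coordinate expressions of an immersion of a manifold -/

section Charts

variable {m : ℕ} {M : Type*} [TopologicalSpace M] [ChartedSpace (Euc m) M]
  [IsManifold (𝓡 m) ∞ M] {x : M → Amb m}

theorem fderiv_comp_chart_symm {W : Type*} [NormedAddCommGroup W] [NormedSpace ℝ W]
    {F : M → W} {p : M} {u : Euc m} (hu : u ∈ (extChartAt (𝓡 m) p).target)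
    (hF : MDifferentiableAt (𝓡 m) 𝓘(ℝ, W) F ((extChartAt (𝓡 m) p).symm u)) (v : Euc m) :
    fderiv ℝ (F ∘ (extChartAt (𝓡 m) p).symm) u v =
      mfderiv (𝓡 m) 𝓘(ℝ, W) F ((extChartAt (𝓡 m) p).symm u)
        (mfderiv 𝓘(ℝ, Euc m) (𝓡 m) (extChartAt (𝓡 m) p).symm u v) := by
  have h1 : MDifferentiableAt 𝓘(ℝ, Euc m) (𝓡 m) (extChartAt (𝓡 m) p).symm u :=
    ((contMDiffOn_extChartAt_symm (n := ∞) p).contMDiffAt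
      ((isOpen_extChartAt_target p).mem_nhds hu)).mdifferentiableAt (by simp)
  rw [← mfderiv_eq_fderiv, mfderiv_comp u hF h1]
  rfl

theorem bijective_mfderiv_chart_symm {p : M} {u : Euc m}
    (hu : u ∈ (extChartAt (𝓡 m) p).target) :
    Function.Bijective (mfderiv 𝓘(ℝ, Euc m) (𝓡 m) (extChartAt (𝓡 m) p).symm u) := by
  have := isInvertible_mfderivWithin_extChartAt_symm (I := 𝓡 m) hu
  rw [ModelWithCorners.range_eq_univ, mfderivWithin_univ] at this
  exact this.bijective

theorem IsSphereImmersion.isImmersionOn (hx : IsSphereImmersion x) (p : M) :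
    IsImmersionOn (localRep x p) (extChartAt (𝓡 m) p).target where
  isOpen := isOpen_extChartAt_target p
  smooth := contMDiffOn_iff_contDiffOn.1
    (hx.smooth.comp_contMDiffOn (contMDiffOn_extChartAt_symm p))
  norm_eq_one u _ := hx.norm_eq_one _
  injective u hu v w hvw := by
    have hF : MDifferentiableAt (𝓡 m) 𝓘(ℝ, Amb m) x ((extChartAt (𝓡 m) p).symm u) :=
      (hx.smooth _).mdifferentiableAt (by simp)
    change fderiv ℝ (x ∘ (extChartAt (𝓡 m) p).symm) u v =
      fderiv ℝ (x ∘ (extChartAt (𝓡 m) p).symm) u w at hvw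
    rw [fderiv_comp_chart_symm hu hF, fderiv_comp_chart_symm hu hF] at hvw
    exact (bijective_mfderiv_chart_symm hu).injective (hx.immersion _ hvw)

/-- The data at a point are defined in the preferred chart of that very point. The transition map
brings those of all points near `p` into the one chart at `p`, where they can be differentiated. -/
theorem exists_isCoordChange (hx : IsSphereImmersion x) {p q : M}
    (hq : q ∈ (extChartAt (𝓡 m) p).source) :
    ∃ T, IsCoordChange (localRep x p) (localRep x q) (extChartAt (𝓡 m) p).target
      (extChartAt (𝓡 m) p ∘ (extChartAt (𝓡 m) q).symm) (basePt q) T := by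
  obtain ⟨T, hT⟩ := isInvertible_mfderiv_extChartAt (I := 𝓡 m) hq
  have hqq : (extChartAt (𝓡 m) q).symm (basePt q) = q := extChartAt_to_inv q
  have hsm : ContMDiffAt (𝓡 m) 𝓘(ℝ, Euc m) ∞ (extChartAt (𝓡 m) p) q :=
    contMDiffAt_extChartAt' (by rwa [← extChartAt_source (𝓡 m)])
  refine ⟨T, hx.isImmersionOn p, ?_, ?_, ?_, ?_⟩
  · change extChartAt (𝓡 m) p ((extChartAt (𝓡 m) q).symm (basePt q)) ∈ _
    rw [hqq]
    exact (extChartAt (𝓡 m) p).map_source hq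
  · rw [← contMDiffAt_iff_contDiffAt]
    refine ContMDiffAt.comp (basePt q) (I' := 𝓡 m) (by rwa [hqq]) ?_
    exact (contMDiffOn_extChartAt_symm q).contMDiffAt
      ((isOpen_extChartAt_target q).mem_nhds (mem_extChartAt_target q))
  · have h := (hsm.mdifferentiableAt (by simp)).hasMFDerivAt.2
    rw [← hT] at h
    simp only [ModelWithCorners.range_eq_univ] at h
    exact hasFDerivWithinAt_univ.1 h
  · have h1 : ContinuousAt (extChartAt (𝓡 m) q).symm (basePt q) := continuousAt_extChartAt_symm q
    have h2 : ∀ᶠ y in 𝓝 (basePt q), (extChartAt (𝓡 m) q).symm y ∈ (extChartAt (𝓡 m) p).source :=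
      h1 (by rw [hqq]; exact extChartAt_source_mem_nhds' hq)
    filter_upwards [h2] with y hy
    change x _ = x _
    congr 1
    exact ((extChartAt (𝓡 m) p).left_inv hy).symm

theorem normalAt_eq (hx : IsSphereImmersion x) {p q : M}
    (hq : q ∈ (extChartAt (𝓡 m) p).source) :
    normalAt x q = normalPlane (localRep x p) (extChartAt (𝓡 m) p q) := by
  obtain ⟨T, hT⟩ := exists_isCoordChange hx hq
  have := hT.normalPlane_eq
  rwa [Function.comp_apply, basePt, extChartAt_to_inv] at this

theorem meanCurvAt_eq (hx : IsSphereImmersion x) {p q : M}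
    (hq : q ∈ (extChartAt (𝓡 m) p).source) :
    meanCurvAt x q = meanCurv (localRep x p) (extChartAt (𝓡 m) p q) := by
  obtain ⟨T, hT⟩ := exists_isCoordChange hx hq
  have := hT.meanCurv_eq
  rwa [Function.comp_apply, basePt, extChartAt_to_inv] at this

theorem basePt_mem (p : M) : basePt p ∈ (extChartAt (𝓡 m) p).target := mem_extChartAt_target p

theorem exists_isNormalForm_basePt (hm : 2 ≤ m) (hx : IsSphereImmersion x) (hW : IsWintgenIdeal x)
    (hU : IsUmbilicFree x) (p : M) {n₁ n₂ : Amb m}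
    (hn : IsNormalFrame (localRep x p) (basePt p) n₁ n₂) :
    ∃ e t, IsNormalForm (localRep x p) (basePt p) e n₁ n₂ t :=
  (hW p).exists_isNormalForm hm (hx.isImmersionOn p) (basePt_mem p) (hU p) hn

/-- The hypotheses concern the base point of each preferred chart; for another point of the chart at
`p` the normal form is found in the preferred chart of that point and transported. -/
theorem exists_isNormalForm_chart (hm : 2 ≤ m) (hx : IsSphereImmersion x) (hW : IsWintgenIdeal x)
    (hU : IsUmbilicFree x) (p : M) {u : Euc m} (hu : u ∈ (extChartAt (𝓡 m) p).target)
    {n₁ n₂ : Amb m} (hn : IsNormalFrame (localRep x p) u n₁ n₂) :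
    ∃ e t, IsNormalForm (localRep x p) u e n₁ n₂ t := by
  have hq := (extChartAt (𝓡 m) p).map_target hu
  obtain ⟨T, hT⟩ := exists_isCoordChange hx hq
  set q := (extChartAt (𝓡 m) p).symm u with hqdef
  have hu' : extChartAt (𝓡 m) p q = u := (extChartAt (𝓡 m) p).right_inv hu
  have hτ : (extChartAt (𝓡 m) p ∘ (extChartAt (𝓡 m) q).symm) (basePt q) = u := by
    rw [Function.comp_apply, basePt, extChartAt_to_inv, hu']
  have hn' : IsNormalFrame (localRep x q) (basePt q) n₁ n₂ := by
    unfold IsNormalFrame at hn ⊢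
    rw [hT.normalPlane_eq, hτ]
    exact hn
  obtain ⟨e, t, he⟩ := exists_isNormalForm_basePt hm hx hW hU q hn'
  have := hT.isNormalForm he
  rw [hτ] at this
  exact ⟨_, _, this⟩

end Charts

/-! ### Algebra of the complexified Lorentz space -/

section Lorentz

variable {m : ℕ}

theorem lor_comm (Z W : CLor m) : lor Z W = lor W Z := by
  simp only [lor, mul_comm]

theorem lor_add_left (Z Z' W : CLor m) : lor (Z + Z') W = lor Z W + lor Z' W := by
  simp only [lor, Pi.add_apply, add_mul, Finset.sum_add_distrib]; ring

theorem lor_smul_left (c : ℂ) (Z W : CLor m) : lor (c • Z) W = c * lor Z W := by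
  simp only [lor, Pi.smul_apply, smul_eq_mul, mul_add, Finset.mul_sum, mul_assoc, mul_neg]

theorem lor_add_right (Z W W' : CLor m) : lor Z (W + W') = lor Z W + lor Z W' := by
  rw [lor_comm, lor_add_left, lor_comm W, lor_comm W']

theorem lor_smul_right (c : ℂ) (Z W : CLor m) : lor Z (c • W) = c * lor Z W := by
  rw [lor_comm, lor_smul_left, lor_comm]

/-- The complex bilinear Lorentz product as a bilinear map. -/
def lorBilin (m : ℕ) : CLor m →ₗ[ℂ] CLor m →ₗ[ℂ] ℂ :=
  LinearMap.mk₂ ℂ lor lor_add_left lor_smul_left lor_add_right lor_smul_right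

theorem lorBilin_apply (Z W : CLor m) : lorBilin m Z W = lor Z W := rfl

theorem lor_zero_left (W : CLor m) : lor 0 W = 0 := by
  rw [← lorBilin_apply]; simp

theorem lor_sub_left (Z Z' W : CLor m) : lor (Z - Z') W = lor Z W - lor Z' W := by
  simp only [← lorBilin_apply, map_sub, LinearMap.sub_apply]

theorem lor_sub_right (W Z Z' : CLor m) : lor W (Z - Z') = lor W Z - lor W Z' := by
  simp only [← lorBilin_apply, map_sub]

theorem conjL_add (Z W : CLor m) : conjL (Z + W) = conjL Z + conjL W := by
  ext i; simp [conjL]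

theorem conjL_sub (Z W : CLor m) : conjL (Z - W) = conjL Z - conjL W := by
  ext i; simp [conjL]

theorem conjL_smul (c : ℂ) (Z : CLor m) : conjL (c • Z) = (starRingEnd ℂ) c • conjL Z := by
  ext i; simp [conjL]

theorem conjL_conjL (Z : CLor m) : conjL (conjL Z) = Z := by
  ext i; simp [conjL]

theorem lor_conjL (Z W : CLor m) : lor (conjL Z) (conjL W) = (starRingEnd ℂ) (lor Z W) := by
  simp [lor, conjL, map_sum]

theorem conjL_realVec (t : ℝ) (y : Amb m) : conjL (realVec t y) = realVec t y := by
  ext i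
  refine Fin.cases ?_ (fun j => ?_) i <;> simp [conjL, realVec]

theorem lor_realVec (s t : ℝ) (x y : Amb m) :
    lor (realVec s x) (realVec t y) = ((-(s * t) + ⟪x, y⟫_ℝ : ℝ) : ℂ) := by
  simp only [lor, realVec, Fin.cons_zero, Fin.cons_succ, PiLp.inner_apply, RCLike.inner_apply,
    conj_trivial]
  push_cast
  congr 1
  exact Finset.sum_congr rfl fun _ _ => mul_comm _ _

theorem realVec_add (s t : ℝ) (x y : Amb m) :
    realVec (s + t) (x + y) = realVec s x + realVec t y := by
  ext i
  refine Fin.cases ?_ (fun j => ?_) i <;> simp [realVec]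

theorem realVec_smul (c t : ℝ) (x : Amb m) :
    realVec (c * t) (c • x) = (c : ℂ) • realVec t x := by
  ext i
  refine Fin.cases ?_ (fun j => ?_) i <;> simp [realVec]

/-- The inclusion of the real Lorentz space as a real linear map. -/
def realVecL (m : ℕ) : ℝ × Amb m →L[ℝ] CLor m :=
  LinearMap.toContinuousLinearMap
    { toFun := fun p => realVec p.1 p.2
      map_add' := fun p q => realVec_add _ _ _ _
      map_smul' := fun c p => by
        rw [RingHom.id_apply, Prod.smul_fst, Prod.smul_snd, smul_eq_mul, realVec_smul]
        ext i; simp }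

theorem realVecL_apply (t : ℝ) (y : Amb m) : realVecL m (t, y) = realVec t y := rfl

theorem realVec_eq (t : ℝ) (y : Amb m) : realVec t y = (t : ℂ) • realVec 1 0 + realVec 0 y := by
  rw [← realVec_smul, ← realVec_add]; simp

theorem realVec_zero_add (x y : Amb m) : realVec 0 (x + y) = realVec 0 x + realVec 0 y := by
  rw [← realVec_add, add_zero]

theorem realVec_zero_smul (c : ℝ) (x : Amb m) : realVec 0 (c • x) = (c : ℂ) • realVec 0 x := by
  rw [← realVec_smul, mul_zero]

theorem realVec_zero_sub (x y : Amb m) : realVec 0 (x - y) = realVec 0 x - realVec 0 y := by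
  rw [sub_eq_add_neg, ← neg_one_smul ℝ y, realVec_zero_add, realVec_zero_smul]
  simp [sub_eq_add_neg]

theorem isBoundedBilinearMap_lor :
    IsBoundedBilinearMap ℝ (fun p : CLor m × CLor m => lor p.1 p.2) := by
  let L : CLor m →L[ℂ] CLor m →L[ℂ] ℂ := LinearMap.toContinuousLinearMap
    ((LinearMap.toContinuousLinearMap : (CLor m →ₗ[ℂ] ℂ) ≃ₗ[ℂ] (CLor m →L[ℂ] ℂ)).toLinearMap ∘ₗ
      lorBilin m)
  have h := L.isBoundedBilinearMap
  exact
    { add_left := h.add_left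
      smul_left := fun c x y => by
        rw [show c • x = (c : ℂ) • x by ext i; simp, lor_smul_left]; simp
      add_right := h.add_right
      smul_right := fun c x y => by
        rw [show c • y = (c : ℂ) • y by ext i; simp, lor_smul_right]; simp
      bound := h.bound }

variable {V : Type*} [NormedAddCommGroup V] [NormedSpace ℝ V]

theorem hasFDerivAt_lor {a b : V → CLor m} {a' b' : V →L[ℝ] CLor m} {u : V}
    (ha : HasFDerivAt a a' u) (hb : HasFDerivAt b b' u) :
    HasFDerivAt (fun u => lor (a u) (b u))
      (isBoundedBilinearMap_lor.deriv (a u, b u) ∘L a'.prod b') u :=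
  HasFDerivAt.comp (g := fun p : CLor m × CLor m => lor p.1 p.2) u
    (isBoundedBilinearMap_lor.hasFDerivAt (a u, b u)) (ha.prodMk hb)

/-- The product rule for a vanishing Lorentz product. -/
theorem lor_fderiv_eq_zero {a b : V → CLor m} {a' b' : V →L[ℝ] CLor m} {u : V}
    (ha : HasFDerivAt a a' u) (hb : HasFDerivAt b b' u)
    (h : ∀ᶠ y in 𝓝 u, lor (a y) (b y) = 0) (v : V) :
    lor (a' v) (b u) + lor (a u) (b' v) = 0 := by
  have h1 := hasFDerivAt_lor ha hb
  have h2 := (hasFDerivAt_const (𝕜 := ℝ) (0 : ℂ) u).congr_of_eventuallyEq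
    (f₁ := fun u => lor (a u) (b u)) h
  have := congrArg (fun L => L v) (h1.unique h2)
  simp only [ContinuousLinearMap.comp_apply, ContinuousLinearMap.prod_apply, zero_apply] at this
  rw [add_comm]
  exact this

end Lorentz

/-! ### The mean curvature spheres in a coordinate domain -/

section Lift

variable {m : ℕ} {f : Euc m → Amb m} {Ω : Set (Euc m)} {u : Euc m}

theorem contDiffOn_gramInv (hf : IsImmersionOn f Ω) (i j : Fin m) :
    ContDiffOn ℝ ∞ (fun u => gramInv f u i j) Ω := by
  -- Which norm is used does not matter; a normed algebra is needed for the smoothness of inversion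
  -- at units.
  let _ : NormedRing (Matrix (Fin m) (Fin m) ℝ) := Matrix.linftyOpNormedRing
  let _ : NormedAlgebra ℝ (Matrix (Fin m) (Fin m) ℝ) := Matrix.linftyOpNormedAlgebra
  let Gm : Euc m → Matrix (Fin m) (Fin m) ℝ := fun u =>
    Matrix.of fun i j => firstFF f u (coordVec m i) (coordVec m j)
  have hunit : ∀ u ∈ Ω, IsUnit (Gm u) := by
    intro u hu
    obtain ⟨e, he⟩ := exists_isTangentFrame (hf.injective u hu)
    rw [← Matrix.isUnit_nonsing_inv_iff]
    let X : Matrix (Fin m) (Fin m) ℝ := Matrix.of fun i k => e k i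
    have h1 : (Gm u)⁻¹ = X * X.transpose := by
      ext i j
      exact (he.gramInv_eq i j).trans (by simp [X, Matrix.mul_apply])
    have h2 : LinearIndependent ℝ X.transpose := by
      have := he.linearIndependent.map' (WithLp.linearEquiv 2 ℝ (Fin m → ℝ)).toLinearMap
        (LinearEquiv.ker _)
      exact this
    have h3 : IsUnit X.transpose := Matrix.linearIndependent_rows_iff_isUnit.1 h2
    rw [h1]
    exact ((Matrix.isUnit_transpose _).1 h3).mul h3
  have hG : ContDiffOn ℝ ∞ Gm Ω := by
    have h1 : ∀ i j, ContDiffOn ℝ ∞ (fun u => Gm u i j) Ω := fun i j =>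
      (hf.contDiffOn_fderiv.clm_apply contDiffOn_const).inner ℝ
        (hf.contDiffOn_fderiv.clm_apply contDiffOn_const)
    have h2 : Gm = fun u => ∑ i, ∑ j, Gm u i j • Matrix.single i j (1 : ℝ) := by
      funext u
      conv_lhs => rw [Matrix.matrix_eq_sum_single (Gm u)]
      simp
    rw [h2]
    exact ContDiffOn.sum fun i _ => ContDiffOn.sum fun j _ => (h1 i j).smul contDiffOn_const
  have hinv : ContDiffOn ℝ ∞ (fun u => Ring.inverse (Gm u)) Ω := by
    intro u hu
    obtain ⟨y, hy⟩ := hunit u hu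
    have := contDiffAt_ringInverse ℝ (n := ∞) y
    rw [hy] at this
    exact this.comp_contDiffWithinAt u (hG u hu)
  let L : Matrix (Fin m) (Fin m) ℝ →L[ℝ] ℝ := LinearMap.toContinuousLinearMap
    { toFun := fun A => A i j, map_add' := fun _ _ => rfl, map_smul' := fun _ _ => rfl }
  refine (L.contDiff.comp_contDiffOn hinv).congr fun u _ => ?_
  rw [gramInv, Matrix.nonsing_inv_eq_ringInverse]
  rfl

/-- Pairing with a normal field absorbs the normal projection in the second fundamental form,
leaving second derivatives of `f` and the inverse Gram matrix. -/
theorem contDiffOn_inner_meanCurv (hf : IsImmersionOn f Ω) {Ω' : Set (Euc m)} (hΩ' : Ω' ⊆ Ω)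
    {n : Euc m → Amb m} (hn : ContDiffOn ℝ ∞ n Ω') (hmem : ∀ u ∈ Ω', n u ∈ normalPlane f u) :
    ContDiffOn ℝ ∞ (fun u => ⟪meanCurv f u, n u⟫_ℝ) Ω' := by
  have h1 : ContDiffOn ℝ ∞ (fun u => (1 / (m : ℝ)) * ∑ i, ∑ j, gramInv f u i j *
      ⟪fderiv ℝ (fderiv ℝ f) u (coordVec m i) (coordVec m j), n u⟫_ℝ) Ω' := by
    refine contDiffOn_const.mul (ContDiffOn.sum fun i _ => ContDiffOn.sum fun j _ =>
      ((contDiffOn_gramInv hf i j).mono hΩ').mul (ContDiffOn.inner ℝ ?_ hn))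
    exact ((hf.contDiffOn_fderiv_fderiv.clm_apply contDiffOn_const).clm_apply
      contDiffOn_const).mono hΩ'
  refine h1.congr fun u hu => ?_
  rw [meanCurv, real_inner_smul_left, sum_inner]
  congr 1
  refine Finset.sum_congr rfl fun i _ => ?_
  rw [sum_inner]
  refine Finset.sum_congr rfl fun j _ => ?_
  rw [real_inner_smul_left, inner_secondFF (hmem u hu)]

/-- The vector `ξ₁ - i ξ₂` of the mean curvature sphere for the normal frame `n₁, n₂`. -/
def coordLift (f n₁ n₂ : Euc m → Amb m) (u : Euc m) : CLor m :=
  realVec ⟪meanCurv f u, n₁ u⟫_ℝ (n₁ u + ⟪meanCurv f u, n₁ u⟫_ℝ • f u) -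
    Complex.I • realVec ⟪meanCurv f u, n₂ u⟫_ℝ (n₂ u + ⟪meanCurv f u, n₂ u⟫_ℝ • f u)

/-- A smooth orthonormal frame of the normal bundle in which the second fundamental form has the
normal form of Wintgen ideal submanifolds. -/
structure IsWintgenFrameOn (f n₁ n₂ : Euc m → Amb m) (Ω : Set (Euc m)) : Prop where
  two_le : 2 ≤ m
  immersion : IsImmersionOn f Ω
  smooth₁ : ContDiffOn ℝ ∞ n₁ Ω
  smooth₂ : ContDiffOn ℝ ∞ n₂ Ω
  isNormalFrame : ∀ u ∈ Ω, IsNormalFrame f u (n₁ u) (n₂ u)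
  exists_form : ∀ u ∈ Ω, ∃ e t, IsNormalForm f u e (n₁ u) (n₂ u) t

variable {n₁ n₂ : Euc m → Amb m}

theorem IsWintgenFrameOn.contDiffOn_coordLift (h : IsWintgenFrameOn f n₁ n₂ Ω) :
    ContDiffOn ℝ ∞ (coordLift f n₁ n₂) Ω := by
  have hf := h.immersion.smooth
  have h1 := contDiffOn_inner_meanCurv h.immersion subset_rfl h.smooth₁
    (fun u hu => (h.isNormalFrame u hu).1)
  have h2 := contDiffOn_inner_meanCurv h.immersion subset_rfl h.smooth₂
    (fun u hu => (h.isNormalFrame u hu).2.1)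
  have h3 : ContDiffOn ℝ ∞ (fun u => realVecL m (⟪meanCurv f u, n₁ u⟫_ℝ,
      n₁ u + ⟪meanCurv f u, n₁ u⟫_ℝ • f u)) Ω :=
    (realVecL m).contDiff.comp_contDiffOn (h1.prodMk (h.smooth₁.add (h1.smul hf)))
  have h4 : ContDiffOn ℝ ∞ (fun u => realVecL m (⟪meanCurv f u, n₂ u⟫_ℝ,
      n₂ u + ⟪meanCurv f u, n₂ u⟫_ℝ • f u)) Ω :=
    (realVecL m).contDiff.comp_contDiffOn (h2.prodMk (h.smooth₂.add (h2.smul hf)))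
  exact h3.sub (h4.const_smul Complex.I)

end Lift

/-! ### The differential of the lift, from the Weingarten equations. -/

section LiftDerivative

variable {m : ℕ} {f : Euc m → Amb m} {Ω : Set (Euc m)} {u : Euc m}

theorem sum_offDiagForm (hm : 2 ≤ m) (t : ℝ) (c d : Fin m → ℝ) :
    ∑ i, ∑ j, c i * d j * offDiagForm t i j =
      t * (c ⟨0, by omega⟩ * d ⟨1, by omega⟩ + c ⟨1, by omega⟩ * d ⟨0, by omega⟩) := by
  have h : ∀ i j : Fin m, offDiagForm t i j =
      (if i = ⟨0, by omega⟩ then (if j = ⟨1, by omega⟩ then t else 0) else 0) +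
      (if i = ⟨1, by omega⟩ then (if j = ⟨0, by omega⟩ then t else 0) else 0) := by
    intro i j
    simp only [offDiagForm, Fin.ext_iff]
    by_cases h0 : i.val = 0 <;> by_cases h1 : i.val = 1 <;> simp [h0, h1]
  simp only [h, mul_add, mul_ite, mul_zero, Finset.sum_add_distrib]
  rw [Finset.sum_comm]
  simp only [Finset.sum_ite_eq', Finset.mem_univ, if_true]
  rw [Finset.sum_comm]
  simp only [Finset.sum_ite_eq', Finset.mem_univ, if_true]
  ring

theorem sum_diagForm (hm : 2 ≤ m) (t : ℝ) (c d : Fin m → ℝ) :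
    ∑ i, ∑ j, c i * d j * diagForm t i j =
      t * (c ⟨0, by omega⟩ * d ⟨0, by omega⟩ - c ⟨1, by omega⟩ * d ⟨1, by omega⟩) := by
  have h : ∀ i j : Fin m, diagForm t i j =
      (if i = ⟨0, by omega⟩ then (if j = ⟨0, by omega⟩ then t else 0) else 0) +
      (if i = ⟨1, by omega⟩ then (if j = ⟨1, by omega⟩ then -t else 0) else 0) := by
    intro i j
    simp only [diagForm, Fin.ext_iff]
    by_cases h0 : i.val = 0 <;> by_cases h1 : i.val = 1 <;> simp [h0, h1]
  simp only [h, mul_add, mul_ite, mul_zero, Finset.sum_add_distrib]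
  rw [Finset.sum_comm]
  simp only [Finset.sum_ite_eq', Finset.mem_univ, if_true]
  rw [Finset.sum_comm]
  simp only [Finset.sum_ite_eq', Finset.mem_univ, if_true]
  ring

variable {e : Fin m → Euc m} {k₁ k₂ : Amb m} {t : ℝ}

theorem IsTangentFrame.inner_tracelessFF (he : IsTangentFrame f u e) (n : Amb m) (v w : Euc m) :
    ⟪tracelessFF f u v w, n⟫_ℝ = ∑ i, ∑ j, firstFF f u v (e i) * firstFF f u w (e j) *
      ⟪tracelessFF f u (e i) (e j), n⟫_ℝ := by
  conv_lhs => rw [← he.expand v, ← he.expand w]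
  rw [← tracelessBilin_apply]
  simp only [map_sum, map_smul, LinearMap.sum_apply, LinearMap.smul_apply, sum_inner,
      real_inner_smul_left, tracelessBilin_apply, Finset.mul_sum]
  rw [Finset.sum_comm]
  exact Finset.sum_congr rfl fun _ _ => Finset.sum_congr rfl fun _ _ => by ring

theorem IsNormalForm.inner₁ (hm : 2 ≤ m) (h : IsNormalForm f u e k₁ k₂ t) (v w : Euc m) :
    ⟪tracelessFF f u v w, k₁⟫_ℝ =
      t * (firstFF f u v (e ⟨0, by omega⟩) * firstFF f u w (e ⟨1, by omega⟩) +
        firstFF f u v (e ⟨1, by omega⟩) * firstFF f u w (e ⟨0, by omega⟩)) := by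
  rw [h.frame.inner_tracelessFF]
  simp only [h.form₁]
  exact sum_offDiagForm hm t (fun i => firstFF f u v (e i)) (fun i => firstFF f u w (e i))

theorem IsNormalForm.inner₂ (hm : 2 ≤ m) (h : IsNormalForm f u e k₁ k₂ t) (v w : Euc m) :
    ⟪tracelessFF f u v w, k₂⟫_ℝ =
      t * (firstFF f u v (e ⟨0, by omega⟩) * firstFF f u w (e ⟨0, by omega⟩) -
        firstFF f u v (e ⟨1, by omega⟩) * firstFF f u w (e ⟨1, by omega⟩)) := by
  rw [h.frame.inner_tracelessFF]
  simp only [h.form₂]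
  exact sum_diagForm hm t (fun i => firstFF f u v (e i)) (fun i => firstFF f u w (e i))

theorem inner_fderiv_fderiv_normal {n : Amb m} (hn : n ∈ normalPlane f u) (v w : Euc m) :
    ⟪fderiv ℝ (fderiv ℝ f) u v w, n⟫_ℝ =
      ⟪tracelessFF f u v w, n⟫_ℝ + firstFF f u v w * ⟪meanCurv f u, n⟫_ℝ := by
  rw [← inner_secondFF hn, tracelessFF, inner_sub_left, real_inner_smul_left]; ring

/-- The product rule for an inner product that vanishes identically. -/
theorem inner_fderiv_add_eq {a b : Euc m → Amb m} {a' b' : Euc m →L[ℝ] Amb m} {c : ℝ}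
    (ha : HasFDerivAt a a' u) (hb : HasFDerivAt b b' u)
    (h : ∀ᶠ y in 𝓝 u, ⟪a y, b y⟫_ℝ = c) (v : Euc m) :
    ⟪a u, b' v⟫_ℝ + ⟪a' v, b u⟫_ℝ = 0 := by
  have h1 := ha.inner ℝ hb
  have h2 := (hasFDerivAt_const (𝕜 := ℝ) c u).congr_of_eventuallyEq
    (f₁ := fun u => ⟪a u, b u⟫_ℝ) h
  have := congrArg (fun L => L v) (h1.unique h2)
  simpa [fderivInnerCLM_apply] using this

variable {n₁ n₂ : Euc m → Amb m}

/-- The complex linear form `v ↦ ⟨v, e₂⟩ - i ⟨v, e₁⟩` of a frame. -/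
def frameForm (f : Euc m → Amb m) (u : Euc m) (e : Fin m → Euc m) (hm : 2 ≤ m) :
    Euc m →ₗ[ℝ] ℂ where
  toFun v := (firstFF f u v (e ⟨1, by omega⟩) : ℂ) -
    Complex.I * (firstFF f u v (e ⟨0, by omega⟩) : ℂ)
  map_add' v w := by
    simp only [← firstFFBilin_apply, map_add, LinearMap.add_apply]; push_cast; ring
  map_smul' c v := by
    simp only [← firstFFBilin_apply, map_smul, LinearMap.smul_apply, smul_eq_mul,
      RingHom.id_apply, Complex.real_smul, Complex.ofReal_mul]
    ring

/-- The isotropic vector `(0, df(e₁) + i df(e₂))` of a frame. -/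
def frameVec (f : Euc m → Amb m) (u : Euc m) (e : Fin m → Euc m) (hm : 2 ≤ m) : CLor m :=
  realVec 0 (fderiv ℝ f u (e ⟨0, by omega⟩)) +
    Complex.I • realVec 0 (fderiv ℝ f u (e ⟨1, by omega⟩))

theorem IsWintgenFrameOn.differentiableAt₁ (h : IsWintgenFrameOn f n₁ n₂ Ω) (hu : u ∈ Ω) :
    DifferentiableAt ℝ n₁ u :=
  (h.smooth₁.contDiffAt (h.immersion.isOpen.mem_nhds hu)).differentiableAt (by simp)

theorem IsWintgenFrameOn.differentiableAt₂ (h : IsWintgenFrameOn f n₁ n₂ Ω) (hu : u ∈ Ω) :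
    DifferentiableAt ℝ n₂ u :=
  (h.smooth₂.contDiffAt (h.immersion.isOpen.mem_nhds hu)).differentiableAt (by simp)

theorem IsNormalFrame.ext_inner {k₁ k₂ : Amb m} (hn : IsNormalFrame f u k₁ k₂)
    (hr : Module.finrank ℝ (normalPlane f u) = 2) {X Y : Amb m}
    (h1 : ⟪f u, X⟫_ℝ = ⟪f u, Y⟫_ℝ)
    (h2 : ∀ a, ⟪fderiv ℝ f u a, X⟫_ℝ = ⟪fderiv ℝ f u a, Y⟫_ℝ)
    (h3 : ⟪k₁, X⟫_ℝ = ⟪k₁, Y⟫_ℝ) (h4 : ⟪k₂, X⟫_ℝ = ⟪k₂, Y⟫_ℝ) : X = Y := by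
  refine ext_inner_immersion h1 h2 fun n hn' => ?_
  rw [hn.inner_eq hr hn' X, hn.inner_eq hr hn' Y, real_inner_comm k₁ X, real_inner_comm k₂ X, h3,
    h4, real_inner_comm k₁ Y, real_inner_comm k₂ Y]

/-- The Weingarten equations with the mean curvature part moved to the left, so that only the
trace-free shape operators in normal form remain. The number `w` is the normal connection form `⟪n₂,
dn₁⟫`. Both sides are compared by their products with `f`, `df`, `n₁` and `n₂`. -/
theorem IsWintgenFrameOn.fderiv_normal (h : IsWintgenFrameOn f n₁ n₂ Ω) (hu : u ∈ Ω)
    (he : IsNormalForm f u e (n₁ u) (n₂ u) t) (v : Euc m) :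
    ∃ w : ℝ,
      fderiv ℝ n₁ u v + ⟪meanCurv f u, n₁ u⟫_ℝ • fderiv ℝ f u v = w • n₂ u -
        t • (firstFF f u v (e ⟨1, h.two_le⟩) • fderiv ℝ f u (e ⟨0, by have := h.two_le; omega⟩) +
          firstFF f u v (e ⟨0, by have := h.two_le; omega⟩) • fderiv ℝ f u (e ⟨1, h.two_le⟩)) ∧
      fderiv ℝ n₂ u v + ⟪meanCurv f u, n₂ u⟫_ℝ • fderiv ℝ f u v = - w • n₁ u -
        t • (firstFF f u v (e ⟨0, by have := h.two_le; omega⟩) •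
            fderiv ℝ f u (e ⟨0, by have := h.two_le; omega⟩) -
          firstFF f u v (e ⟨1, h.two_le⟩) • fderiv ℝ f u (e ⟨1, h.two_le⟩)) := by
  have hm := h.two_le
  have hf := h.immersion
  have hr := hf.finrank_normalPlane hu
  have hn := h.isNormalFrame u hu
  have hd1 := (h.differentiableAt₁ hu).hasFDerivAt
  have hd2 := (h.differentiableAt₂ hu).hasFDerivAt
  have hdf := (hf.differentiableAt hu).hasFDerivAt
  have hev : ∀ᶠ y in 𝓝 u, y ∈ Ω := hf.isOpen.mem_nhds hu
  obtain ⟨hm1, hm2, hl1, hl2, horth⟩ := hn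
  have hp1 := mem_normalPlane_iff.1 hm1
  have hp2 := mem_normalPlane_iff.1 hm2
  have hnn1 : ⟪n₁ u, n₁ u⟫_ℝ = 1 := by rw [real_inner_self_eq_norm_sq, hl1, one_pow]
  have hnn2 : ⟪n₂ u, n₂ u⟫_ℝ = 1 := by rw [real_inner_self_eq_norm_sq, hl2, one_pow]
  have horth' : ⟪n₂ u, n₁ u⟫_ℝ = 0 := by rw [real_inner_comm]; exact horth
  have hq1 : ∀ a, ⟪n₁ u, fderiv ℝ f u a⟫_ℝ = 0 := fun a => by
    rw [real_inner_comm]; exact hp1.2 a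
  have hq2 : ∀ a, ⟪n₂ u, fderiv ℝ f u a⟫_ℝ = 0 := fun a => by
    rw [real_inner_comm]; exact hp2.2 a
  have f1 : ⟪f u, fderiv ℝ n₁ u v⟫_ℝ = 0 := by
    have := inner_fderiv_add_eq (c := 0) hdf hd1 (by
      filter_upwards [hev] with y hy
      exact (mem_normalPlane_iff.1 (h.isNormalFrame y hy).1).1) v
    rwa [hp1.2, add_zero] at this
  have f2 : ⟪f u, fderiv ℝ n₂ u v⟫_ℝ = 0 := by
    have := inner_fderiv_add_eq (c := 0) hdf hd2 (by
      filter_upwards [hev] with y hy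
      exact (mem_normalPlane_iff.1 (h.isNormalFrame y hy).2.1).1) v
    rwa [hp2.2, add_zero] at this
  have d1 : ∀ a, ⟪fderiv ℝ f u a, fderiv ℝ n₁ u v⟫_ℝ =
      - (⟪tracelessFF f u v a, n₁ u⟫_ℝ + firstFF f u v a * ⟪meanCurv f u, n₁ u⟫_ℝ) := by
    intro a
    have := inner_fderiv_add_eq (c := 0) (hf.hasFDerivAt_apply hu a) hd1 (by
      filter_upwards [hev] with y hy
      exact (mem_normalPlane_iff.1 (h.isNormalFrame y hy).1).2 a) v
    rw [← inner_fderiv_fderiv_normal hm1]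
    exact eq_neg_of_add_eq_zero_left this
  have d2 : ∀ a, ⟪fderiv ℝ f u a, fderiv ℝ n₂ u v⟫_ℝ =
      - (⟪tracelessFF f u v a, n₂ u⟫_ℝ + firstFF f u v a * ⟪meanCurv f u, n₂ u⟫_ℝ) := by
    intro a
    have := inner_fderiv_add_eq (c := 0) (hf.hasFDerivAt_apply hu a) hd2 (by
      filter_upwards [hev] with y hy
      exact (mem_normalPlane_iff.1 (h.isNormalFrame y hy).2.1).2 a) v
    rw [← inner_fderiv_fderiv_normal hm2]
    exact eq_neg_of_add_eq_zero_left this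
  have g11 : ⟪n₁ u, fderiv ℝ n₁ u v⟫_ℝ = 0 := by
    have := inner_fderiv_add_eq (c := 1) hd1 hd1 (by
      filter_upwards [hev] with y hy
      rw [real_inner_self_eq_norm_sq, (h.isNormalFrame y hy).2.2.1, one_pow]) v
    rw [real_inner_comm (n₁ u)] at this
    linarith
  have g22 : ⟪n₂ u, fderiv ℝ n₂ u v⟫_ℝ = 0 := by
    have := inner_fderiv_add_eq (c := 1) hd2 hd2 (by
      filter_upwards [hev] with y hy
      rw [real_inner_self_eq_norm_sq, (h.isNormalFrame y hy).2.2.2.1, one_pow]) v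
    rw [real_inner_comm (n₂ u)] at this
    linarith
  have g12 : ⟪n₁ u, fderiv ℝ n₂ u v⟫_ℝ = - ⟪n₂ u, fderiv ℝ n₁ u v⟫_ℝ := by
    have := inner_fderiv_add_eq (c := 0) hd1 hd2 (by
      filter_upwards [hev] with y hy
      exact (h.isNormalFrame y hy).2.2.2.2) v
    rw [real_inner_comm (n₂ u)] at this
    linarith
  have hff : ∀ a b, ⟪fderiv ℝ f u a, fderiv ℝ f u b⟫_ℝ = firstFF f u a b := fun a b => rfl
  refine ⟨⟪n₂ u, fderiv ℝ n₁ u v⟫_ℝ, ?_, ?_⟩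
  · apply (h.isNormalFrame u hu).ext_inner hr
    · simp only [inner_add_right, inner_sub_right, real_inner_smul_right, f1, hp2.1,
        hf.inner_fderiv hu]
      ring
    · intro a
      simp only [inner_add_right, inner_sub_right, real_inner_smul_right, d1, hp2.2, hff,
        he.inner₁ hm, firstFF_comm a v]
      ring
    · simp only [inner_add_right, inner_sub_right, real_inner_smul_right, g11, hq1, horth]
      ring
    · simp only [inner_add_right, inner_sub_right, real_inner_smul_right, hq2, hnn2]
      ring
  · apply (h.isNormalFrame u hu).ext_inner hr
    · simp only [inner_add_right, inner_sub_right, real_inner_smul_right, f2, hp1.1,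
        hf.inner_fderiv hu]
      ring
    · intro a
      simp only [inner_add_right, inner_sub_right, real_inner_smul_right, d2, hp1.2, hff,
        he.inner₂ hm, firstFF_comm a v]
      ring
    · simp only [inner_add_right, inner_sub_right, real_inner_smul_right, g12, hq1, hnn1]
      ring
    · simp only [inner_add_right, inner_sub_right, real_inner_smul_right, hq2, horth', g22]
      ring

/-- The differential of the lift `ξ` of the mean curvature spheres, up to the coefficient of the
position vector. -/
theorem IsWintgenFrameOn.exists_fderiv_coordLift (h : IsWintgenFrameOn f n₁ n₂ Ω) (hu : u ∈ Ω)
    (he : IsNormalForm f u e (n₁ u) (n₂ u) t) (v : Euc m) :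
    ∃ a b : ℂ, fderiv ℝ (coordLift f n₁ n₂) u v = a • coordLift f n₁ n₂ u +
      b • realVec 1 (f u) - ((t : ℂ) * frameForm f u e h.two_le v) • frameVec f u e h.two_le := by
  have hf := h.immersion
  have hd1 := (h.differentiableAt₁ hu).hasFDerivAt
  have hd2 := (h.differentiableAt₂ hu).hasFDerivAt
  have hdf := (hf.differentiableAt hu).hasFDerivAt
  have hh1 : DifferentiableAt ℝ (fun u => ⟪meanCurv f u, n₁ u⟫_ℝ) u :=
    ((contDiffOn_inner_meanCurv hf subset_rfl h.smooth₁
      (fun u hu => (h.isNormalFrame u hu).1)).contDiffAt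
      (hf.isOpen.mem_nhds hu)).differentiableAt (by simp)
  have hh2 : DifferentiableAt ℝ (fun u => ⟪meanCurv f u, n₂ u⟫_ℝ) u :=
    ((contDiffOn_inner_meanCurv hf subset_rfl h.smooth₂
      (fun u hu => (h.isNormalFrame u hu).2.1)).contDiffAt
      (hf.isOpen.mem_nhds hu)).differentiableAt (by simp)
  have e1 := (realVecL m).hasFDerivAt.comp u
    (hh1.hasFDerivAt.prodMk (hd1.add (hh1.hasFDerivAt.smul hdf)))
  have e2 := (realVecL m).hasFDerivAt.comp u
    (hh2.hasFDerivAt.prodMk (hd2.add (hh2.hasFDerivAt.smul hdf)))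
  have e3 : HasFDerivAt (coordLift f n₁ n₂) _ u := e1.sub (e2.const_smul Complex.I)
  obtain ⟨w, hw1, hw2⟩ := h.fderiv_normal hu he v
  set H₁ := ⟪meanCurv f u, n₁ u⟫_ℝ with hH1
  set H₂ := ⟪meanCurv f u, n₂ u⟫_ℝ with hH2
  set p := fderiv ℝ (fun u => ⟪meanCurv f u, n₁ u⟫_ℝ) u v with hp
  set q := fderiv ℝ (fun u => ⟪meanCurv f u, n₂ u⟫_ℝ) u v with hq
  have hval : fderiv ℝ (coordLift f n₁ n₂) u v =
      realVec p (fderiv ℝ n₁ u v + H₁ • fderiv ℝ f u v + p • f u) -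
      Complex.I • realVec q (fderiv ℝ n₂ u v + H₂ • fderiv ℝ f u v + q • f u) := by
    rw [e3.fderiv]
    simp [realVecL_apply, add_assoc]
    rfl
  -- The normal connection turns `n₁ - i n₂` by `i w`. The coefficient of the position vector
  -- collects the derivatives of the mean curvatures, minus what `i w ξ` already contains along that
  -- vector.
  refine ⟨Complex.I * w, p - Complex.I * q - Complex.I * w * (H₁ - Complex.I * H₂), ?_⟩
  rw [hval, hw1, hw2, coordLift, frameForm, frameVec]
  simp only [LinearMap.coe_mk, AddHom.coe_mk]
  rw [realVec_eq p, realVec_eq q, realVec_eq 1 (f u), realVec_eq ⟪meanCurv f u, n₁ u⟫_ℝ,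
    realVec_eq ⟪meanCurv f u, n₂ u⟫_ℝ, ← hH1, ← hH2]
  simp only [realVec_zero_add, realVec_zero_sub, realVec_zero_smul]
  push_cast
  match_scalars <;> ring_nf <;> simp only [Complex.I_sq] <;> ring_nf

end LiftDerivative

/-- The Lorentz products of the position vector `Y`, the value `ξ` and the (horizontal) derivative
`τ` of the complex curve of mean curvature spheres. -/
structure IsGaussPair {m : ℕ} (Y ξ τ : CLor m) (t : ℝ) : Prop where
  pos : 0 < t
  xi_xi : lor ξ ξ = 0
  xi_conj : lor ξ (conjL ξ) = 2
  tau_tau : lor τ τ = 0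
  xi_tau : lor ξ τ = 0
  tau_conj_xi : lor τ (conjL ξ) = 0
  tau_conj : lor τ (conjL τ) = 2 * (t : ℂ) ^ 2
  Y_xi : lor Y ξ = 0
  Y_tau : lor Y τ = 0

/-! ### Lorentz products of the lift and the reduction of its differential to one vector. -/

section LiftDerivative

variable {m : ℕ} {f : Euc m → Amb m} {Ω : Set (Euc m)} {u : Euc m}
  {e : Fin m → Euc m} {n₁ n₂ : Euc m → Amb m} {t : ℝ}

/-- `ξ₁` and `ξ₂` are orthonormal and orthogonal to `(1, f)` and `(0, df)`; hence `⟨ξ,ξ⟩ = 1 - 1`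
and `⟨ξ,ξ̄⟩ = 1 + 1`. -/
theorem IsWintgenFrameOn.lor_coordLift (h : IsWintgenFrameOn f n₁ n₂ Ω) (hu : u ∈ Ω) :
    lor (coordLift f n₁ n₂ u) (coordLift f n₁ n₂ u) = 0 ∧
    lor (coordLift f n₁ n₂ u) (conjL (coordLift f n₁ n₂ u)) = 2 ∧
    lor (realVec 1 (f u)) (coordLift f n₁ n₂ u) = 0 ∧
    ∀ a, lor (realVec 0 (fderiv ℝ f u a)) (coordLift f n₁ n₂ u) = 0 := by
  obtain ⟨hm1, hm2, hl1, hl2, horth⟩ := h.isNormalFrame u hu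
  have hp1 := mem_normalPlane_iff.1 hm1
  have hp2 := mem_normalPlane_iff.1 hm2
  have hnn1 : ⟪n₁ u, n₁ u⟫_ℝ = 1 := by rw [real_inner_self_eq_norm_sq, hl1, one_pow]
  have hnn2 : ⟪n₂ u, n₂ u⟫_ℝ = 1 := by rw [real_inner_self_eq_norm_sq, hl2, one_pow]
  have horth' : ⟪n₂ u, n₁ u⟫_ℝ = 0 := by rw [real_inner_comm]; exact horth
  have hq1 : ⟪n₁ u, f u⟫_ℝ = 0 := by rw [real_inner_comm]; exact hp1.1
  have hq2 : ⟪n₂ u, f u⟫_ℝ = 0 := by rw [real_inner_comm]; exact hp2.1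
  have hff := h.immersion.inner_self hu
  have hfa : ∀ a, ⟪fderiv ℝ f u a, f u⟫_ℝ = 0 := fun a => by
    rw [real_inner_comm]; exact h.immersion.inner_fderiv hu a
  simp only [coordLift, conjL_sub, conjL_smul, conjL_realVec, lor_sub_left, lor_sub_right,
    lor_smul_left, lor_smul_right, lor_realVec, inner_add_left, inner_add_right,
    real_inner_smul_left, real_inner_smul_right, hnn1, hnn2, horth, horth', hq1, hq2, hp1.1, hp2.1,
    hff, hfa, hp1.2, hp2.2, Complex.conj_I]
  push_cast
  refine ⟨?_, ?_, ?_, ?_⟩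
  · ring_nf; simp only [Complex.I_sq]; ring
  · ring_nf; simp only [Complex.I_sq]; ring
  · ring
  · intro a; ring

theorem IsNormalForm.lor_frameVec (hm : 2 ≤ m) (hf : IsImmersionOn f Ω) (hu : u ∈ Ω)
    {k₁ k₂ : Amb m} (he : IsNormalForm f u e k₁ k₂ t) :
    lor (frameVec f u e hm) (frameVec f u e hm) = 0 ∧
    lor (frameVec f u e hm) (conjL (frameVec f u e hm)) = 2 ∧
    lor (realVec 1 (f u)) (frameVec f u e hm) = 0 ∧
    ∀ a, lor (realVec 0 (fderiv ℝ f u a)) (frameVec f u e hm) =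
      Complex.I * frameForm f u e hm a := by
  have h01 : firstFF f u (e ⟨0, by omega⟩) (e ⟨1, by omega⟩) = 0 := by
    rw [he.frame]; simp
  have h10 : firstFF f u (e ⟨1, by omega⟩) (e ⟨0, by omega⟩) = 0 := by
    rw [he.frame]; simp
  have h00 : firstFF f u (e ⟨0, by omega⟩) (e ⟨0, by omega⟩) = 1 := by
    rw [he.frame]; simp
  have h11 : firstFF f u (e ⟨1, by omega⟩) (e ⟨1, by omega⟩) = 1 := by
    rw [he.frame]; simp
  have hff : ∀ a b, ⟪fderiv ℝ f u a, fderiv ℝ f u b⟫_ℝ = firstFF f u a b := fun a b => rfl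
  simp only [frameVec, conjL_add, conjL_smul, conjL_realVec, lor_add_left, lor_add_right,
    lor_smul_left, lor_smul_right, lor_realVec, hff, h00, h01, h10, h11, Complex.conj_I,
    hf.inner_fderiv hu, frameForm, LinearMap.coe_mk, AddHom.coe_mk]
  push_cast
  refine ⟨?_, ?_, ?_, ?_⟩
  · ring_nf; simp only [Complex.I_sq]; ring
  · ring_nf; simp only [Complex.I_sq]; ring
  · ring
  · intro a; ring_nf; simp only [Complex.I_sq]; ring

theorem IsWintgenFrameOn.lor_coordLift_frameVec (h : IsWintgenFrameOn f n₁ n₂ Ω) (hu : u ∈ Ω) :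
    lor (coordLift f n₁ n₂ u) (frameVec f u e h.two_le) = 0 ∧
    lor (frameVec f u e h.two_le) (conjL (coordLift f n₁ n₂ u)) = 0 ∧
    lor (realVec 1 (f u)) (conjL (coordLift f n₁ n₂ u)) = 0 := by
  obtain ⟨-, -, h3, h4⟩ := h.lor_coordLift hu
  have hc : ∀ a, lor (realVec 0 (fderiv ℝ f u a)) (conjL (coordLift f n₁ n₂ u)) = 0 := by
    intro a
    rw [← conjL_realVec, lor_conjL, h4, map_zero]
  refine ⟨?_, ?_, ?_⟩
  · rw [lor_comm, frameVec, lor_add_left, lor_smul_left, h4, h4]; ring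
  · rw [frameVec, lor_add_left, lor_smul_left, hc, hc]; ring
  · rw [← conjL_realVec, lor_conjL, h3, map_zero]

/-- The differential of the lift of the mean curvature spheres of a Wintgen ideal submanifold. -/
theorem IsWintgenFrameOn.exists_isGaussPair (h : IsWintgenFrameOn f n₁ n₂ Ω) (hu : u ∈ Ω)
    (he : IsNormalForm f u e (n₁ u) (n₂ u) t) :
    ∃ τ, IsGaussPair (realVec 1 (f u)) (coordLift f n₁ n₂ u) τ t ∧
      ∀ v, ∃ a : ℂ, fderiv ℝ (coordLift f n₁ n₂) u v =
        a • coordLift f n₁ n₂ u + frameForm f u e h.two_le v • τ := by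
  have hm := h.two_le
  have hf := h.immersion
  set ξ := coordLift f n₁ n₂ with hξ
  have hsm := h.contDiffOn_coordLift
  have hev : ∀ᶠ y in 𝓝 u, y ∈ Ω := hf.isOpen.mem_nhds hu
  have hD : ∀ y ∈ Ω, HasFDerivAt ξ (fderiv ℝ ξ y) y := fun y hy =>
    ((hsm.contDiffAt (hf.isOpen.mem_nhds hy)).differentiableAt (by simp)).hasFDerivAt
  have hD2 : DifferentiableAt ℝ (fderiv ℝ ξ) u :=
    ((hsm.fderiv_of_isOpen (m := ∞) hf.isOpen (by simp)).contDiffAt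
      (hf.isOpen.mem_nhds hu)).differentiableAt (by simp)
  -- products of first derivatives, on the whole domain
  have hprod : ∀ y ∈ Ω, (∀ v w, lor (fderiv ℝ ξ y v) (fderiv ℝ ξ y w) = 0) ∧
      (∀ v, lor (fderiv ℝ ξ y v) (ξ y) = 0) ∧
      (∀ v, lor (fderiv ℝ ξ y v) (realVec 1 (f y)) = 0) := by
    intro y hy
    obtain ⟨e', t', he'⟩ := h.exists_form y hy
    obtain ⟨p1, p2, p3, p4⟩ := h.lor_coordLift hy
    obtain ⟨q1, q2, q3, q4⟩ := he'.lor_frameVec hm hf hy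
    obtain ⟨r1, r2, r3⟩ := h.lor_coordLift_frameVec (e := e') hy
    have hYY : lor (realVec 1 (f y)) (realVec 1 (f y)) = 0 := by
      rw [lor_realVec, hf.inner_self hy]; simp
    rw [← hξ] at p1 p2 p3 r1
    have p3' : lor (ξ y) (realVec 1 (f y)) = 0 := by rw [lor_comm]; exact p3
    have r1' : lor (frameVec f y e' hm) (ξ y) = 0 := by rw [lor_comm]; exact r1
    have q3' : lor (frameVec f y e' hm) (realVec 1 (f y)) = 0 := by rw [lor_comm]; exact q3
    refine ⟨fun v w => ?_, fun v => ?_, fun v => ?_⟩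
    · obtain ⟨a, b, hv⟩ := h.exists_fderiv_coordLift hy he' v
      obtain ⟨a', b', hw⟩ := h.exists_fderiv_coordLift hy he' w
      rw [← hξ] at hv hw
      rw [hv, hw]
      simp only [lor_add_left, lor_sub_left, lor_smul_left, lor_add_right, lor_sub_right,
        lor_smul_right, p1, p3, p3', q1, q3, q3', r1, r1', hYY]
      ring
    · obtain ⟨a, b, hv⟩ := h.exists_fderiv_coordLift hy he' v
      rw [← hξ] at hv
      rw [hv]
      simp only [lor_add_left, lor_sub_left, lor_smul_left, p1, p3, r1']
      ring
    · obtain ⟨a, b, hv⟩ := h.exists_fderiv_coordLift hy he' v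
      rw [← hξ] at hv
      rw [hv]
      simp only [lor_add_left, lor_sub_left, lor_smul_left, p3', q3', hYY]
      ring
  have happ : ∀ w, HasFDerivAt (fun y => fderiv ℝ ξ y w)
      ((ContinuousLinearMap.apply ℝ (CLor m) w) ∘L fderiv ℝ (fderiv ℝ ξ) u) u :=
    fun w => hasFDerivAt_clm_apply_const hD2 w
  have hY : HasFDerivAt (fun y => realVec 1 (f y))
      ((realVecL m) ∘L ((0 : Euc m →L[ℝ] ℝ).prod (fderiv ℝ f u))) u :=
    (realVecL m).hasFDerivAt.comp u
      ((hasFDerivAt_const (1 : ℝ) u).prodMk (hf.differentiableAt hu).hasFDerivAt)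
  have hsym : ∀ a v, fderiv ℝ (fderiv ℝ ξ) u a v = fderiv ℝ (fderiv ℝ ξ) u v a := fun a v =>
    ((hsm.contDiffAt (hf.isOpen.mem_nhds hu)).isSymmSndFDerivAt (by
      simp only [minSmoothness_of_isRCLikeNormedField]
      exact WithTop.coe_le_coe.2 (le_top : (2 : ℕ∞) ≤ ⊤))) a v
  -- the second derivatives are orthogonal to the first ones
  have hanti : ∀ a v w, lor (fderiv ℝ (fderiv ℝ ξ) u a v) (fderiv ℝ ξ u w) =
      - lor (fderiv ℝ (fderiv ℝ ξ) u a w) (fderiv ℝ ξ u v) := by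
    intro a v w
    have := lor_fderiv_eq_zero (happ v) (happ w) (by
      filter_upwards [hev] with y hy using (hprod y hy).1 v w) a
    rw [lor_comm (fderiv ℝ ξ u v)] at this
    exact eq_neg_of_add_eq_zero_left this
  -- A trilinear expression symmetric in its first two arguments and skew in the last two vanishes,
  -- as in the uniqueness of the Levi-Civita connection.
  have hzero : ∀ a v w, lor (fderiv ℝ (fderiv ℝ ξ) u a v) (fderiv ℝ ξ u w) = 0 := by
    intro a v w
    have h1 := hanti a v w
    rw [hsym a w, hanti w a v, hsym w v, hanti v w a, hsym v a] at h1
    have h2 : (2 : ℂ) * lor (fderiv ℝ (fderiv ℝ ξ) u a v) (fderiv ℝ ξ u w) = 0 := by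
      linear_combination h1
    exact (mul_eq_zero.1 h2).resolve_left two_ne_zero
  have hxi : ∀ a v, lor (fderiv ℝ (fderiv ℝ ξ) u a v) (ξ u) = 0 := by
    intro a v
    have := lor_fderiv_eq_zero (happ v) (hD u hu) (by
      filter_upwards [hev] with y hy using (hprod y hy).2.1 v) a
    rw [(hprod u hu).1, add_zero] at this
    exact this
  have hYD : ∀ a v, lor (fderiv ℝ (fderiv ℝ ξ) u a v) (realVec 1 (f u)) =
      - lor (fderiv ℝ ξ u v) (realVec 0 (fderiv ℝ f u a)) := by
    intro a v
    have := lor_fderiv_eq_zero (happ v) hY (by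
      filter_upwards [hev] with y hy using (hprod y hy).2.2 v) a
    exact eq_neg_of_add_eq_zero_left this
  obtain ⟨p1, p2, p3, p4⟩ := h.lor_coordLift hu
  obtain ⟨q1, q2, q3, q4⟩ := he.lor_frameVec hm hf hu
  obtain ⟨r1, r2, r3⟩ := h.lor_coordLift_frameVec (e := e) hu
  rw [← hξ] at p1 p2 p3 r1 r2 r3
  have hYa : ∀ a, lor (realVec 1 (f u)) (realVec 0 (fderiv ℝ f u a)) = 0 := fun a => by
    rw [lor_realVec, hf.inner_fderiv hu]; simp
  have hlorD : ∀ a v, lor (fderiv ℝ ξ u v) (realVec 0 (fderiv ℝ f u a)) =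
      - (t * frameForm f u e hm v * (Complex.I * frameForm f u e hm a)) := by
    intro a v
    obtain ⟨x, y, hv⟩ := h.exists_fderiv_coordLift hu he v
    rw [← hξ] at hv
    rw [hv, lor_sub_left, lor_add_left, lor_smul_left, lor_smul_left, lor_smul_left, hYa,
      lor_comm (ξ u), p4, lor_comm (frameVec f u e hm), q4]
    ring
  have ht : (t : ℂ) ≠ 0 := by exact_mod_cast he.pos.ne'
  -- the vector `e₂`, on which the linear form of the frame takes the value one
  set e₁ := e ⟨1, by omega⟩ with he₁
  have hη : frameForm f u e hm e₁ = 1 := by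
    simp only [frameForm, LinearMap.coe_mk, AddHom.coe_mk, he₁]
    rw [he.frame, he.frame]
    simp
  set B := fderiv ℝ (fderiv ℝ ξ) u e₁ e₁ with hB
  have hBY : lor B (realVec 1 (f u)) = t * Complex.I := by
    rw [hB, hYD, hlorD, hη]; ring
  -- Orthogonality of `B` to `dξ(v)` reads `b · i t = t · η(v) · ⟨B, frameVec⟩`; solving for `b`
  -- gives `b = η(v) κ`. This step takes the place of the Codazzi equations.
  set κ : ℂ := - Complex.I * lor B (frameVec f u e hm) with hκ
  have hcoef : ∀ v, ∃ a : ℂ, fderiv ℝ ξ u v = a • ξ u +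
      frameForm f u e hm v • (κ • realVec 1 (f u) - (t : ℂ) • frameVec f u e hm) := by
    intro v
    obtain ⟨a, b, hv⟩ := h.exists_fderiv_coordLift hu he v
    rw [← hξ] at hv
    refine ⟨a, ?_⟩
    have h0 := hzero e₁ e₁ v
    rw [hv, lor_sub_right, lor_add_right, lor_smul_right, lor_smul_right, lor_smul_right, ← hB,
      hBY, hB, hxi, ← hB] at h0
    have hb : b = frameForm f u e hm v * κ := by
      have : (t : ℂ) * (b - frameForm f u e hm v * κ) = 0 := by
        rw [hκ]
        linear_combination (-Complex.I) * h0 + (b * t) * Complex.I_sq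
      exact sub_eq_zero.1 ((mul_eq_zero.1 this).resolve_left ht)
    rw [hv, hb]
    module
  refine ⟨κ • realVec 1 (f u) - (t : ℂ) • frameVec f u e hm, ?_, hcoef⟩
  have hYY : lor (realVec 1 (f u)) (realVec 1 (f u)) = 0 := by
    rw [lor_realVec, hf.inner_self hu]; simp
  have q3' : lor (frameVec f u e hm) (realVec 1 (f u)) = 0 := by rw [lor_comm]; exact q3
  have q5 : lor (realVec 1 (f u)) (conjL (frameVec f u e hm)) = 0 := by
    rw [← conjL_realVec, lor_conjL, q3, map_zero]
  refine ⟨he.pos, p1, p2, ?_, ?_, ?_, ?_, p3, ?_⟩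
  · simp only [lor_sub_left, lor_sub_right, lor_smul_left, lor_smul_right, hYY, q3, q3', q1]
    ring
  · rw [lor_comm]
    simp only [lor_sub_left, lor_smul_left, p3]
    rw [lor_comm (frameVec f u e hm), r1]; ring
  · simp only [lor_sub_left, lor_smul_left, r2, r3]; ring
  · simp only [conjL_sub, conjL_smul, conjL_realVec, lor_sub_left, lor_sub_right, lor_smul_left,
      lor_smul_right, hYY, q3', q5, q2, Complex.conj_ofReal]
    ring
  · simp only [lor_sub_right, lor_smul_right, hYY, q3]; ring

end LiftDerivative

/-! ### Adapted frames -/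

section Adapted

variable {m : ℕ} {f : Euc m → Amb m} {Ω : Set (Euc m)} {u : Euc m}
  {e : Fin m → Euc m} {k₁ k₂ : Amb m} {t : ℝ}

theorem offDiagForm_sq (t : ℝ) (i j : Fin m) : offDiagForm t i j ^ 2 = offDiagForm (t ^ 2) i j := by
  unfold offDiagForm; split_ifs <;> simp

/-- Squaring loses the sign of the second diagonal entry; the weight restores it, in the product
shape that `sum_diagForm` expects. -/
theorem diagForm_sq (t : ℝ) (i j : Fin m) :
    diagForm t i j ^ 2 = (if i.val = 1 then -1 else 1) * 1 * diagForm (t ^ 2) i j := by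
  unfold diagForm
  by_cases h0 : i.val = 0 <;> by_cases h1 : i.val = 1 <;> simp [h0, h1]

/-- Each of the two normal forms has two entries `±t`. -/
theorem IsNormalForm.tracelessNormSq_eq (hm : 2 ≤ m) (h : IsNormalForm f u e k₁ k₂ t)
    (hn : IsNormalFrame f u k₁ k₂) (hr : Module.finrank ℝ (normalPlane f u) = 2) :
    tracelessNormSq f u = 4 * t ^ 2 := by
  have h1 : ∀ i j, ‖tracelessFF f u (e i) (e j)‖ ^ 2 =
      1 * 1 * offDiagForm (t ^ 2) i j + (if i.val = 1 then -1 else 1) * 1 * diagForm (t ^ 2) i j := by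
    intro i j
    rw [← real_inner_self_eq_norm_sq, hn.inner_eq hr (tracelessFF_mem _ _), h.form₁, h.form₂,
      ← diagForm_sq, ← offDiagForm_sq]
    ring
  rw [h.frame.tracelessNormSq_eq]
  simp only [h1, Finset.sum_add_distrib]
  rw [sum_offDiagForm hm (t ^ 2) (fun _ => 1) (fun _ => 1),
    sum_diagForm hm (t ^ 2) (fun i => if i.val = 1 then -1 else 1) (fun _ => 1)]
  simp; ring

theorem mu_pos (hm : 2 ≤ m) : 0 < mu m := by
  have h : (2 : ℝ) ≤ m := by exact_mod_cast hm
  exact Real.sqrt_pos.2 (div_pos (by linarith) (by linarith))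

/-- `ρ² = (m/(m-1)) · 4t²` and `μ² = (m-1)/(4m)`: the constant `μ` is what relates the parameter of
the normal form to the Möbius metric. -/
theorem IsNormalForm.mu_mul_rho (hm : 2 ≤ m) (h : IsNormalForm f u e k₁ k₂ t)
    (hn : IsNormalFrame f u k₁ k₂) (hr : Module.finrank ℝ (normalPlane f u) = 2) :
    mu m * rho f u = t := by
  have h2 : (2 : ℝ) ≤ m := by exact_mod_cast hm
  have h3 : (m : ℝ) - 1 ≠ 0 := by linarith
  rw [mu, rho, ← Real.sqrt_mul (div_nonneg (by linarith) (by linarith)),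
    h.tracelessNormSq_eq hm hn hr]
  rw [show ((m : ℝ) - 1) / (4 * m) * (m / (m - 1) * (4 * t ^ 2)) = t ^ 2 by field_simp]
  exact Real.sqrt_sq h.pos.le

theorem firstFF_smul (c : ℝ) (v w : Euc m) :
    firstFF f u (c • v) (c • w) = c ^ 2 * firstFF f u v w := by
  simp only [← firstFFBilin_apply, map_smul, LinearMap.smul_apply, smul_eq_mul]; ring

theorem tracelessFF_smul (c : ℝ) (v w : Euc m) :
    tracelessFF f u (c • v) (c • w) = c ^ 2 • tracelessFF f u v w := by
  simp only [← tracelessBilin_apply, map_smul, LinearMap.smul_apply, smul_smul, pow_two]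

/-- The kernel of the complex linear form of a frame in normal form is the kernel of the trace-free
second fundamental form. -/
theorem IsNormalForm.frameForm_eq_zero_iff (hm : 2 ≤ m) (h : IsNormalForm f u e k₁ k₂ t)
    (hn : IsNormalFrame f u k₁ k₂) (hr : Module.finrank ℝ (normalPlane f u) = 2) (v : Euc m) :
    frameForm f u e hm v = 0 ↔ ∀ w, tracelessFF f u v w = 0 := by
  have hre : frameForm f u e hm v = 0 ↔
      firstFF f u v (e ⟨0, by omega⟩) = 0 ∧ firstFF f u v (e ⟨1, by omega⟩) = 0 := by
    rw [Complex.ext_iff, and_comm]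
    simp [frameForm]
  have h01 : firstFF f u (e ⟨0, by omega⟩) (e ⟨1, by omega⟩) = 0 := by
    rw [h.frame]; simp
  have h00 : firstFF f u (e ⟨0, by omega⟩) (e ⟨0, by omega⟩) = 1 := by
    rw [h.frame]; simp
  rw [hre]
  constructor
  · rintro ⟨h0, h1⟩ w
    rw [hn.expand hr (tracelessFF_mem (f := f) (u := u) v w), h.inner₁ hm, h.inner₂ hm, h0, h1]
    simp
  · intro hv
    have h1 := h.inner₁ hm v (e ⟨0, by omega⟩)
    have h2 := h.inner₂ hm v (e ⟨0, by omega⟩)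
    rw [hv, inner_zero_left, h00, h01] at h1 h2
    have ht := h.pos.ne'
    constructor
    · have : t * firstFF f u v (e ⟨0, by omega⟩) = 0 := by linarith
      exact (mul_eq_zero.1 this).resolve_left ht
    · have : t * firstFF f u v (e ⟨1, by omega⟩) = 0 := by linarith
      exact (mul_eq_zero.1 this).resolve_left ht

theorem frameForm_eq_zero_iff_mem_span (hm : 2 ≤ m) (he : IsTangentFrame f u e) (v : Euc m) :
    frameForm f u e hm v = 0 ↔ v ∈ Submodule.span ℝ {w | ∃ a : Fin m, 2 ≤ a.val ∧ w = e a} := by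
  have hre : ∀ v, frameForm f u e hm v = 0 ↔
      firstFF f u v (e ⟨0, by omega⟩) = 0 ∧ firstFF f u v (e ⟨1, by omega⟩) = 0 := by
    intro v
    rw [Complex.ext_iff, and_comm]
    simp [frameForm]
  constructor
  · intro hv
    rw [hre] at hv
    rw [← he.expand v]
    refine Submodule.sum_mem _ fun k _ => ?_
    by_cases hk : 2 ≤ k.val
    · exact Submodule.smul_mem _ _ (Submodule.subset_span ⟨k, hk, rfl⟩)
    · have : k = ⟨0, by omega⟩ ∨ k = ⟨1, by omega⟩ := by
        simp only [Fin.ext_iff]; omega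
      rcases this with h | h
      · rw [h, hv.1, zero_smul]; exact Submodule.zero_mem _
      · rw [h, hv.2, zero_smul]; exact Submodule.zero_mem _
  · intro hv
    have : Submodule.span ℝ {w | ∃ a : Fin m, 2 ≤ a.val ∧ w = e a} ≤
        LinearMap.ker (frameForm f u e hm) := by
      rw [Submodule.span_le]
      rintro w ⟨a, ha, rfl⟩
      change frameForm f u e hm (e a) = 0
      rw [hre, he, he]
      constructor
      · rw [if_neg]; rintro rfl; simp at ha
      · rw [if_neg]; rintro rfl; simp at ha
    exact this hv

theorem frameForm_surjective (hm : 2 ≤ m) (he : IsTangentFrame f u e) :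
    Function.Surjective (frameForm f u e hm) := by
  intro z
  have h0 : frameForm f u e hm (e ⟨0, by omega⟩) = - Complex.I := by
    simp only [frameForm, LinearMap.coe_mk, AddHom.coe_mk]
    rw [he, he]; simp
  have h1 : frameForm f u e hm (e ⟨1, by omega⟩) = 1 := by
    simp only [frameForm, LinearMap.coe_mk, AddHom.coe_mk]
    rw [he, he]; simp
  refine ⟨z.re • e ⟨1, by omega⟩ + (-z.im) • e ⟨0, by omega⟩, ?_⟩
  rw [map_add, map_smul, map_smul, h0, h1]
  apply Complex.ext <;> simp

/-- On the orthogonal complement of its kernel the form of a frame is isometric. -/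
theorem normSq_frameForm (hm : 2 ≤ m) (he : IsTangentFrame f u e) {v : Euc m}
    (hv : ∀ w, frameForm f u e hm w = 0 → firstFF f u v w = 0) :
    Complex.normSq (frameForm f u e hm v) = firstFF f u v v := by
  have h1 : firstFF f u v v = ∑ k, firstFF f u v (e k) * firstFF f u v (e k) := by
    conv_lhs => rw [← firstFFBilin_apply]; arg 2; rw [← he.expand v]
    simp [firstFFBilin_apply]
  have h2 : ∀ k : Fin m, 2 ≤ k.val → firstFF f u v (e k) = 0 := fun k hk =>
    hv _ ((frameForm_eq_zero_iff_mem_span hm he _).2 (Submodule.subset_span ⟨k, hk, rfl⟩))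
  have hne : (⟨0, by omega⟩ : Fin m) ≠ ⟨1, by omega⟩ := by simp [Fin.ext_iff]
  rw [h1, ← Finset.sum_subset (Finset.subset_univ {⟨0, by omega⟩, ⟨1, by omega⟩}),
    Finset.sum_pair hne]
  · rw [Complex.normSq_apply]; simp [frameForm]; ring
  · intro k _ hk
    rw [h2 k, mul_zero]
    simp only [Finset.mem_insert, Finset.mem_singleton, not_or, Fin.ext_iff] at hk
    omega

end Adapted

/-! ### Adapted frames of a submanifold and the distribution `𝔻^⊥`. -/

section AdaptedManifold

variable {m : ℕ} {M : Type*} [TopologicalSpace M] [ChartedSpace (Euc m) M]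
  [IsManifold (𝓡 m) ∞ M] {x : M → Amb m}

/-- Multiplication by `ρ` makes a Möbius-orthonormal frame orthonormal for the first fundamental
form. The second fundamental form then gains `ρ²`, of which `mobiusFF` already contains one factor,
so the entries `μ` become `μρ`. -/
theorem isAdaptedFrame_iff (p : M) (hρ : 0 < rho (localRep x p) (basePt p)) (hm : 2 ≤ m)
    {E : Fin m → Euc m} {n₁ n₂ : Amb m} (hn : IsNormalFrame (localRep x p) (basePt p) n₁ n₂) :
    IsAdaptedFrame x p E n₁ n₂ ↔
      IsNormalForm (localRep x p) (basePt p) (fun i => rho (localRep x p) (basePt p) • E i) n₁ n₂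
        (mu m * rho (localRep x p) (basePt p)) := by
  set ρ := rho (localRep x p) (basePt p) with hρd
  have h1 : ∀ i j, offDiagForm (mu m * ρ) i j = ρ * normalForm₁ m i j := by
    intro i j; unfold offDiagForm normalForm₁; split_ifs <;> ring
  have h2 : ∀ i j, diagForm (mu m * ρ) i j = ρ * normalForm₂ m i j := by
    intro i j; unfold diagForm normalForm₂; split_ifs <;> ring
  have h3 : ∀ n i j, ⟪tracelessFF (localRep x p) (basePt p) (ρ • E i) (ρ • E j), n⟫_ℝ =
      ρ * mobiusFF x p n (E i) (E j) := by
    intro n i j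
    rw [tracelessFF_smul, real_inner_smul_left]
    change ρ ^ 2 * _ = ρ * (ρ * ⟪tracelessFF (localRep x p) (basePt p) (E i) (E j), n⟫_ℝ)
    ring
  constructor
  · intro h
    refine ⟨mul_pos (mu_pos hm) hρ, fun i j => ?_, fun i j => ?_, fun i j => ?_⟩
    · rw [firstFF_smul]; exact h.orthonormal i j
    · rw [h3, h.form₁, h1]
    · rw [h3, h.form₂, h2]
  · intro h
    refine ⟨fun i j => ?_, hn, fun i j => ?_, fun i j => ?_⟩
    · rw [← h.frame i j, firstFF_smul]; rfl
    · have := h.form₁ i j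
      rw [h3, h1] at this
      exact mul_left_cancel₀ hρ.ne' this
    · have := h.form₂ i j
      rw [h3, h2] at this
      exact mul_left_cancel₀ hρ.ne' this

theorem IsNormalOrientation.isNormalFrame {J : M → Amb m →L[ℝ] Amb m}
    (hJ : IsNormalOrientation x J) {p : M} {n : Amb m} (hn : n ∈ normalAt x p) (h1 : ‖n‖ = 1) :
    IsNormalFrame (localRep x p) (basePt p) n (J p n) :=
  ⟨hn, hJ.mapsTo p n hn, h1, by rw [hJ.norm_eq p n hn, h1],
    by rw [real_inner_comm]; exact hJ.inner_eq_zero p n hn⟩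

theorem exists_unit_normal (hx : IsSphereImmersion x) (p : M) :
    ∃ n ∈ normalAt x p, ‖n‖ = 1 := by
  have hr := (hx.isImmersionOn p).finrank_normalPlane (basePt_mem p)
  have : 0 < Module.finrank ℝ (normalPlane (localRep x p) (basePt p)) := by omega
  obtain ⟨v, hv⟩ := Module.finrank_pos_iff_exists_ne_zero.1 this
  have hv' : (v : Amb m) ≠ 0 := by simpa using hv
  refine ⟨‖(v : Amb m)‖⁻¹ • (v : Amb m), Submodule.smul_mem _ _ v.2, ?_⟩
  rw [norm_smul, norm_inv, norm_norm, inv_mul_cancel₀ (norm_ne_zero_iff.2 hv')]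

theorem rho_pos (hm : 2 ≤ m) (hx : IsSphereImmersion x) {p : M} {e : Fin m → Euc m}
    {n₁ n₂ : Amb m} {t : ℝ} (hn : IsNormalFrame (localRep x p) (basePt p) n₁ n₂)
    (h : IsNormalForm (localRep x p) (basePt p) e n₁ n₂ t) :
    0 < rho (localRep x p) (basePt p) := by
  have h1 := h.mu_mul_rho hm hn ((hx.isImmersionOn p).finrank_normalPlane (basePt_mem p))
  have h2 := h.pos
  rw [← h1] at h2
  exact (mul_pos_iff_of_pos_left (mu_pos hm)).1 h2

theorem exists_isAdaptedFrame (hm : 2 ≤ m) (hx : IsSphereImmersion x) (hW : IsWintgenIdeal x)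
    (hU : IsUmbilicFree x) {p : M} {n₁ n₂ : Amb m}
    (hn : IsNormalFrame (localRep x p) (basePt p) n₁ n₂) : ∃ E, IsAdaptedFrame x p E n₁ n₂ := by
  obtain ⟨e, t, he⟩ := exists_isNormalForm_basePt hm hx hW hU p hn
  have hρ := rho_pos hm hx hn he
  refine ⟨fun i => (rho (localRep x p) (basePt p))⁻¹ • e i, ?_⟩
  have := (isAdaptedFrame_iff p hρ hm
    (E := fun i => (rho (localRep x p) (basePt p))⁻¹ • e i) hn).2
  apply this
  simp only [smul_inv_smul₀ hρ.ne']
  rwa [he.mu_mul_rho hm hn ((hx.isImmersionOn p).finrank_normalPlane (basePt_mem p))]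

/-- The right-hand side, the nullity of the trace-free second fundamental form, makes no reference
to the frame; this is why `𝔻^⊥` is well defined. -/
theorem IsAdaptedFrame.mem_span_iff (hm : 2 ≤ m) (hx : IsSphereImmersion x)
    (hW : IsWintgenIdeal x) (hU : IsUmbilicFree x) {p : M} {E : Fin m → Euc m} {n₁ n₂ : Amb m}
    (h : IsAdaptedFrame x p E n₁ n₂) (v : Euc m) :
    v ∈ Submodule.span ℝ {w | ∃ a : Fin m, 2 ≤ a.val ∧ w = E a} ↔
      ∀ w, tracelessFF (localRep x p) (basePt p) v w = 0 := by
  have hr := (hx.isImmersionOn p).finrank_normalPlane (basePt_mem p)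
  obtain ⟨e, t, he⟩ := exists_isNormalForm_basePt hm hx hW hU p h.normal
  have hρ := rho_pos hm hx h.normal he
  have hN := (isAdaptedFrame_iff p hρ hm h.normal).1 h
  rw [← hN.frameForm_eq_zero_iff hm h.normal hr, frameForm_eq_zero_iff_mem_span hm hN.frame]
  set ρ := rho (localRep x p) (basePt p)
  have : Submodule.span ℝ {w | ∃ a : Fin m, 2 ≤ a.val ∧ w = E a} =
      Submodule.span ℝ {w | ∃ a : Fin m, 2 ≤ a.val ∧ w = ρ • E a} := by
    apply le_antisymm
    · rw [Submodule.span_le]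
      rintro w ⟨a, ha, rfl⟩
      have := Submodule.smul_mem (Submodule.span ℝ {w | ∃ a : Fin m, 2 ≤ a.val ∧ w = ρ • E a}) ρ⁻¹
        (Submodule.subset_span ⟨a, ha, rfl⟩)
      rwa [inv_smul_smul₀ hρ.ne'] at this
    · rw [Submodule.span_le]
      rintro w ⟨a, ha, rfl⟩
      exact Submodule.smul_mem _ _ (Submodule.subset_span ⟨a, ha, rfl⟩)
  rw [this]

theorem mem_Dperp_iff (hm : 2 ≤ m) (hx : IsSphereImmersion x)
    (hW : IsWintgenIdeal x) (hU : IsUmbilicFree x) {J : M → Amb m →L[ℝ] Amb m}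
    (hJ : IsNormalOrientation x J) (p : M) (v : Euc m) :
    v ∈ Dperp x p ↔ ∀ w, tracelessFF (localRep x p) (basePt p) v w = 0 := by
  obtain ⟨n, hn, hn1⟩ := exists_unit_normal hx p
  obtain ⟨E, hE⟩ := exists_isAdaptedFrame hm hx hW hU (hJ.isNormalFrame hn hn1)
  rw [← hE.mem_span_iff hm hx hW hU]
  have : Dperp x p = Submodule.span ℝ {w | ∃ a : Fin m, 2 ≤ a.val ∧ w = E a} := by
    apply le_antisymm
    · refine Submodule.span_le.2 ?_
      rintro w ⟨E', n₁, n₂, hE', a, ha, rfl⟩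
      have h1 : E' a ∈ Submodule.span ℝ {w : Euc m | ∃ a : Fin m, 2 ≤ a.val ∧ w = E' a} :=
        Submodule.subset_span ⟨a, ha, rfl⟩
      exact (hE.mem_span_iff hm hx hW hU _).2 ((hE'.mem_span_iff hm hx hW hU _).1 h1)
    · refine Submodule.span_le.2 ?_
      rintro w ⟨a, ha, rfl⟩
      exact Submodule.subset_span ⟨E, n, J p n, hE, a, ha, rfl⟩
  rw [this]
  rfl

theorem Dperp_eq_span (hm : 2 ≤ m) (hx : IsSphereImmersion x)
    (hW : IsWintgenIdeal x) (hU : IsUmbilicFree x) {J : M → Amb m →L[ℝ] Amb m}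
    (hJ : IsNormalOrientation x J) {p : M} {E : Fin m → TangentSpace (𝓡 m) p} {n₁ n₂ : Amb m}
    (h : IsAdaptedFrame x p E n₁ n₂) :
    Dperp x p = Submodule.span ℝ {v | ∃ a : Fin m, 2 ≤ a.val ∧ v = E a} := by
  ext v
  exact (mem_Dperp_iff hm hx hW hU hJ p v).trans (h.mem_span_iff hm hx hW hU v).symm

end AdaptedManifold

/-! ### Lifts of maps into the projective space -/

section VectorDerivative

variable {E H X W W' : Type*} [NormedAddCommGroup E] [NormedSpace ℝ E] [TopologicalSpace H]
  [TopologicalSpace X] [ChartedSpace H X] [NormedAddCommGroup W] [NormedSpace ℝ W]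
  [NormedAddCommGroup W'] [NormedSpace ℝ W']

/-- The differential at `p` of a map from a manifold into a vector space, on the model space. -/
def vderiv (I : ModelWithCorners ℝ E H) (g : X → W) (p : X) : E →L[ℝ] W :=
  mfderiv I 𝓘(ℝ, W) g p

variable {I : ModelWithCorners ℝ E H} {g g' : X → W} {p : X}

theorem vderiv_congr (h : g =ᶠ[𝓝 p] g') : vderiv I g p = vderiv I g' p := h.mfderiv_eq

theorem vderiv_comp {F : W → W'} (hF : DifferentiableAt ℝ F (g p))
    (hg : MDifferentiableAt I 𝓘(ℝ, W) g p) (v : E) :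
    vderiv I (F ∘ g) p v = fderiv ℝ F (g p) (vderiv I g p v) := by
  have h := DFunLike.congr_fun (mfderiv_comp (I' := 𝓘(ℝ, W)) p hF.mdifferentiableAt hg) v
  rw [mfderiv_eq_fderiv] at h
  exact h

end VectorDerivative

/-! ### Normalized lifts and the comparison of the differentials of different lifts. -/

section Lifts

variable {N : ℕ}

/-- The representative of a point of the projective space whose `k`-th coordinate is `1`. -/
def normRep (k : Fin N) (P : ℙ ℂ (Fin N → ℂ)) : Fin N → ℂ := (P.rep k)⁻¹ • P.rep

/-- The normalization is invariant under scaling, so the arbitrary representative in its definition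
plays no role; its components are the affine coordinates of the projective space. -/
theorem normRep_mk (k : Fin N) {v : Fin N → ℂ} (hv : v ≠ 0) :
    normRep k (Projectivization.mk ℂ v hv) = (v k)⁻¹ • v := by
  obtain ⟨a, ha⟩ := Projectivization.exists_smul_eq_mk_rep ℂ v hv
  rw [normRep, ← ha, Units.smul_def, Pi.smul_apply, smul_eq_mul, smul_smul, mul_inv, mul_comm,
    ← mul_assoc, mul_inv_cancel₀ a.ne_zero, one_mul]

theorem rep_mk_ne_zero_iff (k : Fin N) {v : Fin N → ℂ} (hv : v ≠ 0) :
    (Projectivization.mk ℂ v hv).rep k ≠ 0 ↔ v k ≠ 0 := by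
  obtain ⟨a, ha⟩ := Projectivization.exists_smul_eq_mk_rep ℂ v hv
  rw [← ha, Units.smul_def, Pi.smul_apply, smul_eq_mul, mul_ne_zero_iff]
  exact and_iff_right a.ne_zero

theorem normRep_self {k : Fin N} {P : ℙ ℂ (Fin N → ℂ)} (h : P.rep k ≠ 0) : normRep k P k = 1 := by
  simp [normRep, h]

theorem normRep_ne_zero {k : Fin N} {P : ℙ ℂ (Fin N → ℂ)} (h : P.rep k ≠ 0) :
    normRep k P ≠ 0 := fun h0 => by
  have := normRep_self h
  rw [h0] at this; simp at this

theorem mk_normRep {k : Fin N} {P : ℙ ℂ (Fin N → ℂ)} (h : P.rep k ≠ 0) :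
    Projectivization.mk ℂ (normRep k P) (normRep_ne_zero h) = P := by
  conv_rhs => rw [← Projectivization.mk_rep P]
  rw [Projectivization.mk_eq_mk_iff']
  exact ⟨(P.rep k)⁻¹, rfl⟩

theorem eq_of_normRep_eq {k : Fin N} {P Q : ℙ ℂ (Fin N → ℂ)} (hP : P.rep k ≠ 0)
    (hQ : Q.rep k ≠ 0) (h : normRep k P = normRep k Q) : P = Q := by
  rw [← mk_normRep hP, ← mk_normRep hQ]
  simp only [h]

theorem exists_rep_ne_zero (P : ℙ ℂ (Fin N → ℂ)) : ∃ k, P.rep k ≠ 0 := by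
  by_contra! h
  exact P.rep_nonzero (funext h)

variable {E H X : Type*} [NormedAddCommGroup E] [NormedSpace ℝ E] [TopologicalSpace H]
  [TopologicalSpace X] [ChartedSpace H X]

/-- A lift, smooth at `p`, of a map into the projective space. -/
structure IsLiftAt (I : ModelWithCorners ℝ E H) (F : X → ℙ ℂ (Fin N → ℂ)) (ξ : X → Fin N → ℂ)
    (p : X) : Prop where
  smooth : ContMDiffAt I 𝓘(ℝ, Fin N → ℂ) ∞ ξ p
  lifts : ∀ᶠ q in 𝓝 p, ∃ h : ξ q ≠ 0, Projectivization.mk ℂ (ξ q) h = F q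

variable {I : ModelWithCorners ℝ E H} {F : X → ℙ ℂ (Fin N → ℂ)} {ξ : X → Fin N → ℂ} {p : X}

theorem IsLiftAt.ne_zero (h : IsLiftAt I F ξ p) : ξ p ≠ 0 := h.lifts.self_of_nhds.choose

theorem IsLiftAt.mk_eq (h : IsLiftAt I F ξ p) : Projectivization.mk ℂ (ξ p) h.ne_zero = F p :=
  h.lifts.self_of_nhds.choose_spec

theorem IsLiftAt.rep_ne_zero_iff (h : IsLiftAt I F ξ p) (k : Fin N) :
    (F p).rep k ≠ 0 ↔ ξ p k ≠ 0 := by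
  rw [← h.mk_eq, rep_mk_ne_zero_iff]

theorem IsLiftAt.normRep_eventuallyEq (h : IsLiftAt I F ξ p) (k : Fin N) :
    (normRep k ∘ F) =ᶠ[𝓝 p] (fun v => (v k)⁻¹ • v) ∘ ξ := by
  filter_upwards [h.lifts] with q ⟨hq, hq'⟩
  rw [Function.comp_apply, ← hq', normRep_mk, Function.comp_apply]

theorem contDiffAt_normalize {k : Fin N} {v : Fin N → ℂ} (hv : v k ≠ 0) :
    ContDiffAt ℝ ∞ (fun w : Fin N → ℂ => (w k)⁻¹ • w) v :=
  (ContDiffAt.inv (ContinuousLinearMap.proj k : (Fin N → ℂ) →L[ℝ] ℂ).contDiff.contDiffAt hv).smul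
    contDiffAt_id

theorem fderiv_normalize {k : Fin N} {v : Fin N → ℂ} (hv : v k ≠ 0) (w : Fin N → ℂ) :
    fderiv ℝ (fun w : Fin N → ℂ => (w k)⁻¹ • w) v w = (v k)⁻¹ • w - ((v k)⁻¹ ^ 2 * w k) • v := by
  have h1 : HasFDerivAt (fun w : Fin N → ℂ => w k)
      (ContinuousLinearMap.proj k : (Fin N → ℂ) →L[ℝ] ℂ) v :=
    (ContinuousLinearMap.proj k : (Fin N → ℂ) →L[ℝ] ℂ).hasFDerivAt
  have h2 := ((hasDerivAt_inv hv).hasFDerivAt.restrictScalars ℝ).comp v h1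
  have h3 := h2.smul (hasFDerivAt_id (𝕜 := ℝ) v)
  have h4 : HasFDerivAt (fun w : Fin N → ℂ => (w k)⁻¹ • w) _ v := h3
  rw [h4.fderiv]
  simp [sub_eq_add_neg, mul_comm]

theorem eventually_lift_ne_zero (h : IsLiftAt I F ξ p) {k : Fin N} (hk : ξ p k ≠ 0) :
    ∀ᶠ q in 𝓝 p, ξ q k ≠ 0 :=
  ((continuous_apply k).continuousAt.comp h.smooth.continuousAt).eventually_ne hk

/-- Existence of some smooth lift makes the normalized lift smooth, since `v ↦ v / v k` is smooth
where `v k ≠ 0`. -/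
theorem IsLiftAt.normRep (h : IsLiftAt I F ξ p) {k : Fin N} (hk : (F p).rep k ≠ 0) :
    IsLiftAt I F (normRep k ∘ F) p := by
  have hk' := (h.rep_ne_zero_iff k).1 hk
  constructor
  · exact ((contDiffAt_normalize hk').contMDiffAt.comp p h.smooth).congr_of_eventuallyEq
      (h.normRep_eventuallyEq k)
  · filter_upwards [h.lifts, eventually_lift_ne_zero h hk'] with q ⟨hq, hq'⟩ hqk
    have : (F q).rep k ≠ 0 := by rw [← hq', rep_mk_ne_zero_iff]; exact hqk
    exact ⟨normRep_ne_zero this, mk_normRep this⟩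

theorem IsLiftAt.eventually_rep_ne_zero (h : IsLiftAt I F ξ p) {k : Fin N}
    (hk : (F p).rep k ≠ 0) : ∀ᶠ q in 𝓝 p, (F q).rep k ≠ 0 := by
  filter_upwards [h.lifts, eventually_lift_ne_zero h ((h.rep_ne_zero_iff k).1 hk)]
    with q ⟨hq, hq'⟩ hqk
  rw [← hq', rep_mk_ne_zero_iff]; exact hqk

theorem IsLiftAt.mfderiv_normRep (h : IsLiftAt I F ξ p) {k : Fin N} (hk : (F p).rep k ≠ 0)
    (v : E) :
    vderiv I (Wintgen.normRep k ∘ F) p v =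
      (ξ p k)⁻¹ • vderiv I ξ p v -
        ((ξ p k)⁻¹ ^ 2 * vderiv I ξ p v k) • ξ p := by
  have hk' := (h.rep_ne_zero_iff k).1 hk
  rw [vderiv_congr (h.normRep_eventuallyEq k), vderiv_comp
    ((contDiffAt_normalize hk').differentiableAt (by simp)) (h.smooth.mdifferentiableAt (by simp)),
    fderiv_normalize hk']

/-- The differential of a lift in terms of the differential of a normalized lift. -/
theorem IsLiftAt.mfderiv_eq (h : IsLiftAt I F ξ p) {k : Fin N} (hk : (F p).rep k ≠ 0)
    (v : E) :
    ∃ a : ℂ, vderiv I ξ p v =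
      ξ p k • vderiv I (Wintgen.normRep k ∘ F) p v + a • ξ p := by
  have hk' := (h.rep_ne_zero_iff k).1 hk
  refine ⟨(ξ p k)⁻¹ * vderiv I ξ p v k, ?_⟩
  rw [h.mfderiv_normRep hk, smul_sub, smul_smul, smul_smul, mul_inv_cancel₀ hk', one_smul]
  rw [show ξ p k * ((ξ p k)⁻¹ ^ 2 * vderiv I ξ p v k) =
    (ξ p k)⁻¹ * vderiv I ξ p v k by field_simp]
  abel

/-- The complex-valued form `η` and the vectors `ξ₀`, `τ₀` describe the differential at `p` of every
lift of `F`. -/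
def HasFormAt (I : ModelWithCorners ℝ E H) (F : X → ℙ ℂ (Fin N → ℂ)) (p : X)
    (η : E →ₗ[ℝ] ℂ) (ξ₀ τ₀ : Fin N → ℂ) : Prop :=
  ∀ ξ, IsLiftAt I F ξ p → ∃ c : ℂ, c ≠ 0 ∧ ξ p = c • ξ₀ ∧ ∀ v : E, ∃ a : ℂ,
    vderiv I ξ p v =
      a • ξ₀ + (c * η v) • τ₀

/-- Two lifts differ by a scalar function, which changes the differential by a multiple of the lift.
Both are compared with the normalized lift, so the scalar function itself is never differentiated.
-/
theorem IsLiftAt.hasFormAt (h : IsLiftAt I F ξ p) {η : E →ₗ[ℝ] ℂ} {τ : Fin N → ℂ}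
    (hτ : ∀ v : E, ∃ a : ℂ, vderiv I ξ p v =
      a • ξ p + η v • τ) : HasFormAt I F p η (ξ p) τ := by
  intro ξ' h'
  obtain ⟨k, hk⟩ := exists_rep_ne_zero (F p)
  have hξ := (h.rep_ne_zero_iff k).1 hk
  have hξ' := (h'.rep_ne_zero_iff k).1 hk
  have hc : ξ' p = (ξ' p k / ξ p k) • ξ p := by
    have := h.mk_eq.trans h'.mk_eq.symm
    obtain ⟨a, ha⟩ := (Projectivization.mk_eq_mk_iff' ℂ _ _ _ _).1 this
    have h1 : ξ p k = a * ξ' p k := by rw [← ha]; rfl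
    have h2 : a ≠ 0 := by rintro rfl; simp at h1; exact hξ h1
    rw [← ha, smul_smul]
    simp only [Pi.smul_apply, smul_eq_mul]
    rw [show ξ' p k / (a * ξ' p k) * a = 1 by field_simp, one_smul]
  refine ⟨ξ' p k / ξ p k, div_ne_zero hξ' hξ, hc, fun v => ?_⟩
  obtain ⟨a, ha⟩ := hτ v
  obtain ⟨a', ha'⟩ := h'.mfderiv_eq hk v
  have h3 := h.mfderiv_normRep hk v
  refine ⟨ξ' p k * (ξ p k)⁻¹ * a - ξ' p k * ((ξ p k)⁻¹ ^ 2 *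
    vderiv I ξ p v k) +
      a' * (ξ' p k / ξ p k), ?_⟩
  rw [ha', h3]
  conv_lhs => rw [hc]
  generalize vderiv I ξ p v k = b
  rw [ha]
  simp only [Pi.smul_apply, smul_eq_mul]
  rw [div_mul_cancel₀ _ hξ, div_eq_mul_inv]
  module

end Lifts

/-! ### The Gauss map of the mean curvature spheres -/

section GaussMap

variable {m : ℕ} {M : Type*} [TopologicalSpace M] [ChartedSpace (Euc m) M]
  {x : M → Amb m} {J : M → Amb m →L[ℝ] Amb m}

/-- Evaluating `⟪J k, k⟫ = 0` at `k = n + J n` gives `⟪J (J n), n⟫ = -1`, and `J (J n)` is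
orthogonal to `J n`; the two numbers determine it in the normal plane. -/
theorem IsNormalOrientation.apply_apply [IsManifold (𝓡 m) ∞ M] (hJ : IsNormalOrientation x J)
    (hx : IsSphereImmersion x) {p : M}
    {n : Amb m} (hn : n ∈ normalAt x p) (h1 : ‖n‖ = 1) : J p (J p n) = -n := by
  have hr := (hx.isImmersionOn p).finrank_normalPlane (basePt_mem p)
  have hf := hJ.isNormalFrame hn h1
  have hk := hJ.mapsTo p n hn
  have h2 := hJ.inner_eq_zero p _ hk
  have h3 := hJ.inner_eq_zero p n hn
  have h4 := hJ.inner_eq_zero p (n + J p n) (Submodule.add_mem _ hn hk)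
  have h5 : ⟪J p n, J p n⟫_ℝ = 1 := by
    rw [real_inner_self_eq_norm_sq, hJ.norm_eq p n hn, h1, one_pow]
  rw [map_add, inner_add_left, inner_add_right, inner_add_right, h3, h5, h2] at h4
  have h6 := hf.expand hr (hJ.mapsTo p _ hk)
  rw [h6, h2, show ⟪J p (J p n), n⟫_ℝ = -1 by linarith]
  simp

theorem sphereVec_add (p : M) (n k : Amb m) :
    sphereVec x p (n + k) = sphereVec x p n + sphereVec x p k := by
  rw [sphereVec, sphereVec, sphereVec, ← realVec_add, inner_add_right, add_smul]
  congr 1; abel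

theorem sphereVec_smul (p : M) (a : ℝ) (n : Amb m) :
    sphereVec x p (a • n) = (a : ℂ) • sphereVec x p n := by
  rw [sphereVec, sphereVec, ← realVec_smul, real_inner_smul_right, smul_add, smul_smul]

theorem gaussVec_ne_zero (p : M) {n : Amb m} (h1 : ‖n‖ = 1) : gaussVec x J p n ≠ 0 := by
  intro h
  have h2 : ∀ i, (gaussVec x J p n i).re = (sphereVec x p n i).re := by
    intro i
    have : (sphereVec x p (J p n) i).im = 0 := by
      refine Fin.cases ?_ (fun j => ?_) i <;> simp [sphereVec, realVec]
    simp [gaussVec, this]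
  rw [h] at h2
  have h3 := h2 0
  simp only [Pi.zero_apply, Complex.zero_re, sphereVec, realVec, Fin.cons_zero,
    Complex.ofReal_re] at h3
  have h4 : n = 0 := by
    ext i
    have := h2 i.succ
    simp only [Pi.zero_apply, Complex.zero_re, sphereVec, realVec, Fin.cons_succ,
      Complex.ofReal_re, ← h3] at this
    simpa using this.symm
  rw [h4, norm_zero] at h1
  exact zero_ne_one h1

variable [IsManifold (𝓡 m) ∞ M]

/-- If `n' = a n + b J n`, then `J n' = a J n - b n`, so the vector for `n'` is `a + i b` times the
vector for `n`. Rotating the oriented frame does not change the complex line. -/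
theorem exists_smul_gaussVec (hx : IsSphereImmersion x) (hJ : IsNormalOrientation x J) {p : M}
    {n n' : Amb m} (hn : n ∈ normalAt x p) (h1 : ‖n‖ = 1) (hn' : n' ∈ normalAt x p) :
    ∃ c : ℂ, gaussVec x J p n' = c • gaussVec x J p n := by
  have hr := (hx.isImmersionOn p).finrank_normalPlane (basePt_mem p)
  have h2 := (hJ.isNormalFrame hn h1).expand hr hn'
  refine ⟨⟪n', n⟫_ℝ + ⟪n', J p n⟫_ℝ * Complex.I, ?_⟩
  generalize ⟪n', n⟫_ℝ = a at *
  generalize ⟪n', J p n⟫_ℝ = b at *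
  have h3 : J p n' = a • J p n + (-b) • n := by
    rw [h2, map_add, map_smul, map_smul, hJ.apply_apply hx hn h1, smul_neg, neg_smul]
  rw [gaussVec, h3, h2, sphereVec_add, sphereVec_add, sphereVec_smul, sphereVec_smul,
    sphereVec_smul, sphereVec_smul, gaussVec]
  push_cast
  have hI : Complex.I * Complex.I = -1 := Complex.I_mul_I
  ext i
  simp only [Pi.sub_apply, Pi.add_apply, Pi.smul_apply, smul_eq_mul]
  linear_combination ((b : ℂ) * sphereVec x p (J p n) i) * hI

theorem exists_gaussMap (hx : IsSphereImmersion x) (hJ : IsNormalOrientation x J) :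
    ∃ F : M → ℙ ℂ (CLor m), ∀ p, ∀ n ∈ normalAt x p, ‖n‖ = 1 →
      ∃ h : gaussVec x J p n ≠ 0, Projectivization.mk ℂ (gaussVec x J p n) h = F p := by
  choose n hn h1 using fun p => exists_unit_normal hx p
  refine ⟨fun p => Projectivization.mk ℂ (gaussVec x J p (n p)) (gaussVec_ne_zero p (h1 p)),
    fun p n' hn' h1' => ⟨gaussVec_ne_zero p h1', ?_⟩⟩
  rw [Projectivization.mk_eq_mk_iff']
  obtain ⟨c, hc⟩ := exists_smul_gaussVec hx hJ (hn p) (h1 p) hn'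
  exact ⟨c, hc.symm⟩

/-- A map of a submanifold into the projective space of the Lorentz space, with the infinitesimal
properties of the Gauss map of the mean curvature spheres of a Wintgen ideal submanifold. -/
structure IsGaussMap (x : M → Amb m) (F : M → ℙ ℂ (CLor m)) : Prop where
  two_le : 2 ≤ m
  exists_lift : ∀ p, ∃ ξ, IsLiftAt (𝓡 m) F ξ p
  exists_form : ∀ p, ∃ (η : Euc m →ₗ[ℝ] ℂ) (ξ τ : CLor m) (t : ℝ),
    IsGaussPair (realVec 1 (x p)) ξ τ t ∧ Function.Surjective η ∧
      (∀ v : Euc m, v ∈ Dperp x p ↔ η v = 0) ∧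
      (∀ v : Euc m, (∀ w ∈ Dperp x p, mobiusMetric x p v w = 0) →
        t ^ 2 * Complex.normSq (η v) = mu m ^ 2 * mobiusMetric x p v v) ∧
      HasFormAt (𝓡 m) F p η ξ τ

/-- A smooth oriented orthonormal frame of the normal bundle near a point. -/
theorem exists_oriented_normalFrame (hx : IsSphereImmersion x)
    (hJ : IsNormalOrientation x J) (p : M) :
    ∃ (Ω : Set (Euc m)) (n₁ n₂ : Euc m → Amb m), IsOpen Ω ∧ basePt p ∈ Ω ∧
      Ω ⊆ (extChartAt (𝓡 m) p).target ∧ ContDiffOn ℝ ∞ n₁ Ω ∧ ContDiffOn ℝ ∞ n₂ Ω ∧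
      (∀ u ∈ Ω, IsNormalFrame (localRep x p) u (n₁ u) (n₂ u)) ∧
      ∀ᶠ q in 𝓝 p, J q (n₁ (extChartAt (𝓡 m) p q)) = n₂ (extChartAt (𝓡 m) p q) := by
  have hI := hx.isImmersionOn p
  obtain ⟨Ω, w, hΩ, hpΩ, hsub, hw, hwo⟩ := exists_smooth_orthonormal_frame hI.isOpen
    hI.contDiffOn_normalProj (basePt_mem p) (hI.finrank_normalPlane (basePt_mem p))
  have hnorm : ∀ u ∈ Ω, IsNormalFrame (localRep x p) u (w 0 u) (w 1 u) := fun u hu =>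
    ⟨(hwo u hu).2 0, (hwo u hu).2 1, (hwo u hu).1.1 0, (hwo u hu).1.1 1,
      (hwo u hu).1.2 (by decide)⟩
  have hev : ∀ᶠ q in 𝓝 p, q ∈ (extChartAt (𝓡 m) p).source ∧ extChartAt (𝓡 m) p q ∈ Ω :=
    Filter.Eventually.and (extChartAt_source_mem_nhds p)
      ((continuousAt_extChartAt p).eventually (hΩ.mem_nhds hpΩ))
  -- `J` maps the first frame vector to `s = ±1` times the second. By continuity of `J` the sign is
  -- constant near `p`, and it is corrected once and for all by its value at `p`.
  set s : M → ℝ := fun q => ⟪J q (w 0 (extChartAt (𝓡 m) p q)), w 1 (extChartAt (𝓡 m) p q)⟫_ℝ with hs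
  have hJs : ∀ q, q ∈ (extChartAt (𝓡 m) p).source ∧ extChartAt (𝓡 m) p q ∈ Ω →
      J q (w 0 (extChartAt (𝓡 m) p q)) = s q • w 1 (extChartAt (𝓡 m) p q) ∧ s q ^ 2 = 1 := by
    rintro q ⟨hq, hqΩ⟩
    have hn := hnorm _ hqΩ
    have h0 : w 0 (extChartAt (𝓡 m) p q) ∈ normalAt x q := by
      rw [normalAt_eq hx hq]; exact hn.1
    have h1 : J q (w 0 (extChartAt (𝓡 m) p q)) ∈
        normalPlane (localRep x p) (extChartAt (𝓡 m) p q) := by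
      rw [← normalAt_eq hx hq]; exact hJ.mapsTo q _ h0
    have h2 := hn.expand (hI.finrank_normalPlane (hsub hqΩ)) h1
    rw [hJ.inner_eq_zero q _ h0, zero_smul, zero_add] at h2
    refine ⟨h2, ?_⟩
    have h3 := hJ.norm_eq q _ h0
    rw [h2, norm_smul, hn.2.2.2.1, hn.2.2.1, mul_one, Real.norm_eq_abs] at h3
    rw [← sq_abs]; rw [h3, one_pow]
  have hcont : ContinuousAt s p := by
    have hφ := continuousAt_extChartAt (I := 𝓡 m) p
    have hc : ∀ j, ContinuousAt (fun q => w j (extChartAt (𝓡 m) p q)) p := fun j =>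
      ContinuousAt.comp (f := extChartAt (𝓡 m) p) (g := w j)
        ((hw j).continuousOn.continuousAt (hΩ.mem_nhds hpΩ)) hφ
    exact (hJ.continuous.continuousAt.clm_apply (hc 0)).inner (hc 1)
  have hsp := (hJs p hev.self_of_nhds).2
  have hconst : ∀ᶠ q in 𝓝 p, s q = s p := by
    have h1 : ∀ᶠ q in 𝓝 p, 0 < s q * s p := by
      have : ContinuousAt (fun q => s q * s p) p := hcont.mul continuousAt_const
      exact this.eventually (lt_mem_nhds (by nlinarith))
    filter_upwards [h1, hev] with q hq hq'
    have h2 := (hJs q hq').2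
    rcases (by simpa using h2 : s q = 1 ∨ s q = -1) with h | h <;> rcases (by simpa using hsp : s p = 1 ∨ s p = -1) with h' | h' <;>
      rw [h, h'] at hq ⊢ <;> norm_num at hq
  refine ⟨Ω, w 0, fun u => s p • w 1 u, hΩ, hpΩ, hsub, hw 0, (hw 1).const_smul _, fun u hu => ?_, ?_⟩
  · have hn := hnorm u hu
    refine ⟨hn.1, Submodule.smul_mem _ _ hn.2.1, hn.2.2.1, ?_, ?_⟩
    · rw [norm_smul, hn.2.2.2.1, mul_one, Real.norm_eq_abs, ← sq_eq_sq₀ (abs_nonneg _) zero_le_one,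
        sq_abs, hsp, one_pow]
    · rw [real_inner_smul_right, hn.2.2.2.2, mul_zero]
  · filter_upwards [hconst, hev] with q hq hq'
    rw [(hJs q hq').1, hq]

theorem vderiv_comp_extChartAt {W : Type*} [NormedAddCommGroup W] [NormedSpace ℝ W] {p : M}
    {g : Euc m → W} (hg : DifferentiableAt ℝ g (basePt p)) :
    vderiv (𝓡 m) (g ∘ extChartAt (𝓡 m) p) p = fderiv ℝ g (basePt p) := by
  have h1 : MDifferentiableAt (𝓡 m) 𝓘(ℝ, W) (g ∘ extChartAt (𝓡 m) p) p :=
    MDifferentiableAt.comp (I' := 𝓘(ℝ, Euc m)) p hg.mdifferentiableAt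
      (mdifferentiableAt_extChartAt (mem_chart_source _ p))
  have h2 : vderiv (𝓡 m) (g ∘ extChartAt (𝓡 m) p) p = fderivWithin ℝ
      (writtenInExtChartAt (𝓡 m) 𝓘(ℝ, W) p (g ∘ extChartAt (𝓡 m) p)) (Set.range (𝓡 m))
        (basePt p) := h1.mfderiv
  rw [h2, ModelWithCorners.range_eq_univ, fderivWithin_univ]
  refine Filter.EventuallyEq.fderiv_eq ?_
  filter_upwards [(isOpen_extChartAt_target (I := 𝓡 m) p).mem_nhds (basePt_mem p)] with u hu
  exact congrArg g ((extChartAt (𝓡 m) p).right_inv hu)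

theorem coordLift_eq_gaussVec (hx : IsSphereImmersion x) {p q : M}
    (hq : q ∈ (extChartAt (𝓡 m) p).source) {n₁ n₂ : Euc m → Amb m}
    (hJ : J q (n₁ (extChartAt (𝓡 m) p q)) = n₂ (extChartAt (𝓡 m) p q)) :
    coordLift (localRep x p) n₁ n₂ (extChartAt (𝓡 m) p q) =
      gaussVec x J q (n₁ (extChartAt (𝓡 m) p q)) := by
  have h2 : localRep x p (extChartAt (𝓡 m) p q) = x q :=
    congrArg x ((extChartAt (𝓡 m) p).left_inv hq)
  rw [coordLift, gaussVec, sphereVec, sphereVec, hJ, meanCurvAt_eq hx hq, h2]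

theorem exists_gaussLift (hm : 2 ≤ m) (hx : IsSphereImmersion x) (hW : IsWintgenIdeal x)
    (hU : IsUmbilicFree x) (hJ : IsNormalOrientation x J) {F : M → ℙ ℂ (CLor m)}
    (hF : ∀ p, ∀ n ∈ normalAt x p, ‖n‖ = 1 →
      ∃ h : gaussVec x J p n ≠ 0, Projectivization.mk ℂ (gaussVec x J p n) h = F p) (p : M) :
    ∃ (Ω : Set (Euc m)) (n₁ n₂ : Euc m → Amb m), basePt p ∈ Ω ∧
      IsWintgenFrameOn (localRep x p) n₁ n₂ Ω ∧
      IsLiftAt (𝓡 m) F (coordLift (localRep x p) n₁ n₂ ∘ extChartAt (𝓡 m) p) p := by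
  have hI := hx.isImmersionOn p
  obtain ⟨Ω, n₁, n₂, hΩ, hpΩ, hsub, hn₁, hn₂, hfr, hor⟩ := exists_oriented_normalFrame hx hJ p
  have hW' : IsWintgenFrameOn (localRep x p) n₁ n₂ Ω :=
    ⟨hm, ⟨hΩ, hI.smooth.mono hsub, fun u hu => hI.norm_eq_one u (hsub hu),
      fun u hu => hI.injective u (hsub hu)⟩, hn₁, hn₂, hfr,
      fun u hu => exists_isNormalForm_chart hm hx hW hU p (hsub hu) (hfr u hu)⟩
  refine ⟨Ω, n₁, n₂, hpΩ, hW', ?_, ?_⟩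
  · have hsm : ContDiffAt ℝ ∞ (coordLift (localRep x p) n₁ n₂) (extChartAt (𝓡 m) p p) :=
      hW'.contDiffOn_coordLift.contDiffAt (hΩ.mem_nhds hpΩ)
    exact hsm.contMDiffAt.comp p contMDiffAt_extChartAt
  · have h1 : ∀ᶠ q in 𝓝 p, extChartAt (𝓡 m) p q ∈ Ω :=
      (continuousAt_extChartAt p).eventually (hΩ.mem_nhds hpΩ)
    filter_upwards [hor, extChartAt_source_mem_nhds (I := 𝓡 m) p, h1] with q hq hqs hqΩ
    have h2 : n₁ (extChartAt (𝓡 m) p q) ∈ normalAt x q := by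
      rw [normalAt_eq hx hqs]; exact (hfr _ hqΩ).1
    obtain ⟨h3, h4⟩ := hF q _ h2 (hfr _ hqΩ).2.2.1
    have h5 : (coordLift (localRep x p) n₁ n₂ ∘ extChartAt (𝓡 m) p) q =
        gaussVec x J q (n₁ (extChartAt (𝓡 m) p q)) := coordLift_eq_gaussVec hx hqs hq
    rw [h5]
    exact ⟨h3, h4⟩

/-- The form is `frameForm`, whose kernel and `𝔻^⊥` are both the nullity of the trace-free second
fundamental form. The metric clause is `t² |η(v)|² = (μρ)² I(v,v) = μ² g(v,v)` on the complement of
the kernel. -/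
theorem isGaussMap (hm : 2 ≤ m) (hx : IsSphereImmersion x) (hW : IsWintgenIdeal x)
    (hU : IsUmbilicFree x) (hJ : IsNormalOrientation x J) {F : M → ℙ ℂ (CLor m)}
    (hF : ∀ p, ∀ n ∈ normalAt x p, ‖n‖ = 1 →
      ∃ h : gaussVec x J p n ≠ 0, Projectivization.mk ℂ (gaussVec x J p n) h = F p) :
    IsGaussMap x F := by
  refine ⟨hm, fun p => ?_, fun p => ?_⟩
  · obtain ⟨Ω, n₁, n₂, hpΩ, hW', hL⟩ := exists_gaussLift hm hx hW hU hJ hF p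
    exact ⟨_, hL⟩
  obtain ⟨Ω, n₁, n₂, hpΩ, hW', hL⟩ := exists_gaussLift hm hx hW hU hJ hF p
  have hr := (hx.isImmersionOn p).finrank_normalPlane (basePt_mem p)
  have hfr := hW'.isNormalFrame _ hpΩ
  have hxp : localRep x p (basePt p) = x p := congrArg x (extChartAt_to_inv p)
  obtain ⟨e, t, he⟩ := hW'.exists_form _ hpΩ
  obtain ⟨τ, hτ, hd⟩ := hW'.exists_isGaussPair hpΩ he
  rw [hxp] at hτ
  have hker : ∀ v : Euc m, v ∈ Dperp x p ↔ frameForm (localRep x p) (basePt p) e hm v = 0 :=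
    fun v => (mem_Dperp_iff hm hx hW hU hJ p v).trans
      (he.frameForm_eq_zero_iff hm hfr hr v).symm
  have hsm : ContDiffAt ℝ ∞ (coordLift (localRep x p) n₁ n₂) (basePt p) :=
    hW'.contDiffOn_coordLift.contDiffAt (hW'.immersion.isOpen.mem_nhds hpΩ)
  refine ⟨frameForm (localRep x p) (basePt p) e hm, _, τ, t, hτ, frameForm_surjective hm he.frame,
    hker, fun v hv => ?_, hL.hasFormAt fun v => ?_⟩
  · have hρ := rho_pos hm hx hfr he
    have h1 : ∀ w, frameForm (localRep x p) (basePt p) e hm w = 0 →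
        firstFF (localRep x p) (basePt p) v w = 0 := fun w hw =>
      (mul_eq_zero.1 (hv w ((hker w).2 hw))).resolve_left (by positivity)
    rw [normSq_frameForm hm he.frame h1, ← he.mu_mul_rho hm hfr hr]
    change _ = mu m ^ 2 * (rho (localRep x p) (basePt p) ^ 2 * firstFF (localRep x p) (basePt p) v v)
    ring
  · rw [vderiv_comp_extChartAt (hsm.differentiableAt (by simp))]
    exact hd v

end GaussMap

/-! ### The inverse function theorem -/

section InverseFunction

variable {E E' : Type*} [NormedAddCommGroup E] [NormedSpace ℝ E] [FiniteDimensional ℝ E]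
  [NormedAddCommGroup E'] [NormedSpace ℝ E'] [FiniteDimensional ℝ E']

theorem exists_partialDiffeomorph_of_bijective_fderiv {g : E → E'} {Ω : Set E} (hΩ : IsOpen Ω)
    (hg : ContDiffOn ℝ ∞ g Ω) {u₀ : E} (hu₀ : u₀ ∈ Ω)
    (hb : Function.Bijective (fderiv ℝ g u₀)) :
    ∃ Θ : PartialDiffeomorph 𝓘(ℝ, E) 𝓘(ℝ, E') E E' ∞, u₀ ∈ Θ.source ∧ Θ.source ⊆ Ω ∧
      ⇑Θ = g := by
  have : CompleteSpace E := FiniteDimensional.complete ℝ E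
  have : CompleteSpace E' := FiniteDimensional.complete ℝ E'
  have hdiff : ∀ u ∈ Ω, ContDiffAt ℝ ∞ g u := fun u hu => hg.contDiffAt (hΩ.mem_nhds hu)
  let f' : E ≃L[ℝ] E' := ContinuousLinearEquiv.ofBijective (fderiv ℝ g u₀)
    (LinearMap.ker_eq_bot.2 hb.1) (LinearMap.range_eq_top.2 hb.2)
  have hf' : HasFDerivAt g (f' : E →L[ℝ] E') u₀ :=
    ((hdiff u₀ hu₀).differentiableAt (by simp)).hasFDerivAt
  set θ := (hdiff u₀ hu₀).toOpenPartialHomeomorph g hf' (by simp) with hθ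
  -- The local inverse is smooth at the images of points where the derivative is invertible. This is
  -- an open condition on the point, so restricting the source to `S` makes the inverse smooth on
  -- the whole target.
  set S : Set E := Ω ∩ fderiv ℝ g ⁻¹' (Set.range fun e : E ≃L[ℝ] E' => (e : E →L[ℝ] E')) with hS
  have hSo : IsOpen S :=
    (hg.fderiv_of_isOpen (m := 0) hΩ (by simp)).continuousOn.isOpen_inter_preimage hΩ
      (ContinuousLinearEquiv.isOpen)
  have hsymm : ContDiffOn ℝ ∞ θ.symm (θ.restrOpen S hSo).target := by
    intro a ha
    have h1 : a ∈ θ.target := by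
      rw [OpenPartialHomeomorph.restrOpen, ] at ha
      exact ((θ.restrOpen S hSo).symm.mapsTo ha |> fun h => by
        have := (θ.restrOpen S hSo).right_inv ha
        have h2 : (θ.restrOpen S hSo).symm a ∈ θ.source := h.1
        rw [← this]
        exact θ.map_source h2)
    have h2 : θ.symm a ∈ S := ((θ.restrOpen S hSo).map_target ha).2
    obtain ⟨e, he⟩ := h2.2
    have he' : HasFDerivAt θ (e : E →L[ℝ] E') (θ.symm a) := by
      rw [show (e : E →L[ℝ] E') = fderiv ℝ g (θ.symm a) from he]
      exact ((hdiff _ h2.1).differentiableAt (by simp)).hasFDerivAt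
    exact (θ.contDiffAt_symm h1 he' (hdiff _ h2.1)).contDiffWithinAt
  refine ⟨⟨(θ.restrOpen S hSo).toPartialEquiv, (θ.restrOpen S hSo).open_source,
    (θ.restrOpen S hSo).open_target, ?_, ?_⟩, ⟨?_, hu₀, f', rfl⟩, fun u hu => hu.2.1, rfl⟩
  · exact (hg.mono fun u hu => hu.2.1).contMDiffOn
  · exact hsymm.contMDiffOn
  · exact (hdiff u₀ hu₀).mem_toOpenPartialHomeomorph_source hf' (by simp)

variable {M N : Type*} [TopologicalSpace M] [ChartedSpace E M] [IsManifold 𝓘(ℝ, E) ∞ M]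
  [TopologicalSpace N] [ChartedSpace E' N] [IsManifold 𝓘(ℝ, E') ∞ N]

/-- The preferred chart at a point, as a partial diffeomorphism. -/
def chartDiffeo (p : M) : PartialDiffeomorph 𝓘(ℝ, E) 𝓘(ℝ, E) M E ∞ where
  toPartialEquiv := extChartAt 𝓘(ℝ, E) p
  open_source := isOpen_extChartAt_source p
  open_target := isOpen_extChartAt_target p
  contMDiffOn_toFun := contMDiffOn_extChartAt.mono (by simp)
  contMDiffOn_invFun := contMDiffOn_extChartAt_symm p

/-- The inverse function theorem for maps of manifolds. -/
theorem exists_partialDiffeomorph {f : M → N} {U : Set M} (hU : IsOpen U)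
    (hf : ContMDiffOn 𝓘(ℝ, E) 𝓘(ℝ, E') ∞ f U) {p : M} (hp : p ∈ U)
    (hb : Function.Bijective (mfderiv 𝓘(ℝ, E) 𝓘(ℝ, E') f p)) :
    ∃ Φ : PartialDiffeomorph 𝓘(ℝ, E) 𝓘(ℝ, E') M N ∞, p ∈ Φ.source ∧ Φ.source ⊆ U ∧
      Set.EqOn f Φ Φ.source := by
  set φ := chartDiffeo (E := E) p with hφ
  set ψ := chartDiffeo (E := E') (f p) with hψ
  set g : E → E' := ψ ∘ f ∘ φ.invFun with hgdef
  have hV : IsOpen (U ∩ f ⁻¹' ψ.source) := hf.continuousOn.isOpen_inter_preimage hU ψ.open_source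
  set Ω : Set E := φ.target ∩ φ.invFun ⁻¹' (U ∩ f ⁻¹' ψ.source) with hΩdef
  have hΩ : IsOpen Ω := φ.contMDiffOn_invFun.continuousOn.isOpen_inter_preimage φ.open_target hV
  have hg : ContDiffOn ℝ ∞ g Ω := contMDiffOn_iff_contDiffOn.1
    (ψ.contMDiffOn_toFun.comp (hf.comp (φ.contMDiffOn_invFun.mono fun u hu => hu.1)
      fun u hu => hu.2.1) fun u hu => hu.2.2)
  have hpφ : p ∈ φ.source := mem_extChartAt_source p
  have hpψ : f p ∈ ψ.source := mem_extChartAt_source (f p)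
  have hφp : φ.invFun (φ p) = p := φ.left_inv hpφ
  have hu₀ : φ p ∈ Ω := ⟨φ.map_source hpφ, by rw [Set.mem_preimage, hφp]; exact ⟨hp, hpψ⟩⟩
  have hmd : MDifferentiableAt 𝓘(ℝ, E) 𝓘(ℝ, E') f p :=
    (hf.contMDiffAt (hU.mem_nhds hp)).mdifferentiableAt (by simp)
  have hd : mfderiv 𝓘(ℝ, E) 𝓘(ℝ, E') f p = fderiv ℝ g (φ p) := by
    have := hmd.mfderiv
    rw [ModelWithCorners.range_eq_univ, fderivWithin_univ] at this
    exact this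
  obtain ⟨Θ, hΘ, hΘΩ, hΘg⟩ := exists_partialDiffeomorph_of_bijective_fderiv hΩ hg hu₀ (by
    have h2 : ⇑(mfderiv 𝓘(ℝ, E) 𝓘(ℝ, E') f p) = ⇑(fderiv ℝ g (φ p)) := by rw [hd]; rfl
    exact h2 ▸ hb)
  have hval : ∀ q ∈ φ.source, φ q ∈ Θ.source → Θ (φ q) = ψ (f q) := by
    intro q hq _
    have h1 : φ.invFun (φ q) = q := φ.left_inv hq
    change Θ.toFun (φ q) = _
    rw [show Θ.toFun = g from hΘg, hgdef, Function.comp_apply, Function.comp_apply, h1]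
  have hmem : ∀ q ∈ φ.source, φ q ∈ Θ.source → q ∈ U ∧ f q ∈ ψ.source := by
    intro q hq hq'
    have h1 : φ.invFun (φ q) = q := φ.left_inv hq
    have := (hΘΩ hq').2
    rwa [Set.mem_preimage, h1] at this
  have hsrc : ∀ q, q ∈ ((φ.trans Θ).trans ψ.symm).source ↔ q ∈ φ.source ∧ φ q ∈ Θ.source := by
    intro q
    constructor
    · exact fun h => h.1
    · rintro ⟨h1, h2⟩
      refine ⟨⟨h1, h2⟩, ?_⟩
      change Θ (φ q) ∈ ψ.target
      rw [hval q h1 h2]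
      exact ψ.map_source (hmem q h1 h2).2
  refine ⟨(φ.trans Θ).trans ψ.symm, (hsrc p).2 ⟨hpφ, hΘ⟩, fun q hq => ?_, fun q hq => ?_⟩
  · obtain ⟨h1, h2⟩ := (hsrc q).1 hq
    exact (hmem q h1 h2).1
  · obtain ⟨h1, h2⟩ := (hsrc q).1 hq
    change f q = ψ.invFun (Θ (φ q))
    rw [hval q h1 h2]
    exact (ψ.left_inv (hmem q h1 h2).2).symm

/-- Restriction of a partial diffeomorphism to the preimage of an open set. -/
def restrTarget {H₁ H₂ E₁ E₂ M₁ M₂ : Type*} [NormedAddCommGroup E₁] [NormedSpace ℝ E₁]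
    [NormedAddCommGroup E₂] [NormedSpace ℝ E₂] [TopologicalSpace H₁] [TopologicalSpace H₂]
    {I₁ : ModelWithCorners ℝ E₁ H₁} {I₂ : ModelWithCorners ℝ E₂ H₂} [TopologicalSpace M₁]
    [ChartedSpace H₁ M₁] [TopologicalSpace M₂] [ChartedSpace H₂ M₂]
    (Φ : PartialDiffeomorph I₁ I₂ M₁ M₂ ∞) (B : Set M₂) (hB : IsOpen B) :
    PartialDiffeomorph I₁ I₂ M₁ M₂ ∞ where
  toFun := Φ
  invFun := Φ.invFun
  source := Φ.source ∩ Φ ⁻¹' B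
  target := Φ.target ∩ B
  map_source' q hq := ⟨Φ.map_source hq.1, hq.2⟩
  map_target' u hu := ⟨Φ.map_target hu.1, by
    change Φ.toFun (Φ.invFun u) ∈ B
    rw [show Φ.toFun (Φ.invFun u) = u from Φ.right_inv hu.1]; exact hu.2⟩
  left_inv' q hq := Φ.left_inv hq.1
  right_inv' u hu := Φ.right_inv hu.1
  open_source := Φ.contMDiffOn_toFun.continuousOn.isOpen_inter_preimage Φ.open_source hB
  open_target := Φ.open_target.inter hB
  contMDiffOn_toFun := Φ.contMDiffOn_toFun.mono Set.inter_subset_left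
  contMDiffOn_invFun := Φ.contMDiffOn_invFun.mono Set.inter_subset_left

theorem bijective_mfderiv (Φ : PartialDiffeomorph 𝓘(ℝ, E) 𝓘(ℝ, E') M N ∞) {p : M}
    (hp : p ∈ Φ.source) : Function.Bijective (mfderiv 𝓘(ℝ, E) 𝓘(ℝ, E') Φ p) := by
  have h : IsLocalDiffeomorphAt 𝓘(ℝ, E) 𝓘(ℝ, E') ∞ Φ p := Φ.isLocalDiffeomorphAt _ _ _ hp
  have := (h.mfderivToContinuousLinearEquiv (by simp)).bijective
  exact this

theorem mem_maximalAtlas (Φ : PartialDiffeomorph 𝓘(ℝ, E) 𝓘(ℝ, E) M E ∞) :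
    Φ.toOpenPartialHomeomorph ∈ IsManifold.maximalAtlas 𝓘(ℝ, E) ∞ M := by
  have hsm : ∀ e ∈ atlas E M,
      Φ.toOpenPartialHomeomorph.symm ≫ₕ e ∈ contDiffGroupoid ∞ 𝓘(ℝ, E) := by
    intro e he
    have he1 := contMDiffOn_of_mem_maximalAtlas (I := 𝓘(ℝ, E)) (n := ∞)
      (IsManifold.subset_maximalAtlas he)
    have he2 := contMDiffOn_symm_of_mem_maximalAtlas (I := 𝓘(ℝ, E)) (n := ∞)
      (IsManifold.subset_maximalAtlas he)
    rw [contDiffGroupoid, mem_groupoid_of_pregroupoid]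
    constructor
    · have : ContDiffOn ℝ ∞ (e ∘ Φ.toOpenPartialHomeomorph.symm)
          (Φ.toOpenPartialHomeomorph.symm ≫ₕ e).source := contMDiffOn_iff_contDiffOn.1
        (he1.comp (Φ.contMDiffOn_invFun.mono fun u hu => hu.1) fun u hu => hu.2)
      simpa [contDiffPregroupoid] using this
    · have : ContDiffOn ℝ ∞ (Φ.toOpenPartialHomeomorph ∘ e.symm)
          (Φ.toOpenPartialHomeomorph.symm ≫ₕ e).target := contMDiffOn_iff_contDiffOn.1
        (Φ.contMDiffOn_toFun.comp (he2.mono fun u hu => hu.1) fun u hu => hu.2)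
      simpa [contDiffPregroupoid] using this
  refine mem_maximalAtlas_iff.2 fun e he => ⟨hsm e he, ?_⟩
  have := (contDiffGroupoid ∞ 𝓘(ℝ, E)).symm (hsm e he)
  simpa [OpenPartialHomeomorph.trans_symm_eq_symm_trans_symm] using this

end InverseFunction

/-! ### Maps into the projective space with kernel of codimension two -/

/-- The identification `ℂ × ℝ^{m-2} = ℝ^m`. -/
def flattenLin (m : ℕ) : (ℂ × Euc (m - 2)) →ₗ[ℝ] Euc m where
  toFun z := WithLp.toLp 2 fun i => if i.val = 0 then z.1.re else if i.val = 1 then z.1.im else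
    if h : i.val - 2 < m - 2 then z.2 ⟨i.val - 2, h⟩ else 0
  map_add' z w := by
    ext i; simp only [PiLp.add_apply]; split_ifs <;> simp
  map_smul' a z := by
    ext i; simp only [PiLp.smul_apply]; split_ifs <;> simp

theorem flattenLin_injective {m : ℕ} (hm : 2 ≤ m) : Function.Injective (flattenLin m) := by
  refine (injective_iff_map_eq_zero _).2 fun z hz => ?_
  have h : ∀ i : Fin m, flattenLin m z i = 0 := fun i => by rw [hz]; rfl
  have h0 : z.1.re = 0 := by simpa [flattenLin] using h ⟨0, by omega⟩
  have h1 : z.1.im = 0 := by simpa [flattenLin] using h ⟨1, by omega⟩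
  have h2 : z.2 = 0 := by
    ext i
    have := h ⟨i.val + 2, by omega⟩
    simpa [flattenLin] using this
  exact Prod.ext (Complex.ext h0 h1) h2

theorem finrank_prod_euc {m : ℕ} (hm : 2 ≤ m) :
    Module.finrank ℝ (ℂ × Euc (m - 2)) = Module.finrank ℝ (Euc m) := by
  rw [Module.finrank_prod, Complex.finrank_real_complex, finrank_euclideanSpace_fin,
    finrank_euclideanSpace_fin]
  omega

/-- The identification `ℂ × ℝ^{m-2} = ℝ^m`. -/
def flatten {m : ℕ} (hm : 2 ≤ m) : (ℂ × Euc (m - 2)) ≃L[ℝ] Euc m :=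
  (LinearEquiv.ofInjectiveOfFinrankEq (flattenLin m) (flattenLin_injective hm)
    (finrank_prod_euc hm)).toContinuousLinearEquiv

theorem flatten_apply_eq_zero_iff {m : ℕ} (hm : 2 ≤ m) (z : ℂ × Euc (m - 2)) :
    (∀ i : Fin m, i.val < 2 → flatten hm z i = 0) ↔ z.1 = 0 := by
  have h : ∀ i, flatten hm z i = flattenLin m z i := fun i => rfl
  constructor
  · intro hz
    have h0 := hz ⟨0, by omega⟩ (by simp)
    have h1 := hz ⟨1, by omega⟩ (by simp)
    rw [h] at h0 h1
    exact Complex.ext (by simpa [flattenLin] using h0) (by simpa [flattenLin] using h1)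
  · intro hz i hi
    rw [h]
    have : i.val = 0 ∨ i.val = 1 := by omega
    rcases this with h | h <;> simp [flattenLin, h, hz]

/-! ### Flow boxes and integrability. -/

section Submersive

variable {m N : ℕ} {M : Type*} [TopologicalSpace M] [ChartedSpace (Euc m) M]
  {F : M → ℙ ℂ (Fin N → ℂ)} {D : ∀ p : M, Submodule ℝ (TangentSpace (𝓡 m) p)}

/-- A smooth map into the projective space whose differential is, at every point, a surjective
complex-valued form with kernel `D` times a vector transversal to the image point. -/
structure IsSubmersiveCurve (F : M → ℙ ℂ (Fin N → ℂ))
    (D : ∀ p : M, Submodule ℝ (TangentSpace (𝓡 m) p)) : Prop where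
  two_le : 2 ≤ m
  exists_lift : ∀ p, ∃ ξ, IsLiftAt (𝓡 m) F ξ p
  exists_form : ∀ p, ∃ (η : Euc m →ₗ[ℝ] ℂ) (ξ τ : Fin N → ℂ), LinearIndependent ℂ ![ξ, τ] ∧
    Function.Surjective η ∧ (∀ v : Euc m, v ∈ D p ↔ η v = 0) ∧ HasFormAt (𝓡 m) F p η ξ τ

theorem IsSubmersiveCurve.isLiftAt_normRep (hF : IsSubmersiveCurve F D) {p : M} {k : Fin N}
    (hk : (F p).rep k ≠ 0) : IsLiftAt (𝓡 m) F (normRep k ∘ F) p := by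
  obtain ⟨ξ, hξ⟩ := hF.exists_lift p
  exact hξ.normRep hk

theorem IsSubmersiveCurve.isOpen_rep_ne_zero (hF : IsSubmersiveCurve F D) (k : Fin N) :
    IsOpen {p | (F p).rep k ≠ 0} := by
  refine isOpen_iff_mem_nhds.2 fun p hp => ?_
  exact (hF.isLiftAt_normRep hp).eventually_rep_ne_zero hp

theorem IsSubmersiveCurve.contMDiffAt (hF : IsSubmersiveCurve F D) {p : M} {k : Fin N}
    (hk : (F p).rep k ≠ 0) : ContMDiffAt (𝓡 m) 𝓘(ℝ, Fin N → ℂ) ∞ (normRep k ∘ F) p :=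
  (hF.isLiftAt_normRep hk).smooth

/-- The `k`-th component of the normalized lift is constant, which determines the multiple of `ξ` in
its differential. What remains is `η` times one vector, the same for all `v`. -/
theorem IsSubmersiveCurve.exists_eta (hF : IsSubmersiveCurve F D) (p : M) :
    ∃ η : Euc m →ₗ[ℝ] ℂ, Function.Surjective η ∧ (∀ v : Euc m, v ∈ D p ↔ η v = 0) ∧
      ∀ k, (F p).rep k ≠ 0 → ∃ τ : Fin N → ℂ, τ ≠ 0 ∧
        ∀ v, vderiv (𝓡 m) (normRep k ∘ F) p v = η v • τ := by
  obtain ⟨η, ξ, τ, hli, hs, hker, hform⟩ := hF.exists_form p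
  refine ⟨η, hs, hker, fun k hk => ?_⟩
  have hL := hF.isLiftAt_normRep hk
  obtain ⟨c, hc, h1, h2⟩ := hform _ hL
  have hone : normRep k (F p) k = 1 := normRep_self hk
  have hξ : c * ξ k = 1 := by
    rw [← hone]; exact (congrFun h1 k).symm
  have hξk : ξ k ≠ 0 := right_ne_zero_of_mul_eq_one hξ
  -- The vector `τ` is corrected by a multiple of `ξ` so that its `k`-th component vanishes; linear
  -- independence keeps it nonzero.
  refine ⟨c • (τ - (τ k / ξ k) • ξ), fun h0 => ?_, fun v => ?_⟩
  · have h3 : τ - (τ k / ξ k) • ξ = 0 := (smul_eq_zero.1 h0).resolve_left hc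
    have h4 := LinearIndependent.pair_iff.1 hli (-(τ k / ξ k)) 1 (by
      rw [← h3]; module)
    exact one_ne_zero h4.2
  · obtain ⟨a, ha⟩ := h2 v
    have hconst : vderiv (𝓡 m) (normRep k ∘ F) p v k = 0 := by
      have h5 : vderiv (𝓡 m) ((fun w : Fin N → ℂ => w k) ∘ (normRep k ∘ F)) p v =
          vderiv (𝓡 m) (normRep k ∘ F) p v k := by
        have h6 : HasFDerivAt (fun w : Fin N → ℂ => w k)
          (ContinuousLinearMap.proj k : (Fin N → ℂ) →L[ℝ] ℂ) ((normRep k ∘ F) p) :=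
          (ContinuousLinearMap.proj k : (Fin N → ℂ) →L[ℝ] ℂ).hasFDerivAt
        rw [vderiv_comp h6.differentiableAt (hL.smooth.mdifferentiableAt (by simp)), h6.fderiv]
        rfl
      rw [← h5, vderiv_congr (g' := fun _ => (1 : ℂ))]
      · rw [vderiv, mfderiv_const]; rfl
      · filter_upwards [hL.eventually_rep_ne_zero hk] with q hq
        exact normRep_self hq
    have h7 : vderiv (𝓡 m) (normRep k ∘ F) p v = a • ξ + (c * η v) • τ := ha
    rw [h7] at hconst ⊢
    have h8 : a = - (c * η v * (τ k / ξ k)) := by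
      simp only [Pi.add_apply, Pi.smul_apply, smul_eq_mul] at hconst
      field_simp
      linear_combination hconst
    rw [h8]
    module

/-- A chart of the foliation: the first component is a coordinate of the projective space. -/
structure IsFlowBox (F : M → ℙ ℂ (Fin N → ℂ)) (k j : Fin N)
    (Φ : PartialDiffeomorph (𝓡 m) 𝓘(ℝ, ℂ × Euc (m - 2)) M (ℂ × Euc (m - 2)) ∞)
    (a : ℂ) (b : Euc (m - 2)) (r : ℝ) : Prop where
  pos : 0 < r
  rep_ne_zero : ∀ q ∈ Φ.source, (F q).rep k ≠ 0
  fst_eq : ∀ q ∈ Φ.source, (Φ q).1 = normRep k (F q) j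
  target_eq : Φ.target = Metric.ball a r ×ˢ Metric.ball b r

theorem vderiv_fst {g : M → ℂ × Euc (m - 2)} {p : M}
    (hg : MDifferentiableAt (𝓡 m) 𝓘(ℝ, ℂ × Euc (m - 2)) g p) (v : Euc m) :
    vderiv (𝓡 m) (fun q => (g q).1) p v = (vderiv (𝓡 m) g p v).1 := by
  have := vderiv_comp (F := (Prod.fst : ℂ × Euc (m - 2) → ℂ)) differentiableAt_fst hg v
  rw [fderiv_fst] at this
  exact this

theorem vderiv_apply {g : M → Fin N → ℂ} {p : M}
    (hg : MDifferentiableAt (𝓡 m) 𝓘(ℝ, Fin N → ℂ) g p) (j : Fin N) (v : Euc m) :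
    vderiv (𝓡 m) (fun q => g q j) p v = vderiv (𝓡 m) g p v j := by
  have h6 : HasFDerivAt (fun w : Fin N → ℂ => w j)
    (ContinuousLinearMap.proj j : (Fin N → ℂ) →L[ℝ] ℂ) (g p) :=
    (ContinuousLinearMap.proj j : (Fin N → ℂ) →L[ℝ] ℂ).hasFDerivAt
  have := vderiv_comp h6.differentiableAt hg v
  rw [h6.fderiv] at this
  exact this

variable [IsManifold (𝓡 m) ∞ M]

/-- For an index `j` with `τ j ≠ 0` the affine coordinate `z` has differential `τ j · η`, with
kernel `ker η`. Together with an isomorphism of `ker η` with `ℝ^{m-2}`, extended by orthogonal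
projection, it has bijective differential at `p`, and the inverse function theorem applies. -/
theorem IsSubmersiveCurve.exists_isFlowBox (hF : IsSubmersiveCurve F D) (p : M) :
    ∃ (k j : Fin N)
      (Φ : PartialDiffeomorph (𝓡 m) 𝓘(ℝ, ℂ × Euc (m - 2)) M (ℂ × Euc (m - 2)) ∞)
      (a : ℂ) (b : Euc (m - 2)) (r : ℝ), p ∈ Φ.source ∧ IsFlowBox F k j Φ a b r := by
  obtain ⟨η, hs, hker, hη⟩ := hF.exists_eta p
  obtain ⟨k, hk⟩ := exists_rep_ne_zero (F p)
  obtain ⟨τ, hτ, hd⟩ := hη k hk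
  obtain ⟨j, hj⟩ : ∃ j, τ j ≠ 0 := by
    by_contra! h; exact hτ (funext h)
  set K : Submodule ℝ (Euc m) := LinearMap.ker η with hK
  have hKr : Module.finrank ℝ K = Module.finrank ℝ (Euc (m - 2)) := by
    have h1 := LinearMap.finrank_range_add_finrank_ker η
    rw [LinearMap.range_eq_top.2 hs, finrank_top, Complex.finrank_real_complex,
      finrank_euclideanSpace_fin] at h1
    rw [finrank_euclideanSpace_fin]
    change 2 + Module.finrank ℝ K = m at h1
    omega
  let κ : K ≃L[ℝ] Euc (m - 2) := ContinuousLinearEquiv.ofFinrankEq hKr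
  let A : Euc m →L[ℝ] Euc (m - 2) := (κ : K →L[ℝ] Euc (m - 2)) ∘L K.orthogonalProjectionOnto
  let z : M → ℂ := fun q => normRep k (F q) j
  have hz : ∀ q, (F q).rep k ≠ 0 → ContMDiffAt (𝓡 m) 𝓘(ℝ, ℂ) ∞ z q := fun q hq =>
    (ContinuousLinearMap.proj j : (Fin N → ℂ) →L[ℝ] ℂ).contDiff.contMDiff.contMDiffAt.comp q
      (hF.contMDiffAt hq)
  set U : Set M := {q | (F q).rep k ≠ 0} ∩ (extChartAt (𝓡 m) p).source with hU
  have hUo : IsOpen U := (hF.isOpen_rep_ne_zero k).inter (isOpen_extChartAt_source p)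
  let f : M → ℂ × Euc (m - 2) := fun q => (z q, A (extChartAt (𝓡 m) p q))
  have hA : ContMDiffOn (𝓡 m) 𝓘(ℝ, Euc (m - 2)) ∞ (A ∘ extChartAt (𝓡 m) p)
      (extChartAt (𝓡 m) p).source :=
    A.contDiff.contMDiff.comp_contMDiffOn (contMDiffOn_extChartAt.mono (by simp))
  have hfU : ContMDiffOn (𝓡 m) 𝓘(ℝ, ℂ × Euc (m - 2)) ∞ f U := fun q hq =>
    ((hz q hq.1).contMDiffWithinAt).prodMk_space (hA.mono Set.inter_subset_right q hq)
  have hpU : p ∈ U := ⟨hk, mem_extChartAt_source p⟩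
  have hfp : MDifferentiableAt (𝓡 m) 𝓘(ℝ, ℂ × Euc (m - 2)) f p :=
    (hfU.contMDiffAt (hUo.mem_nhds hpU)).mdifferentiableAt (by simp)
  have hdf1 : ∀ v, (vderiv (𝓡 m) f p v).1 = η v * τ j := by
    intro v
    rw [← vderiv_fst hfp]
    change vderiv (𝓡 m) (fun q => (normRep k ∘ F) q j) p v = _
    rw [vderiv_apply ((hF.contMDiffAt hk).mdifferentiableAt (by simp)), hd]
    rfl
  have hdf2 : ∀ v, (vderiv (𝓡 m) f p v).2 = A v := by
    intro v
    have h1 := vderiv_comp (F := (Prod.snd : ℂ × Euc (m - 2) → Euc (m - 2)))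
      differentiableAt_snd hfp v
    rw [fderiv_snd] at h1
    have h2 : vderiv (𝓡 m) (Prod.snd ∘ f) p = fderiv ℝ A (basePt p) :=
      vderiv_comp_extChartAt (g := A) A.differentiableAt
    rw [h2, A.fderiv] at h1
    exact h1.symm
  have hinj : Function.Injective (vderiv (𝓡 m) f p) := by
    refine (injective_iff_map_eq_zero _).2 fun v hv => ?_
    have h1 := hdf1 v
    have h2 := hdf2 v
    rw [hv] at h1 h2
    have h3 : η v = 0 := (mul_eq_zero.1 h1.symm).resolve_right hj
    have h4 : K.orthogonalProjectionOnto v = 0 := by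
      have : κ (K.orthogonalProjectionOnto v) = 0 := h2.symm
      simpa using this
    have h5 : (K.orthogonalProjectionOnto v : Euc m) = v :=
      Submodule.starProjection_eq_self_iff.2 (LinearMap.mem_ker.2 h3)
    rw [← h5, h4]; rfl
  have hbij : Function.Bijective (vderiv (𝓡 m) f p) := by
    have h := LinearMap.injective_iff_surjective_of_finrank_eq_finrank
      (f := (vderiv (𝓡 m) f p).toLinearMap) (finrank_prod_euc hF.two_le).symm
    exact ⟨hinj, h.1 hinj⟩
  obtain ⟨Φ, hpΦ, hΦU, hΦf⟩ := exists_partialDiffeomorph (E := Euc m) (E' := ℂ × Euc (m - 2))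
    hUo hfU hpU hbij
  -- In the product metric a ball is a product of balls; the target then has a disc as base and
  -- convex slices.
  obtain ⟨r, hr, hball⟩ := Metric.isOpen_iff.1 Φ.open_target (Φ p) (Φ.map_source hpΦ)
  refine ⟨k, j, restrTarget Φ (Metric.ball (Φ p) r) Metric.isOpen_ball, (Φ p).1, (Φ p).2, r,
    ⟨hpΦ, Metric.mem_ball_self hr⟩, hr, fun q hq => (hΦU hq.1).1, fun q hq => ?_, ?_⟩
  · change (Φ q).1 = _
    rw [← hΦf hq.1]
  · change Φ.target ∩ _ = _
    rw [Set.inter_eq_right.2 hball, ← ball_prod_same]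

variable {k j : Fin N} {Φ : PartialDiffeomorph (𝓡 m) 𝓘(ℝ, ℂ × Euc (m - 2)) M (ℂ × Euc (m - 2)) ∞}
  {a : ℂ} {b : Euc (m - 2)} {r : ℝ}

/-- At each point of the box the differential of the first coordinate is `τ j · η`, and `τ j ≠ 0`
because the box is a diffeomorphism. So that coordinate can replace `η`, and with it controls the
differentials of all normalized lifts. -/
theorem IsFlowBox.exists_eta (h : IsFlowBox F k j Φ a b r) (hF : IsSubmersiveCurve F D) {q : M}
    (hq : q ∈ Φ.source) :
    (∀ v : Euc m, v ∈ D q ↔ (vderiv (𝓡 m) Φ q v).1 = 0) ∧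
      ∀ l, (F q).rep l ≠ 0 → ∃ τ : Fin N → ℂ, τ ≠ 0 ∧
        ∀ v, vderiv (𝓡 m) (normRep l ∘ F) q v = (vderiv (𝓡 m) Φ q v).1 • τ := by
  obtain ⟨η, hs, hker, hη⟩ := hF.exists_eta q
  have hk := h.rep_ne_zero q hq
  obtain ⟨τ, hτ, hd⟩ := hη k hk
  have h1 : ∀ v, (vderiv (𝓡 m) Φ q v).1 = η v * τ j := by
    intro v
    rw [← vderiv_fst (Φ.mdifferentiableAt (by simp) hq), vderiv_congr (g' := fun q => (normRep k ∘ F) q j),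
      vderiv_apply ((hF.contMDiffAt hk).mdifferentiableAt (by simp)), hd]
    · rfl
    · filter_upwards [Φ.open_source.mem_nhds hq] with q' hq'
      exact h.fst_eq q' hq'
  have hj : τ j ≠ 0 := by
    intro h0
    obtain ⟨v, hv⟩ := (bijective_mfderiv (E := Euc m) (E' := ℂ × Euc (m - 2)) Φ hq).2
      ((1, 0) : ℂ × Euc (m - 2))
    have h2 := h1 v
    rw [h0, mul_zero] at h2
    have h3 : vderiv (𝓡 m) Φ q v = ((1, 0) : ℂ × Euc (m - 2)) := hv
    rw [h3] at h2
    exact one_ne_zero h2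
  refine ⟨fun v => ?_, fun l hl => ?_⟩
  · rw [hker, h1, mul_eq_zero, or_iff_left hj]
  · obtain ⟨τ', hτ', hd'⟩ := hη l hl
    refine ⟨(τ j)⁻¹ • τ', smul_ne_zero (inv_ne_zero hj) hτ', fun v => ?_⟩
    rw [hd', h1, smul_smul, mul_assoc, mul_inv_cancel₀ hj, mul_one]

theorem IsSubmersiveCurve.isIntegrable (hF : IsSubmersiveCurve F D) : IsIntegrable D := by
  intro p
  obtain ⟨k, j, Φ, a, b, r, hp, h⟩ := hF.exists_isFlowBox p
  let Ψ : PartialDiffeomorph (𝓡 m) 𝓘(ℝ, Euc m) M (Euc m) ∞ :=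
    Φ.trans (flatten hF.two_le).toDiffeomorph.toPartialDiffeomorph
  have hsrc : ∀ q, q ∈ Ψ.source ↔ q ∈ Φ.source := fun q => ⟨fun h => h.1, fun h => ⟨h, trivial⟩⟩
  refine ⟨Ψ.toOpenPartialHomeomorph, mem_maximalAtlas (E := Euc m) Ψ, (hsrc p).2 hp,
    fun q hq v => ?_⟩
  have hq' := (hsrc q).1 hq
  have h1 : ∀ v : Euc m, vderiv (𝓡 m) (flatten hF.two_le ∘ Φ) q v =
      flatten hF.two_le (vderiv (𝓡 m) Φ q v) := by
    intro v
    rw [vderiv_comp (flatten hF.two_le).differentiableAt (Φ.mdifferentiableAt (by simp) hq'),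
      ContinuousLinearEquiv.fderiv]
    rfl
  have h2 := ((h.exists_eta hF hq').1 v).trans
    (flatten_apply_eq_zero_iff hF.two_le (vderiv (𝓡 m) Φ q v)).symm
  rw [← h1 v] at h2
  exact h2

end Submersive

/-! ### Leaves -/

section ChainRule

variable {E H X E' H' X' W : Type*} [NormedAddCommGroup E] [NormedSpace ℝ E] [TopologicalSpace H]
  [TopologicalSpace X] [ChartedSpace H X] [NormedAddCommGroup E'] [NormedSpace ℝ E']
  [TopologicalSpace H'] [TopologicalSpace X'] [ChartedSpace H' X'] [NormedAddCommGroup W]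
  [NormedSpace ℝ W] {I : ModelWithCorners ℝ E H} {I' : ModelWithCorners ℝ E' H'}

theorem vderiv_comp_map {g : X' → W} {f : X → X'} {p : X}
    (hg : MDifferentiableAt I' 𝓘(ℝ, W) g (f p)) (hf : MDifferentiableAt I I' f p) (v : E) :
    vderiv I (g ∘ f) p v = vderiv I' g (f p) (mfderiv I I' f p (v : TangentSpace I p)) :=
  DFunLike.congr_fun (mfderiv_comp p hg hf) v

theorem vderiv_const (c : W) (p : X) : vderiv I (fun _ => c) p = 0 := mfderiv_const

theorem vderiv_eq_fderiv {g : E → W} {u : E} : vderiv 𝓘(ℝ, E) g u = fderiv ℝ g u :=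
  mfderiv_eq_fderiv

end ChainRule

/-! ### Curves tangent to the distribution, and saturation of open sets. -/

section Leaves

variable {m N : ℕ} {M : Type*} [TopologicalSpace M] [ChartedSpace (Euc m) M]
  {F : M → ℙ ℂ (Fin N → ℂ)} {D : ∀ p : M, Submodule ℝ (TangentSpace (𝓡 m) p)}

/-- Along the curve the normalized lifts have derivative `η(γ') τ = 0`, so `F ∘ γ` is locally
constant on the connected line. -/
theorem IsSubmersiveCurve.eq_of_curve (hF : IsSubmersiveCurve F D) {γ : ℝ → M}
    (hγ : ContMDiff 𝓘(ℝ, ℝ) (𝓡 m) ∞ γ)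
    (hD : ∀ t : ℝ, mfderiv 𝓘(ℝ, ℝ) (𝓡 m) γ t (1 : ℝ) ∈ D (γ t)) (s t : ℝ) :
    F (γ s) = F (γ t) := by
  have hloc : ∀ t₀, ∀ᶠ t in 𝓝 t₀, F (γ t) = F (γ t₀) := by
    intro t₀
    obtain ⟨k, hk⟩ := exists_rep_ne_zero (F (γ t₀))
    have hO := (hF.isOpen_rep_ne_zero k).preimage hγ.continuous
    obtain ⟨ε, hε, hball⟩ := Metric.isOpen_iff.1 hO t₀ hk
    have hd : ∀ t ∈ Metric.ball t₀ ε, DifferentiableAt ℝ ((normRep k ∘ F) ∘ γ) t ∧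
        fderiv ℝ ((normRep k ∘ F) ∘ γ) t = 0 := by
      intro t ht
      have hk' := hball ht
      have h1 := (hF.contMDiffAt hk').mdifferentiableAt (by simp)
      have h2 := (hγ t).mdifferentiableAt (by simp)
      refine ⟨mdifferentiableAt_iff_differentiableAt.1 (h1.comp t h2), ?_⟩
      obtain ⟨η, -, hker, hη⟩ := hF.exists_eta (γ t)
      obtain ⟨τ, -, hτ⟩ := hη k hk'
      refine ContinuousLinearMap.ext_ring ?_
      rw [← vderiv_eq_fderiv, vderiv_comp_map h1 h2]
      refine (hτ _).trans ?_
      have h3 := (hker _).1 (hD t)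
      rw [h3, zero_smul]
      rfl
    filter_upwards [Metric.ball_mem_nhds t₀ hε] with t ht
    refine eq_of_normRep_eq (hball ht) hk ?_
    exact Metric.isOpen_ball.is_const_of_fderiv_eq_zero (convex_ball t₀ ε).isPreconnected
      (fun t ht => (hd t ht).1.differentiableWithinAt) (fun t ht => (hd t ht).2) ht
      (Metric.mem_ball_self hε)
  exact ((IsLocallyConstant.iff_eventually_eq _).2 hloc).apply_eq_of_preconnectedSpace s t

theorem IsSubmersiveCurve.eq_of_leafSetoid (hF : IsSubmersiveCurve F D) {p q : M}
    (h : leafSetoid D p q) : F p = F q := by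
  induction h with
  | rel a b h =>
    obtain ⟨γ, hγ, h0, h1, hD⟩ := h
    rw [← h0, ← h1]; exact hF.eq_of_curve hγ hD 0 1
  | refl a => rfl
  | symm a b _ ih => exact ih.symm
  | trans a b c _ _ ih ih' => exact ih.trans ih'

theorem leafSetoid_of_leafRel {p q : M} (h : LeafRel D p q) : leafSetoid D p q :=
  Relation.EqvGen.rel _ _ h

theorem continuous_leafProj : Continuous (leafProj D) := continuous_quotient_mk'

theorem surjective_leafProj : Function.Surjective (leafProj D) := Quotient.mk_surjective

variable [IsManifold (𝓡 m) ∞ M] {k j : Fin N}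
  {Φ : PartialDiffeomorph (𝓡 m) 𝓘(ℝ, ℂ × Euc (m - 2)) M (ℂ × Euc (m - 2)) ∞}
  {a : ℂ} {b : Euc (m - 2)} {r : ℝ}

theorem IsFlowBox.leafRel (h : IsFlowBox F k j Φ a b r) (hF : IsSubmersiveCurve F D) {q q' : M}
    (hq : q ∈ Φ.source) (hq' : q' ∈ Φ.source) (hqq' : (Φ q).1 = (Φ q').1) : LeafRel D q q' := by
  -- The segment within the slice. The smooth transition is constant outside `[0, 1]`, so the curve
  -- is defined on all of `ℝ` and never leaves the convex target.
  let u : ℝ → ℂ × Euc (m - 2) := fun t =>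
    Φ q + Real.smoothTransition t • (Φ q' - Φ q)
  have hu1 : ∀ t, (u t).1 = (Φ q).1 := by
    intro t
    change (Φ q).1 + _ • ((Φ q').1 - (Φ q).1) = _
    rw [hqq', sub_self, smul_zero, add_zero]
  have hut : ∀ t, u t ∈ Φ.target := by
    intro t
    have hconv : Convex ℝ Φ.target := by
      rw [h.target_eq]; exact (convex_ball a r).prod (convex_ball b r)
    exact hconv.add_smul_sub_mem (Φ.map_source hq) (Φ.map_source hq')
      ⟨Real.smoothTransition.nonneg t, Real.smoothTransition.le_one t⟩
  have hus : ContDiff ℝ ∞ u := contDiff_const.add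
    (Real.smoothTransition.contDiff.smul contDiff_const)
  have hγ : ContMDiff 𝓘(ℝ, ℝ) (𝓡 m) ∞ (fun t => Φ.invFun (u t)) := fun t =>
    (Φ.contMDiffOn_invFun.contMDiffAt (Φ.open_target.mem_nhds (hut t))).comp t
      hus.contMDiff.contMDiffAt
  refine ⟨fun t => Φ.invFun (u t), hγ, ?_, ?_, fun t => ?_⟩
  · have : u 0 = Φ q := by simp [u]
    simp only [this]; exact Φ.left_inv hq
  · have : u 1 = Φ q' := by simp [u]
    simp only [this]; exact Φ.left_inv hq'
  · have hs : Φ.invFun (u t) ∈ Φ.source := Φ.map_target (hut t)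
    refine ((h.exists_eta hF hs).1 _).2 ?_
    have h1 := Φ.mdifferentiableAt (by simp) hs
    have h2 : MDifferentiableAt (𝓡 m) 𝓘(ℝ, ℂ) (fun q => (Φ q).1) (Φ.invFun (u t)) :=
      (differentiableAt_fst (𝕜 := ℝ)).mdifferentiableAt.comp (I' := 𝓘(ℝ, ℂ × Euc (m - 2))) _ h1
    refine (vderiv_fst h1 _).symm.trans ?_
    have h3 := vderiv_comp_map (f := fun t => Φ.invFun (u t)) (p := t) h2 ((hγ t).mdifferentiableAt (by simp)) (1 : ℝ)
    refine h3.symm.trans ?_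
    have h4 : ((fun q => (Φ q).1) ∘ fun t => Φ.invFun (u t)) = fun _ => (Φ q).1 := by
      funext t
      rw [← hu1 t]
      exact congrArg Prod.fst (Φ.right_inv (hut t))
    rw [h4, vderiv_const]
    rfl

/-- The set of such times is open and closed in `ℝ`. For closedness, points of a flow box at a limit
time are moved along their slices by `ψ` to the height of a point `γ t₁` in the interior. This
preserves leaves, is continuous, and sends the limit point to `γ t₁`, because `F` and hence the
transverse coordinate is constant along the curve. -/
theorem IsSubmersiveCurve.mem_interior_of_curve (hF : IsSubmersiveCurve F D) {S : Set M}
    (hS : ∀ p q, leafSetoid D p q → p ∈ S → q ∈ S) {γ : ℝ → M}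
    (hγ : ContMDiff 𝓘(ℝ, ℝ) (𝓡 m) ∞ γ)
    (hD : ∀ t : ℝ, mfderiv 𝓘(ℝ, ℝ) (𝓡 m) γ t (1 : ℝ) ∈ D (γ t)) {s : ℝ}
    (hs : γ s ∈ interior S) (t : ℝ) : γ t ∈ interior S := by
  have hclopen : IsClopen (γ ⁻¹' interior S) := by
    refine ⟨isClosed_of_closure_subset fun t₀ ht₀ => ?_, isOpen_interior.preimage hγ.continuous⟩
    obtain ⟨k, j, Φ, a, b, r, hp, h⟩ := hF.exists_isFlowBox (γ t₀)
    obtain ⟨t₁, ht₁, ht₁'⟩ := mem_closure_iff.1 ht₀ _ (Φ.open_source.preimage hγ.continuous) hp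
    have hfst : ∀ q ∈ Φ.source, ((Φ q).1, (Φ (γ t₁)).2) ∈ Φ.target := by
      intro q hq
      have h1 := Φ.map_source hq
      have h2 := Φ.map_source ht₁
      rw [h.target_eq] at h1 h2 ⊢
      exact ⟨h1.1, h2.2⟩
    let ψ : M → M := fun q => Φ.invFun ((Φ q).1, (Φ (γ t₁)).2)
    have hψ : ψ (γ t₀) = γ t₁ := by
      have h1 : (Φ (γ t₀)).1 = (Φ (γ t₁)).1 := by
        rw [h.fst_eq _ hp, h.fst_eq _ ht₁, hF.eq_of_curve hγ hD t₀ t₁]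
      simp only [ψ, h1]
      exact Φ.left_inv ht₁
    have hψc : ContinuousAt ψ (γ t₀) := by
      have h1 : ContinuousAt Φ (γ t₀) :=
        Φ.contMDiffOn_toFun.continuousOn.continuousAt (Φ.open_source.mem_nhds hp)
      have h2 : ContinuousAt Φ.invFun ((Φ (γ t₀)).1, (Φ (γ t₁)).2) :=
        Φ.contMDiffOn_invFun.continuousOn.continuousAt (Φ.open_target.mem_nhds (hfst _ hp))
      exact ContinuousAt.comp (g := Φ.invFun) (f := fun q => ((Φ q).1, (Φ (γ t₁)).2)) h2
        (h1.fst.prodMk continuousAt_const)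
    have hev : ∀ᶠ q in 𝓝 (γ t₀), ψ q ∈ interior S := by
      refine hψc.eventually (isOpen_interior.mem_nhds ?_)
      rw [hψ]; exact ht₁'
    refine mem_interior_iff_mem_nhds.2 ?_
    filter_upwards [hev, Φ.open_source.mem_nhds hp] with q hq hqs
    refine hS (ψ q) q (leafSetoid_of_leafRel (h.leafRel hF (Φ.map_target (hfst q hqs)) hqs ?_))
      (interior_subset hq)
    have h1 : Φ (ψ q) = ((Φ q).1, (Φ (γ t₁)).2) := Φ.right_inv (hfst q hqs)
    rw [h1]
  have := (isClopen_iff.1 hclopen).resolve_left (Set.nonempty_iff_ne_empty.1 ⟨s, hs⟩)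
  have ht : t ∈ γ ⁻¹' interior S := by rw [this]; trivial
  exact ht

/-- By transport along curves the interior of a saturated set is saturated. The saturation of an
open set `V` has interior containing `V`, so it equals its interior. -/
theorem IsSubmersiveCurve.isOpenMap_leafProj (hF : IsSubmersiveCurve F D) :
    IsOpenMap (leafProj D) := by
  intro V hV
  rw [← (isQuotientMap_quotient_mk' (s := leafSetoid D)).isOpen_preimage]
  set S : Set M := leafProj D ⁻¹' (leafProj D '' V) with hSdef
  have hS : ∀ p q, leafSetoid D p q → p ∈ S → q ∈ S := by
    intro p q hpq hp
    have : leafProj D p = leafProj D q := Quotient.sound hpq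
    rw [hSdef, Set.mem_preimage, ← this]; exact hp
  have hVS : V ⊆ interior S :=
    interior_maximal (fun p hp => ⟨p, hp, rfl⟩) hV
  have hsat : ∀ p q, leafSetoid D p q → (p ∈ interior S ↔ q ∈ interior S) := by
    intro p q hpq
    induction hpq with
    | rel a b h =>
      obtain ⟨γ, hγ, h0, h1, hD⟩ := h
      rw [← h0, ← h1]
      exact ⟨fun h => hF.mem_interior_of_curve hS hγ hD h 1,
        fun h => hF.mem_interior_of_curve hS hγ hD h 0⟩
    | refl a => rfl
    | symm a b _ ih => exact ih.symm
    | trans a b c _ _ ih ih' => exact ih.trans ih'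
  have : S = interior S := by
    refine Set.Subset.antisymm (fun q hq => ?_) interior_subset
    obtain ⟨p, hp, hpq⟩ := hq
    exact (hsat p q (Quotient.exact hpq)).1 (hVS hp)
  change IsOpen S
  rw [this]; exact isOpen_interior

end Leaves

/-! ### The space of leaves -/

section LeafSpace

variable {m N : ℕ} {M : Type*} [TopologicalSpace M] [ChartedSpace (Euc m) M]
  [IsManifold (𝓡 m) ∞ M]
  {F : M → ℙ ℂ (Fin N → ℂ)} {D : ∀ p : M, Submodule ℝ (TangentSpace (𝓡 m) p)}

/-- A chart of the foliation defined by a map into the projective space. -/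
structure FlowBox (m : ℕ) {N : ℕ} {M : Type*} [TopologicalSpace M] [ChartedSpace (Euc m) M]
    (F : M → ℙ ℂ (Fin N → ℂ)) where
  denom : Fin N
  numer : Fin N
  toChart : PartialDiffeomorph (𝓡 m) 𝓘(ℝ, ℂ × Euc (m - 2)) M (ℂ × Euc (m - 2)) ∞
  centre : ℂ
  slice : Euc (m - 2)
  radius : ℝ
  isFlowBox : IsFlowBox F denom numer toChart centre slice radius

namespace FlowBox

variable (B : FlowBox m F)

/-- The transversal of a flow box. -/
def transversal (z : ℂ) : M := B.toChart.invFun (z, B.slice)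

/-- The domain of the transversal. -/
def disc : Set ℂ := Metric.ball B.centre B.radius

theorem isOpen_disc : IsOpen B.disc := Metric.isOpen_ball

theorem mem_target {z : ℂ} (hz : z ∈ B.disc) : (z, B.slice) ∈ B.toChart.target := by
  rw [B.isFlowBox.target_eq]
  exact ⟨hz, Metric.mem_ball_self B.isFlowBox.pos⟩

theorem transversal_mem {z : ℂ} (hz : z ∈ B.disc) : B.transversal z ∈ B.toChart.source :=
  B.toChart.map_target (B.mem_target hz)

theorem toChart_transversal {z : ℂ} (hz : z ∈ B.disc) :
    B.toChart (B.transversal z) = (z, B.slice) := B.toChart.right_inv (B.mem_target hz)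

theorem normRep_transversal {z : ℂ} (hz : z ∈ B.disc) :
    normRep B.denom (F (B.transversal z)) B.numer = z := by
  rw [← B.isFlowBox.fst_eq _ (B.transversal_mem hz), B.toChart_transversal hz]

theorem normRep_mem_disc {q : M} (hq : q ∈ B.toChart.source) :
    normRep B.denom (F q) B.numer ∈ B.disc := by
  rw [← B.isFlowBox.fst_eq _ hq]
  have := B.toChart.map_source hq
  rw [B.isFlowBox.target_eq] at this
  exact this.1

theorem contMDiffOn_transversal : ContMDiffOn 𝓘(ℝ, ℂ) (𝓡 m) ∞ B.transversal B.disc :=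
  B.toChart.contMDiffOn_invFun.comp
    (contDiff_id.prodMk contDiff_const).contMDiff.contMDiffOn fun _ hz => B.mem_target hz

theorem leafProj_transversal (hF : IsSubmersiveCurve F D) {q : M} (hq : q ∈ B.toChart.source) :
    leafProj D (B.transversal (normRep B.denom (F q) B.numer)) = leafProj D q := by
  have hz := B.normRep_mem_disc hq
  refine Quotient.sound (leafSetoid_of_leafRel (B.isFlowBox.leafRel hF (B.transversal_mem hz) hq ?_))
  rw [B.toChart_transversal hz, B.isFlowBox.fst_eq q hq]

/-- The normalized lifts are holomorphic functions along a transversal. -/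
theorem hasDerivAt_normRep (hF : IsSubmersiveCurve F D) {z : ℂ} (hz : z ∈ B.disc) {l : Fin N}
    (hl : (F (B.transversal z)).rep l ≠ 0) :
    ∃ τ : Fin N → ℂ, HasDerivAt (fun z => normRep l (F (B.transversal z))) τ z := by
  have hs := B.transversal_mem hz
  obtain ⟨-, hη⟩ := B.isFlowBox.exists_eta hF hs
  obtain ⟨τ, -, hτ⟩ := hη l hl
  refine ⟨τ, ?_⟩
  have h1 := (hF.contMDiffAt hl).mdifferentiableAt (by simp)
  have h2 := (B.contMDiffOn_transversal.contMDiffAt (B.isOpen_disc.mem_nhds hz)).mdifferentiableAt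
    (by simp)
  have h3 : DifferentiableAt ℝ ((normRep l ∘ F) ∘ B.transversal) z :=
    mdifferentiableAt_iff_differentiableAt.1 (h1.comp z h2)
  have h4 := B.toChart.mdifferentiableAt (by simp) hs
  have h5 : MDifferentiableAt (𝓡 m) 𝓘(ℝ, ℂ) (fun q => (B.toChart q).1) (B.transversal z) :=
    (differentiableAt_fst (𝕜 := ℝ)).mdifferentiableAt.comp (I' := 𝓘(ℝ, ℂ × Euc (m - 2))) _ h4
  have h6 : ∀ ζ : ℂ, (vderiv (𝓡 m) B.toChart (B.transversal z)
      (mfderiv 𝓘(ℝ, ℂ) (𝓡 m) B.transversal z ζ)).1 = ζ := by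
    intro ζ
    refine (vderiv_fst h4 _).symm.trans ?_
    refine (vderiv_comp_map h5 h2 ζ).symm.trans ?_
    rw [vderiv_congr (g' := fun z => z), vderiv_eq_fderiv, fderiv_fun_id]
    · rfl
    · filter_upwards [B.isOpen_disc.mem_nhds hz] with z' hz'
      exact congrArg Prod.fst (B.toChart_transversal hz')
  rw [hasDerivAt_iff_hasFDerivAt]
  -- Along the transversal the first coordinate of the box is the identity, so the real differential
  -- is `ζ ↦ ζ • τ`, which is complex linear.
  refine hasFDerivAt_of_restrictScalars ℝ h3.hasFDerivAt ?_
  ext1 ζ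
  rw [← vderiv_eq_fderiv, vderiv_comp_map h1 h2]
  refine Eq.trans ?_ (hτ _).symm
  rw [h6]
  simp

end FlowBox

theorem IsSubmersiveCurve.exists_flowBox (hF : IsSubmersiveCurve F D) (p : M) :
    ∃ B : FlowBox m F, p ∈ B.toChart.source := by
  obtain ⟨k, j, Φ, a, b, r, hp, h⟩ := hF.exists_isFlowBox p
  exact ⟨⟨k, j, Φ, a, b, r, h⟩, hp⟩

/-- The map induced on the space of leaves. -/
def leafMap (hF : IsSubmersiveCurve F D) : LeafSpace D → ℙ ℂ (Fin N → ℂ) :=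
  Quotient.lift F fun _ _ h => hF.eq_of_leafSetoid h

theorem leafMap_leafProj (hF : IsSubmersiveCurve F D) (p : M) : leafMap hF (leafProj D p) = F p :=
  rfl

theorem map_nhds_leafProj (hF : IsSubmersiveCurve F D) (p : M) :
    Filter.map (leafProj D) (𝓝 p) = 𝓝 (leafProj D p) :=
  hF.isOpenMap_leafProj.map_nhds_eq continuous_leafProj.continuousAt

/-- The chart of the space of leaves defined by a flow box. -/
def FlowBox.leafChart (hF : IsSubmersiveCurve F D) (B : FlowBox m F) :
    OpenPartialHomeomorph (LeafSpace D) ℂ where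
  toFun Q := normRep B.denom (leafMap hF Q) B.numer
  invFun z := leafProj D (B.transversal z)
  source := leafProj D '' B.toChart.source
  target := B.disc
  map_source' := by
    rintro _ ⟨q, hq, rfl⟩
    exact B.normRep_mem_disc hq
  map_target' z hz := ⟨_, B.transversal_mem hz, rfl⟩
  left_inv' := by
    rintro _ ⟨q, hq, rfl⟩
    exact B.leafProj_transversal hF hq
  right_inv' z hz := B.normRep_transversal hz
  open_source := hF.isOpenMap_leafProj _ B.toChart.open_source
  open_target := B.isOpen_disc
  continuousOn_toFun := by
    rintro _ ⟨q, hq, rfl⟩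
    refine ContinuousAt.continuousWithinAt ?_
    -- Openness of the projection makes neighbourhood filters images of those upstairs, so
    -- continuity can be tested on `M`.
    rw [ContinuousAt, ← map_nhds_leafProj hF, Filter.tendsto_map'_iff]
    exact (continuous_apply B.numer).continuousAt.comp
      (hF.contMDiffAt (B.isFlowBox.rep_ne_zero q hq)).continuousAt
  continuousOn_invFun :=
    continuous_leafProj.comp_continuousOn B.contMDiffOn_transversal.continuousOn

/-- The charted space structure of the space of leaves. -/
@[reducible] def leafChartedSpace (hF : IsSubmersiveCurve F D) : ChartedSpace ℂ (LeafSpace D) where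
  atlas := Set.range fun B : FlowBox m F => B.leafChart hF
  chartAt Q := (hF.exists_flowBox Q.out).choose.leafChart hF
  mem_chart_source Q := ⟨Q.out, (hF.exists_flowBox Q.out).choose_spec, Quotient.out_eq Q⟩
  chart_mem_atlas _ := ⟨_, rfl⟩

theorem rep_ne_zero_of_mem_leafChart (hF : IsSubmersiveCurve F D) {B : FlowBox m F}
    {Q : LeafSpace D} (hQ : Q ∈ (B.leafChart hF).source) : (leafMap hF Q).rep B.denom ≠ 0 := by
  obtain ⟨q, hq, rfl⟩ := hQ
  exact B.isFlowBox.rep_ne_zero q hq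

/-- A coordinate change is one component of a normalized lift along a transversal; it is complex
differentiable on an open set, hence analytic. -/
theorem contDiffOn_leafChart_transition (hF : IsSubmersiveCurve F D) (B B' : FlowBox m F) :
    ContDiffOn ℂ ω ((B.leafChart hF).symm ≫ₕ B'.leafChart hF)
      ((B.leafChart hF).symm ≫ₕ B'.leafChart hF).source := by
  refine DifferentiableOn.contDiffOn (fun z hz => ?_) (OpenPartialHomeomorph.open_source _)
  obtain ⟨τ, hτ⟩ := B.hasDerivAt_normRep hF (l := B'.denom) hz.1
    (rep_ne_zero_of_mem_leafChart hF hz.2)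
  exact ((hasDerivAt_pi.1 hτ B'.numer).differentiableAt).differentiableWithinAt

theorem isManifold_leafSpace (hF : IsSubmersiveCurve F D) :
    letI := leafChartedSpace hF
    IsManifold 𝓘(ℂ, ℂ) ω (LeafSpace D) ∧ IsManifold 𝓘(ℝ, ℂ) ∞ (LeafSpace D) := by
  let := leafChartedSpace hF
  constructor
  · refine isManifold_of_contDiffOn _ _ _ ?_
    rintro _ _ ⟨B, rfl⟩ ⟨B', rfl⟩
    simpa using contDiffOn_leafChart_transition hF B B'
  · refine isManifold_of_contDiffOn _ _ _ ?_
    rintro _ _ ⟨B, rfl⟩ ⟨B', rfl⟩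
    have := ((contDiffOn_leafChart_transition hF B B').restrict_scalars ℝ).of_le
      (show (∞ : WithTop ℕ∞) ≤ ω from le_top)
    simpa using this

theorem secondCountable_leafSpace [SecondCountableTopology M] (hF : IsSubmersiveCurve F D) :
    SecondCountableTopology (LeafSpace D) :=
  TopologicalSpace.Quotient.secondCountableTopology hF.isOpenMap_leafProj

/-- A chart domain maps injectively and continuously to `ℂ`. Different leaves need not have disjoint
saturated neighbourhoods, so only local separation is obtained. -/
theorem exists_t2_nhds (hF : IsSubmersiveCurve F D) (Q : LeafSpace D) :
    ∃ U : Set (LeafSpace D), IsOpen U ∧ Q ∈ U ∧ T2Space U := by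
  let := leafChartedSpace hF
  refine ⟨(chartAt ℂ Q).source, (chartAt ℂ Q).open_source, mem_chart_source ℂ Q, ?_⟩
  exact T2Space.of_injective_continuous (chartAt ℂ Q).injOn.injective
    (chartAt ℂ Q).continuousOn.domRestrict

end LeafSpace

/-! ### The projection onto the space of leaves -/

section Quotient

variable {m N : ℕ} {M : Type*} [TopologicalSpace M] [ChartedSpace (Euc m) M]
  {F : M → ℙ ℂ (Fin N → ℂ)} {D : ∀ p : M, Submodule ℝ (TangentSpace (𝓡 m) p)}

/-- The differential of a map into a surface, on the model spaces. -/
def surfDeriv {X : Type*} [TopologicalSpace X] [ChartedSpace ℂ X] (π : M → X) (p : M) :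
    Euc m →L[ℝ] ℂ :=
  mfderiv (𝓡 m) 𝓘(ℝ, ℂ) π p

/-- `π` is a surjective submersion with kernel `D` onto a surface, and `F` descends to a map `G` on
the surface whose normalized lifts are smooth with complex linear differential. -/
structure IsQuotientCurve {X : Type*} [TopologicalSpace X] [ChartedSpace ℂ X] (π : M → X)
    (G : X → ℙ ℂ (Fin N → ℂ)) (F : M → ℙ ℂ (Fin N → ℂ))
    (D : ∀ p : M, Submodule ℝ (TangentSpace (𝓡 m) p)) : Prop where
  smooth : ContMDiff (𝓡 m) 𝓘(ℝ, ℂ) ∞ π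
  surjective : Function.Surjective π
  surjective_deriv : ∀ p, Function.Surjective (surfDeriv (m := m) π p)
  mem_iff : ∀ p (v : Euc m), v ∈ D p ↔ surfDeriv π p v = 0
  comp_eq : ∀ p, G (π p) = F p
  isLiftAt : ∀ Q k, (G Q).rep k ≠ 0 → IsLiftAt 𝓘(ℝ, ℂ) G (normRep k ∘ G) Q
  vderiv_eq : ∀ p k, (F p).rep k ≠ 0 → ∃ τ : Fin N → ℂ, τ ≠ 0 ∧
    ∀ v : Euc m, vderiv (𝓡 m) (normRep k ∘ F) p v =
      surfDeriv π p v • τ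

variable [IsManifold (𝓡 m) ∞ M]

/-- In the coordinates of the space of leaves, the projection has a derivative that is a nonzero
multiple of the first component of a flow box. -/
theorem exists_smul_vderiv_leafChart (hF : IsSubmersiveCurve F D) {B B₀ : FlowBox m F} {p : M}
    (hp : p ∈ B.toChart.source) (hp₀ : leafProj D p ∈ (B₀.leafChart hF).source) :
    ∃ c : ℂ, c ≠ 0 ∧ ∀ v, vderiv (𝓡 m) (B₀.leafChart hF ∘ leafProj D) p v =
      (vderiv (𝓡 m) B.toChart p v).1 * c := by
  obtain ⟨-, hη⟩ := B.isFlowBox.exists_eta hF hp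
  have hk : (F p).rep B₀.denom ≠ 0 := rep_ne_zero_of_mem_leafChart hF hp₀
  obtain ⟨τ, -, hτ⟩ := hη _ hk
  have hmd := (hF.contMDiffAt hk).mdifferentiableAt (n := ∞) (by simp)
  have h1 : ∀ v, vderiv (𝓡 m) (B₀.leafChart hF ∘ leafProj D) p v =
      (vderiv (𝓡 m) B.toChart p v).1 * τ B₀.numer := by
    intro v
    change vderiv (𝓡 m) (fun q => (normRep B₀.denom ∘ F) q B₀.numer) p v = _
    rw [vderiv_apply hmd, hτ]
    rfl
  refine ⟨τ B₀.numer, fun h0 => ?_, h1⟩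
  set z₀ : ℂ := B₀.leafChart hF (leafProj D p) with hz₀
  have hz₀d : z₀ ∈ B₀.disc := (B₀.leafChart hF).map_source hp₀
  have hσ : leafProj D (B₀.transversal z₀) = leafProj D p := (B₀.leafChart hF).left_inv hp₀
  have hFσ : F (B₀.transversal z₀) = F p := by
    rw [← leafMap_leafProj hF, hσ, leafMap_leafProj]
  have hl : (F (B₀.transversal z₀)).rep B.denom ≠ 0 := by
    rw [hFσ]; exact B.isFlowBox.rep_ne_zero p hp
  obtain ⟨τ', hτ'⟩ := B₀.hasDerivAt_normRep hF hz₀d hl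
  set g : ℂ → ℂ := fun z => normRep B.denom (F (B₀.transversal z)) B.numer with hg
  have hgd : DifferentiableAt ℝ g z₀ :=
    ((hasDerivAt_pi.1 hτ' B.numer).differentiableAt).restrictScalars ℝ
  -- The coordinate of `B` factors through that of `B₀`. If the factor were zero, the first
  -- coordinate of `B` would have vanishing differential at `p`, contrary to `B` being a
  -- diffeomorphism.
  have h2 : (fun q => (B.toChart q).1) =ᶠ[𝓝 p] g ∘ (B₀.leafChart hF ∘ leafProj D) := by
    have h3 : ∀ᶠ q in 𝓝 p, leafProj D q ∈ (B₀.leafChart hF).source :=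
      continuous_leafProj.continuousAt.eventually ((B₀.leafChart hF).open_source.mem_nhds hp₀)
    filter_upwards [h3, B.toChart.open_source.mem_nhds hp] with q hq hq'
    have h4 : leafProj D (B₀.transversal (B₀.leafChart hF (leafProj D q))) = leafProj D q :=
      (B₀.leafChart hF).left_inv hq
    have h5 : F (B₀.transversal (B₀.leafChart hF (leafProj D q))) = F q := by
      rw [← leafMap_leafProj hF, h4, leafMap_leafProj]
    simp only [hg, Function.comp_apply, h5]
    exact B.isFlowBox.fst_eq q hq'
  have hmd' : MDifferentiableAt (𝓡 m) 𝓘(ℝ, ℂ) (B₀.leafChart hF ∘ leafProj D) p := by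
    have : DifferentiableAt ℝ (fun w : Fin N → ℂ => w B₀.numer) ((normRep B₀.denom ∘ F) p) :=
      (ContinuousLinearMap.proj B₀.numer : (Fin N → ℂ) →L[ℝ] ℂ).differentiableAt
    exact this.mdifferentiableAt.comp p hmd
  obtain ⟨v, hv'⟩ : ∃ v : Euc m, vderiv (𝓡 m) B.toChart p v = ((1, 0) : ℂ × Euc (m - 2)) :=
    (bijective_mfderiv (E := Euc m) (E' := ℂ × Euc (m - 2)) B.toChart hp).2
      ((1, 0) : ℂ × Euc (m - 2))
  have h6 := vderiv_fst (B.toChart.mdifferentiableAt (by simp) hp) v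
  have h7 := vderiv_comp (F := g) (g := B₀.leafChart hF ∘ leafProj D) hgd hmd' v
  rw [vderiv_congr h2, h7, h1, h0, mul_zero, map_zero, hv'] at h6
  exact zero_ne_one h6

/-- The projection onto the space of leaves is a submersion with kernel `D`, and the normalized lifts
have complex linear differential. -/
theorem isQuotientCurve_leafProj (hF : IsSubmersiveCurve F D) :
    letI := leafChartedSpace hF
    IsQuotientCurve (leafProj D) (leafMap hF) F D := by
  let := leafChartedSpace hF
  have hman : IsManifold 𝓘(ℝ, ℂ) ∞ (LeafSpace D) := (isManifold_leafSpace hF).2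
  have hchart : ∀ Q : LeafSpace D, ∃ B₀ : FlowBox m F, chartAt ℂ Q = B₀.leafChart hF :=
    fun Q => ⟨_, rfl⟩
  have hsm : ContMDiff (𝓡 m) 𝓘(ℝ, ℂ) ∞ (leafProj D) := by
    intro p
    rw [contMDiffAt_iff_target]
    refine ⟨continuous_leafProj.continuousAt, ?_⟩
    obtain ⟨B₀, hB₀⟩ := hchart (leafProj D p)
    have hp₀ : leafProj D p ∈ (B₀.leafChart hF).source := by
      rw [← hB₀]; exact mem_chart_source ℂ _
    have hk : (F p).rep B₀.denom ≠ 0 := rep_ne_zero_of_mem_leafChart hF hp₀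
    have h1 : extChartAt 𝓘(ℝ, ℂ) (leafProj D p) ∘ leafProj D =
        (fun w : Fin N → ℂ => w B₀.numer) ∘ (normRep B₀.denom ∘ F) := by
      funext q
      simp only [extChartAt, hB₀]
      rfl
    rw [h1]
    exact (ContinuousLinearMap.proj B₀.numer : (Fin N → ℂ) →L[ℝ] ℂ).contDiff.contMDiff.contMDiffAt.comp
      p (hF.contMDiffAt hk)
  have hmf : ∀ p, ∃ B₀ : FlowBox m F, leafProj D p ∈ (B₀.leafChart hF).source ∧
      ∀ v : Euc m, surfDeriv (leafProj D) p v =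
        vderiv (𝓡 m) (B₀.leafChart hF ∘ leafProj D) p v := by
    intro p
    obtain ⟨B₀, hB₀⟩ := hchart (leafProj D p)
    have hp₀ : leafProj D p ∈ (B₀.leafChart hF).source := by
      rw [← hB₀]; exact mem_chart_source ℂ _
    refine ⟨B₀, hp₀, fun v => ?_⟩
    have h1 : MDifferentiableAt (𝓡 m) 𝓘(ℝ, ℂ) (B₀.leafChart hF ∘ leafProj D) p := by
      have hk : (F p).rep B₀.denom ≠ 0 := rep_ne_zero_of_mem_leafChart hF hp₀
      have : DifferentiableAt ℝ (fun w : Fin N → ℂ => w B₀.numer) ((normRep B₀.denom ∘ F) p) :=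
        (ContinuousLinearMap.proj B₀.numer : (Fin N → ℂ) →L[ℝ] ℂ).differentiableAt
      exact this.mdifferentiableAt.comp p ((hF.contMDiffAt hk).mdifferentiableAt (by simp))
    have h2 := (hsm.mdifferentiableAt (x := p) (by simp)).mfderiv
    have h3 := h1.mfderiv
    have h4 : writtenInExtChartAt (𝓡 m) 𝓘(ℝ, ℂ) p (leafProj D) =
        writtenInExtChartAt (𝓡 m) 𝓘(ℝ, ℂ) p (B₀.leafChart hF ∘ leafProj D) := by
      funext u
      simp only [writtenInExtChartAt, extChartAt, hB₀]
      rfl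
    rw [h4] at h2
    exact DFunLike.congr_fun (h2.trans h3.symm) v
  -- The differential of the projection, in the preferred chart of the leaf space, is the first
  -- component of a flow box times a nonzero complex number. Surjectivity, the kernel and complex
  -- linearity all follow from this.
  have hmaster : ∀ p, ∃ (B : FlowBox m F) (c : ℂ), p ∈ B.toChart.source ∧ c ≠ 0 ∧
      ∀ v : Euc m, surfDeriv (leafProj D) p v =
        (vderiv (𝓡 m) B.toChart p v).1 * c := by
    intro p
    obtain ⟨B₀, hp₀, h⟩ := hmf p
    obtain ⟨B, hB⟩ := hF.exists_flowBox p
    obtain ⟨c, hc, h'⟩ := exists_smul_vderiv_leafChart hF hB hp₀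
    exact ⟨B, c, hB, hc, fun v => (h v).trans (h' v)⟩
  refine ⟨hsm, surjective_leafProj, fun p ζ => ?_, fun p v => ?_, fun p => rfl, fun Q k hk => ?_,
    fun p k hk => ?_⟩
  · obtain ⟨B, c, hB, hc, h⟩ := hmaster p
    obtain ⟨v, hv'⟩ : ∃ v : Euc m, vderiv (𝓡 m) B.toChart p v = ((ζ / c, 0) : ℂ × Euc (m - 2)) :=
      (bijective_mfderiv (E := Euc m) (E' := ℂ × Euc (m - 2)) B.toChart hB).2
        ((ζ / c, 0) : ℂ × Euc (m - 2))
    refine ⟨v, (h v).trans ?_⟩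
    rw [hv']
    exact div_mul_cancel₀ _ hc
  · obtain ⟨B, c, hB, hc, h⟩ := hmaster p
    refine ((B.isFlowBox.exists_eta hF hB).1 v).trans ?_
    rw [h, mul_eq_zero, or_iff_left hc]
  · obtain ⟨B₀, hB₀⟩ := hchart Q
    have hQ₀ : Q ∈ (B₀.leafChart hF).source := by
      rw [← hB₀]; exact mem_chart_source ℂ _
    have hopen : IsOpen {Q | (leafMap hF Q).rep k ≠ 0} := by
      have : {Q | (leafMap hF Q).rep k ≠ 0} = leafProj D '' {p | (F p).rep k ≠ 0} := by
        ext Q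
        constructor
        · intro hQ
          obtain ⟨p, rfl⟩ := surjective_leafProj Q
          exact ⟨p, hQ, rfl⟩
        · rintro ⟨p, hp, rfl⟩; exact hp
      rw [this]
      exact hF.isOpenMap_leafProj _ (hF.isOpen_rep_ne_zero k)
    constructor
    · have h1 : normRep k ∘ leafMap hF =ᶠ[𝓝 Q]
          (fun z => (normRep k ∘ F) (B₀.transversal z)) ∘ B₀.leafChart hF := by
        filter_upwards [(B₀.leafChart hF).open_source.mem_nhds hQ₀] with Q' hQ'
        have h2 : leafProj D (B₀.transversal (B₀.leafChart hF Q')) = Q' :=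
          (B₀.leafChart hF).left_inv hQ'
        simp only [Function.comp_apply]
        rw [← leafMap_leafProj hF, h2]
      have hz : B₀.leafChart hF Q ∈ B₀.disc := (B₀.leafChart hF).map_source hQ₀
      have h3 : (F (B₀.transversal (B₀.leafChart hF Q))).rep k ≠ 0 := by
        have h2 : leafProj D (B₀.transversal (B₀.leafChart hF Q)) = Q :=
          (B₀.leafChart hF).left_inv hQ₀
        rw [← leafMap_leafProj hF, h2]; exact hk
      have h4 : ContMDiffAt 𝓘(ℝ, ℂ) 𝓘(ℝ, Fin N → ℂ) ∞ ((normRep k ∘ F) ∘ B₀.transversal)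
          (B₀.leafChart hF Q) :=
        (hF.contMDiffAt h3).comp _
          (B₀.contMDiffOn_transversal.contMDiffAt (B₀.isOpen_disc.mem_nhds hz))
      have h5 : ContMDiffAt 𝓘(ℝ, ℂ) 𝓘(ℝ, ℂ) ∞ (B₀.leafChart hF) Q := by
        rw [← hB₀]; exact contMDiffOn_chart.contMDiffAt (chart_source_mem_nhds ℂ Q)
      exact (h4.comp Q h5).congr_of_eventuallyEq h1
    · filter_upwards [hopen.mem_nhds hk] with Q' hQ'
      exact ⟨normRep_ne_zero hQ', mk_normRep hQ'⟩
  · obtain ⟨B, c, hB, hc, h⟩ := hmaster p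
    obtain ⟨τ, hτ, h'⟩ := (B.isFlowBox.exists_eta hF hB).2 k hk
    refine ⟨c⁻¹ • τ, smul_ne_zero (inv_ne_zero hc) hτ, fun v => ?_⟩
    rw [h', h v, smul_smul, mul_assoc, mul_inv_cancel₀ hc, mul_one]

end Quotient

/-! ### The complex curve of the mean curvature spheres -/

section GaussPair

variable {m : ℕ} {Y ξ τ : CLor m} {t : ℝ}

theorem IsGaussPair.xi_conj_tau (h : IsGaussPair Y ξ τ t) : lor ξ (conjL τ) = 0 := by
  have := lor_conjL (conjL ξ) τ
  rw [conjL_conjL, lor_comm (conjL ξ), h.tau_conj_xi, map_zero] at this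
  exact this

/-- On the span of `ξ` and `τ` the Hermitian product is `diag(2, 2t²)`. Its positivity yields
independence, the positive metric and the spacelike real parts used for the envelope. -/
theorem IsGaussPair.lor_conj (h : IsGaussPair Y ξ τ t) (a b : ℂ) :
    lor (a • ξ + b • τ) (conjL (a • ξ + b • τ)) =
      ((2 * Complex.normSq a + 2 * t ^ 2 * Complex.normSq b : ℝ) : ℂ) := by
  simp only [conjL_add, conjL_smul, lor_add_left, lor_add_right, lor_smul_left, lor_smul_right,
    h.xi_conj, h.xi_conj_tau, h.tau_conj_xi, h.tau_conj]
  push_cast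
  rw [← Complex.mul_conj, ← Complex.mul_conj]
  ring

theorem IsGaussPair.lor_self (h : IsGaussPair Y ξ τ t) (a b a' b' : ℂ) :
    lor (a • ξ + b • τ) (a' • ξ + b' • τ) = 0 := by
  simp only [lor_add_left, lor_add_right, lor_smul_left, lor_smul_right,
    h.xi_xi, h.xi_tau, h.tau_tau, lor_comm τ ξ]
  ring

theorem IsGaussPair.eq_zero (h : IsGaussPair Y ξ τ t) {a b : ℂ} (h0 : a • ξ + b • τ = 0) :
    a = 0 ∧ b = 0 := by
  have h1 := h.lor_conj a b
  rw [h0, lor_zero_left] at h1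
  have h2 : 2 * Complex.normSq a + 2 * t ^ 2 * Complex.normSq b = 0 := by exact_mod_cast h1.symm
  have h3 := h.pos
  have h4 : 0 ≤ 2 * t ^ 2 * Complex.normSq b :=
    mul_nonneg (by positivity) (Complex.normSq_nonneg b)
  have h5 := Complex.normSq_nonneg a
  constructor
  · exact Complex.normSq_eq_zero.1 (by linarith)
  · refine Complex.normSq_eq_zero.1 ?_
    have : 2 * t ^ 2 * Complex.normSq b = 0 := by linarith
    exact (mul_eq_zero.1 this).resolve_left (by positivity)

theorem IsGaussPair.smul (h : IsGaussPair Y ξ τ t) {κ : ℂ} (hκ : κ ≠ 0) :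
    IsGaussPair Y ξ (κ • τ) (‖κ‖ * t) where
  pos := mul_pos (norm_pos_iff.2 hκ) h.pos
  xi_xi := h.xi_xi
  xi_conj := h.xi_conj
  tau_tau := by rw [lor_smul_left, lor_smul_right, h.tau_tau]; simp
  xi_tau := by rw [lor_smul_right, h.xi_tau, mul_zero]
  tau_conj_xi := by rw [lor_smul_left, h.tau_conj_xi, mul_zero]
  tau_conj := by
    rw [conjL_smul, lor_smul_left, lor_smul_right, h.tau_conj, ← mul_assoc, Complex.mul_conj,
      Complex.normSq_eq_norm_sq]
    push_cast; ring
  Y_xi := h.Y_xi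
  Y_tau := by rw [lor_smul_right, h.Y_tau, mul_zero]

/-- The horizontal part drops the component along `ξ`, and the factor `|c|²` cancels between
numerator and denominator, so the value does not depend on the lift. -/
theorem IsGaussPair.quadricMetric_eq (h : IsGaussPair Y ξ τ t) {c : ℂ} (hc : c ≠ 0) (a ζ : ℂ) :
    quadricMetric (c • ξ) (a • ξ + (c * ζ) • τ) = t ^ 2 * Complex.normSq ζ := by
  have h1 : lor (c • ξ) (conjL (c • ξ)) = ((2 * Complex.normSq c : ℝ) : ℂ) := by
    have := h.lor_conj c 0
    simpa using this
  have hcn : Complex.normSq c ≠ 0 := fun h0 => hc (Complex.normSq_eq_zero.1 h0)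
  have hcc : (starRingEnd ℂ) c ≠ 0 := (map_ne_zero _).2 hc
  have h2 : horPart (c • ξ) (a • ξ + (c * ζ) • τ) = (0 : ℂ) • ξ + (c * ζ) • τ := by
    rw [horPart, conjL_smul, lor_smul_right, lor_smul_right, lor_add_left, lor_smul_left,
      lor_smul_left, lor_smul_left, h.xi_conj, h.tau_conj_xi, smul_smul]
    have : (starRingEnd ℂ) c * (a * 2 + c * ζ * 0) / ((starRingEnd ℂ) c * (c * 2)) * c = a := by
      field_simp; ring
    rw [this]; module
  rw [quadricMetric, h1, h2, h.lor_conj, ← Complex.ofReal_div, Complex.ofReal_re, map_zero, map_mul]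
  field_simp; ring

end GaussPair

/-! ### Holomorphy, isotropy and the induced metric on the quotient surface. -/

section Curve

variable {m : ℕ} {M : Type*} [TopologicalSpace M] [ChartedSpace (Euc m) M]
  {x : M → Amb m} {F : M → ℙ ℂ (CLor m)} {X : Type*} [TopologicalSpace X] [ChartedSpace ℂ X]
  {π : M → X} {G : X → ℙ ℂ (CLor m)}

theorem IsGaussMap.isSubmersiveCurve (hF : IsGaussMap x F) : IsSubmersiveCurve F (Dperp x) := by
  refine ⟨hF.two_le, hF.exists_lift, fun p => ?_⟩
  obtain ⟨η, ξ, τ, t, hp, hs, hk, -, hf⟩ := hF.exists_form p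
  exact ⟨η, ξ, τ, LinearIndependent.pair_iff.2 fun a b h => hp.eq_zero h, hs, hk, hf⟩

theorem IsLift.isLiftAt {U : Set X} {ξ : X → CLor m} (h : IsLift G U ξ) {q : X} (hq : q ∈ U) :
    IsLiftAt 𝓘(ℝ, ℂ) G ξ q :=
  ⟨h.smooth.contMDiffAt (h.isOpen.mem_nhds hq),
    Filter.eventually_of_mem (h.isOpen.mem_nhds hq) h.lifts⟩

/-- The description of the curve `G` at the point `π p`, in a frame `ξ, τ` of the complex line and
its derivative. -/
theorem IsQuotientCurve.exists_curveForm (hπ : IsQuotientCurve π G F (Dperp x))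
    (hF : IsGaussMap x F) (p : M) :
    ∃ (ξ τ : CLor m) (t : ℝ), IsGaussPair (realVec 1 (x p)) ξ τ t ∧
      (∀ v : Euc m, (∀ w ∈ Dperp x p, mobiusMetric x p v w = 0) →
        t ^ 2 * Complex.normSq (surfDeriv π p v) = mu m ^ 2 * mobiusMetric x p v v) ∧
      HasFormAt 𝓘(ℝ, ℂ) G (π p) LinearMap.id ξ τ := by
  obtain ⟨η, ξ₀, τ₀, t, hp, hs, hk, hmet, hf⟩ := hF.exists_form p
  obtain ⟨k, hrep⟩ := exists_rep_ne_zero (F p)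
  obtain ⟨τ₁, hτ₁, hd₁⟩ := hπ.vderiv_eq p k hrep
  obtain ⟨v₁, hv₁⟩ := hπ.surjective_deriv p 1
  obtain ⟨c, hc, hc1, hc2⟩ := hf _ (hF.isSubmersiveCurve.isLiftAt_normRep hrep)
  -- Two descriptions of the differential of the same normalized lift are compared with their values
  -- at `v₁`, where `dπ(v₁) = 1`. Thus `η` is a nonzero complex multiple of `dπ`; the multiple is
  -- absorbed into `τ`, and its modulus into `t`.
  have hη : ∀ v, η v = η v₁ * surfDeriv π p v := by
    intro v
    obtain ⟨a, ha⟩ := hc2 v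
    obtain ⟨a₁, ha₁⟩ := hc2 v₁
    change vderiv (𝓡 m) (normRep k ∘ F) p v = _ at ha
    change vderiv (𝓡 m) (normRep k ∘ F) p v₁ = _ at ha₁
    rw [hd₁] at ha ha₁
    rw [hv₁, one_smul] at ha₁
    rw [ha₁] at ha
    have h1 : (surfDeriv π p v * a₁ - a) • ξ₀ + (c * (η v₁ * surfDeriv π p v - η v)) • τ₀ = 0 := by
      rw [← sub_eq_zero] at ha
      rw [← ha]; module
    have h2 := (mul_eq_zero.1 (hp.eq_zero h1).2).resolve_left hc
    exact (sub_eq_zero.1 h2).symm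
  have hκ : η v₁ ≠ 0 := by
    intro h0
    obtain ⟨v, hv⟩ := hs 1
    rw [hη, h0, zero_mul] at hv
    exact zero_ne_one hv
  refine ⟨ξ₀, η v₁ • τ₀, ‖η v₁‖ * t, hp.smul hκ, fun v hv => ?_, fun ξ hξ => ?_⟩
  · rw [← hmet v hv, hη v, map_mul, Complex.normSq_eq_norm_sq (η v₁)]; ring
  · have hπp := hπ.smooth p
    have hL : IsLiftAt (𝓡 m) F (ξ ∘ π) p := by
      refine ⟨hξ.smooth.comp p hπp, ?_⟩
      filter_upwards [hπp.continuousAt.eventually hξ.lifts] with q ⟨h1, h2⟩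
      exact ⟨h1, h2.trans (hπ.comp_eq q)⟩
    obtain ⟨c, hc, hc1, hc2⟩ := hf _ hL
    refine ⟨c, hc, hc1, fun ζ => ?_⟩
    obtain ⟨v, hv⟩ := hπ.surjective_deriv p ζ
    obtain ⟨a, ha⟩ := hc2 v
    refine ⟨a, ?_⟩
    have h1 : vderiv (𝓡 m) (ξ ∘ π) p v = vderiv 𝓘(ℝ, ℂ) ξ (π p) (surfDeriv π p v) :=
      vderiv_comp_map (hξ.smooth.mdifferentiableAt (by simp)) (hπp.mdifferentiableAt (by simp)) v
    rw [hv] at h1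
    refine h1.symm.trans (ha.trans ?_)
    rw [hη v, hv, LinearMap.id_apply, smul_smul, mul_assoc, mul_comm ζ]

theorem IsQuotientCurve.exists_dLift (hπ : IsQuotientCurve π G F (Dperp x))
    (hF : IsGaussMap x F) (q : X) : ∃ (Y ξ₀ τ₀ : CLor m) (t : ℝ), IsGaussPair Y ξ₀ τ₀ t ∧
      ∀ U ξ, IsLift G U ξ → q ∈ U → ∃ c : ℂ, c ≠ 0 ∧ ξ q = c • ξ₀ ∧
        ∀ v : ℂ, ∃ a : ℂ, dLift ξ q v = a • ξ₀ + (c * v) • τ₀ := by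
  obtain ⟨p, rfl⟩ := hπ.surjective q
  obtain ⟨ξ₀, τ₀, t, hp, -, hf⟩ := hπ.exists_curveForm hF p
  exact ⟨_, ξ₀, τ₀, t, hp, fun U ξ h hq => hf ξ (h.isLiftAt hq)⟩

theorem IsQuotientCurve.exists_isLift (hπ : IsQuotientCurve π G F (Dperp x)) (q : X) :
    ∃ U ξ, q ∈ U ∧ IsLift G U ξ := by
  obtain ⟨k, hk⟩ := exists_rep_ne_zero (G q)
  refine ⟨interior {Q | (G Q).rep k ≠ 0}, normRep k ∘ G, ?_, isOpen_interior, fun Q hQ => ?_,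
    fun Q hQ => ?_⟩
  · exact mem_interior_iff_mem_nhds.2 ((hπ.isLiftAt q k hk).eventually_rep_ne_zero hk)
  · exact (hπ.isLiftAt Q k (interior_subset hQ)).smooth.contMDiffWithinAt
  · have hQ' := interior_subset hQ
    exact ⟨normRep_ne_zero hQ', mk_normRep hQ'⟩

/-- In `dξ(v) = a ξ₀ + c v τ₀` the factor `v` is a complex number. In the `∂/∂z̄` derivative the
`τ₀`-terms cancel because `i · i = -1`, and only a multiple of `ξ` remains. The other clauses are
the products of a Gauss pair. -/
theorem IsQuotientCurve.isIsotropicCurve (hπ : IsQuotientCurve π G F (Dperp x))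
    (hF : IsGaussMap x F) : IsIsotropicCurve G where
  mem_quadric q := by
    obtain ⟨Y, ξ₀, τ₀, t, hp, h⟩ := hπ.exists_dLift hF q
    obtain ⟨U, ξ, hq, hU⟩ := hπ.exists_isLift q
    obtain ⟨c, hc, hξ, -⟩ := h U ξ hU hq
    obtain ⟨hne, hmk⟩ := hU.lifts q hq
    obtain ⟨a, ha⟩ := Projectivization.exists_smul_eq_mk_rep ℂ (ξ q) hne
    rw [hmk, hξ, Units.smul_def, smul_smul] at ha
    have h1 := hp.lor_conj (a * c) 0
    have h2 := hp.lor_self (a * c) 0 (a * c) 0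
    rw [zero_smul, add_zero, ha] at h1 h2
    refine ⟨h2, ?_⟩
    rw [h1, Complex.ofReal_re, map_zero, mul_zero, add_zero]
    have := Complex.normSq_pos.2 (mul_ne_zero a.ne_zero hc)
    linarith
  exists_lift := hπ.exists_isLift
  holomorphic U ξ hU q hq := by
    obtain ⟨Y, ξ₀, τ₀, t, hp, h⟩ := hπ.exists_dLift hF q
    obtain ⟨c, hc, hξ, hd⟩ := h U ξ hU hq
    obtain ⟨a, ha⟩ := hd 1
    obtain ⟨b, hb⟩ := hd Complex.I
    refine ⟨(1 / 2) * (a + Complex.I * b) / c, ?_⟩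
    rw [ha, hb, hξ, smul_smul, div_mul_cancel₀ _ hc, smul_add Complex.I, smul_smul, smul_smul,
      show Complex.I * (c * Complex.I) = -c by linear_combination c * Complex.I_mul_I]
    module
  isotropic U ξ hU q hq v w := by
    obtain ⟨Y, ξ₀, τ₀, t, hp, h⟩ := hπ.exists_dLift hF q
    obtain ⟨c, hc, hξ, hd⟩ := h U ξ hU hq
    obtain ⟨a, ha⟩ := hd v
    obtain ⟨b, hb⟩ := hd w
    rw [ha, hb]
    exact hp.lor_self _ _ _ _
  positive U ξ hU q hq v hv := by
    obtain ⟨Y, ξ₀, τ₀, t, hp, h⟩ := hπ.exists_dLift hF q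
    obtain ⟨c, hc, hξ, hd⟩ := h U ξ hU hq
    have key : ∀ v : ℂ, v ≠ 0 → 0 < (lor (dLift ξ q v) (conjL (dLift ξ q v))).re := by
      intro v hv
      obtain ⟨a, ha⟩ := hd v
      rw [ha, hp.lor_conj, Complex.ofReal_re]
      have h1 := Complex.normSq_nonneg a
      have h2 : 0 < Complex.normSq (c * v) := Complex.normSq_pos.2 (mul_ne_zero hc hv)
      have h3 := hp.pos
      positivity
    exact key v hv
  immersion U ξ hU q hq v hv := by
    obtain ⟨Y, ξ₀, τ₀, t, hp, h⟩ := hπ.exists_dLift hF q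
    obtain ⟨c, hc, hξ, hd⟩ := h U ξ hU hq
    have key : ∀ v : ℂ, v ≠ 0 → 0 < quadricMetric (ξ q) (dLift ξ q v) := by
      intro v hv
      obtain ⟨a, ha⟩ := hd v
      rw [ha, hξ, hp.quadricMetric_eq hc]
      have h2 : 0 < Complex.normSq v := Complex.normSq_pos.2 hv
      have h3 := hp.pos
      positivity
    exact key v hv

theorem IsQuotientCurve.quadricMetric_eq (hπ : IsQuotientCurve π G F (Dperp x))
    (hF : IsGaussMap x F) {p : M} {v : Euc m}
    (hv : ∀ w ∈ Dperp x p, mobiusMetric x p v w = 0) {U : Set X} {ξ : X → CLor m}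
    (hU : IsLift G U ξ) (hp : π p ∈ U) :
    quadricMetric (ξ (π p)) (dLift ξ (π p) (surfDeriv π p v)) =
      mu m ^ 2 * mobiusMetric x p v v := by
  obtain ⟨ξ₀, τ₀, t, hpair, hmet, hf⟩ := hπ.exists_curveForm hF p
  obtain ⟨c, hc, hξ, hd⟩ := hf ξ (hU.isLiftAt hp)
  obtain ⟨a, ha⟩ := hd (surfDeriv π p v)
  have ha' : dLift ξ (π p) (surfDeriv π p v) = a • ξ₀ + (c * surfDeriv π p v) • τ₀ := ha
  rw [ha', hξ, hpair.quadricMetric_eq hc, hmet v hv]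

end Curve

/-! ### Sections of the unit sphere by affine subspaces -/

section AffineSection

variable {E : Type*} [NormedAddCommGroup E] [InnerProductSpace ℝ E] [FiniteDimensional ℝ E]
variable {F : Type*} [NormedAddCommGroup F] [InnerProductSpace ℝ F] [FiniteDimensional ℝ F]

/-- The point nearest to the origin of the affine subspace `⟪y, L k⟫ = T k`, `k ∈ F`. -/
def footPoint [CompleteSpace E] [CompleteSpace F] (L : F →L[ℝ] E) (T : F →L[ℝ] ℝ) : E :=
  L ((ContinuousLinearMap.adjoint L ∘L L).inverse (ContinuousLinearMap.adjoint T 1))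

variable [CompleteSpace E] [CompleteSpace F] {L : F →L[ℝ] E} {T : F →L[ℝ] ℝ}

theorem footPoint_mem (L : F →L[ℝ] E) (T : F →L[ℝ] ℝ) :
    footPoint L T ∈ LinearMap.range L.toLinearMap := ⟨_, rfl⟩

theorem inner_footPoint (hL : Function.Injective L) (k : F) : ⟪footPoint L T, L k⟫_ℝ = T k := by
  obtain ⟨e, he⟩ := isInvertible_adjoint_comp_self hL
  have key : (ContinuousLinearMap.adjoint L ∘L L)
      ((ContinuousLinearMap.adjoint L ∘L L).inverse (ContinuousLinearMap.adjoint T 1)) =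
        ContinuousLinearMap.adjoint T 1 := by
    rw [← he]; simp
  rw [ContinuousLinearMap.comp_apply] at key
  rw [footPoint, ← ContinuousLinearMap.adjoint_inner_left, key,
    ContinuousLinearMap.adjoint_inner_left]
  simp

theorem injective_of_abs_lt (h : ∀ k, k ≠ 0 → |T k| < ‖L k‖) : Function.Injective L := by
  rw [injective_iff_map_eq_zero]
  intro k hk
  by_contra h0
  have := h k h0
  rw [hk, norm_zero] at this
  exact absurd this (not_lt.2 (abs_nonneg _))

/-- The foot point is some `L k`, and `‖L k‖² = T k` because it satisfies its own equation; if `k ≠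
0` this is less than `‖L k‖`. So the affine subspace enters the open unit ball. -/
theorem norm_footPoint_lt_one (h : ∀ k, k ≠ 0 → |T k| < ‖L k‖) : ‖footPoint L T‖ < 1 := by
  obtain ⟨k, hk⟩ := footPoint_mem L T
  have hk' : L k = footPoint L T := hk
  by_cases h0 : k = 0
  · rw [← hk', h0, map_zero, norm_zero]; exact one_pos
  · have h1 := inner_footPoint (T := T) (injective_of_abs_lt h) k
    rw [hk', real_inner_self_eq_norm_sq] at h1
    have h2 := h k h0
    rw [hk', ← h1, abs_of_nonneg (by positivity)] at h2
    by_contra h3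
    have := not_lt.1 h3
    nlinarith [norm_nonneg (footPoint L T)]

/-- Pythagoras: a point of the affine subspace is the foot point plus a vector of the orthogonal
complement of the range, and it has norm one exactly when that vector has norm `√(1 - ‖c‖²)`. -/
theorem mem_section_iff (h : ∀ k, k ≠ 0 → |T k| < ‖L k‖) {κ : Type*} [Fintype κ] {w : κ → E}
    (hw : Orthonormal ℝ w) (hwL : ∀ j, w j ∈ (LinearMap.range L.toLinearMap)ᗮ)
    (hcard : Fintype.card κ + Module.finrank ℝ F = Module.finrank ℝ E) (y : E) :
    (‖y‖ = 1 ∧ ∀ k, ⟪y, L k⟫_ℝ = T k) ↔ ∃ θ ∈ Metric.sphere (0 : EuclideanSpace ℝ κ) 1,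
      y = footPoint L T + √(1 - ‖footPoint L T‖ ^ 2) • ∑ j, θ j • w j := by
  classical
  have hinj := injective_of_abs_lt h
  set c := footPoint L T with hc
  have hc1 : ‖c‖ < 1 := norm_footPoint_lt_one h
  have hpos : 0 < 1 - ‖c‖ ^ 2 := by nlinarith [norm_nonneg c]
  set r := √(1 - ‖c‖ ^ 2) with hr
  have hr0 : 0 < r := Real.sqrt_pos.2 hpos
  have hr2 : r ^ 2 = 1 - ‖c‖ ^ 2 := Real.sq_sqrt hpos.le
  have horth : ∀ k j, ⟪w j, L k⟫_ℝ = 0 := fun k j => Submodule.inner_left_of_mem_orthogonal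
    (K := LinearMap.range L.toLinearMap) ⟨k, rfl⟩ (hwL j)
  have hnorm : ∀ θ : EuclideanSpace ℝ κ, ‖∑ j, θ j • w j‖ ^ 2 = ‖θ‖ ^ 2 := by
    intro θ
    rw [← real_inner_self_eq_norm_sq, hw.inner_sum, EuclideanSpace.norm_sq_eq]
    simp [sq]
  have hperp : ∀ θ : EuclideanSpace ℝ κ, ⟪c, ∑ j, θ j • w j⟫_ℝ = 0 := by
    intro θ
    rw [inner_sum]
    refine Finset.sum_eq_zero fun j _ => ?_
    obtain ⟨k, hk⟩ := footPoint_mem L T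
    have hk' : L k = c := hk
    rw [inner_smul_right, ← hk', real_inner_comm, horth, mul_zero]
  constructor
  · rintro ⟨hy, hyk⟩
    have hmem : y - c ∈ (LinearMap.range L.toLinearMap)ᗮ := by
      rw [Submodule.mem_orthogonal']
      rintro _ ⟨k, rfl⟩
      change ⟪y - c, L k⟫_ℝ = 0
      rw [inner_sub_left, hyk, inner_footPoint hinj, sub_self]
    have hspan : Submodule.span ℝ (Set.range w) = (LinearMap.range L.toLinearMap)ᗮ := by
      refine Submodule.eq_of_le_of_finrank_eq (Submodule.span_le.2 ?_) ?_
      · rintro _ ⟨j, rfl⟩; exact hwL j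
      · rw [finrank_span_eq_card hw.linearIndependent]
        have h1 := Submodule.finrank_add_finrank_orthogonal (LinearMap.range L.toLinearMap)
        rw [LinearMap.finrank_range_of_inj hinj] at h1
        omega
    rw [← hspan, Submodule.mem_span_range_iff_exists_fun] at hmem
    obtain ⟨a, ha⟩ := hmem
    set θ : EuclideanSpace ℝ κ := WithLp.toLp 2 fun j => r⁻¹ * a j with hθ
    have hsum : r • ∑ j, θ j • w j = y - c := by
      rw [← ha, Finset.smul_sum]
      refine Finset.sum_congr rfl fun j _ => ?_
      rw [smul_smul, hθ]
      change (r * (r⁻¹ * a j)) • w j = _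
      rw [mul_inv_cancel_left₀ hr0.ne']
    have hy2 : y = c + r • ∑ j, θ j • w j := by rw [hsum]; abel
    refine ⟨θ, ?_, hy2⟩
    rw [mem_sphere_zero_iff_norm]
    have h1 : ‖y‖ ^ 2 = ‖c‖ ^ 2 + r ^ 2 * ‖θ‖ ^ 2 := by
      rw [hy2, norm_add_sq_real, inner_smul_right, hperp, norm_smul, mul_pow, hnorm,
        Real.norm_eq_abs, sq_abs]; ring
    rw [hy] at h1
    have h2 : r ^ 2 * ‖θ‖ ^ 2 = r ^ 2 * 1 := by linarith
    have h3 := mul_left_cancel₀ (by positivity) h2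
    exact (sq_eq_sq₀ (norm_nonneg θ) zero_le_one).1 (by rw [h3, one_pow])
  · rintro ⟨θ, hθ, rfl⟩
    rw [mem_sphere_zero_iff_norm] at hθ
    constructor
    · have h1 : ‖c + r • ∑ j, θ j • w j‖ ^ 2 = 1 := by
        rw [norm_add_sq_real, inner_smul_right, hperp, norm_smul, mul_pow, hnorm,
          Real.norm_eq_abs, sq_abs, hθ, hr2]; ring
      exact (sq_eq_sq₀ (norm_nonneg _) zero_le_one).1 (by rw [h1, one_pow])
    · intro k
      rw [inner_add_left, inner_footPoint hinj, inner_smul_left, sum_inner,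
        Finset.sum_eq_zero, mul_zero, add_zero]
      intro j _
      rw [inner_smul_left, horth, mul_zero]

variable {V : Type*} [NormedAddCommGroup V] [NormedSpace ℝ V]

theorem contDiffOn_footPoint {L : V → F →L[ℝ] E} {T : V → F →L[ℝ] ℝ} {Ω : Set V}
    {n : WithTop ℕ∞} (hL : ContDiffOn ℝ n L Ω) (hT : ContDiffOn ℝ n T Ω)
    (hinj : ∀ u ∈ Ω, Function.Injective (L u)) :
    ContDiffOn ℝ n (fun u => footPoint (L u) (T u)) Ω := by
  have h1 : ContDiffOn ℝ n (fun u => ContinuousLinearMap.adjoint (L u)) Ω :=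
    contDiff_adjoint.comp_contDiffOn hL
  have h2 : ContDiffOn ℝ n (fun u => ContinuousLinearMap.adjoint (L u) ∘L L u) Ω :=
    h1.clm_comp hL
  have h3 : ContDiffOn ℝ n
      (fun u => (ContinuousLinearMap.adjoint (L u) ∘L L u).inverse) Ω := by
    intro u hu
    exact ((isInvertible_adjoint_comp_self (hinj u hu)).contDiffAt_map_inverse
      (n := n)).comp_contDiffWithinAt u (h2 u hu)
  have h4 : ContDiffOn ℝ n (fun u => ContinuousLinearMap.adjoint (T u) (1 : ℝ)) Ω :=
    (contDiff_adjoint.comp_contDiffOn hT).clm_apply contDiffOn_const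
  exact hL.clm_apply (h3.clm_apply h4)

/-- A smooth family of sections of the unit sphere by affine subspaces is a smooth family of round
spheres. -/
theorem exists_smooth_round_spheres {L : V → F →L[ℝ] E} {T : V → F →L[ℝ] ℝ} {Ω : Set V}
    (hΩ : IsOpen Ω) (hL : ContDiffOn ℝ ∞ L Ω) (hT : ContDiffOn ℝ ∞ T Ω)
    (h : ∀ u ∈ Ω, ∀ k, k ≠ 0 → |T u k| < ‖L u k‖) {u₀ : V} (hu₀ : u₀ ∈ Ω) {d : ℕ}
    (hd : d + Module.finrank ℝ F = Module.finrank ℝ E) :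
    ∃ (Ω' : Set V) (c : V → E) (r : V → ℝ) (w : Fin d → V → E), IsOpen Ω' ∧ u₀ ∈ Ω' ∧ Ω' ⊆ Ω ∧
      ContDiffOn ℝ ∞ c Ω' ∧ ContDiffOn ℝ ∞ r Ω' ∧ (∀ j, ContDiffOn ℝ ∞ (w j) Ω') ∧
      ∀ u ∈ Ω', 0 < r u ∧ (Orthonormal ℝ fun j => w j u) ∧
        ∀ y, (‖y‖ = 1 ∧ ∀ k, ⟪y, L u k⟫_ℝ = T u k) ↔
          ∃ θ ∈ Metric.sphere (0 : Euc d) 1, y = c u + r u • ∑ j, θ j • w j u := by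
  have hinj : ∀ u ∈ Ω, Function.Injective (L u) := fun u hu => injective_of_abs_lt (h u hu)
  have hK : ContDiffOn ℝ ∞ (fun u => ((LinearMap.range (L u).toLinearMap)ᗮ).starProjection) Ω := by
    have : (fun u => ((LinearMap.range (L u).toLinearMap)ᗮ).starProjection) = fun u =>
        ContinuousLinearMap.id ℝ E - (LinearMap.range (L u).toLinearMap).starProjection := by
      funext u
      exact Submodule.starProjection_orthogonal _
    rw [this]
    exact contDiffOn_const.sub (contDiffOn_starProjection_range hL hinj)
  have hfin : Module.finrank ℝ ((LinearMap.range (L u₀).toLinearMap)ᗮ : Submodule ℝ E) = d := by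
    have h1 := Submodule.finrank_add_finrank_orthogonal (LinearMap.range (L u₀).toLinearMap)
    rw [LinearMap.finrank_range_of_inj (hinj u₀ hu₀)] at h1
    omega
  obtain ⟨Ω', w, hΩ', hu', hsub, hw, hww⟩ := exists_smooth_orthonormal_frame hΩ hK hu₀ hfin
  have hc : ContDiffOn ℝ ∞ (fun u => footPoint (L u) (T u)) Ω' :=
    contDiffOn_footPoint (hL.mono hsub) (hT.mono hsub) fun u hu => hinj u (hsub hu)
  have hpos : ∀ u ∈ Ω', 0 < 1 - ‖footPoint (L u) (T u)‖ ^ 2 := by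
    intro u hu
    have := norm_footPoint_lt_one (h u (hsub hu))
    nlinarith [norm_nonneg (footPoint (L u) (T u))]
  refine ⟨Ω', fun u => footPoint (L u) (T u), fun u => √(1 - ‖footPoint (L u) (T u)‖ ^ 2), w, hΩ',
    hu', hsub, hc, (contDiffOn_const.sub (hc.norm_sq ℝ)).sqrt fun u hu => (hpos u hu).ne', hw,
    fun u hu => ⟨Real.sqrt_pos.2 (hpos u hu), (hww u hu).1, fun y => ?_⟩⟩
  exact mem_section_iff (h u (hsub hu)) (hww u hu).1 (hww u hu).2 (by simpa using hd) y

end AffineSection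

/-! ### The envelope in local parameters -/

section RealParts

variable {m : ℕ}

/-- The real part of the spatial component of a vector of the complexified Lorentz space. -/
def spaceRe (m : ℕ) : CLor m →L[ℝ] Amb m :=
  (EuclideanSpace.equiv (Fin (m + 3)) ℝ).symm.toContinuousLinearMap ∘L
    ContinuousLinearMap.pi fun i => Complex.reCLM ∘L
      ContinuousLinearMap.proj (R := ℝ) (φ := fun _ : Fin (m + 4) => ℂ) i.succ

theorem spaceRe_apply (Z : CLor m) (i : Fin (m + 3)) : spaceRe m Z i = (Z i.succ).re := rfl

/-- The real part of the time component. -/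
def timeRe (m : ℕ) : CLor m →L[ℝ] ℝ :=
  Complex.reCLM ∘L ContinuousLinearMap.proj (R := ℝ) (φ := fun _ : Fin (m + 4) => ℂ) 0

theorem timeRe_apply (Z : CLor m) : timeRe m Z = (Z 0).re := rfl

theorem re_lor_realVec (y : Amb m) (Z : CLor m) :
    (lor (realVec 1 y) Z).re = ⟪y, spaceRe m Z⟫_ℝ - timeRe m Z := by
  rw [timeRe_apply, PiLp.inner_apply]
  simp only [lor, realVec, Fin.cons_zero, Fin.cons_succ, Complex.add_re, Complex.neg_re,
    Complex.re_sum, spaceRe_apply]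
  simp [mul_comm]
  ring

/-- One complex equation is two real ones, the imaginary part being read off from `i Z`. -/
theorem lor_realVec_eq_zero_iff (y : Amb m) (Z : CLor m) :
    lor (realVec 1 y) Z = 0 ↔ ⟪y, spaceRe m Z⟫_ℝ = timeRe m Z ∧
      ⟪y, spaceRe m (Complex.I • Z)⟫_ℝ = timeRe m (Complex.I • Z) := by
  rw [← sub_eq_zero (b := timeRe m Z), ← re_lor_realVec,
    ← sub_eq_zero (b := timeRe m (Complex.I • Z)), ← re_lor_realVec, lor_smul_right,
    Complex.ext_iff]
  simp

/-- The left-hand side is the Lorentz square of the real part `(Z + Z̄)/2`. -/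
theorem norm_sq_spaceRe_sub (Z : CLor m) :
    ‖spaceRe m Z‖ ^ 2 - timeRe m Z ^ 2 = ((lor Z Z).re + (lor Z (conjL Z)).re) / 2 := by
  rw [EuclideanSpace.real_norm_sq_eq]
  simp only [lor, conjL, Complex.add_re, Complex.neg_re, Complex.re_sum, spaceRe_apply,
    timeRe_apply, Complex.mul_re, Complex.conj_re, Complex.conj_im, Finset.sum_sub_distrib]
  have : ∀ f g : Fin (m + 3) → ℝ, (∑ i, f i * -(g i)) = - ∑ i, f i * g i := by
    intro f g; simp
  rw [this]
  simp only [sq]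
  ring

/-- The real linear parametrization of the complex span of `ξ` and `τ`. -/
def pairSpan (ξ τ : CLor m) : Euc 4 →L[ℝ] CLor m :=
  (EuclideanSpace.proj 0 : Euc 4 →L[ℝ] ℝ).smulRight ξ +
    (EuclideanSpace.proj 1 : Euc 4 →L[ℝ] ℝ).smulRight (Complex.I • ξ) +
    (EuclideanSpace.proj 2 : Euc 4 →L[ℝ] ℝ).smulRight τ +
    (EuclideanSpace.proj 3 : Euc 4 →L[ℝ] ℝ).smulRight (Complex.I • τ)

theorem pairSpan_apply (ξ τ : CLor m) (k : Euc 4) : pairSpan ξ τ k =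
    (k 0 + k 1 * Complex.I : ℂ) • ξ + (k 2 + k 3 * Complex.I : ℂ) • τ := by
  ext i
  simp [pairSpan]
  ring

theorem lor_eq_zero_iff_pairSpan (y : Amb m) (ξ τ : CLor m) :
    (lor (realVec 1 y) ξ = 0 ∧ lor (realVec 1 y) τ = 0) ↔
      ∀ k, ⟪y, (spaceRe m ∘L pairSpan ξ τ) k⟫_ℝ = (timeRe m ∘L pairSpan ξ τ) k := by
  constructor
  · rintro ⟨h1, h2⟩ k
    rw [← sub_eq_zero]
    change ⟪y, spaceRe m (pairSpan ξ τ k)⟫_ℝ - timeRe m (pairSpan ξ τ k) = 0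
    rw [← re_lor_realVec, pairSpan_apply, lor_add_right, lor_smul_right, lor_smul_right, h1, h2]
    simp
  · intro h
    have hk : ∀ j, ⟪y, spaceRe m (pairSpan ξ τ (EuclideanSpace.single j 1))⟫_ℝ =
        timeRe m (pairSpan ξ τ (EuclideanSpace.single j 1)) := fun j => h _
    have h0 : pairSpan ξ τ (EuclideanSpace.single 0 1) = ξ := by rw [pairSpan_apply]; simp
    have h1 : pairSpan ξ τ (EuclideanSpace.single 1 1) = Complex.I • ξ := by
      rw [pairSpan_apply]; simp
    have h2 : pairSpan ξ τ (EuclideanSpace.single 2 1) = τ := by rw [pairSpan_apply]; simp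
    have h3 : pairSpan ξ τ (EuclideanSpace.single 3 1) = Complex.I • τ := by
      rw [pairSpan_apply]; simp
    refine ⟨(lor_realVec_eq_zero_iff y ξ).2 ⟨?_, ?_⟩, (lor_realVec_eq_zero_iff y τ).2 ⟨?_, ?_⟩⟩
    · have := hk 0; rwa [h0] at this
    · have := hk 1; rwa [h1] at this
    · have := hk 2; rwa [h2] at this
    · have := hk 3; rwa [h3] at this

/-- The span of a Gauss pair is totally isotropic with positive Hermitian product, so real parts of
its nonzero vectors are spacelike. This is the condition under which an affine subspace cuts the
unit sphere in a round sphere. -/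
theorem IsGaussPair.abs_timeRe_lt {Y ξ₀ τ₀ : CLor m} {t : ℝ} (h : IsGaussPair Y ξ₀ τ₀ t)
    {c a b : ℂ} (hc : c ≠ 0) (hb : b ≠ 0) {k : Euc 4} (hk : k ≠ 0) :
    |(timeRe m ∘L pairSpan (c • ξ₀) (a • ξ₀ + b • τ₀)) k| <
      ‖(spaceRe m ∘L pairSpan (c • ξ₀) (a • ξ₀ + b • τ₀)) k‖ := by
  set Z := pairSpan (c • ξ₀) (a • ξ₀ + b • τ₀) k with hZ
  change |timeRe m Z| < ‖spaceRe m Z‖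
  set α : ℂ := k 0 + k 1 * Complex.I with hα
  set β : ℂ := k 2 + k 3 * Complex.I with hβ
  have hZ' : Z = (α * c + β * a) • ξ₀ + (β * b) • τ₀ := by
    rw [hZ, pairSpan_apply, ← hα, ← hβ]; module
  have h1 := norm_sq_spaceRe_sub Z
  rw [hZ', h.lor_self, h.lor_conj, ← hZ', Complex.ofReal_re, Complex.zero_re] at h1
  have h2 : 0 < 2 * Complex.normSq (α * c + β * a) + 2 * t ^ 2 * Complex.normSq (β * b) := by
    have ht := h.pos
    have n1 := Complex.normSq_nonneg (α * c + β * a)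
    by_cases hβ0 : β = 0
    · have hα0 : α ≠ 0 := by
        intro hα0
        apply hk
        have e1 := Complex.ext_iff.1 hα0
        have e2 := Complex.ext_iff.1 hβ0
        simp [hα] at e1
        simp [hβ] at e2
        ext j
        fin_cases j
        · exact e1.1
        · exact e1.2
        · exact e2.1
        · exact e2.2
      have := Complex.normSq_pos.2 (mul_ne_zero hα0 hc)
      rw [hβ0, zero_mul, zero_mul, add_zero, map_zero, mul_zero, add_zero]
      positivity
    · have := Complex.normSq_pos.2 (mul_ne_zero hβ0 hb)
      positivity
  exact abs_lt_of_sq_lt_sq (by linarith) (norm_nonneg _)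

theorem contDiff_pairSpan {V : Type*} [NormedAddCommGroup V] [NormedSpace ℝ V]
    {ξ τ : V → CLor m} {Ω : Set V} {n : WithTop ℕ∞} (hξ : ContDiffOn ℝ n ξ Ω)
    (hτ : ContDiffOn ℝ n τ Ω) : ContDiffOn ℝ n (fun u => pairSpan (ξ u) (τ u)) Ω := by
  have h (f : Euc 4 →L[ℝ] ℝ) {g : V → CLor m} (hg : ContDiffOn ℝ n g Ω) :
      ContDiffOn ℝ n (fun u => f.smulRight (g u)) Ω :=
    (ContinuousLinearMap.smulRightL ℝ (Euc 4) (CLor m) f).contDiff.comp_contDiffOn hg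
  exact (((h _ hξ).add (h _ (hξ.const_smul Complex.I))).add (h _ hτ)).add
    (h _ (hτ.const_smul Complex.I))

end RealParts

/-! ### The fibres of the envelope as a smooth family of round spheres. -/

section Envelope

variable {m : ℕ} {X : Type*} [TopologicalSpace X] [ChartedSpace ℂ X]
  {G : X → ℙ ℂ (CLor m)}

/-- A complex curve with smooth local lifts, all of which are described at each point by a common
pair of vectors that spans a spacelike null plane. -/
structure IsGaussCurve (G : X → ℙ ℂ (CLor m)) : Prop where
  exists_isLift : ∀ q, ∃ U ξ, q ∈ U ∧ IsLift G U ξ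
  exists_dLift : ∀ q, ∃ (Y ξ₀ τ₀ : CLor m) (t : ℝ), IsGaussPair Y ξ₀ τ₀ t ∧
    ∀ U ξ, IsLift G U ξ → q ∈ U → ∃ c : ℂ, c ≠ 0 ∧ ξ q = c • ξ₀ ∧
      ∀ v : ℂ, ∃ a : ℂ, dLift ξ q v = a • ξ₀ + (c * v) • τ₀

/-- For any lift the equations say that `(1, y)` is orthogonal to the common pair `ξ₀, τ₀`, so any
one lift may be used to test membership. -/
theorem IsGaussCurve.mem_envelope_iff (hG : IsGaussCurve G) {U : Set X} {ξ : X → CLor m}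
    (hU : IsLift G U ξ) {q : X} (hq : q ∈ U) (y : Amb m) :
    (q, y) ∈ envelope G ↔ ‖y‖ = 1 ∧ lor (realVec 1 y) (ξ q) = 0 ∧
      ∀ v, lor (realVec 1 y) (dLift ξ q v) = 0 := by
  refine ⟨?_, fun ⟨h1, h2, h3⟩ => ⟨h1, U, ξ, hU, hq, h2, h3⟩⟩
  rintro ⟨h1, U', ξ', hU', hq', h2, h3⟩
  obtain ⟨Y, ξ₀, τ₀, t, hp, h⟩ := hG.exists_dLift q
  obtain ⟨c, hc, hξ, hd⟩ := h U ξ hU hq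
  obtain ⟨c', hc', hξ', hd'⟩ := h U' ξ' hU' hq'
  change lor (realVec 1 y) (ξ' q) = 0 at h2
  have e1 : lor (realVec 1 y) ξ₀ = 0 := by
    rw [hξ', lor_smul_right] at h2
    exact (mul_eq_zero.1 h2).resolve_left hc'
  have e2 : lor (realVec 1 y) τ₀ = 0 := by
    obtain ⟨a, ha⟩ := hd' 1
    have h4 : lor (realVec 1 y) (dLift ξ' q (1 : ℂ)) = 0 := h3 (1 : ℂ)
    rw [ha, lor_add_right, lor_smul_right, lor_smul_right, e1, mul_zero, zero_add, mul_one] at h4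
    exact (mul_eq_zero.1 h4).resolve_left hc'
  refine ⟨h1, by rw [hξ, lor_smul_right, e1, mul_zero], fun v => ?_⟩
  have key : ∀ v : ℂ, lor (realVec 1 y) (dLift ξ q v) = 0 := by
    intro v
    obtain ⟨a, ha⟩ := hd v
    rw [ha, lor_add_right, lor_smul_right, lor_smul_right, e1, e2, mul_zero, mul_zero, add_zero]
  exact key v

/-- The envelope over `U` is parametrized by a smooth family of round spheres. -/
structure IsSphereFamily (G : X → ℙ ℂ (CLor m)) (U : Set X) (c : X → Amb m) (r : X → ℝ)
    (w : Fin (m - 2 + 1) → X → Amb m) : Prop where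
  isOpen : IsOpen U
  smooth_centre : ContMDiffOn 𝓘(ℝ, ℂ) 𝓘(ℝ, Amb m) ∞ c U
  smooth_radius : ContMDiffOn 𝓘(ℝ, ℂ) 𝓘(ℝ, ℝ) ∞ r U
  smooth_frame : ∀ j, ContMDiffOn 𝓘(ℝ, ℂ) 𝓘(ℝ, Amb m) ∞ (w j) U
  radius_pos : ∀ q ∈ U, 0 < r q
  orthonormal : ∀ q ∈ U, Orthonormal ℝ fun j => w j q
  mem_iff : ∀ q ∈ U, ∀ y, (q, y) ∈ envelope G ↔
    ∃ θ ∈ Metric.sphere (0 : Euc (m - 2 + 1)) 1, y = c q + r q • ∑ j, θ j • w j q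

variable [IsManifold 𝓘(ℝ, ℂ) ∞ X]

/-- In a chart of the surface, the lift and one derivative of it span the plane of `ξ₀, τ₀`. The
envelope becomes a smooth family of sections of the unit sphere by four real affine equations. -/
theorem IsGaussCurve.exists_isSphereFamily (hm : 2 ≤ m) (hG : IsGaussCurve G) (q₀ : X) :
    ∃ U c r w, q₀ ∈ U ∧ IsSphereFamily G U c r w := by
  obtain ⟨U, ξ, hq₀, hU⟩ := hG.exists_isLift q₀
  set e := chartAt ℂ q₀ with he
  have hes : ContMDiffOn 𝓘(ℝ, ℂ) 𝓘(ℝ, ℂ) ∞ e.symm e.target := contMDiffOn_chart_symm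
  have hef : ContMDiffOn 𝓘(ℝ, ℂ) 𝓘(ℝ, ℂ) ∞ e e.source := contMDiffOn_chart
  set Ω : Set ℂ := e.target ∩ e.symm ⁻¹' U with hΩ
  have hΩo : IsOpen Ω := e.isOpen_inter_preimage_symm hU.isOpen
  have hξs : ContDiffOn ℝ ∞ (ξ ∘ e.symm) Ω :=
    contMDiffOn_iff_contDiffOn.1 (hU.smooth.comp (hes.mono Set.inter_subset_left) fun u hu => hu.2)
  set τ : ℂ → CLor m := fun u => fderiv ℝ (ξ ∘ e.symm) u 1 with hτ
  have hτs : ContDiffOn ℝ ∞ τ Ω :=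
    (hξs.fderiv_of_isOpen (m := ∞) hΩo (by simp)).clm_apply contDiffOn_const
  have hform : ∀ u ∈ Ω, ∃ (Y ξ₀ τ₀ : CLor m) (t : ℝ) (c v₁ : ℂ), IsGaussPair Y ξ₀ τ₀ t ∧ c ≠ 0 ∧
      v₁ ≠ 0 ∧ ξ (e.symm u) = c • ξ₀ ∧ τ u = dLift ξ (e.symm u) v₁ ∧
      ∀ v : ℂ, ∃ a : ℂ, dLift ξ (e.symm u) v = a • ξ₀ + (c * v) • τ₀ := by
    intro u hu
    obtain ⟨Y, ξ₀, τ₀, t, hp, h⟩ := hG.exists_dLift (e.symm u)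
    obtain ⟨c, hc, hξ, hd⟩ := h U ξ hU hu.2
    have hdξ : MDifferentiableAt 𝓘(ℝ, ℂ) 𝓘(ℝ, CLor m) ξ (e.symm u) :=
      (hU.smooth.contMDiffAt (hU.isOpen.mem_nhds hu.2)).mdifferentiableAt (by simp)
    have hde : MDifferentiableAt 𝓘(ℝ, ℂ) 𝓘(ℝ, ℂ) e.symm u :=
      (hes.contMDiffAt (e.open_target.mem_nhds hu.1)).mdifferentiableAt (by simp)
    have hde' : MDifferentiableAt 𝓘(ℝ, ℂ) 𝓘(ℝ, ℂ) e (e.symm u) :=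
      (hef.contMDiffAt (e.open_source.mem_nhds (e.map_target hu.1))).mdifferentiableAt (by simp)
    -- `dLift` at a point refers to the preferred chart there, which need not be the chart `e` at
    -- `q₀`. Only `D 1 ≠ 0` is needed, since any nonzero derivative spans the same plane together
    -- with the lift.
    let D : ℂ →L[ℝ] ℂ := mfderiv 𝓘(ℝ, ℂ) 𝓘(ℝ, ℂ) e.symm u
    let D' : ℂ →L[ℝ] ℂ := mfderiv 𝓘(ℝ, ℂ) 𝓘(ℝ, ℂ) e (e.symm u)
    have hDD : D' ∘L D = ContinuousLinearMap.id ℝ ℂ := by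
      have h1 := mfderiv_comp u hde' hde
      have h2 : mfderiv 𝓘(ℝ, ℂ) 𝓘(ℝ, ℂ) (e ∘ e.symm) u = mfderiv 𝓘(ℝ, ℂ) 𝓘(ℝ, ℂ) id u := by
        refine Filter.EventuallyEq.mfderiv_eq ?_
        filter_upwards [e.open_target.mem_nhds hu.1] with u' hu' using e.right_inv hu'
      rw [h2, mfderiv_id] at h1
      exact h1.symm
    have hD1 : D 1 ≠ 0 := by
      intro h0
      have := congrArg (fun A : ℂ →L[ℝ] ℂ => A 1) hDD
      simp [h0] at this
    have hτu : τ u = dLift ξ (e.symm u) (D 1) := by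
      have h1 : vderiv 𝓘(ℝ, ℂ) (ξ ∘ e.symm) u (1 : ℂ) = vderiv 𝓘(ℝ, ℂ) ξ (e.symm u) (D 1) :=
        vderiv_comp_map hdξ hde 1
      rw [vderiv_eq_fderiv] at h1
      exact h1
    exact ⟨Y, ξ₀, τ₀, t, c, D 1, hp, hc, hD1, hξ, hτu, hd⟩
  have hmem : ∀ u ∈ Ω, ∀ y, (e.symm u, y) ∈ envelope G ↔ ‖y‖ = 1 ∧
      ∀ k, ⟪y, (spaceRe m ∘L pairSpan (ξ (e.symm u)) (τ u)) k⟫_ℝ =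
        (timeRe m ∘L pairSpan (ξ (e.symm u)) (τ u)) k := by
    intro u hu y
    obtain ⟨Y, ξ₀, τ₀, t, c, v₁, hp, hc, hv, h1, h2, h3⟩ := hform u hu
    rw [hG.mem_envelope_iff hU hu.2, ← lor_eq_zero_iff_pairSpan, h2]
    refine and_congr_right fun _ => and_congr_right fun h4 => ⟨fun h5 => h5 v₁, fun h5 => ?_⟩
    rw [h1, lor_smul_right, mul_eq_zero, or_iff_right hc] at h4
    obtain ⟨a, ha⟩ := h3 v₁
    rw [ha, lor_add_right, lor_smul_right, lor_smul_right, h4, mul_zero, zero_add, mul_eq_zero,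
      or_iff_right (mul_ne_zero hc hv)] at h5
    have key : ∀ v : ℂ, lor (realVec 1 y) (dLift ξ (e.symm u) v) = 0 := by
      intro v
      obtain ⟨b, hb⟩ := h3 v
      rw [hb, lor_add_right, lor_smul_right, lor_smul_right, h4, h5, mul_zero, mul_zero, add_zero]
    exact key
  have hlt : ∀ u ∈ Ω, ∀ k, k ≠ 0 → |(timeRe m ∘L pairSpan (ξ (e.symm u)) (τ u)) k| <
      ‖(spaceRe m ∘L pairSpan (ξ (e.symm u)) (τ u)) k‖ := by
    intro u hu k hk
    obtain ⟨Y, ξ₀, τ₀, t, c, v₁, hp, hc, hv, h1, h2, h3⟩ := hform u hu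
    obtain ⟨a, ha⟩ := h3 v₁
    rw [h2, h1, ha]
    exact hp.abs_timeRe_lt hc (mul_ne_zero hc hv) hk
  have hps := contDiff_pairSpan hξs hτs
  have hu₀ : e q₀ ∈ Ω := by
    refine ⟨mem_chart_target ℂ q₀, ?_⟩
    rw [Set.mem_preimage, e.left_inv (mem_chart_source ℂ q₀)]; exact hq₀
  -- Four equations in `ℝ^{m+3}` leave dimension `m - 1`, written `m - 2 + 1` so that the fibre is
  -- the sphere of dimension `m - 2`; the two agree because `2 ≤ m`.
  obtain ⟨Ω', c, r, w, hΩ', hu', hsub, hc, hr, hw, hall⟩ := exists_smooth_round_spheres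
    (L := fun u => spaceRe m ∘L pairSpan (ξ (e.symm u)) (τ u))
    (T := fun u => timeRe m ∘L pairSpan (ξ (e.symm u)) (τ u)) hΩo
    (contDiffOn_const.clm_comp hps) (contDiffOn_const.clm_comp hps) hlt hu₀
    (d := m - 2 + 1) (by simp; omega)
  set U' : Set X := e.source ∩ e ⁻¹' Ω' with hU'
  have hef' : ContMDiffOn 𝓘(ℝ, ℂ) 𝓘(ℝ, ℂ) ∞ e U' := hef.mono Set.inter_subset_left
  have hmaps : Set.MapsTo e U' Ω' := fun q hq => hq.2
  refine ⟨U', c ∘ e, r ∘ e, fun j => w j ∘ e, ⟨mem_chart_source ℂ q₀, hu'⟩,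
    e.isOpen_inter_preimage hΩ', hc.contMDiffOn.comp hef' hmaps, hr.contMDiffOn.comp hef' hmaps,
    fun j => (hw j).contMDiffOn.comp hef' hmaps, fun q hq => (hall _ hq.2).1,
    fun q hq => (hall _ hq.2).2.1, fun q hq y => ?_⟩
  have h1 := hmem (e q) (hsub hq.2) y
  rw [e.left_inv hq.1] at h1
  rw [h1]
  have h2 := (hall _ hq.2).2.2 y
  rw [e.left_inv hq.1] at h2
  exact h2

end Envelope

/-! ### Manifolds glued from open pieces of a manifold -/

section Glue

variable {V H W : Type*} [NormedAddCommGroup V] [NormedSpace ℝ V] [TopologicalSpace H]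
  [NormedAddCommGroup W] [NormedSpace ℝ W] (I : ModelWithCorners ℝ V H) [I.Boundaryless]
  {N : Type*} [TopologicalSpace N] [ChartedSpace H N]
  {E : Type*} [TopologicalSpace E] {ι : Type*}

/-- The extended chart of a manifold without boundary, as a partial homeomorphism. -/
def extChartHomeo (x : N) : OpenPartialHomeomorph N V where
  toPartialEquiv := extChartAt I x
  open_source := isOpen_extChartAt_source x
  open_target := isOpen_extChartAt_target x
  continuousOn_toFun := continuousOn_extChartAt x
  continuousOn_invFun := continuousOn_extChartAt_symm x

/-- Homeomorphisms of open subsets of `E` onto open subsets of a manifold `N`, with smooth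
transition maps, whose domains cover `E`. -/
structure GluingData (N E ι : Type*) [TopologicalSpace N] [ChartedSpace H N]
    [TopologicalSpace E] where
  /-- The pieces. -/
  piece : ι → OpenPartialHomeomorph E N
  /-- The index of a piece that contains a given point. -/
  index : E → ι
  mem_source : ∀ a, a ∈ (piece (index a)).source
  smooth : ∀ i j, ContMDiffOn I I ∞ (piece j ∘ (piece i).symm)
    ((piece i).symm.trans (piece j)).source

namespace GluingData

variable {I} (A : GluingData I N E ι) (L : V ≃L[ℝ] W)

/-- The chart at a point of the glued manifold. -/
def chart (a : E) : OpenPartialHomeomorph E W :=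
  ((A.piece (A.index a)).trans (extChartHomeo I (A.piece (A.index a) a))).trans
    L.toHomeomorph.toOpenPartialHomeomorph

theorem mem_chart_source_iff (a b : E) : b ∈ (A.chart L a).source ↔
    b ∈ (A.piece (A.index a)).source ∧
      A.piece (A.index a) b ∈ (extChartAt I (A.piece (A.index a) a)).source := by
  rw [chart, OpenPartialHomeomorph.trans_source, OpenPartialHomeomorph.trans_source]
  simp [extChartHomeo]

theorem mem_chart_target_iff (a : E) (u : W) : u ∈ (A.chart L a).target ↔
    L.symm u ∈ (extChartAt I (A.piece (A.index a) a)).target ∧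
      (extChartAt I (A.piece (A.index a) a)).symm (L.symm u) ∈
        (A.piece (A.index a)).target := by
  rw [chart, OpenPartialHomeomorph.trans_target, OpenPartialHomeomorph.trans_target]
  simp [extChartHomeo]

/-- The charted space structure obtained by gluing. -/
@[reducible] def chartedSpace : ChartedSpace W E where
  atlas := Set.range (A.chart L)
  chartAt := A.chart L
  mem_chart_source a := (A.mem_chart_source_iff L a a).2 ⟨A.mem_source a, mem_extChartAt_source _⟩
  chart_mem_atlas a := ⟨a, rfl⟩

variable [IsManifold I ∞ N]

theorem contMDiffOn_chart_comp (a : E) (i : ι) :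
    ContMDiffOn I 𝓘(ℝ, W) ∞ (A.chart L a ∘ (A.piece i).symm)
      ((A.piece i).target ∩ (A.piece i).symm ⁻¹' (A.chart L a).source) := by
  have h1 : ContMDiffOn I 𝓘(ℝ, V) ∞ (extChartAt I (A.piece (A.index a) a))
      (extChartAt I (A.piece (A.index a) a)).source := by
    rw [extChartAt_source]; exact contMDiffOn_extChartAt
  have hs : ∀ n ∈ (A.piece i).target ∩ (A.piece i).symm ⁻¹' (A.chart L a).source, _ :=
    fun n hn => (A.mem_chart_source_iff L a ((A.piece i).symm n)).1 hn.2
  have h0 : ContMDiffOn I I ∞ (A.piece (A.index a) ∘ (A.piece i).symm)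
      ((A.piece i).target ∩ (A.piece i).symm ⁻¹' (A.chart L a).source) :=
    (A.smooth i (A.index a)).mono fun n hn => ⟨hn.1, (hs n hn).1⟩
  have h2 := h1.comp h0 fun n hn => (hs n hn).2
  exact (L.contDiff.contMDiff (n := ∞)).comp_contMDiffOn h2

theorem contMDiffOn_comp_chart_symm (a : E) (i : ι) :
    ContMDiffOn 𝓘(ℝ, W) I ∞ (A.piece i ∘ (A.chart L a).symm)
      ((A.chart L a).target ∩ (A.chart L a).symm ⁻¹' (A.piece i).source) := by
  have h1 : ContMDiffOn 𝓘(ℝ, V) I ∞ (extChartAt I (A.piece (A.index a) a)).symm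
      (extChartAt I (A.piece (A.index a) a)).target := contMDiffOn_extChartAt_symm _
  have h2 : ContMDiffOn 𝓘(ℝ, W) I ∞
      ((extChartAt I (A.piece (A.index a) a)).symm ∘ L.symm)
      ((A.chart L a).target ∩ (A.chart L a).symm ⁻¹' (A.piece i).source) :=
    h1.comp (L.symm.contDiff.contMDiff (n := ∞)).contMDiffOn
      fun u hu => ((A.mem_chart_target_iff L a u).1 hu.1).1
  exact (A.smooth (A.index a) i).comp h2
    fun u hu => ⟨((A.mem_chart_target_iff L a u).1 hu.1).2, hu.2⟩

theorem isManifold : let _ := A.chartedSpace L; IsManifold 𝓘(ℝ, W) ∞ E := by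
  intro _
  refine isManifold_of_contDiffOn _ _ _ ?_
  rintro _ _ ⟨a, rfl⟩ ⟨b, rfl⟩
  have h : ContMDiffOn 𝓘(ℝ, W) 𝓘(ℝ, W) ∞ (A.chart L b ∘ (A.chart L a).symm)
      ((A.chart L a).symm.trans (A.chart L b)).source := by
    have hs : ∀ u ∈ ((A.chart L a).symm.trans (A.chart L b)).source,
        (A.chart L a).symm u ∈ (A.piece (A.index a)).source := fun u hu =>
      ((A.mem_chart_source_iff L a _).1 ((A.chart L a).map_target hu.1)).1
    have h0 : ContMDiffOn 𝓘(ℝ, W) I ∞ (A.piece (A.index a) ∘ (A.chart L a).symm)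
        ((A.chart L a).symm.trans (A.chart L b)).source :=
      (A.contMDiffOn_comp_chart_symm L a (A.index a)).mono fun u hu => ⟨hu.1, hs u hu⟩
    -- The coordinate change factors through the piece of `a`, where both halves are smooth as maps
    -- to and from `N`.
    have h1 := (A.contMDiffOn_chart_comp L b (A.index a)).comp h0 ?_
    · refine h1.congr fun u hu => ?_
      change _ = A.chart L b ((A.piece (A.index a)).symm
        (A.piece (A.index a) ((A.chart L a).symm u)))
      rw [(A.piece (A.index a)).left_inv (hs u hu)]
      rfl
    · intro u hu
      refine ⟨(A.piece (A.index a)).map_source (hs u hu), ?_⟩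
      change (A.piece (A.index a)).symm (A.piece (A.index a) ((A.chart L a).symm u)) ∈
        (A.chart L b).source
      rw [(A.piece (A.index a)).left_inv (hs u hu)]
      exact hu.2
  have := contMDiffOn_iff_contDiffOn.1 h
  simpa using this

theorem contMDiffOn_piece (i : ι) : let _ := A.chartedSpace L
    ContMDiffOn 𝓘(ℝ, W) I ∞ (A.piece i) (A.piece i).source := by
  intro _
  have : IsManifold 𝓘(ℝ, W) ∞ E := A.isManifold L
  intro a ha
  have hs : a ∈ (A.chart L a).source := mem_chart_source W a
  have h1 : ContMDiffAt 𝓘(ℝ, W) I ∞ (A.piece i ∘ (A.chart L a).symm) (A.chart L a a) := by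
    refine (A.contMDiffOn_comp_chart_symm L a i).contMDiffAt ?_
    refine ((A.chart L a).isOpen_inter_preimage_symm (A.piece i).open_source).mem_nhds
      ⟨(A.chart L a).map_source hs, ?_⟩
    rw [Set.mem_preimage, (A.chart L a).left_inv hs]; exact ha
  have h2 : ContMDiffAt 𝓘(ℝ, W) 𝓘(ℝ, W) ∞ (A.chart L a) a :=
    (contMDiffOn_chart (I := 𝓘(ℝ, W)) (n := ∞) (x := a)).contMDiffAt
      ((A.chart L a).open_source.mem_nhds hs)
  refine ContMDiffAt.contMDiffWithinAt ((h1.comp a h2).congr_of_eventuallyEq ?_)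
  filter_upwards [(A.chart L a).open_source.mem_nhds hs] with b hb
  exact congrArg (A.piece i) ((A.chart L a).left_inv hb).symm

theorem contMDiffOn_piece_symm (i : ι) : let _ := A.chartedSpace L
    ContMDiffOn I 𝓘(ℝ, W) ∞ (A.piece i).symm (A.piece i).target := by
  intro _
  have : IsManifold 𝓘(ℝ, W) ∞ E := A.isManifold L
  intro n hn
  set a := (A.piece i).symm n with ha
  have hs : a ∈ (A.chart L a).source := mem_chart_source W a
  have hopen := (A.piece i).isOpen_inter_preimage_symm (A.chart L a).open_source
  have hmem : n ∈ (A.piece i).target ∩ (A.piece i).symm ⁻¹' (A.chart L a).source := ⟨hn, hs⟩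
  have h1 : ContMDiffAt I 𝓘(ℝ, W) ∞ (A.chart L a ∘ (A.piece i).symm) n :=
    (A.contMDiffOn_chart_comp L a i).contMDiffAt (hopen.mem_nhds hmem)
  have h2 : ContMDiffAt 𝓘(ℝ, W) 𝓘(ℝ, W) ∞ (A.chart L a).symm (A.chart L a a) :=
    (contMDiffOn_chart_symm (I := 𝓘(ℝ, W)) (n := ∞) (x := a)).contMDiffAt
      ((A.chart L a).open_target.mem_nhds ((A.chart L a).map_source hs))
  refine ContMDiffAt.contMDiffWithinAt ((ContMDiffAt.comp n h2 h1).congr_of_eventuallyEq ?_)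
  filter_upwards [hopen.mem_nhds hmem] with n' hn'
  exact ((A.chart L a).left_inv hn'.2).symm

/-- The pieces, as diffeomorphisms. -/
def diffeo (i : ι) : let _ := A.chartedSpace L
    PartialDiffeomorph I 𝓘(ℝ, W) N E ∞ :=
  let _ := A.chartedSpace L
  { toPartialEquiv := (A.piece i).symm.toPartialEquiv
    open_source := (A.piece i).open_target
    open_target := (A.piece i).open_source
    contMDiffOn_toFun := A.contMDiffOn_piece_symm L i
    contMDiffOn_invFun := A.contMDiffOn_piece L i }

end GluingData

end Glue

/-! ### The envelope as a sphere bundle -/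

section Sphere

/-- The chart at `f x` is stereographic projection from `-f x`, given by a formula that is smooth on
an ambient neighbourhood of `f x`; smoothness is assumed and proved at a single point. -/
theorem contMDiffAt_codRestrict_sphere {E F H N : Type*} [NormedAddCommGroup E]
    [InnerProductSpace ℝ E] [NormedAddCommGroup F] [NormedSpace ℝ F] [TopologicalSpace H]
    {I : ModelWithCorners ℝ F H} [TopologicalSpace N] [ChartedSpace H N] {k : ℕ}
    [Fact (Module.finrank ℝ E = k + 1)] {f : N → Metric.sphere (0 : E) 1} {x : N}
    {n : WithTop ℕ∞} (hf : ContMDiffAt I 𝓘(ℝ, E) n (fun a => (f a : E)) x) :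
    ContMDiffAt I (𝓡 k) n f x := by
  rw [contMDiffAt_iff_target]
  refine ⟨Topology.IsInducing.subtypeVal.continuousAt_iff.2 hf.continuousAt, ?_⟩
  let U := (OrthonormalBasis.fromOrthogonalSpanSingleton
    (𝕜 := ℝ) k (ne_zero_of_mem_unit_sphere (-(f x)))).repr
  have h1 : ContDiffAt ℝ n (stereoToFun (-(f x) : E)) (f x : E) := by
    refine (contDiffOn_stereoToFun.contDiffAt ?_).of_le le_top
    refine IsOpen.mem_nhds ?_ ?_
    · exact isOpen_ne_fun (by fun_prop) (by fun_prop)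
    · simp
      norm_num
  have h3 : ContDiffAt ℝ n (fun y => U (stereoToFun (-(f x) : E) y)) (f x : E) :=
    U.contDiff.contDiffAt.comp _ h1
  exact ContMDiffAt.comp (I' := 𝓘(ℝ, E)) (g := fun y => U (stereoToFun (-(f x) : E) y))
    (f := fun a => (f a : E)) x h3.contMDiffAt hf

/-- A retraction of Euclidean space onto the unit sphere as a set. -/
def toSphere {d : ℕ} (v : Euc (d + 1)) : Metric.sphere (0 : Euc (d + 1)) 1 :=
  open Classical in
  if h : v ∈ Metric.sphere (0 : Euc (d + 1)) 1 then ⟨v, h⟩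
  else ⟨EuclideanSpace.single 0 1, by simp⟩

theorem coe_toSphere {d : ℕ} {v : Euc (d + 1)} (h : v ∈ Metric.sphere (0 : Euc (d + 1)) 1) :
    (toSphere v : Euc (d + 1)) = v := by rw [toSphere, dif_pos h]

theorem toSphere_coe {d : ℕ} (θ : Metric.sphere (0 : Euc (d + 1)) 1) : toSphere θ.1 = θ :=
  Subtype.ext (coe_toSphere θ.2)

variable {d : ℕ} {X E : Type*} [NormedAddCommGroup E] [InnerProductSpace ℝ E]
  {c : X → E} {r : X → ℝ} {w : Fin d → X → E}

/-- The point of a round sphere with given angular coordinates. -/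
def roundPoint (c : X → E) (r : X → ℝ) (w : Fin d → X → E) (q : X) (θ : Euc d) : E :=
  c q + r q • ∑ j, θ j • w j q

/-- The angular coordinates of a point of a round sphere. -/
def roundAngle (c : X → E) (r : X → ℝ) (w : Fin d → X → E) (q : X) (y : E) : Euc d :=
  (EuclideanSpace.equiv (Fin d) ℝ).symm fun j => (r q)⁻¹ * ⟪w j q, y - c q⟫_ℝ

theorem roundAngle_roundPoint {q : X} (hr : r q ≠ 0) (hw : Orthonormal ℝ fun j => w j q)
    (θ : Euc d) : roundAngle c r w q (roundPoint c r w q θ) = θ := by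
  ext i
  change (r q)⁻¹ * ⟪w i q, c q + r q • ∑ j, θ j • w j q - c q⟫_ℝ = θ i
  rw [add_sub_cancel_left, inner_smul_right, hw.inner_right_fintype, inv_mul_cancel_left₀ hr]

variable [TopologicalSpace X] [ChartedSpace ℂ X] {F H N : Type*} [NormedAddCommGroup F]
  [NormedSpace ℝ F] [TopologicalSpace H] {I : ModelWithCorners ℝ F H} [TopologicalSpace N]
  [ChartedSpace H N] {U : Set X} {S : Set N} {g : N → X}

theorem contMDiffOn_roundPoint (hc : ContMDiffOn 𝓘(ℝ, ℂ) 𝓘(ℝ, E) ∞ c U)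
    (hr : ContMDiffOn 𝓘(ℝ, ℂ) 𝓘(ℝ, ℝ) ∞ r U)
    (hw : ∀ j, ContMDiffOn 𝓘(ℝ, ℂ) 𝓘(ℝ, E) ∞ (w j) U) (hg : ContMDiffOn I 𝓘(ℝ, ℂ) ∞ g S)
    (hS : Set.MapsTo g S U) {θ : N → Euc d} (hθ : ContMDiffOn I 𝓘(ℝ, Euc d) ∞ θ S) :
    ContMDiffOn I 𝓘(ℝ, E) ∞ (fun n => roundPoint c r w (g n) (θ n)) S := by
  have h1 (j) : ContMDiffOn I 𝓘(ℝ, ℝ) ∞ (fun n => θ n j) S :=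
    ((EuclideanSpace.proj j : Euc d →L[ℝ] ℝ).contDiff.contMDiff (n := ∞)).comp_contMDiffOn hθ
  exact (hc.comp hg hS).add ((hr.comp hg hS).smul
    (contMDiffOn_finsetSum fun j _ => (h1 j).smul ((hw j).comp hg hS)))

theorem contMDiffOn_roundAngle (hc : ContMDiffOn 𝓘(ℝ, ℂ) 𝓘(ℝ, E) ∞ c U)
    (hr : ContMDiffOn 𝓘(ℝ, ℂ) 𝓘(ℝ, ℝ) ∞ r U) (hr0 : ∀ q ∈ U, r q ≠ 0)
    (hw : ∀ j, ContMDiffOn 𝓘(ℝ, ℂ) 𝓘(ℝ, E) ∞ (w j) U) (hg : ContMDiffOn I 𝓘(ℝ, ℂ) ∞ g S)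
    (hS : Set.MapsTo g S U) {y : N → E} (hy : ContMDiffOn I 𝓘(ℝ, E) ∞ y S) :
    ContMDiffOn I 𝓘(ℝ, Euc d) ∞ (fun n => roundAngle c r w (g n) (y n)) S := by
  have h1 (j) : ContMDiffOn I 𝓘(ℝ, ℝ) ∞ (fun n => ⟪w j (g n), y n - c (g n)⟫_ℝ) S :=
    (contDiff_inner.contMDiff (n := ∞)).comp_contMDiffOn
      (((hw j).comp hg hS).prodMk_space (hy.sub (hc.comp hg hS)))
  have h2 : ContMDiffOn I 𝓘(ℝ, ℝ) ∞ (fun n => (r (g n))⁻¹) S := fun n hn =>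
    (contDiffAt_inv ℝ (hr0 _ (hS hn))).contMDiffAt.comp_contMDiffWithinAt n
      ((hr.comp hg hS) n hn)
  exact ((EuclideanSpace.equiv (Fin d) ℝ).symm.contDiff.contMDiff (n := ∞)).comp_contMDiffOn
    (contMDiffOn_pi_space.2 fun j => h2.smul (h1 j))

end Sphere

/-! ### Local trivializations of the envelope -/

section Trivialization

variable {m : ℕ} {X : Type*} [TopologicalSpace X] [ChartedSpace ℂ X]
  {G : X → ℙ ℂ (CLor m)} {U : Set X} {c : X → Amb m} {r : X → ℝ}
  {w : Fin (m - 2 + 1) → X → Amb m}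

theorem IsSphereFamily.roundPoint_mem (h : IsSphereFamily G U c r w) {q : X} (hq : q ∈ U)
    (θ : Metric.sphere (0 : Euc (m - 2 + 1)) 1) : (q, roundPoint c r w q θ.1) ∈ envelope G :=
  (h.mem_iff q hq _).2 ⟨θ.1, θ.2, rfl⟩

theorem IsSphereFamily.exists_theta (h : IsSphereFamily G U c r w) {z : envelope G}
    (hz : envProj G z ∈ U) : ∃ θ : Metric.sphere (0 : Euc (m - 2 + 1)) 1,
      roundAngle c r w (envProj G z) (envMap G z) = θ.1 ∧
      envMap G z = roundPoint c r w (envProj G z) θ.1 := by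
  obtain ⟨θ, hθ, hy⟩ := (h.mem_iff (envProj G z) hz (envMap G z)).1 z.2
  refine ⟨⟨θ, hθ⟩, ?_, hy⟩
  have := roundAngle_roundPoint (c := c) (h.radius_pos _ hz).ne' (h.orthonormal _ hz) θ
  exact (congrArg (roundAngle c r w (envProj G z)) hy).trans this

theorem contMDiff_coe_sphere_euc (k : ℕ) :
    ContMDiff (𝓡 k) 𝓘(ℝ, Euc (k + 1)) ∞ fun θ : Metric.sphere (0 : Euc (k + 1)) 1 => θ.1 := by
  have : Fact (Module.finrank ℝ (Euc (k + 1)) = k + 1) := ⟨by simp⟩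
  exact contMDiff_coe_sphere

theorem contMDiffAt_codRestrict_sphere_euc {F H N : Type*} [NormedAddCommGroup F]
    [NormedSpace ℝ F] [TopologicalSpace H] {I : ModelWithCorners ℝ F H} [TopologicalSpace N]
    [ChartedSpace H N] {k : ℕ} {f : N → Metric.sphere (0 : Euc (k + 1)) 1} {x : N}
    (hf : ContMDiffAt I 𝓘(ℝ, Euc (k + 1)) ∞ (fun a => (f a).1) x) :
    ContMDiffAt I (𝓡 k) ∞ f x := by
  have : Fact (Module.finrank ℝ (Euc (k + 1)) = k + 1) := ⟨by simp⟩
  exact contMDiffAt_codRestrict_sphere hf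

theorem IsSphereFamily.contMDiffOn_roundPoint (h : IsSphereFamily G U c r w) :
    ContMDiffOn (𝓘(ℝ, ℂ).prod (𝓡 (m - 2))) 𝓘(ℝ, Amb m) ∞
      (fun n : X × Metric.sphere (0 : Euc (m - 2 + 1)) 1 => roundPoint c r w n.1 n.2.1)
      (U ×ˢ Set.univ) :=
  Wintgen.contMDiffOn_roundPoint (g := Prod.fst) h.smooth_centre h.smooth_radius h.smooth_frame
    contMDiffOn_fst (fun _ hn => hn.1)
    ((contMDiff_coe_sphere_euc (m - 2)).comp contMDiff_snd).contMDiffOn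

theorem continuous_envProj : Continuous (envProj G) := continuous_fst.comp continuous_subtype_val

theorem continuous_envMap : Continuous (envMap G) := continuous_snd.comp continuous_subtype_val

open Classical in
/-- The homeomorphism of the part of the envelope over `U` with the product of `U` and the
sphere. -/
def IsSphereFamily.homeo (h : IsSphereFamily G U c r w) {q₀ : X} (hq₀ : q₀ ∈ U) :
    OpenPartialHomeomorph (envelope G) (X × Metric.sphere (0 : Euc (m - 2 + 1)) 1) where
  toFun z := (envProj G z, toSphere (roundAngle c r w (envProj G z) (envMap G z)))
  -- Outside `U` the value is immaterial; the point over `q₀` is a default that makes the function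
  -- total.
  invFun n := if hn : (n.1, roundPoint c r w n.1 n.2.1) ∈ envelope G then ⟨_, hn⟩
    else ⟨_, h.roundPoint_mem hq₀ n.2⟩
  source := envProj G ⁻¹' U
  target := U ×ˢ Set.univ
  map_source' z hz := ⟨hz, trivial⟩
  map_target' n hn := by
    rw [dif_pos (h.roundPoint_mem hn.1 n.2)]
    exact hn.1
  left_inv' z hz := by
    obtain ⟨θ, h1, h2⟩ := h.exists_theta hz
    simp only [h1, toSphere_coe]
    rw [dif_pos (h.roundPoint_mem hz θ)]
    exact Subtype.ext (Prod.ext rfl h2.symm)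
  right_inv' n hn := by
    rw [dif_pos (h.roundPoint_mem hn.1 n.2)]
    refine Prod.ext rfl ?_
    change toSphere (roundAngle c r w n.1 (roundPoint c r w n.1 n.2.1)) = n.2
    rw [roundAngle_roundPoint (h.radius_pos _ hn.1).ne' (h.orthonormal _ hn.1), toSphere_coe]
  open_source := h.isOpen.preimage continuous_envProj
  open_target := h.isOpen.prod isOpen_univ
  continuousOn_toFun := by
    refine continuous_envProj.continuousOn.prodMk ?_
    rw [Topology.IsInducing.subtypeVal.continuousOn_iff]
    have hc : ContinuousOn (fun z : envelope G => c (envProj G z)) (envProj G ⁻¹' U) :=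
      h.smooth_centre.continuousOn.comp continuous_envProj.continuousOn fun _ hz => hz
    have hr : ContinuousOn (fun z : envelope G => (r (envProj G z))⁻¹) (envProj G ⁻¹' U) :=
      (h.smooth_radius.continuousOn.comp continuous_envProj.continuousOn fun _ hz => hz).inv₀
        fun z hz => (h.radius_pos _ hz).ne'
    have hw (j) : ContinuousOn (fun z : envelope G => w j (envProj G z)) (envProj G ⁻¹' U) :=
      (h.smooth_frame j).continuousOn.comp continuous_envProj.continuousOn fun _ hz => hz
    have h1 : ContinuousOn (fun z : envelope G => roundAngle c r w (envProj G z) (envMap G z))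
        (envProj G ⁻¹' U) :=
      (EuclideanSpace.equiv (Fin (m - 2 + 1)) ℝ).symm.continuous.comp_continuousOn
        (continuousOn_pi.2 fun j => hr.mul
          ((hw j).inner (𝕜 := ℝ) (continuous_envMap.continuousOn.sub hc)))
    refine h1.congr fun z hz => ?_
    obtain ⟨θ, h2, -⟩ := h.exists_theta hz
    change (toSphere (roundAngle c r w (envProj G z) (envMap G z))).1 =
      roundAngle c r w (envProj G z) (envMap G z)
    rw [h2, toSphere_coe]
  continuousOn_invFun := by
    rw [Topology.IsInducing.subtypeVal.continuousOn_iff]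
    have h1 : ContinuousOn (fun n : X × Metric.sphere (0 : Euc (m - 2 + 1)) 1 =>
        (n.1, roundPoint c r w n.1 n.2.1)) (U ×ˢ Set.univ) :=
      continuousOn_fst.prodMk h.contMDiffOn_roundPoint.continuousOn
    refine h1.congr fun n hn => ?_
    simp only [Function.comp_apply, dif_pos (h.roundPoint_mem hn.1 n.2)]

theorem IsSphereFamily.homeo_apply (h : IsSphereFamily G U c r w) {q₀ : X} (hq₀ : q₀ ∈ U)
    (z : envelope G) : h.homeo hq₀ z =
      (envProj G z, toSphere (roundAngle c r w (envProj G z) (envMap G z))) := rfl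

theorem IsSphereFamily.homeo_symm_apply (h : IsSphereFamily G U c r w) {q₀ : X} (hq₀ : q₀ ∈ U)
    {n : X × Metric.sphere (0 : Euc (m - 2 + 1)) 1} (hn : n.1 ∈ U) :
    (h.homeo hq₀).symm n = ⟨(n.1, roundPoint c r w n.1 n.2.1), h.roundPoint_mem hn n.2⟩ :=
  dif_pos (h.roundPoint_mem hn n.2)

/-- The angles of one family at the points of another depend smoothly on parameter and angle as a
map to Euclidean space. On the overlap they lie on the unit sphere, so the restriction of the
codomain is smooth too. -/
theorem IsSphereFamily.contMDiffOn_transition (h : IsSphereFamily G U c r w) {q₀ : X}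
    (hq₀ : q₀ ∈ U) {U' : Set X} {c' : X → Amb m} {r' : X → ℝ} {w' : Fin (m - 2 + 1) → X → Amb m}
    (h' : IsSphereFamily G U' c' r' w') {q₁ : X} (hq₁ : q₁ ∈ U') :
    ContMDiffOn (𝓘(ℝ, ℂ).prod (𝓡 (m - 2))) (𝓘(ℝ, ℂ).prod (𝓡 (m - 2))) ∞
      (h'.homeo hq₁ ∘ (h.homeo hq₀).symm) ((h.homeo hq₀).symm.trans (h'.homeo hq₁)).source := by
  set S := ((h.homeo hq₀).symm.trans (h'.homeo hq₁)).source with hS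
  have hSU : ∀ n ∈ S, n.1 ∈ U := fun n hn => hn.1.1
  have hSU' : ∀ n ∈ S, n.1 ∈ U' := by
    intro n hn
    have h1 : (h.homeo hq₀).symm n ∈ envProj G ⁻¹' U' := hn.2
    rw [h.homeo_symm_apply hq₀ (hSU n hn)] at h1
    exact h1
  have hSo : IsOpen S := ((h.homeo hq₀).symm.trans (h'.homeo hq₁)).open_source
  have h1 : ContMDiffOn (𝓘(ℝ, ℂ).prod (𝓡 (m - 2))) 𝓘(ℝ, Euc (m - 2 + 1)) ∞
      (fun n : X × Metric.sphere (0 : Euc (m - 2 + 1)) 1 =>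
        roundAngle c' r' w' n.1 (roundPoint c r w n.1 n.2.1)) S :=
    contMDiffOn_roundAngle (g := Prod.fst) h'.smooth_centre h'.smooth_radius
      (fun q hq => (h'.radius_pos q hq).ne') h'.smooth_frame contMDiffOn_fst hSU'
      (h.contMDiffOn_roundPoint.mono fun n hn => ⟨hSU n hn, trivial⟩)
  have hval : ∀ n ∈ S, (h'.homeo hq₁) ((h.homeo hq₀).symm n) =
      (n.1, toSphere (roundAngle c' r' w' n.1 (roundPoint c r w n.1 n.2.1))) := by
    intro n hn
    rw [h.homeo_symm_apply hq₀ (hSU n hn), h'.homeo_apply]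
    rfl
  have hsph : ContMDiffOn (𝓘(ℝ, ℂ).prod (𝓡 (m - 2))) (𝓡 (m - 2)) ∞
      (fun n : X × Metric.sphere (0 : Euc (m - 2 + 1)) 1 =>
        toSphere (roundAngle c' r' w' n.1 (roundPoint c r w n.1 n.2.1))) S := by
    refine fun n hn => ContMDiffAt.contMDiffWithinAt (contMDiffAt_codRestrict_sphere_euc ?_)
    refine (h1.contMDiffAt (hSo.mem_nhds hn)).congr_of_eventuallyEq ?_
    filter_upwards [hSo.mem_nhds hn] with n' hn'
    obtain ⟨θ, h2, -⟩ := h'.exists_theta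
      (z := ⟨(n'.1, roundPoint c r w n'.1 n'.2.1), h.roundPoint_mem (hSU n' hn') n'.2⟩)
      (hSU' n' hn')
    have h3 : roundAngle c' r' w' n'.1 (roundPoint c r w n'.1 n'.2.1) = θ.1 := h2
    rw [h3, toSphere_coe]
  exact ContMDiffOn.congr (contMDiffOn_fst.prodMk hsph) hval

end Trivialization

/-! ### The smooth structure of the envelope. -/

section Bundle

variable {m : ℕ} {X : Type*} [TopologicalSpace X] [ChartedSpace ℂ X] [IsManifold 𝓘(ℝ, ℂ) ∞ X]
  {G : X → ℙ ℂ (CLor m)}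

/-- The envelope is covered by pieces diffeomorphic to products with a sphere. -/
theorem IsGaussCurve.exists_gluingData (hm : 2 ≤ m) (hG : IsGaussCurve G) :
    ∃ A : GluingData (𝓘(ℝ, ℂ).prod (𝓡 (m - 2)))
        (X × Metric.sphere (0 : Euc (m - 2 + 1)) 1) (envelope G) X,
      ∀ q, ∃ U c r w, q ∈ U ∧ ∃ (h : IsSphereFamily G U c r w) (hq : q ∈ U),
        A.piece q = h.homeo hq := by
  choose U c r w hq h using hG.exists_isSphereFamily hm
  exact ⟨⟨fun q => (h q).homeo (hq q), envProj G, fun z => hq (envProj G z),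
    fun i j => (h i).contMDiffOn_transition (hq i) (h j) (hq j)⟩,
    fun q => ⟨U q, c q, r q, w q, hq q, h q, hq q, rfl⟩⟩

/-- The smooth structure of the envelope as a bundle of round spheres. -/
theorem IsGaussCurve.exists_chartedSpace (hm : 2 ≤ m) (hG : IsGaussCurve G) :
    ∃ _ : ChartedSpace (Euc m) (envelope G), IsManifold (𝓡 m) ∞ (envelope G) ∧
      ∀ q, ∃ U Ψ c r w, q ∈ U ∧ IsSphereTrivialization G U Ψ c r w := by
  obtain ⟨A, hA⟩ := hG.exists_gluingData hm
  have : IsManifold (𝓡 (m - 2)) ∞ (Metric.sphere (0 : Euc (m - 2 + 1)) 1) := inferInstance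
  let L : (ℂ × Euc (m - 2)) ≃L[ℝ] Euc m := flatten hm
  refine ⟨A.chartedSpace L, A.isManifold L, fun q => ?_⟩
  obtain ⟨U, c, r, w, hq, h, hq', hAq⟩ := hA q
  let _ := A.chartedSpace L
  refine ⟨U, A.diffeo L q, c, r, w, hq, ?_⟩
  have hval : ∀ q' (hq' : q' ∈ U) Θ, A.diffeo L q (q', Θ) =
      ⟨(q', roundPoint c r w q' Θ.1), h.roundPoint_mem hq' Θ⟩ := by
    intro q' hq' Θ
    change (A.piece q).symm (q', Θ) = _
    rw [hAq, h.homeo_symm_apply _ hq']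
  exact {
    isOpen := h.isOpen
    source_eq := by
      change (A.piece q).target = _
      rw [hAq]; rfl
    target_eq := by
      change (A.piece q).source = _
      rw [hAq]; rfl
    smooth_centre := h.smooth_centre
    smooth_radius := h.smooth_radius
    smooth_frame := h.smooth_frame
    radius_pos := h.radius_pos
    orthonormal := h.orthonormal
    proj_eq := fun q' hq' Θ => by rw [hval q' hq']; rfl
    map_eq := fun q' hq' Θ => by rw [hval q' hq']; rfl }

end Bundle

/-! ### The map of the envelope to the sphere -/

section LorentzDerivative

variable {m k : ℕ} {N W : Type*} [TopologicalSpace N] [ChartedSpace (Euc k) N]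
  [NormedAddCommGroup W] [NormedSpace ℝ W]

theorem hasFDerivAt_vderiv {g : N → W} {p : N} (hg : MDifferentiableAt (𝓡 k) 𝓘(ℝ, W) g p) :
    HasFDerivAt (g ∘ (extChartAt (𝓡 k) p).symm) (vderiv (𝓡 k) g p) (basePt p) := by
  have h : HasFDerivWithinAt (g ∘ (extChartAt (𝓡 k) p).symm) (vderiv (𝓡 k) g p)
    (Set.range (𝓡 k)) (basePt p) := hg.hasMFDerivAt.2
  rw [ModelWithCorners.range_eq_univ, hasFDerivWithinAt_univ] at h
  exact h

theorem lor_vderiv_eq_zero {a b : N → CLor m} {p : N}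
    (ha : MDifferentiableAt (𝓡 k) 𝓘(ℝ, CLor m) a p) (hb : MDifferentiableAt (𝓡 k) 𝓘(ℝ, CLor m) b p)
    (h : ∀ᶠ y in 𝓝 p, lor (a y) (b y) = 0) (v : Euc k) :
    lor (vderiv (𝓡 k) a p v) (b p) + lor (a p) (vderiv (𝓡 k) b p v) = 0 := by
  have hp : (extChartAt (𝓡 k) p).symm (basePt p) = p := extChartAt_to_inv p
  have h1 := lor_fderiv_eq_zero (hasFDerivAt_vderiv ha) (hasFDerivAt_vderiv hb) ?_ v
  · simpa only [Function.comp_apply, hp] using h1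
  · have h2 : ContinuousAt (extChartAt (𝓡 k) p).symm (basePt p) := continuousAt_extChartAt_symm p
    rw [← hp] at h
    exact h2.eventually h

theorem hasFDerivAt_realVec (t : ℝ) (y : Amb m) :
    HasFDerivAt (realVec t) (realVecL m ∘L ContinuousLinearMap.inr ℝ ℝ (Amb m)) y :=
  (realVecL m).hasFDerivAt.comp (f := fun y => (t, y)) y
    ((hasFDerivAt_prodMk_right t y))

theorem vderiv_realVec {g : N → Amb m} {p : N} (hg : MDifferentiableAt (𝓡 k) 𝓘(ℝ, Amb m) g p)
    (t : ℝ) (v : Euc k) :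
    vderiv (𝓡 k) (realVec t ∘ g) p v = realVec 0 (vderiv (𝓡 k) g p v) := by
  rw [vderiv_comp (hasFDerivAt_realVec t _).differentiableAt hg, (hasFDerivAt_realVec t _).fderiv]
  rfl

end LorentzDerivative

/-! ### Smoothness of the two projections of the envelope, and tangency to the spheres. -/

section Envelope

variable {m : ℕ} {X : Type*} [TopologicalSpace X] [ChartedSpace ℂ X]
  {G : X → ℙ ℂ (CLor m)} [ChartedSpace (Euc m) (envelope G)]

section Local

variable {U : Set X} {Ψ : PartialDiffeomorph (𝓘(ℝ, ℂ).prod (𝓡 (m - 2))) (𝓡 m)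
  (X × Metric.sphere (0 : Euc (m - 2 + 1)) 1) (envelope G) ∞}
  {c : X → Amb m} {r : X → ℝ} {w : Fin (m - 2 + 1) → X → Amb m}

theorem IsSphereTrivialization.exists_eq (h : IsSphereTrivialization G U Ψ c r w) {z : envelope G}
    (hz : envProj G z ∈ U) : ∃ Θ, Ψ (envProj G z, Θ) = z ∧ Ψ.invFun z = (envProj G z, Θ) ∧
      envMap G z = roundPoint c r w (envProj G z) Θ.1 := by
  have hz' : z ∈ Ψ.target := by rw [h.target_eq]; exact hz
  have h1 : Ψ.invFun z ∈ Ψ.source := Ψ.map_target hz'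
  have h2 : Ψ (Ψ.invFun z) = z := Ψ.right_inv hz'
  rw [h.source_eq] at h1
  have h3 : envProj G z = (Ψ.invFun z).1 := by
    have := h.proj_eq _ h1.1 (Ψ.invFun z).2
    rw [Prod.mk.eta, h2] at this
    exact this
  have h4 : Ψ.invFun z = (envProj G z, (Ψ.invFun z).2) := Prod.ext h3.symm rfl
  refine ⟨(Ψ.invFun z).2, by rw [← h4, h2], h4, ?_⟩
  have := h.map_eq _ hz (Ψ.invFun z).2
  rw [← h4, h2] at this
  exact this

theorem IsSphereTrivialization.contMDiffOn_envProj (h : IsSphereTrivialization G U Ψ c r w) :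
    ContMDiffOn (𝓡 m) 𝓘(ℝ, ℂ) ∞ (envProj G) (envProj G ⁻¹' U) := by
  have h1 := Ψ.contMDiffOn_invFun
  rw [h.target_eq] at h1
  refine (contMDiff_fst.comp_contMDiffOn h1).congr fun z hz => ?_
  obtain ⟨Θ, -, h2, -⟩ := h.exists_eq hz
  exact (congrArg Prod.fst h2).symm

theorem IsSphereTrivialization.contMDiffOn_envMap (h : IsSphereTrivialization G U Ψ c r w) :
    ContMDiffOn (𝓡 m) 𝓘(ℝ, Amb m) ∞ (envMap G) (envProj G ⁻¹' U) := by
  have h1 := Ψ.contMDiffOn_invFun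
  rw [h.target_eq] at h1
  have h2 : ContMDiffOn (𝓡 m) 𝓘(ℝ, Euc (m - 2 + 1)) ∞ (fun z => (Ψ.invFun z).2.1)
      (envProj G ⁻¹' U) :=
    ((contMDiff_coe_sphere_euc (m - 2)).comp contMDiff_snd).comp_contMDiffOn h1
  refine (contMDiffOn_roundPoint h.smooth_centre h.smooth_radius h.smooth_frame
    h.contMDiffOn_envProj (fun _ hz => hz) h2).congr fun z hz => ?_
  obtain ⟨Θ, -, h3, h4⟩ := h.exists_eq hz
  rw [h4, h3]

/-- A map into the envelope is smooth if its two components are. -/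
theorem IsSphereTrivialization.contMDiffAt (h : IsSphereTrivialization G U Ψ c r w)
    {F H N : Type*} [NormedAddCommGroup F] [NormedSpace ℝ F] [TopologicalSpace H]
    {I : ModelWithCorners ℝ F H} [TopologicalSpace N] [ChartedSpace H N] {f : N → envelope G}
    (h1 : ContMDiff I 𝓘(ℝ, ℂ) ∞ (envProj G ∘ f)) (h2 : ContMDiff I 𝓘(ℝ, Amb m) ∞ (envMap G ∘ f))
    {p : N} (hp : envProj G (f p) ∈ U) : ContMDiffAt I (𝓡 m) ∞ f p := by
  set S : Set N := envProj G ∘ f ⁻¹' U with hS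
  have hSo : IsOpen S := h.isOpen.preimage h1.continuous
  have hne : ∀ q ∈ U, r q ≠ 0 := fun q hq => (h.radius_pos q hq).ne'
  have hangle : ContMDiffOn I 𝓘(ℝ, Euc (m - 2 + 1)) ∞
      (fun n => roundAngle c r w (envProj G (f n)) (envMap G (f n))) S :=
    contMDiffOn_roundAngle h.smooth_centre h.smooth_radius hne h.smooth_frame h1.contMDiffOn
      (fun _ hn => hn) h2.contMDiffOn
  have heq : ∀ n ∈ S, ∃ Θ : Metric.sphere (0 : Euc (m - 2 + 1)) 1,
      roundAngle c r w (envProj G (f n)) (envMap G (f n)) = Θ.1 ∧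
        Ψ (envProj G (f n), Θ) = f n := by
    intro n hn
    obtain ⟨Θ, h3, -, h4⟩ := h.exists_eq (z := f n) hn
    exact ⟨Θ, (congrArg _ h4).trans
      (roundAngle_roundPoint (hne _ hn) (h.orthonormal _ hn) Θ.1), h3⟩
  have hsph : ContMDiffAt I (𝓡 (m - 2)) ∞
      (fun n => toSphere (roundAngle c r w (envProj G (f n)) (envMap G (f n)))) p := by
    refine contMDiffAt_codRestrict_sphere_euc ?_
    refine (hangle.contMDiffAt (hSo.mem_nhds hp)).congr_of_eventuallyEq ?_
    filter_upwards [hSo.mem_nhds hp] with n hn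
    obtain ⟨Θ, h3, -⟩ := heq n hn
    rw [h3, toSphere_coe]
  have hΨ : ContMDiffAt (𝓘(ℝ, ℂ).prod (𝓡 (m - 2))) (𝓡 m) ∞ Ψ (envProj G (f p),
      toSphere (roundAngle c r w (envProj G (f p)) (envMap G (f p)))) := by
    refine Ψ.contMDiffOn_toFun.contMDiffAt (Ψ.open_source.mem_nhds ?_)
    rw [h.source_eq]
    exact ⟨hp, trivial⟩
  have h5 := ContMDiffAt.comp p hΨ ((h1 p).prodMk hsph)
  refine h5.congr_of_eventuallyEq ?_
  filter_upwards [hSo.mem_nhds hp] with n hn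
  obtain ⟨Θ, h3, h4⟩ := heq n hn
  change f n = Ψ (envProj G (f n), toSphere (roundAngle c r w (envProj G (f n)) (envMap G (f n))))
  rw [h3, toSphere_coe, h4]

end Local

theorem contMDiff_envProj
    (hT : ∀ q, ∃ U Ψ c r w, q ∈ U ∧ IsSphereTrivialization G U Ψ c r w) :
    ContMDiff (𝓡 m) 𝓘(ℝ, ℂ) ∞ (envProj G) := by
  intro z
  obtain ⟨U, Ψ, c, r, w, hq, h⟩ := hT (envProj G z)
  exact h.contMDiffOn_envProj.contMDiffAt ((h.isOpen.preimage continuous_envProj).mem_nhds hq)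

theorem contMDiff_envMap
    (hT : ∀ q, ∃ U Ψ c r w, q ∈ U ∧ IsSphereTrivialization G U Ψ c r w) :
    ContMDiff (𝓡 m) 𝓘(ℝ, Amb m) ∞ (envMap G) := by
  intro z
  obtain ⟨U, Ψ, c, r, w, hq, h⟩ := hT (envProj G z)
  exact h.contMDiffOn_envMap.contMDiffAt ((h.isOpen.preimage continuous_envProj).mem_nhds hq)

/-- The envelope is tangent to the spheres of the family. -/
theorem IsGaussCurve.lor_vderiv_envMap (hG : IsGaussCurve G)
    (hT : ∀ q, ∃ U Ψ c r w, q ∈ U ∧ IsSphereTrivialization G U Ψ c r w)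
    (z : envelope G) (v : Euc m)
    {U : Set X} {ξ : X → CLor m} (hU : IsLift G U ξ) (hz : envProj G z ∈ U) :
    lor (realVec 0 (vderiv (𝓡 m) (envMap G) z v)) (ξ (envProj G z)) = 0 := by
  have hm := (contMDiff_envMap hT z).mdifferentiableAt (by simp)
  have hp := (contMDiff_envProj hT z).mdifferentiableAt (by simp)
  have hξ : MDifferentiableAt 𝓘(ℝ, ℂ) 𝓘(ℝ, CLor m) ξ (envProj G z) :=
    (hU.smooth.contMDiffAt (hU.isOpen.mem_nhds hz)).mdifferentiableAt (by simp)
  have hr : MDifferentiableAt (𝓡 m) 𝓘(ℝ, CLor m) (realVec 1 ∘ envMap G) z :=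
    ((hasFDerivAt_realVec 1 _).differentiableAt.mdifferentiableAt).comp z hm
  -- The derivative of `⟨(1, ŷ), ξ⟩ = 0` on the envelope has two terms; the one with `dξ` vanishes
  -- by the second envelope condition.
  have h0 := lor_vderiv_eq_zero hr (hξ.comp z hp) ?_ v
  · have h1 := ((hG.mem_envelope_iff hU hz (envMap G z)).1 z.2).2.2
    have h2 : lor (realVec 1 (envMap G z)) (vderiv (𝓡 m) (ξ ∘ envProj G) z v) = 0 :=
      (congrArg _ (vderiv_comp_map hξ hp v)).trans (h1 _)
    rw [vderiv_realVec hm] at h0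
    simp only [Function.comp_apply] at h0
    rw [h2, add_zero] at h0
    exact h0
  · filter_upwards [(hU.isOpen.preimage continuous_envProj).mem_nhds hz] with z' hz'
    exact ((hG.mem_envelope_iff hU hz' (envMap G z')).1 z'.2).2.1

end Envelope

/-! ### The submanifold inside its envelope. -/

section Immersion

variable {m : ℕ} {M : Type*} [TopologicalSpace M] [ChartedSpace (Euc m) M]
  [IsManifold (𝓡 m) ∞ M] {x : M → Amb m} {F : M → ℙ ℂ (CLor m)}
  {X : Type*} [TopologicalSpace X] [ChartedSpace ℂ X] {π : M → X} {G : X → ℙ ℂ (CLor m)}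

theorem IsQuotientCurve.isGaussCurve (hπ : IsQuotientCurve π G F (Dperp x))
    (hF : IsGaussMap x F) : IsGaussCurve G := ⟨hπ.exists_isLift, hπ.exists_dLift hF⟩

theorem IsQuotientCurve.mem_envelope (hπ : IsQuotientCurve π G F (Dperp x))
    (hF : IsGaussMap x F) (hx : IsSphereImmersion x) (p : M) : (π p, x p) ∈ envelope G := by
  obtain ⟨U, ξ, hq, hU⟩ := hπ.exists_isLift (π p)
  obtain ⟨ξ₀, τ₀, t, hp, -, hf⟩ := hπ.exists_curveForm hF p
  obtain ⟨c, -, h1, h2⟩ := hf ξ (hU.isLiftAt hq)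
  refine ((hπ.isGaussCurve hF).mem_envelope_iff hU hq (x p)).2 ⟨hx.norm_eq_one p, ?_, fun v => ?_⟩
  · rw [h1, lor_smul_right, hp.Y_xi, mul_zero]
  · have key : ∀ v : ℂ, lor (realVec 1 (x p)) (dLift ξ (π p) v) = 0 := by
      intro v
      obtain ⟨a, ha⟩ := h2 v
      have ha' : dLift ξ (π p) v = a • ξ₀ + (c * v) • τ₀ := ha
      rw [ha', lor_add_right, lor_smul_right, lor_smul_right, hp.Y_xi, hp.Y_tau, mul_zero,
        mul_zero, add_zero]
    exact key v

variable [ChartedSpace (Euc m) (envelope G)] [IsManifold (𝓡 m) ∞ (envelope G)]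

/-- The composite of `ι = (π, x)` with `envMap` is the immersion `x`, so `dι` is injective, and
bijective as both manifolds have dimension `m`. The composite with `envProj` is `π`, whose
differential has kernel `𝔻^⊥`; hence the sphere fibres extend the leaves. -/
theorem IsQuotientCurve.exists_isLocalDiffeomorph
    (hπ : IsQuotientCurve π G F (Dperp x)) (hF : IsGaussMap x F) (hx : IsSphereImmersion x)
    (hT : ∀ q, ∃ U Ψ c r w, q ∈ U ∧ IsSphereTrivialization G U Ψ c r w) :
    ∃ ι : M → envelope G, IsLocalDiffeomorph (𝓡 m) (𝓡 m) ∞ ι ∧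
      (∀ p, envProj G (ι p) = π p ∧ envMap G (ι p) = x p) ∧
      ∀ p v, v ∈ Dperp x p ↔
        mfderiv (𝓡 m) 𝓘(ℝ, ℂ) (envProj G) (ι p) (mfderiv (𝓡 m) (𝓡 m) ι p v) = 0 := by
  let ι : M → envelope G := fun p => ⟨(π p, x p), hπ.mem_envelope hF hx p⟩
  have hι : ContMDiff (𝓡 m) (𝓡 m) ∞ ι := by
    intro p
    obtain ⟨U, Ψ, c, r, w, hq, h⟩ := hT (π p)
    exact h.contMDiffAt (f := ι) hπ.smooth hx.smooth hq
  have hd : ∀ p, MDifferentiableAt (𝓡 m) (𝓡 m) ι p := fun p => (hι p).mdifferentiableAt (by simp)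
  have hbij : ∀ p, Function.Bijective (mfderiv (𝓡 m) (𝓡 m) ι p) := by
    intro p
    let A : Euc m →ₗ[ℝ] Euc m := (mfderiv (𝓡 m) (𝓡 m) ι p).toLinearMap
    have hinj : Function.Injective A := by
      have h1 : ∀ v : Euc m, vderiv (𝓡 m) x p v = vderiv (𝓡 m) (envMap G) (ι p) (A v) := fun v =>
        vderiv_comp_map (g := envMap G) (f := ι)
          ((contMDiff_envMap hT (ι p)).mdifferentiableAt (by simp)) (hd p) v
      have h2 : Function.Injective (vderiv (𝓡 m) x p) := hx.immersion p
      intro a b hab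
      apply h2
      rw [h1, h1, hab]
    have hsurj : Function.Surjective A := LinearMap.injective_iff_surjective.1 hinj
    exact ⟨hinj, hsurj⟩
  refine ⟨ι, fun p => ?_, fun p => ⟨rfl, rfl⟩, fun p v => ?_⟩
  · obtain ⟨Φ, h1, -, h3⟩ := exists_partialDiffeomorph (E := Euc m) (E' := Euc m) isOpen_univ
      hι.contMDiffOn (Set.mem_univ p) (hbij p)
    exact ⟨Φ, h1, h3⟩
  · have h1 : mfderiv (𝓡 m) 𝓘(ℝ, ℂ) (envProj G ∘ ι) p = _ :=
      mfderiv_comp p ((contMDiff_envProj hT (ι p)).mdifferentiableAt (by simp)) (hd p)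
    have h2 : mfderiv (𝓡 m) 𝓘(ℝ, ℂ) π p = _ := h1
    refine (hπ.mem_iff p v).trans ?_
    have h3 : surfDeriv π p v = mfderiv (𝓡 m) 𝓘(ℝ, ℂ) (envProj G) (ι p)
        (mfderiv (𝓡 m) (𝓡 m) ι p v) := DFunLike.congr_fun h2 v
    rw [h3]
    rfl

end Immersion

end Wintgen

end

/-! ### The theorem. -/

open Wintgen in
theorem theorem4p1 {m : ℕ} (hm : 2 ≤ m)
    {M : Type*} [TopologicalSpace M] [T2Space M] [SecondCountableTopology M]
    [ChartedSpace (Euc m) M] [IsManifold (𝓡 m) ∞ M]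
    (x : M → Amb m) (hx : IsSphereImmersion x)
    (hW : IsWintgenIdeal x) (hU : IsUmbilicFree x)
    (J : M → Amb m →L[ℝ] Amb m) (hJ : IsNormalOrientation x J) :
    -- adapted frames exist, and `𝔻^⊥ = Span{E₃, …, E_m}` for each of them
    (∀ p, ∃ E n, IsAdaptedFrame x p E n (J p n)) ∧
    (∀ p E n₁ n₂, IsAdaptedFrame x p E n₁ n₂ →
      Dperp x p = Submodule.span ℝ {v | ∃ a : Fin m, 2 ≤ a.val ∧ v = E a}) ∧
    -- integrability
    IsIntegrable (Dperp x) ∧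
    -- the space of leaves is a Riemann surface onto which `M` is submersed
    ∃ _ : ChartedSpace ℂ (LeafSpace (Dperp x)),
      IsManifold 𝓘(ℂ, ℂ) ω (LeafSpace (Dperp x)) ∧
      IsManifold 𝓘(ℝ, ℂ) ∞ (LeafSpace (Dperp x)) ∧
      SecondCountableTopology (LeafSpace (Dperp x)) ∧
      (∀ q : LeafSpace (Dperp x), ∃ U : Set (LeafSpace (Dperp x)),
        IsOpen U ∧ q ∈ U ∧ T2Space U) ∧
      ContMDiff (𝓡 m) 𝓘(ℝ, ℂ) ∞ (leafProj (Dperp x)) ∧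
      (∀ p, Function.Surjective (mfderiv (𝓡 m) 𝓘(ℝ, ℂ) (leafProj (Dperp x)) p)) ∧
      (∀ p v, v ∈ Dperp x p ↔ mfderiv (𝓡 m) 𝓘(ℝ, ℂ) (leafProj (Dperp x)) p v = 0) ∧
      -- the mean curvature spheres form a 1-isotropic complex curve on the space of leaves
      ∃ G : LeafSpace (Dperp x) → ℙ ℂ (CLor m),
        (∀ p, ∀ n ∈ normalAt x p, ‖n‖ = 1 →
          ∃ h : gaussVec x J p n ≠ 0,
            Projectivization.mk ℂ (gaussVec x J p n) h = G (leafProj (Dperp x) p)) ∧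
        IsIsotropicCurve G ∧
        -- the projection is a Riemannian submersion up to the factor `μ`
        (∀ p (v : TangentSpace (𝓡 m) p), (∀ w ∈ Dperp x p, mobiusMetric x p v w = 0) →
          ∀ U ξ, IsLift G U ξ → leafProj (Dperp x) p ∈ U →
            quadricMetric (ξ (leafProj (Dperp x) p))
              (dLift ξ (leafProj (Dperp x) p)
                (mfderiv (𝓡 m) 𝓘(ℝ, ℂ) (leafProj (Dperp x)) p v)) =
              mu m ^ 2 * mobiusMetric x p v v) ∧
        -- the envelope is an `m`-dimensional manifold, mapped to the sphere (perhaps with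
        -- degenerate points), tangent to the spheres of the family
        ∃ _ : ChartedSpace (Euc m) (envelope G),
          IsManifold (𝓡 m) ∞ (envelope G) ∧
          ContMDiff (𝓡 m) 𝓘(ℝ, ℂ) ∞ (envProj G) ∧
          ContMDiff (𝓡 m) 𝓘(ℝ, Amb m) ∞ (envMap G) ∧
          (∀ (z : envelope G) (v : TangentSpace (𝓡 m) z) (U : Set (LeafSpace (Dperp x)))
            (ξ : LeafSpace (Dperp x) → CLor m), IsLift G U ξ → envProj G z ∈ U →
            lor (realVec 0 (mfderiv (𝓡 m) 𝓘(ℝ, Amb m) (envMap G) z v)) (ξ (envProj G z)) = 0) ∧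
          -- the envelope is a bundle of round `(m-2)`-spheres over the space of leaves
          (∀ q : LeafSpace (Dperp x), ∃ U Ψ c r w, q ∈ U ∧
            IsSphereTrivialization G U Ψ c r w) ∧
          -- the envelope contains `M`, and its foliation by the `(m-2)`-spheres extends
          -- the foliation of `M`
          ∃ ι : M → envelope G, IsLocalDiffeomorph (𝓡 m) (𝓡 m) ∞ ι ∧
            (∀ p, envProj G (ι p) = leafProj (Dperp x) p ∧ envMap G (ι p) = x p) ∧
            ∀ p v, v ∈ Dperp x p ↔
              mfderiv (𝓡 m) 𝓘(ℝ, ℂ) (envProj G) (ι p) (mfderiv (𝓡 m) (𝓡 m) ι p v) = 0 := by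
  obtain ⟨F, hFn⟩ := exists_gaussMap hx hJ
  have hF : IsGaussMap x F := isGaussMap hm hx hW hU hJ hFn
  have hS := hF.isSubmersiveCurve
  refine ⟨fun p => ?_, fun p E n₁ n₂ h => Dperp_eq_span hm hx hW hU hJ h, hS.isIntegrable, ?_⟩
  · obtain ⟨n, hn, h1⟩ := exists_unit_normal hx p
    obtain ⟨E, hE⟩ := exists_isAdaptedFrame hm hx hW hU (hJ.isNormalFrame hn h1)
    exact ⟨E, n, hE⟩
  let _ := leafChartedSpace hS
  have hman := isManifold_leafSpace hS
  have : IsManifold 𝓘(ℝ, ℂ) ∞ (LeafSpace (Dperp x)) := hman.2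
  have hπ : IsQuotientCurve (leafProj (Dperp x)) (leafMap hS) F (Dperp x) :=
    isQuotientCurve_leafProj hS
  refine ⟨leafChartedSpace hS, hman.1, hman.2, secondCountable_leafSpace hS,
    fun q => exists_t2_nhds hS q, hπ.smooth, hπ.surjective_deriv, hπ.mem_iff, leafMap hS, ?_,
    hπ.isIsotropicCurve hF, fun p v hv U ξ hU hp => hπ.quadricMetric_eq hF hv hU hp, ?_⟩
  · intro p n hn h1
    obtain ⟨h, hmk⟩ := hFn p n hn h1
    exact ⟨h, hmk.trans (leafMap_leafProj hS p).symm⟩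
  have hG := hπ.isGaussCurve hF
  obtain ⟨hcs, hE, hT⟩ := hG.exists_chartedSpace hm
  exact ⟨hcs, hE, contMDiff_envProj hT, contMDiff_envMap hT,
    fun z v U ξ hU hz => hG.lor_vderiv_envMap hT z v hU hz, hT,
    hπ.exists_isLocalDiffeomorph hF hx hT⟩
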